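/- **Conventions.** $\mathbb N_0=\{0,1,2,\dots\}$, $D=d/dx$, and $\mathrm{Wr}$ is the Wronskian determinant. A pair $(\alpha,\beta)\in\mathbb R^2$ is of *class C* if $\alpha,\beta,\alpha-\beta\notin\mathbb Z$ and $\alpha+\beta\in\mathbb Z$; it is of *class CB* if $\alpha,\beta\notin\mathbb Z$ and $2\alpha,2\beta\in\mathbb Z$. For a polynomial $\tau$ put $\eta=\frac{\alpha+1}{x-1}+\frac{\beta+1}{x+1}$, $u=\tau'/\tau$, $$T_{\rm ng}(\tau;\alpha,\beta)=(x^2-1)\Big(D^2-2uD+\tfrac{\tau''}{\tau}+\eta\,(D-u)\Big)+2xu,$$ $$T_{\rm rg}(\tau;\alpha,\beta)=\tau^{-1}\circ T_{\rm ng}\circ\tau=(x^2-1)(D^2+\eta D)+2(x^2-1)u'+2xu .$$ $T_{\rm rg}(\tau;\alpha,\beta)$ is an *exceptional operator* if $\tau(\pm1)\ne0$ and $T_{\rm ng}(\tau;\alpha,\beta)$ has eigenpolynomials of all but finitely many degrees. *Quasi-rational eigenfunctions.* Let $T=p D^2+qD+r$ have rational coefficients. $\mathrm{Ric}_\lambda(T)$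 is the set of rational $w$ with $p(w'+w^2)+qw+r=\lambda$, i.e. of log-derivatives $w=\varphi'/\varphi$ of quasi-rational solutions of $T\varphi=\lambda\varphi$ (taken up to scalars). The quasi-rational spectrum of $T$ is $\{\lambda:\mathrm{Ric}_\lambda(T)\neq\emptyset\}$. Such a $\varphi$ has type 1 if $w$ has no pole at $\pm1$, type 2 if $w$ has poles at both $1$ and $-1$, type 3 if only at $1$, type 4 if only at $-1$. Its degree $\deg\varphi$ is the coefficient of $1/x$ in the expansion of $w$ at $\infty$. With $\mu_1=1$, $\mu_2=(1-x)^{-\alpha}(1+x)^{-\beta}$, $\mu_3=(1-x)^{-\alpha}$, $\mu_4=(1+x)^{-\beta}$, the index of a type $\iota$ eigenfunction is $\deg\varphi-\deg\mu_\iota$, and $I_\iota(T)$ is the set of indices of the type $\iota$ quasi-rational eigenfunctions of $T$. Put $$\lambda_1(k)=k(k+\alpha+\beta+1),\quad \lambda_2(k)=(k-\alpha-\beta)(k+1),\quad \lambda_3(k)=(k-\alpha)(k+\beta+1),\quad \lambda_4(k)=(k-\beta)(k+\alpha+1),$$ and $\sigma_{\rm qQ}(\alpha,\beta)=\lambda_1(\mathbb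 Z)\cup\lambda_1(\mathbb Z-\alpha)$. The *spectral diagram* of $T$ assigns to each $\lambda$ in the quasi-rational spectrum a label according to the types of the elements of $\mathrm{Ric}_\lambda(T)$: $\circ,\times,+,-$ if there is exactly one element, of type $1,2,3,4$ respectively; $\otimes$, $\div$, $*$ if there are exactly two elements, of types $\{1,2\}$, $\{3,4\}$, $\{2,3\}$ respectively; $\bullet$ if there are infinitely many, with types 2, 3 and 4 occurring and type 1 not. A *quasi-polynomial eigenfunction* is a rational $f$ with neither zero nor pole at $\pm1$ and $Tf=\lambda f$ for some $\lambda\in\mathbb R$. It is monic of degree $i$ if $f=x^i(1+O(1/x))$ at $\infty$. *Formal norms.* Let $Q_\pm$ be the ring of rational functions regular at $\pm1$ and $\mathrm{qQ}_{A,B}=(1-x)^A(1+x)^BQ_\pm$ (on $(-1,1)$). Put $W=(1-x)^\alpha(1+x)^\beta$, $m=\alpha+\beta+1\in\mathbb Z$ and $\nu(\alpha,\beta)=2^{1+\alpha+\beta}\frac{\Gamma(\alpha+1)\Gamma(\beta+1)}{\Gamma(\alpha+\beta+2)}$. Functions $f,g$ are (formally) *orthogonal* if $fgW$ has an antiderivative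 in $\mathrm{qQ}_{\alpha+1,\beta+1}$. The number $\nu$ is the *(formal) norm* of a rational $f$ if $$\Big(f^2-(1+x)^{-m}\frac{\nu}{\nu(\alpha,-1-\alpha)}\Big)W$$ has an antiderivative in $\mathrm{qQ}_{\alpha+1,\min(\beta+1,-\alpha)}$ and, in case $m\ge0$, also $\big(f^2-\nu/\nu(\alpha,\beta)\big)W$ has an antiderivative in $\mathrm{qQ}_{\alpha+1,\beta+1}$. *Classical objects.* Let $a,b\in\mathbb R$, let $P_n(x;a,b)=2^{-n}\sum_{k=0}^n\binom{n+a}{n-k}\binom{n+b}{k}(x-1)^k(x+1)^{n-k}$ be the Jacobi polynomials, and on $(-1,1)$, for $n\in\mathbb N_0$, $$\phi_1(n)=P_n(x;a,b),\qquad \phi_2(n)=(1-x)^{-a}(1+x)^{-b}P_n(x;-a,-b),$$ $$\phi_3(n)=(1-x)^{-a}P_n(x;-a,b),\qquad \phi_4(n)=(1+x)^{-b}P_n(x;a,-b).$$ Let $\nu(z;a,b)=2^{1+a+b+2z}\frac{\Gamma(z+1)\Gamma(a+b+z+1)\Gamma(a+z+1)\Gamma(b+z+1)}{\Gamma(a+b+2z+1)\Gamma(a+b+2z+2)}$.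 Put $c_1=a+b$, $c_2=-a-b$, $c_3=-a+b$, $c_4=a-b$. If $c_\iota\in\mathbb Z$ let $\check I_{\iota-}=\{n\in\mathbb N_0:2n+c_\iota<0\}$ and $\check I_{\iota+}=\{n\in\mathbb N_0:n+c_\iota+1\ge1\}$; if $c_\iota\notin\mathbb Z$ let $\check I_{\iota-}=\emptyset$ and $\check I_{\iota+}=\mathbb N_0$. *Parameters.* Let $K_\iota\subset\check I_{\iota+}$ ($\iota=1,2,3,4$) be finite sets, $p_\iota=\#K_\iota$, such that the unions $$\tilde K_{12}=K_1\cup(K_2-a-b),\qquad \tilde K_{34}=(K_3-a)\cup(K_4-b)$$ are disjoint; put $\tilde K=\tilde K_{12}\cup\tilde K_{34}$ and $$\alpha=a+p_1-p_2-p_3+p_4,\qquad \beta=b+p_1-p_2+p_3-p_4 .$$ With $-K-1=\{-k-1:k\in K\}$ define $I_\iota=I_{\iota-}\cup I_{\iota+}$, where $$\begin{aligned} I_{1-}&=\big(\check I_{1-}\cup(-K_2-1)\big)-p_1+p_2, & I_{1+}&=\big(\check I_{1+}\setminus\tilde K_{12}\big)-p_1+p_2,\\ I_{2-}&=\big(\check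 I_{2-}\cup(-K_1-1)\big)+p_1-p_2, & I_{2+}&=\big(\check I_{2+}\setminus(\tilde K_{12}+a+b)\big)+p_1-p_2,\\ I_{3-}&=\big(\check I_{3-}\cup(-K_4-1)\big)-p_3+p_4, & I_{3+}&=\big(\check I_{3+}\setminus(\tilde K_{34}+a)\big)-p_3+p_4,\\ I_{4-}&=\big(\check I_{4-}\cup(-K_3-1)\big)+p_3-p_4, & I_{4+}&=\big(\check I_{4+}\setminus(\tilde K_{34}+b)\big)+p_3-p_4, \end{aligned}$$ $\sigma_{\iota\pm}=\lambda_\iota(I_{\iota\pm})$, and $\sigma_\iota=\sigma_{\iota-}\cup\sigma_{\iota+}$. Let $\Lambda_{\rm C}$ be the diagram with label $\circ$ on $\sigma_{1-}$, $\times$ on $\sigma_{2-}$, $\otimes$ on $\sigma_{1+}$, $+$ on $\sigma_3$ and $-$ on $\sigma_4$; let $\Lambda_{\rm CB}$ be the diagram with $\circ$ on $\sigma_{1-}$, $\times$ on $\sigma_{2-}$, $\otimes$ on $\sigma_{1+}$, $+$ on $\sigma_{3-}$, $-$ on $\sigma_{4-}$ and $\div$ on $\sigma_{3+}$. Further, let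 $$\tau=(1-x)^{(p_2+p_3)(p_1+p_4+a)}(1+x)^{(p_2+p_4)(p_1+p_3+b)}\,\mathrm{Wr}[\phi_1(K_1),\phi_2(K_2),\phi_3(K_3),\phi_4(K_4)],$$ each block in increasing order of the indices, $$\kappa(z)=\prod_{k\in\tilde K}\frac{z-k^*}{z-k},\qquad k^*=-k-a-b-1 .$$ **Proposition.** Let $(a,b)$ be of class C or of class CB, with $K_1,\dots,K_4$ as above. Then: 1. On $(-1,1)$, $\tau$ is a polynomial, of degree $$\sum_{\iota=1}^4\sum_{k\in K_\iota}k+2p_1p_2+2p_3p_4-\binom{p_1+p_2}{2}-\binom{p_3+p_4}{2}.$$ 2. $T=T_{\rm rg}(\tau;\alpha,\beta)$ is an exceptional operator with quasi-rational spectrum $\sigma_{\rm qQ}(\alpha,\beta)$, and $\sigma_{1+}=\sigma_{2+}$. If $(a,b)$ is of class C, then so is $(\alpha,\beta)$, the spectral diagram of $T$ is $\Lambda_{\rm C}$, and the sets carrying its labels exhaust $\sigma_{\rm qQ}(\alpha,\beta)$. If $(a,b)$ is of class CB, then so is $(\alpha,\beta)$, the spectral diagram of $T$ is $\Lambda_{\rm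 CB}$, the sets carrying its labels exhaust $\sigma_{\rm qQ}(\alpha,\beta)$, and $\sigma_{3+}=\sigma_{4+}$. 3. $I_\iota(T)=I_\iota$ for $\iota=1,2,3,4$. 4. For every $i\in I_1$ there is a monic quasi-polynomial eigenfunction $\pi_i$ of $T$ of degree $i$, with eigenvalue $\lambda_1(i)$, and every quasi-polynomial eigenfunction of $T$ is a non-zero multiple of exactly one of these. With $n=i+p_1-p_2$, $u(n)=\max(n,-n-1-a-b)$, $$\pi_i=\frac{(x-1)^{p_2+p_3}(1+x)^{p_2+p_4}}{\chi_n\prod_{k\in\tilde K}(n-k)}\cdot\frac{\mathrm{Wr}[\phi_1(K_1),\phi_2(K_2),\phi_3(K_3),\phi_4(K_4),\phi_1(u(n))]}{\mathrm{Wr}[\phi_1(K_1),\phi_2(K_2),\phi_3(K_3),\phi_4(K_4)]}$$ wherever the denominator is non-zero in $(-1,1)$; here $\chi_n$ is the leading coefficient $\ell_{u(n)}$ of $P_{u(n)}(x;a,b)$ if $n\ge0$, while for $n=-k-1<0$, with $N=u(n)=k-a-b$, $$\chi_n=-\,\ell_N\,\frac{2^{1+k+N}\,a\,(1-a)_k\,(1+a)_N\,k!\,N!}{(k+N)!\,(k+N+1)!}.$$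 5. The $\pi_i$, $i\in I_1$, are pairwise formally orthogonal, and $\pi_i$ has a formal norm $\nu_i$ given by $$\nu_i=\kappa(i+p_1-p_2)\,\nu(i+p_1-p_2;a,b)\qquad\text{if } 2i+\alpha+\beta+1\ne0,$$ where for $i\in I_{1+}$ this is the plain value and in general the right-hand side stands for the limit of $\kappa(z)\nu(z;a,b)$ as $z\to i+p_1-p_2$. If $2i+\alpha+\beta+1=0$, then $\nu_i$ is one half of that limit. For $i\in I_1$ one has $\nu_i=0$ if and only if $i\in I_{1-}$ and $2i+\alpha+\beta+1\ne0$. -/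

import Mathlib

open Polynomial Set Filter Topology

noncomputable section

namespace ExcJacobi

/-! ### Rational functions and second-order operators with rational coefficients -/

/-- The derivative `d/dx` on `ℝ(x)`, by the quotient rule. -/
def ratDeriv (f : RatFunc ℝ) : RatFunc ℝ :=
  algebraMap ℝ[X] (RatFunc ℝ) (derivative f.num * f.denom - f.num * derivative f.denom) /
    algebraMap ℝ[X] (RatFunc ℝ) (f.denom ^ 2)

/-- Value of a rational function at a real point which is not a pole. -/
def val (f : RatFunc ℝ) (x : ℝ) : ℝ := f.eval (RingHom.id ℝ) x

/-- `f` has no pole at `x = 1` and no pole at `x = -1`. -/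
def RegularEnds (f : RatFunc ℝ) : Prop := f.denom.eval 1 ≠ 0 ∧ f.denom.eval (-1) ≠ 0

/-- `f` has neither a zero nor a pole at `x = 1` and at `x = -1`. -/
def UnitEnds (f : RatFunc ℝ) : Prop :=
  RegularEnds f ∧ f.num.eval 1 ≠ 0 ∧ f.num.eval (-1) ≠ 0

/-- The differential operator `p D² + q D + r` with rational coefficients. -/
structure Diff2 where
  p : RatFunc ℝ
  q : RatFunc ℝ
  r : RatFunc ℝ

/-- Action of the operator on rational functions. -/
def Diff2.act (T : Diff2) (f : RatFunc ℝ) : RatFunc ℝ :=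
  T.p * ratDeriv (ratDeriv f) + T.q * ratDeriv f + T.r * f

/-- `Ric_λ(T)`: the rational solutions `w` of `p (w' + w²) + q w + r = λ`, that is, the
log-derivatives `w = φ'/φ` of the quasi-rational solutions `φ` of `T φ = λ φ`. -/
def ric (T : Diff2) (lam : ℝ) : Set (RatFunc ℝ) :=
  {w | T.p * (ratDeriv w + w ^ 2) + T.q * w + T.r = RatFunc.C lam}

/-- `x² - 1` -/
def pJ : RatFunc ℝ := RatFunc.X ^ 2 - 1

/-- `η(x;α,β) = (α+1)/(x-1) + (β+1)/(x+1)` -/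
def eta (α β : ℝ) : RatFunc ℝ :=
  RatFunc.C (α + 1) / (RatFunc.X - 1) + RatFunc.C (β + 1) / (RatFunc.X + 1)

/-- `τ'/τ` -/
def logD (τ : ℝ[X]) : RatFunc ℝ :=
  algebraMap ℝ[X] (RatFunc ℝ) (derivative τ) / algebraMap ℝ[X] (RatFunc ℝ) τ

/-- The operator in the natural gauge:
`(x²-1)(D² - 2(τ'/τ) D + τ''/τ + η (D - τ'/τ)) + 2x τ'/τ`. -/
def Tng (τ : ℝ[X]) (α β : ℝ) : Diff2 where
  p := pJ
  q := pJ * (eta α β - 2 * logD τ)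
  r := pJ * (algebraMap ℝ[X] (RatFunc ℝ) (derivative (derivative τ)) /
        algebraMap ℝ[X] (RatFunc ℝ) τ - eta α β * logD τ) + 2 * RatFunc.X * logD τ

/-- The operator in the rational gauge:
`T_rg = τ⁻¹ ∘ T_ng ∘ τ = (x²-1)(D² + η D) + 2(x²-1)u' + 2xu` with `u = τ'/τ`. -/
def Trg (τ : ℝ[X]) (α β : ℝ) : Diff2 where
  p := pJ
  q := pJ * eta α β
  r := 2 * pJ * ratDeriv (logD τ) + 2 * RatFunc.X * logD τ

/-- The degrees of the eigenpolynomials of `T`. -/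
def degreeSet (T : Diff2) : Set ℕ :=
  {n | ∃ (P : ℝ[X]) (lam : ℝ), P ≠ 0 ∧ P.natDegree = n ∧
    T.act (algebraMap ℝ[X] (RatFunc ℝ) P) = RatFunc.C lam * algebraMap ℝ[X] (RatFunc ℝ) P}

/-- `T_rg(τ;α,β)` is an exceptional Jacobi operator in the rational gauge: `τ(±1) ≠ 0` and
`T_ng(τ;α,β)` has eigenpolynomials of all but finitely many degrees. -/
def IsExceptional (τ : ℝ[X]) (α β : ℝ) : Prop :=
  τ.eval 1 ≠ 0 ∧ τ.eval (-1) ≠ 0 ∧ (degreeSet (Tng τ α β))ᶜ.Finite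

/-- A quasi-polynomial eigenfunction of an operator with `p = x² - 1`. -/
def IsQuasiPolyEigen (T : Diff2) (f : RatFunc ℝ) : Prop :=
  UnitEnds f ∧ ∃ lam : ℝ, T.act f = RatFunc.C lam * f

/-- `x` is an integer. -/
def IsInt (x : ℝ) : Prop := ∃ m : ℤ, x = m

/-- Class C: `α, β, α-β ∉ ℤ` and `α+β ∈ ℤ`. -/
def IsClassC (α β : ℝ) : Prop := ¬ IsInt α ∧ ¬ IsInt β ∧ ¬ IsInt (α - β) ∧ IsInt (α + β)

/-- Class CB: `α, β ∉ ℤ` and `2α, 2β ∈ ℤ`. -/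
def IsClassCB (α β : ℝ) : Prop := ¬ IsInt α ∧ ¬ IsInt β ∧ IsInt (2 * α) ∧ IsInt (2 * β)

/-! ### Asymptotic types, index sets, spectral diagrams -/

/-- The four asymptotic types of quasi-rational functions. -/
inductive AType
  | one
  | two
  | three
  | four

/-- Asymptotic type of a log-derivative: type 1 is regular at `±1`, type 2 has poles at both ends,
type 3 has a pole only at `+1`, type 4 has a pole only at `-1`. -/
def HasType (w : RatFunc ℝ) : AType → Prop
  | .one => w.denom.eval 1 ≠ 0 ∧ w.denom.eval (-1) ≠ 0
  | .two => w.denom.eval 1 = 0 ∧ w.denom.eval (-1) = 0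
  | .three => w.denom.eval 1 = 0 ∧ w.denom.eval (-1) ≠ 0
  | .four => w.denom.eval 1 ≠ 0 ∧ w.denom.eval (-1) = 0

/-- The residue of `w` at infinity, with the sign for which `w = φ'/φ` gives `deg φ`: the coefficient
of `1/x` in the expansion of `w` at infinity (`denom` is monic). -/
def qrDegree (w : RatFunc ℝ) : ℝ := (w.num % w.denom).coeff (w.denom.natDegree - 1)

/-- Degrees of `μ₁ = 1`, `μ₂ = (1-x)^(-α) (1+x)^(-β)`, `μ₃ = (1-x)^(-α)`, `μ₄ = (1+x)^(-β)`. -/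
def degMu (α β : ℝ) : AType → ℝ
  | .one => 0
  | .two => -α - β
  | .three => -α
  | .four => -β

/-- The index set `I_ι(T)`: the numbers `deg φ - deg μ_ι`, where `φ` is a quasi-rational
eigenfunction of type `ι`. -/
def indexSet (T : Diff2) (α β : ℝ) (t : AType) : Set ℝ :=
  {k | ∃ (lam : ℝ) (w : RatFunc ℝ), w ∈ ric T lam ∧ HasType w t ∧ k = qrDegree w - degMu α β t}

/-- The quasi-rational spectrum of `T`. -/
def qrSpectrum (T : Diff2) : Set ℝ := {lam | (ric T lam).Nonempty}

/-- `λ_ι(k;α,β)` -/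
def lamT (α β : ℝ) : AType → ℝ → ℝ
  | .one, k => k * (k + α + β + 1)
  | .two, k => (k - α - β) * (k + 1)
  | .three, k => (k - α) * (k + β + 1)
  | .four, k => (k - β) * (k + α + 1)

/-- `σ_qQ(α,β) = λ₁(ℤ;α,β) ∪ λ₁(ℤ-α;α,β)` -/
def sigmaQ (α β : ℝ) : Set ℝ :=
  {lam | ∃ k : ℤ, lam = lamT α β .one k ∨ lam = lamT α β .one (k - α)}

/-- The eight `λ`-labels. -/
inductive Label
  | circ
  | times
  | plus
  | minus
  | asterisk
  | div
  | circtimes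
  | bullet

/-- `R` has exactly one element, and it has type `t`. -/
def Single (R : Set (RatFunc ℝ)) (t : AType) : Prop := ∃ w, R = {w} ∧ HasType w t

/-- `R` has exactly two elements, of the types `s` and `t`. -/
def Double (R : Set (RatFunc ℝ)) (s t : AType) : Prop :=
  ∃ w v, w ≠ v ∧ R = {w, v} ∧ HasType w s ∧ HasType v t

/-- The label of `λ` is determined by the types of the elements of `Ric_λ(T)`. -/
def HasLabel (R : Set (RatFunc ℝ)) : Label → Prop
  | .circ => Single R .one
  | .times => Single R .two
  | .plus => Single R .three
  | .minus => Single R .four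
  | .asterisk => Double R .two .three
  | .div => Double R .three .four
  | .circtimes => Double R .one .two
  | .bullet => R.Infinite ∧ (∃ w ∈ R, HasType w .two) ∧ (∃ w ∈ R, HasType w .three) ∧
      (∃ w ∈ R, HasType w .four) ∧ ∀ w ∈ R, ¬ HasType w .one

/-- The spectral diagram of `T`, as the graph of the assignment of labels to eigenvalues. -/
def spectralDiagram (T : Diff2) : Set (ℝ × Label) :=
  {c | c.1 ∈ qrSpectrum T ∧ HasLabel (ric T c.1) c.2}

/-! ### Classical Jacobi polynomials, quasi-rational eigenfunctions, Wronskians -/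

/-- The classical Jacobi polynomial
`P_n(x;a,b) = 2^(-n) ∑_k binom(n+a, n-k) binom(n+b, k) (x-1)^k (x+1)^(n-k)`. -/
def jacobiP (n : ℕ) (a b : ℝ) : ℝ[X] :=
  C ((2 : ℝ)⁻¹ ^ n) * ∑ k ∈ Finset.range (n + 1),
    C (Ring.choose ((n : ℝ) + a) (n - k) * Ring.choose ((n : ℝ) + b) k) *
      (X - 1) ^ k * (X + 1) ^ (n - k)

/-- The four types of quasi-rational eigenfunctions of the classical operator `T(a,b)`,
as functions on `(-1,1)`. -/
def phi (a b : ℝ) : AType → ℕ → ℝ → ℝ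
  | .one, n => fun x => (jacobiP n a b).eval x
  | .two, n => fun x => (1 - x) ^ (-a) * (1 + x) ^ (-b) * (jacobiP n (-a) (-b)).eval x
  | .three, n => fun x => (1 - x) ^ (-a) * (jacobiP n (-a) b).eval x
  | .four, n => fun x => (1 + x) ^ (-b) * (jacobiP n a (-b)).eval x

/-- The Wronskian determinant of a list of functions. -/
def wr (L : List (ℝ → ℝ)) (x : ℝ) : ℝ :=
  (Matrix.of fun i j : Fin L.length => iteratedDeriv (i : ℕ) (L.get j) x).det

/-- `ν(z;a,b)`, the classical norm function. -/
def nuJ (z a b : ℝ) : ℝ :=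
  2 ^ (1 + a + b + 2 * z) *
    (Real.Gamma (z + 1) * Real.Gamma (a + b + z + 1) * Real.Gamma (a + z + 1) *
      Real.Gamma (b + z + 1)) /
    (Real.Gamma (a + b + 2 * z + 1) * Real.Gamma (a + b + 2 * z + 2))

/-- `ν(a,b) = 2^(1+a+b) Γ(a+1) Γ(b+1) / Γ(a+b+2)` -/
def nuZero (a b : ℝ) : ℝ :=
  2 ^ (1 + a + b) * (Real.Gamma (a + 1) * Real.Gamma (b + 1)) / Real.Gamma (a + b + 2)

/-! ### Formal norms -/

/-- `f` has on `(-1,1)`, outside finitely many points, an antiderivative in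
`qQ_{A,B} = (1-x)^A (1+x)^B Q_±`, where `Q_±` are the rational functions regular at `±1`. -/
def HasQRPrimitive (f : ℝ → ℝ) (A B : ℝ) : Prop :=
  ∃ g : RatFunc ℝ, RegularEnds g ∧
    {x ∈ Ioo (-1 : ℝ) 1 |
      ¬ HasDerivAt (fun y : ℝ => (1 - y) ^ A * (1 + y) ^ B * val g y) (f x) x}.Finite

/-- `nu` is the formal norm of `f` for the weight `(1-x)^α (1+x)^β`, in the case
`α, β ∉ ℤ`, `m = α+β+1 ∈ ℤ`. In every case
`∫ (f² - (1+x)^(-m) nu / ν(α,-1-α)) (1-x)^α (1+x)^β` is quasi-rational; it lies in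
`qQ_{α+1,β+1}` if `m ≤ 0`, and in `qQ_{α+1,-α}` if `m > 0`. If `m ≥ 0`, then also
`∫ (f² - nu / ν(α,β)) (1-x)^α (1+x)^β ∈ qQ_{α+1,β+1}`. -/
def IsFormalNorm (α β : ℝ) (f : RatFunc ℝ) (nu : ℝ) : Prop :=
  HasQRPrimitive
    (fun x => (val f x ^ 2 - (1 + x) ^ (-(α + β + 1)) * (nu / nuZero α (-1 - α))) *
      ((1 - x) ^ α * (1 + x) ^ β)) (α + 1) (min (β + 1) (-α)) ∧
  (0 ≤ α + β + 1 →
    HasQRPrimitive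
      (fun x => (val f x ^ 2 - nu / nuZero α β) * ((1 - x) ^ α * (1 + x) ^ β)) (α + 1) (β + 1))

/-! ### The parameters of the construction -/

/-- The lower part `{n : 2n + c < 0}` of a classical index set with parameter `c`; it is empty
if `c` is not an integer. -/
def lowerIdx (c : ℝ) : Set ℕ := {n | IsInt c ∧ 2 * (n : ℝ) + c < 0}

/-- The upper part `{n : n + c + 1 ≥ 1}` of a classical index set with parameter `c`; it is all
of `ℕ` if `c` is not an integer. -/
def upperIdx (c : ℝ) : Set ℕ := {n | IsInt c → 1 ≤ (n : ℝ) + c + 1}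

/-- Parameters of the construction: two real numbers and four finite sets of indices. -/
structure Params where
  a : ℝ
  b : ℝ
  K₁ : Finset ℕ
  K₂ : Finset ℕ
  K₃ : Finset ℕ
  K₄ : Finset ℕ

namespace Params

variable (d : Params)

def p₁ : ℕ := d.K₁.card
def p₂ : ℕ := d.K₂.card
def p₃ : ℕ := d.K₃.card
def p₄ : ℕ := d.K₄.card

/-- The degrees `K₁` and `K₂ - a - b` of the seed functions of types 1 and 2. -/
def D₁ : Finset ℝ := d.K₁.image fun k : ℕ => (k : ℝ)
def D₂ : Finset ℝ := d.K₂.image fun k : ℕ => (k : ℝ) - d.a - d.b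

/-- The degrees `K₃ - a` and `K₄ - b` of the seed functions of types 3 and 4. -/
def D₃ : Finset ℝ := d.K₃.image fun k : ℕ => (k : ℝ) - d.a
def D₄ : Finset ℝ := d.K₄.image fun k : ℕ => (k : ℝ) - d.b

def K₁₂ : Finset ℝ := d.D₁ ∪ d.D₂
def K₃₄ : Finset ℝ := d.D₃ ∪ d.D₄
def Kall : Finset ℝ := d.K₁₂ ∪ d.K₃₄

/-- `K_ι` is a subset of the upper part of the `ι`-th classical index set, and the unions
`K₁ ∪ (K₂-a-b)` and `(K₃-a) ∪ (K₄-b)` are disjoint. -/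
def Admissible : Prop :=
  (∀ k ∈ d.K₁, k ∈ upperIdx (d.a + d.b)) ∧ (∀ k ∈ d.K₂, k ∈ upperIdx (-d.a - d.b)) ∧
  (∀ k ∈ d.K₃, k ∈ upperIdx (-d.a + d.b)) ∧ (∀ k ∈ d.K₄, k ∈ upperIdx (d.a - d.b)) ∧
  Disjoint d.D₁ d.D₂ ∧ Disjoint d.D₃ d.D₄

def α : ℝ := d.a + d.p₁ - d.p₂ - d.p₃ + d.p₄
def β : ℝ := d.b + d.p₁ - d.p₂ + d.p₃ - d.p₄

/-- The index sets `I_{ι-}`. -/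
def Iminus : AType → Set ℤ
  | .one => {i | (∃ n ∈ lowerIdx (d.a + d.b), i = n - d.p₁ + d.p₂) ∨
      ∃ k ∈ d.K₂, i = -(k : ℤ) - 1 - d.p₁ + d.p₂}
  | .two => {i | (∃ n ∈ lowerIdx (-d.a - d.b), i = n + d.p₁ - d.p₂) ∨
      ∃ k ∈ d.K₁, i = -(k : ℤ) - 1 + d.p₁ - d.p₂}
  | .three => {i | (∃ n ∈ lowerIdx (-d.a + d.b), i = n - d.p₃ + d.p₄) ∨
      ∃ k ∈ d.K₄, i = -(k : ℤ) - 1 - d.p₃ + d.p₄}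
  | .four => {i | (∃ n ∈ lowerIdx (d.a - d.b), i = n + d.p₃ - d.p₄) ∨
      ∃ k ∈ d.K₃, i = -(k : ℤ) - 1 + d.p₃ - d.p₄}

/-- The index sets `I_{ι+}`. -/
def Iplus : AType → Set ℤ
  | .one => {i | ∃ n ∈ upperIdx (d.a + d.b), (n : ℝ) ∉ d.K₁₂ ∧ i = n - d.p₁ + d.p₂}
  | .two => {i | ∃ n ∈ upperIdx (-d.a - d.b), (n : ℝ) - d.a - d.b ∉ d.K₁₂ ∧
      i = n + d.p₁ - d.p₂}
  | .three => {i | ∃ n ∈ upperIdx (-d.a + d.b), (n : ℝ) - d.a ∉ d.K₃₄ ∧ i = n - d.p₃ + d.p₄}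
  | .four => {i | ∃ n ∈ upperIdx (d.a - d.b), (n : ℝ) - d.b ∉ d.K₃₄ ∧ i = n + d.p₃ - d.p₄}

/-- `I_ι = I_{ι-} ∪ I_{ι+}` -/
def I (t : AType) : Set ℤ := d.Iminus t ∪ d.Iplus t

/-- `σ_{ι-} = λ_ι(I_{ι-};α,β)` -/
def σminus (t : AType) : Set ℝ := {lam | ∃ i ∈ d.Iminus t, lam = lamT d.α d.β t i}

/-- `σ_{ι+} = λ_ι(I_{ι+};α,β)` -/
def σplus (t : AType) : Set ℝ := {lam | ∃ i ∈ d.Iplus t, lam = lamT d.α d.β t i}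

/-- The diagram `Λ_C`. -/
def ΛC : Set (ℝ × Label) :=
  d.σminus .one ×ˢ {Label.circ} ∪ d.σminus .two ×ˢ {Label.times} ∪
  d.σplus .one ×ˢ {Label.circtimes} ∪
  (d.σminus .three ∪ d.σplus .three) ×ˢ {Label.plus} ∪
  (d.σminus .four ∪ d.σplus .four) ×ˢ {Label.minus}

/-- The diagram `Λ_CB`. -/
def ΛCB : Set (ℝ × Label) :=
  d.σminus .one ×ˢ {Label.circ} ∪ d.σminus .two ×ˢ {Label.times} ∪
  d.σplus .one ×ˢ {Label.circtimes} ∪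
  d.σminus .three ×ˢ {Label.plus} ∪ d.σminus .four ×ˢ {Label.minus} ∪
  d.σplus .three ×ˢ {Label.div}

/-- The list `φ₁(K₁), φ₂(K₂), φ₃(K₃), φ₄(K₄)`, each block in increasing order of indices. -/
def seeds : List (ℝ → ℝ) :=
  (d.K₁.sort (· ≤ ·)).map (phi d.a d.b .one) ++ (d.K₂.sort (· ≤ ·)).map (phi d.a d.b .two) ++
  (d.K₃.sort (· ≤ ·)).map (phi d.a d.b .three) ++ (d.K₄.sort (· ≤ ·)).map (phi d.a d.b .four)

/-- `τ(x) = (1-x)^((p₂+p₃)(p₁+p₄+a)) (1+x)^((p₂+p₄)(p₁+p₃+b)) Wr[seeds](x)` on `(-1,1)`. -/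
def tauFun (x : ℝ) : ℝ :=
  (1 - x) ^ (((d.p₂ : ℝ) + d.p₃) * (d.p₁ + d.p₄ + d.a)) *
    (1 + x) ^ (((d.p₂ : ℝ) + d.p₄) * (d.p₁ + d.p₃ + d.b)) * wr d.seeds x

/-- `∑_ι ∑_{k ∈ K_ι} k + 2p₁p₂ + 2p₃p₄ - binom(p₁+p₂,2) - binom(p₃+p₄,2)` -/
def tauDegree : ℤ :=
  (∑ k ∈ d.K₁, (k : ℤ)) + (∑ k ∈ d.K₂, (k : ℤ)) + (∑ k ∈ d.K₃, (k : ℤ)) + (∑ k ∈ d.K₄, (k : ℤ)) +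
    2 * d.p₁ * d.p₂ + 2 * d.p₃ * d.p₄ - ((d.p₁ + d.p₂).choose 2 : ℕ) - ((d.p₃ + d.p₄).choose 2 : ℕ)

/-- `max(n, n*)` with `n* = -n-1-a-b`, for `a+b ∈ ℤ`. -/
def u (n : ℤ) : ℕ := (max n (-n - 1 - ⌊d.a + d.b⌋)).toNat

/-- The coefficient of `x^(-k-1)` in the expansion at infinity of the difference of the monic type 1
function of index `N = k - a - b` and the monic type 2 function of index `k`:
`-2^(1+k+N) a (1-a)_k (1+a)_N k! N! / ((k+N)! (k+N+1)!)`. -/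
def connCoeff (k N : ℕ) : ℝ :=
  -(2 ^ (1 + k + N) * d.a * (ascPochhammer ℝ k).eval (1 - d.a) *
      (ascPochhammer ℝ N).eval (1 + d.a) * k.factorial * N.factorial) /
    ((k + N).factorial * (k + N + 1).factorial)

/-- The scalar which, together with `∏ (n - k)`, makes the eigenfunction monic. -/
def chi (n : ℤ) : ℝ :=
  (jacobiP (d.u n) d.a d.b).leadingCoeff *
    if 0 ≤ n then 1 else d.connCoeff (-n - 1).toNat (d.u n)

/-- The Wronskian formula for the eigenfunction with `n = i + p₁ - p₂`. -/
def piFun (i : ℤ) (x : ℝ) : ℝ :=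
  (x - 1) ^ (d.p₂ + d.p₃) * (1 + x) ^ (d.p₂ + d.p₄) /
    (d.chi (i + d.p₁ - d.p₂) * ∏ k ∈ d.Kall, (((i + d.p₁ - d.p₂ : ℤ) : ℝ) - k)) *
    (wr (d.seeds ++ [phi d.a d.b .one (d.u (i + d.p₁ - d.p₂))]) x / wr d.seeds x)

/-- `κ(z) = ∏_k (z - k*)/(z - k)` with `k* = -k-a-b-1`. -/
def kappa (z : ℝ) : ℝ := ∏ k ∈ d.Kall, (z - (-k - d.a - d.b - 1)) / (z - k)

/-- `κ(z) ν(z;a,b)` -/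
def kn (z : ℝ) : ℝ := d.kappa z * nuJ z d.a d.b

end Params

end ExcJacobi

end

open ExcJacobi

noncomputable section

namespace ExcJacobi

/-! ### The derivation of `ℝ(x)` -/

/-! In the symmetric gauge the operator is `D p D + V` with `p = x² - 1`. The log-derivative of a
quasi-rational eigenfunction solves the Riccati equation `SRV`, and the four types differ only in
the signs of the residues `±α/2` at `1` and `±β/2` at `-1`. A Darboux step with seed `w₀` is
therefore the same algebra for all types: it sends `w` to `darbouxW w₀ w`, moves `(α, β)` by the
signs of the seed, multiplies `τ` by the regular part of the seed, and is undone by the step with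
the dual seed (`SRV.darboux`, `SRV.exists_darboux`).

The operator `T` arises from the classical one by one step per element of the sets `K_ι`. Away from
the seed eigenvalue a step is a bijection on Riccati solutions. At the seed eigenvalue the dual seed
is a solution, and a second one would give a quasi-rational antiderivative of the square of the seed
function (`SRV.exists_primitive`). Modulo exact forms each step multiplies squares by a difference
of eigenvalues (`ex_FL_sq`), so such an antiderivative would exist already for the square of a
Jacobi polynomial of upper index. Integration by parts (`ex_jacobiF_sq`) turns this square into a
weight that is not exact (`not_ex_one`). Hence a step deletes the indices at the seed eigenvalue and
adds `-k-1` in the opposite type, which gives `mem_Ind_iff`. Spectrum, index sets and diagrams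
follow, because for non-integral exponents two solutions at one eigenvalue have opposite types
(`type_eq_opp_of_ne`).

The product `tauL` of the successive transformed seeds is a Wronskian up to powers of `x ± 1` by
Crum's formula (`wrS_append`), so it has poles at most at `±1`; the indicial equation makes it a
unit there (`Eig.unitAt`), and it is a polynomial. One more seed of type 1 yields the
eigenpolynomials.

Leading coefficients are computed at infinity (`hasLead_FL`). This degenerates at the index `-k-1`,
`k ∈ K₂`, where the coefficient is read off the constant Wronskian of the two functions sharing an
eigenvalue (`kap_FL`, `hasLead_FL_dual`). Norms come from the same exactness statements: `π_i²` is
compared with a multiple of `(1+x)^(-m)` (`ex_FL_sq_sub`, `isFormalNorm_of_ex`), and the multiple is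
matched with limits of gamma functions (`exists_norm`). -/

theorem exists_num_denom (f : RatFunc ℝ) : ∃ n d : ℝ[X], d ≠ 0 ∧
    f = algebraMap ℝ[X] (RatFunc ℝ) n / algebraMap ℝ[X] (RatFunc ℝ) d :=
  ⟨f.num, f.denom, f.denom_ne_zero, (RatFunc.num_div_denom f).symm⟩

/-- `ratDeriv` is defined on the reduced fraction `N/D`; this identity carries the quotient rule
over to any other fraction `n/d`. -/
theorem cross_derivative {n d N D : ℝ[X]} (h1 : N * d = n * D) :
    (derivative N * D - N * derivative D) * d ^ 2 =
      (derivative n * d - n * derivative d) * D ^ 2 := by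
  have h2 := congrArg derivative h1
  simp only [derivative_mul] at h2
  linear_combination (d * D) * h2 - (D * derivative d + d * derivative D) * h1

theorem ratDeriv_div_poly (n d : ℝ[X]) (hd : d ≠ 0) :
    ratDeriv (algebraMap ℝ[X] (RatFunc ℝ) n / algebraMap ℝ[X] (RatFunc ℝ) d) =
      algebraMap ℝ[X] (RatFunc ℝ) (derivative n * d - n * derivative d) /
        algebraMap ℝ[X] (RatFunc ℝ) (d ^ 2) := by
  have h1 := (RatFunc.num_mul_eq_mul_denom_iff
    (x := algebraMap ℝ[X] (RatFunc ℝ) n / algebraMap ℝ[X] (RatFunc ℝ) d) hd).2 rfl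
  have hD := (algebraMap ℝ[X] (RatFunc ℝ) n / algebraMap ℝ[X] (RatFunc ℝ) d).denom_ne_zero
  rw [ratDeriv, div_eq_div_iff
    (RatFunc.algebraMap_ne_zero (pow_ne_zero 2 hD)) (RatFunc.algebraMap_ne_zero (pow_ne_zero 2 hd)),
    ← map_mul, ← map_mul, cross_derivative h1]

theorem ratDeriv_algebraMap (n : ℝ[X]) :
    ratDeriv (algebraMap ℝ[X] (RatFunc ℝ) n) = algebraMap ℝ[X] (RatFunc ℝ) (derivative n) := by
  have := ratDeriv_div_poly n 1 one_ne_zero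
  simpa using this

theorem ratDeriv_add (f g : RatFunc ℝ) : ratDeriv (f + g) = ratDeriv f + ratDeriv g := by
  obtain ⟨n, d, hd, rfl⟩ := exists_num_denom f
  obtain ⟨m, e, he, rfl⟩ := exists_num_denom g
  have hd' := RatFunc.algebraMap_ne_zero hd
  have he' := RatFunc.algebraMap_ne_zero he
  rw [div_add_div _ _ hd' he', ← map_mul, ← map_mul, ← map_mul, ← map_add,
    ratDeriv_div_poly _ _ (mul_ne_zero hd he), ratDeriv_div_poly _ _ hd, ratDeriv_div_poly _ _ he]
  simp only [map_sub, map_mul, map_pow, derivative_mul, map_add]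
  field_simp
  ring

theorem ratDeriv_mul (f g : RatFunc ℝ) : ratDeriv (f * g) = ratDeriv f * g + f * ratDeriv g := by
  obtain ⟨n, d, hd, rfl⟩ := exists_num_denom f
  obtain ⟨m, e, he, rfl⟩ := exists_num_denom g
  have hd' := RatFunc.algebraMap_ne_zero hd
  have he' := RatFunc.algebraMap_ne_zero he
  rw [div_mul_div_comm, ← map_mul, ← map_mul,
    ratDeriv_div_poly _ _ (mul_ne_zero hd he), ratDeriv_div_poly _ _ hd, ratDeriv_div_poly _ _ he]
  simp only [map_sub, map_mul, map_pow, derivative_mul, map_add]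
  field_simp
  ring

@[simp] theorem ratDeriv_C (c : ℝ) : ratDeriv (RatFunc.C c) = 0 := by
  rw [← RatFunc.algebraMap_C, ratDeriv_algebraMap]; simp

@[simp] theorem ratDeriv_zero : ratDeriv 0 = 0 := by simpa using ratDeriv_C 0

@[simp] theorem ratDeriv_one : ratDeriv 1 = 0 := by simpa using ratDeriv_C 1

@[simp] theorem ratDeriv_X : ratDeriv RatFunc.X = 1 := by
  rw [← RatFunc.algebraMap_X, ratDeriv_algebraMap]; simp

@[simp] theorem ratDeriv_neg (f : RatFunc ℝ) : ratDeriv (-f) = -ratDeriv f := by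
  have := ratDeriv_add f (-f)
  rw [add_neg_cancel, ratDeriv_zero] at this
  linear_combination -this

theorem ratDeriv_sub (f g : RatFunc ℝ) : ratDeriv (f - g) = ratDeriv f - ratDeriv g := by
  rw [sub_eq_add_neg, ratDeriv_add, ratDeriv_neg, sub_eq_add_neg]

theorem ratDeriv_C_mul (c : ℝ) (f : RatFunc ℝ) :
    ratDeriv (RatFunc.C c * f) = RatFunc.C c * ratDeriv f := by
  rw [ratDeriv_mul, ratDeriv_C]; ring

theorem ratDeriv_inv {f : RatFunc ℝ} (hf : f ≠ 0) : ratDeriv f⁻¹ = -ratDeriv f / f ^ 2 := by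
  have := ratDeriv_mul f f⁻¹
  rw [mul_inv_cancel₀ hf, ratDeriv_one] at this
  field_simp at this ⊢
  linear_combination -this

theorem ratDeriv_div {f g : RatFunc ℝ} (hg : g ≠ 0) :
    ratDeriv (f / g) = (ratDeriv f * g - f * ratDeriv g) / g ^ 2 := by
  rw [div_eq_mul_inv, ratDeriv_mul, ratDeriv_inv hg]
  field_simp
  ring

/-! ### Logarithmic derivatives -/

/-- The logarithmic derivative `f'/f`. -/
def ld (f : RatFunc ℝ) : RatFunc ℝ := ratDeriv f / f

@[simp] theorem ld_one : ld 1 = 0 := by simp [ld]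

theorem ld_mul {f g : RatFunc ℝ} (hf : f ≠ 0) (hg : g ≠ 0) : ld (f * g) = ld f + ld g := by
  rw [ld, ld, ld, ratDeriv_mul]; field_simp

theorem ld_inv {f : RatFunc ℝ} (hf : f ≠ 0) : ld f⁻¹ = -ld f := by
  rw [ld, ld, ratDeriv_inv hf]; field_simp

theorem ld_C_mul {c : ℝ} (hc : c ≠ 0) (f : RatFunc ℝ) : ld (RatFunc.C c * f) = ld f := by
  have : RatFunc.C c ≠ 0 := by simpa using hc
  rw [ld, ld, ratDeriv_C_mul]; field_simp

theorem ld_pow (f : RatFunc ℝ) (n : ℕ) : ld (f ^ n) = n * ld f := by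
  induction n with
  | zero => simp
  | succ n ih =>
    by_cases hf : f = 0
    · simp [hf, ld]
    · rw [pow_succ, ld_mul (pow_ne_zero n hf) hf, ih]; push_cast; ring

theorem ld_zpow (f : RatFunc ℝ) (n : ℤ) : ld (f ^ n) = n * ld f := by
  by_cases hf : f = 0
  · rcases eq_or_ne n 0 with rfl | hn
    · simp
    · simp [hf, ld, zero_zpow n hn]
  obtain ⟨m, rfl | rfl⟩ := n.eq_nat_or_neg
  · simp [ld_pow]
  · rw [zpow_neg, zpow_natCast, ld_inv (pow_ne_zero m hf), ld_pow]; push_cast; ring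

theorem ratDeriv_eq_ld_mul {f : RatFunc ℝ} (hf : f ≠ 0) : ratDeriv f = ld f * f := by
  rw [ld, div_mul_cancel₀ _ hf]

theorem logD_eq (τ : ℝ[X]) : logD τ = ld (algebraMap ℝ[X] (RatFunc ℝ) τ) := by
  rw [logD, ld, ratDeriv_algebraMap]

/-! ### Behaviour at infinity -/

/-- `f` vanishes at infinity. -/
def SmallInf (f : RatFunc ℝ) : Prop := f = 0 ∨ f.intDegree < 0

theorem SmallInf.zero : SmallInf 0 := Or.inl rfl

theorem SmallInf.add {f g : RatFunc ℝ} (hf : SmallInf f) (hg : SmallInf g) : SmallInf (f + g) := by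
  rcases hf with rfl | hf
  · simpa using hg
  rcases hg with rfl | hg
  · rw [add_zero]; exact Or.inr hf
  by_cases h : f + g = 0
  · exact Or.inl h
  by_cases h0 : g = 0
  · subst h0; rw [add_zero]; exact Or.inr hf
  exact Or.inr ((RatFunc.intDegree_add_le h0 h).trans_lt (max_lt hf hg))

theorem SmallInf.neg {f : RatFunc ℝ} (hf : SmallInf f) : SmallInf (-f) := by
  rcases hf with rfl | hf
  · simpa using SmallInf.zero
  · exact Or.inr (by simpa using hf)

theorem SmallInf.mul_of_le {f g : RatFunc ℝ} (hf : SmallInf f) (hg : g.intDegree ≤ 0) :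
    SmallInf (f * g) := by
  rcases hf with rfl | hf
  · simpa using SmallInf.zero
  by_cases h : f * g = 0
  · exact Or.inl h
  refine Or.inr ?_
  rw [RatFunc.intDegree_mul (left_ne_zero_of_mul h) (right_ne_zero_of_mul h)]
  omega

theorem SmallInf.mul {f g : RatFunc ℝ} (hf : SmallInf f) (hg : SmallInf g) :
    SmallInf (f * g) := by
  rcases hg with rfl | hg
  · simpa using SmallInf.zero
  · exact hf.mul_of_le hg.le

theorem SmallInf.C_mul {f : RatFunc ℝ} (hf : SmallInf f) (c : ℝ) : SmallInf (RatFunc.C c * f) := by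
  rw [mul_comm]; exact hf.mul_of_le (by simp)

theorem not_smallInf_C {c : ℝ} (hc : c ≠ 0) : ¬ SmallInf (RatFunc.C c) := by
  rintro (h | h)
  · simp [hc] at h
  · simp at h

theorem smallInf_div_poly {n d : ℝ[X]} (hd : d ≠ 0) (h : n.degree < d.degree) :
    SmallInf (algebraMap ℝ[X] (RatFunc ℝ) n / algebraMap ℝ[X] (RatFunc ℝ) d) := by
  by_cases hn : n = 0
  · left; simp [hn]
  right
  rw [RatFunc.intDegree_div (RatFunc.algebraMap_ne_zero hn) (RatFunc.algebraMap_ne_zero hd)]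
  have := natDegree_lt_natDegree hn h
  simp; omega

theorem SmallInf.degree_lt {f : RatFunc ℝ} (hf : SmallInf f) : f.num.degree < f.denom.degree := by
  rcases hf with rfl | hf
  · simp
  · rw [RatFunc.intDegree] at hf
    exact degree_lt_degree (by omega)

/-- Differentiation lowers the degree at infinity by at least one, so the factor `X` does not
destroy the decay. This makes `HasLead` stable under `ratDeriv`. -/
theorem SmallInf.X_mul_ratDeriv {f : RatFunc ℝ} (hf : SmallInf f) :
    SmallInf (RatFunc.X * ratDeriv f) := by
  have h := hf.degree_lt
  rw [ratDeriv, ← RatFunc.algebraMap_X, mul_div_assoc', ← map_mul]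
  have hD := f.denom_ne_zero
  refine smallInf_div_poly (pow_ne_zero 2 hD) ?_
  by_cases hN : f.num = 0
  · rw [hN, derivative_zero, zero_mul, zero_mul, sub_zero, mul_zero, degree_zero, bot_lt_iff_ne_bot,
      Ne, degree_eq_bot]
    exact pow_ne_zero 2 hD
  have hlt := natDegree_lt_natDegree hN h
  refine degree_lt_degree ?_
  rw [natDegree_pow]
  refine (natDegree_mul_le).trans_lt ?_
  rw [natDegree_X]
  have h1 : (derivative f.num * f.denom - f.num * derivative f.denom).natDegree ≤
      f.num.natDegree + f.denom.natDegree - 1 := by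
    refine (natDegree_sub_le _ _).trans (max_le ?_ ?_)
    · by_cases h0 : f.num.natDegree = 0
      · rw [derivative_of_natDegree_zero h0]; simp
      · refine natDegree_mul_le.trans ?_
        have := natDegree_derivative_le f.num
        omega
    · refine natDegree_mul_le.trans ?_
      have := natDegree_derivative_le f.denom
      omega
  omega

/-- `f = c x^d (1 + O(1/x))` at infinity, up to terms `o(x^d)`. -/
def HasLead (f : RatFunc ℝ) (d : ℤ) (c : ℝ) : Prop :=
  ∃ ε, SmallInf ε ∧ f = RatFunc.X ^ d * (RatFunc.C c + ε)

theorem intDegree_X_zpow (d : ℤ) : (RatFunc.X ^ d : RatFunc ℝ).intDegree = d := by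
  obtain ⟨m, rfl | rfl⟩ := d.eq_nat_or_neg
  · rw [zpow_natCast, ← RatFunc.algebraMap_X, ← map_pow, RatFunc.intDegree_polynomial]; simp
  · rw [zpow_neg, RatFunc.intDegree_inv, zpow_natCast, ← RatFunc.algebraMap_X, ← map_pow,
      RatFunc.intDegree_polynomial]; simp

theorem X_zpow_ne_zero (d : ℤ) : (RatFunc.X ^ d : RatFunc ℝ) ≠ 0 := zpow_ne_zero d RatFunc.X_ne_zero

theorem HasLead.mul {f g : RatFunc ℝ} {d e : ℤ} {a b : ℝ} (hf : HasLead f d a)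
    (hg : HasLead g e b) : HasLead (f * g) (d + e) (a * b) := by
  obtain ⟨ε, hε, rfl⟩ := hf
  obtain ⟨η, hη, rfl⟩ := hg
  refine ⟨RatFunc.C a * η + RatFunc.C b * ε + ε * η,
    ((hη.C_mul a).add (hε.C_mul b)).add (hε.mul hη), ?_⟩
  rw [zpow_add₀ RatFunc.X_ne_zero, map_mul]
  ring

theorem HasLead.add {f g : RatFunc ℝ} {d : ℤ} {a b : ℝ} (hf : HasLead f d a)
    (hg : HasLead g d b) : HasLead (f + g) d (a + b) := by
  obtain ⟨ε, hε, rfl⟩ := hf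
  obtain ⟨η, hη, rfl⟩ := hg
  exact ⟨ε + η, hε.add hη, by rw [map_add]; ring⟩

theorem HasLead.C_mul {f : RatFunc ℝ} {d : ℤ} {a : ℝ} (c : ℝ) (hf : HasLead f d a) :
    HasLead (RatFunc.C c * f) d (c * a) := by
  obtain ⟨ε, hε, rfl⟩ := hf
  exact ⟨RatFunc.C c * ε, hε.C_mul c, by rw [map_mul]; ring⟩

theorem HasLead.neg {f : RatFunc ℝ} {d : ℤ} {a : ℝ} (hf : HasLead f d a) :
    HasLead (-f) d (-a) := by
  obtain ⟨ε, hε, rfl⟩ := hf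
  exact ⟨-ε, hε.neg, by rw [map_neg]; ring⟩

theorem HasLead.sub {f g : RatFunc ℝ} {d : ℤ} {a b : ℝ} (hf : HasLead f d a)
    (hg : HasLead g d b) : HasLead (f - g) d (a - b) := by
  rw [sub_eq_add_neg, sub_eq_add_neg]; exact hf.add hg.neg

theorem hasLead_C (c : ℝ) : HasLead (RatFunc.C c) 0 c := ⟨0, SmallInf.zero, by simp⟩

theorem hasLead_one : HasLead 1 0 1 := by simpa using hasLead_C 1

theorem hasLead_zero (d : ℤ) : HasLead 0 d 0 := ⟨0, SmallInf.zero, by simp⟩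

theorem hasLead_X : HasLead RatFunc.X 1 1 := ⟨0, SmallInf.zero, by simp⟩

/-- `HasLead` admits the coefficient `0` and is then only a bound on the degree. Lower-order terms
can thus be padded to a common exponent and added. -/
theorem HasLead.of_lt {f : RatFunc ℝ} {d e : ℤ} {c : ℝ} (hf : HasLead f d c) (h : d < e) :
    HasLead f e 0 := by
  obtain ⟨ε, hε, rfl⟩ := hf
  refine ⟨RatFunc.C c * RatFunc.X ^ (d - e) + ε * RatFunc.X ^ (d - e), ?_, ?_⟩
  · refine SmallInf.add (SmallInf.C_mul (Or.inr ?_) c) (hε.mul_of_le ?_) <;>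
      rw [intDegree_X_zpow] <;> omega
  · rw [map_zero, zero_add, ← add_mul, mul_left_comm, ← zpow_add₀ RatFunc.X_ne_zero]
    rw [add_sub_cancel, mul_comm]

theorem HasLead.ratDeriv {f : RatFunc ℝ} {d : ℤ} {c : ℝ} (hf : HasLead f d c) :
    HasLead (ratDeriv f) (d - 1) (d * c) := by
  obtain ⟨ε, hε, rfl⟩ := hf
  refine ⟨RatFunc.C (d : ℝ) * ε + RatFunc.X * ExcJacobi.ratDeriv ε, (hε.C_mul (d : ℝ)).add hε.X_mul_ratDeriv, ?_⟩
  rw [ratDeriv_mul, ratDeriv_add, ratDeriv_C, ratDeriv_eq_ld_mul (X_zpow_ne_zero d), ld_zpow, ld,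
    ratDeriv_X, zpow_sub₀ RatFunc.X_ne_zero, map_mul, zpow_one, map_intCast]
  have := RatFunc.X_ne_zero (K := ℝ)
  field_simp
  ring

theorem HasLead.ne_zero {f : RatFunc ℝ} {d : ℤ} {c : ℝ} (hf : HasLead f d c) (hc : c ≠ 0) :
    f ≠ 0 := by
  obtain ⟨ε, hε, rfl⟩ := hf
  refine mul_ne_zero (X_zpow_ne_zero d) fun h => not_smallInf_C hc ?_
  rw [eq_neg_of_add_eq_zero_left h]; exact hε.neg

theorem intDegree_C_add {ε : RatFunc ℝ} {c : ℝ} (hε : SmallInf ε) (hc : c ≠ 0) :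
    (RatFunc.C c + ε).intDegree = 0 := by
  rcases hε with rfl | h
  · simp
  have h0 : RatFunc.C c + ε ≠ 0 := fun h' => by
    rw [← neg_eq_of_add_eq_zero_right h'] at h; simp at h
  have hc' : RatFunc.C c ≠ 0 := by simpa using hc
  have h1 := RatFunc.intDegree_add_le (by rintro rfl; simp at h) h0
  rw [RatFunc.intDegree_C] at h1
  have h2 : ((RatFunc.C c + ε) + -ε) ≠ 0 := by simpa using hc'
  have h3 := RatFunc.intDegree_add_le (by rw [neg_ne_zero]; rintro rfl; simp at h) h2
  rw [add_neg_cancel_right, RatFunc.intDegree_C, RatFunc.intDegree_neg] at h3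
  rw [max_eq_left h.le] at h1
  rcases le_max_iff.1 h3 with h4 | h4 <;> omega

theorem HasLead.intDegree_eq {f : RatFunc ℝ} {d : ℤ} {c : ℝ} (hf : HasLead f d c) (hc : c ≠ 0) :
    f.intDegree = d := by
  have h0 := hf.ne_zero hc
  obtain ⟨ε, hε, rfl⟩ := hf
  rw [RatFunc.intDegree_mul (X_zpow_ne_zero d) (right_ne_zero_of_mul h0), intDegree_X_zpow,
    intDegree_C_add hε hc, add_zero]

theorem HasLead.unique {f : RatFunc ℝ} {d : ℤ} {a b : ℝ} (ha : HasLead f d a)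
    (hb : HasLead f d b) : a = b := by
  have h := ha.sub hb
  rw [sub_self] at h
  by_contra hab
  exact h.ne_zero (sub_ne_zero.2 hab) rfl

theorem hasLead_algebraMap (P : ℝ[X]) :
    HasLead (algebraMap ℝ[X] (RatFunc ℝ) P) P.natDegree P.leadingCoeff := by
  have hX : RatFunc.X = algebraMap ℝ[X] (RatFunc ℝ) X := RatFunc.algebraMap_X.symm
  refine ⟨algebraMap ℝ[X] (RatFunc ℝ) P.eraseLead / algebraMap ℝ[X] (RatFunc ℝ) (X ^ P.natDegree),
    ?_, ?_⟩
  · by_cases hP : P = 0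
    · left; simp [hP]
    · refine smallInf_div_poly (by simp) ?_
      rw [degree_X_pow, ← degree_eq_natDegree hP]
      exact degree_eraseLead_lt hP
  · have h := P.eraseLead_add_C_mul_X_pow
    have h0 : algebraMap ℝ[X] (RatFunc ℝ) (X ^ P.natDegree) ≠ 0 :=
      RatFunc.algebraMap_ne_zero (by simp)
    rw [zpow_natCast, hX, ← map_pow, mul_add, mul_div_cancel₀ _ h0, ← RatFunc.algebraMap_C, ← map_mul,
      ← map_add, mul_comm, add_comm, h]

theorem HasLead.inv {f : RatFunc ℝ} {d : ℤ} {c : ℝ} (hf : HasLead f d c) (hc : c ≠ 0) :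
    HasLead f⁻¹ (-d) c⁻¹ := by
  obtain ⟨ε, hε, rfl⟩ := hf
  have hC : RatFunc.C c ≠ 0 := by simpa using hc
  have h0 : RatFunc.C c + ε ≠ 0 := fun h => not_smallInf_C hc (by
    rw [eq_neg_of_add_eq_zero_left h]; exact hε.neg)
  refine ⟨RatFunc.C (-c⁻¹) * ε * (RatFunc.C c + ε)⁻¹, (hε.C_mul _).mul_of_le ?_, ?_⟩
  · rw [RatFunc.intDegree_inv, intDegree_C_add hε hc, neg_zero]
  · have hX := X_zpow_ne_zero d
    rw [zpow_neg, map_neg, map_inv₀, mul_inv]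
    field_simp
    ring

theorem exists_hasLead {f : RatFunc ℝ} (hf : f ≠ 0) : ∃ c ≠ 0, HasLead f f.intDegree c := by
  refine ⟨f.num.leadingCoeff, by simpa using hf, ?_⟩
  have h1 := hasLead_algebraMap f.num
  have h2 := (hasLead_algebraMap f.denom).inv (by rw [(RatFunc.monic_denom f).leadingCoeff]; simp)
  have h3 := h1.mul h2
  rw [← div_eq_mul_inv, RatFunc.num_div_denom, (RatFunc.monic_denom f).leadingCoeff] at h3
  simpa [RatFunc.intDegree, sub_eq_add_neg] using h3

theorem HasLead.num_leadingCoeff {f : RatFunc ℝ} {d : ℤ} {c : ℝ} (hf : HasLead f d c)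
    (hc : c ≠ 0) : f.num.leadingCoeff = c := by
  have h1 := hasLead_algebraMap f.num
  have h2 := (hasLead_algebraMap f.denom).inv (by rw [(RatFunc.monic_denom f).leadingCoeff]; simp)
  have h3 := h1.mul h2
  rw [← div_eq_mul_inv, RatFunc.num_div_denom, (RatFunc.monic_denom f).leadingCoeff] at h3
  have h4 : (f.num.natDegree : ℤ) + -f.denom.natDegree = d := by
    rw [← hf.intDegree_eq hc, RatFunc.intDegree]; ring
  rw [h4] at h3
  simpa using h3.unique hf

theorem hasLead_ld {f : RatFunc ℝ} (hf : f ≠ 0) : HasLead (ld f) (-1) f.intDegree := by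
  obtain ⟨c, hc, h⟩ := exists_hasLead hf
  have h1 := h.ratDeriv.mul (h.inv hc)
  have h2 : (f.intDegree : ℝ) * c * c⁻¹ = f.intDegree := by field_simp
  have h3 : f.intDegree - 1 + -f.intDegree = -1 := by ring
  rwa [← div_eq_mul_inv, h2, h3] at h1

theorem HasLead.div {f g : RatFunc ℝ} {d e : ℤ} {a b : ℝ} (hf : HasLead f d a)
    (hg : HasLead g e b) (hb : b ≠ 0) : HasLead (f / g) (d - e) (a / b) := by
  rw [div_eq_mul_inv, div_eq_mul_inv, sub_eq_add_neg]; exact hf.mul (hg.inv hb)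

theorem HasLead.pow {f : RatFunc ℝ} {d : ℤ} {a : ℝ} (hf : HasLead f d a) (n : ℕ) :
    HasLead (f ^ n) (n * d) (a ^ n) := by
  induction n with
  | zero => simpa using hasLead_one
  | succ n ih =>
    have := ih.mul hf
    rw [pow_succ, pow_succ]
    convert this using 1
    push_cast; ring

/-- For `w = O(1/x)` the remainder in `qrDegree` is the numerator itself, and its coefficient just
below the degree of the monic denominator is the coefficient of `1/x`. -/
theorem qrDegree_eq_of_hasLead {w : RatFunc ℝ} {c : ℝ} (h : HasLead w (-1) c) :
    qrDegree w = c := by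
  have hs : SmallInf w := by
    rcases h.of_lt (e := 0) (by norm_num) with ⟨ε, hε, rfl⟩
    simpa using hε
  have hlt := hs.degree_lt
  rw [qrDegree, mod_eq_self_iff w.denom_ne_zero |>.2 hlt]
  rcases eq_or_ne w 0 with rfl | hw
  · simpa using (h.unique (hasLead_zero (-1))).symm
  have hn : w.num ≠ 0 := RatFunc.num_ne_zero hw
  have hlt' := natDegree_lt_natDegree hn hlt
  by_cases hd : w.num.natDegree = w.denom.natDegree - 1
  · rw [← hd, coeff_natDegree]
    obtain ⟨c', hc', h'⟩ := exists_hasLead hw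
    have hw1 : w.intDegree = -1 := by rw [RatFunc.intDegree]; omega
    rw [hw1] at h'
    rw [h'.num_leadingCoeff hc', h'.unique h]
  · rw [coeff_eq_zero_of_natDegree_lt (by omega)]
    obtain ⟨c', hc', h'⟩ := exists_hasLead hw
    exact ((h'.of_lt (e := -1) (by rw [RatFunc.intDegree]; omega)).unique h)

/-- A non-zero function with zero derivative has degree `0`, since differentiation multiplies the
leading coefficient by the degree. Subtracting the leading coefficient of `f` would leave a function
of degree `0` whose leading coefficient is zero. -/
theorem eq_C_of_ratDeriv_eq_zero {f : RatFunc ℝ} (h : ratDeriv f = 0) : ∃ c, f = RatFunc.C c := by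
  by_contra hne
  push Not at hne
  have hf : f ≠ 0 := by simpa using hne 0
  obtain ⟨c, hc, hl⟩ := exists_hasLead hf
  set g := f - RatFunc.C c with hg
  have hg0 : g ≠ 0 := sub_ne_zero.2 (hne c)
  have hdg : ratDeriv g = 0 := by rw [hg, ratDeriv_sub, h, ratDeriv_C, sub_zero]
  have key : ∀ k : RatFunc ℝ, k ≠ 0 → ratDeriv k = 0 → k.intDegree = 0 := by
    intro k hk hdk
    obtain ⟨c', hc', h'⟩ := exists_hasLead hk
    have := h'.ratDeriv
    rw [hdk] at this
    have := this.unique (hasLead_zero _)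
    simpa [hc'] using this
  have h1 := key f hf h
  have h2 := key g hg0 hdg
  rw [h1] at hl
  have h3 := hl.sub (hasLead_C c)
  rw [sub_self] at h3
  obtain ⟨c', hc', h'⟩ := exists_hasLead hg0
  rw [h2] at h'
  exact hc' (h'.unique h3)

theorem eq_C_mul_of_ld_eq {f g : RatFunc ℝ} (hf : f ≠ 0) (hg : g ≠ 0) (h : ld f = ld g) :
    ∃ c, c ≠ 0 ∧ f = RatFunc.C c * g := by
  have : ratDeriv (f / g) = 0 := by
    rw [ratDeriv_div hg, ratDeriv_eq_ld_mul hf, ratDeriv_eq_ld_mul hg, h]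
    ring
  obtain ⟨c, hc⟩ := eq_C_of_ratDeriv_eq_zero this
  have h1 : f = RatFunc.C c * g := by rw [← hc, div_mul_cancel₀ _ hg]
  exact ⟨c, by rintro rfl; simp [h1] at hf, h1⟩

/-! ### Local behaviour at a real point -/

/-- `f` has no pole at `c`. -/
def Reg (c : ℝ) (f : RatFunc ℝ) : Prop := f.denom.eval c ≠ 0

theorem reg_div_poly {c : ℝ} (n : ℝ[X]) {d : ℝ[X]} (hd : d.eval c ≠ 0) :
    Reg c (algebraMap ℝ[X] (RatFunc ℝ) n / algebraMap ℝ[X] (RatFunc ℝ) d) :=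
  fun h => hd (eval_eq_zero_of_dvd_of_eval_eq_zero (RatFunc.denom_div_dvd n d) h)

theorem Reg.add {c : ℝ} {f g : RatFunc ℝ} (hf : Reg c f) (hg : Reg c g) : Reg c (f + g) :=
  fun h => by
    have := eval_eq_zero_of_dvd_of_eval_eq_zero (RatFunc.denom_add_dvd f g) h
    rw [eval_mul] at this
    exact mul_ne_zero hf hg this

theorem Reg.mul {c : ℝ} {f g : RatFunc ℝ} (hf : Reg c f) (hg : Reg c g) : Reg c (f * g) :=
  fun h => by
    have := eval_eq_zero_of_dvd_of_eval_eq_zero (RatFunc.denom_mul_dvd f g) h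
    rw [eval_mul] at this
    exact mul_ne_zero hf hg this

theorem reg_algebraMap (c : ℝ) (P : ℝ[X]) : Reg c (algebraMap ℝ[X] (RatFunc ℝ) P) := by
  simp [Reg]

theorem reg_C (c a : ℝ) : Reg c (RatFunc.C a) := by simp [Reg]

theorem reg_X (c : ℝ) : Reg c RatFunc.X := by simp [Reg]

theorem reg_one (c : ℝ) : Reg c 1 := by simp [Reg]

theorem reg_zero (c : ℝ) : Reg c 0 := by simp [Reg]

theorem reg_intCast (c : ℝ) (n : ℤ) : Reg c (n : RatFunc ℝ) := by
  rw [← map_intCast (RatFunc.C (K := ℝ)) n]; exact reg_C c n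

theorem reg_two (c : ℝ) : Reg c 2 := by exact_mod_cast reg_intCast c 2

theorem Reg.neg {c : ℝ} {f : RatFunc ℝ} (hf : Reg c f) : Reg c (-f) := by
  have := (reg_C c (-1)).mul hf
  simpa using this

theorem Reg.sub {c : ℝ} {f g : RatFunc ℝ} (hf : Reg c f) (hg : Reg c g) : Reg c (f - g) := by
  rw [sub_eq_add_neg]; exact hf.add hg.neg

theorem Reg.pow {c : ℝ} {f : RatFunc ℝ} (hf : Reg c f) (n : ℕ) : Reg c (f ^ n) := by
  induction n with
  | zero => simpa using reg_one c
  | succ n ih => rw [pow_succ]; exact ih.mul hf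

theorem Reg.ratDeriv {c : ℝ} {f : RatFunc ℝ} (hf : Reg c f) : Reg c (ratDeriv f) := by
  rw [ExcJacobi.ratDeriv]
  exact reg_div_poly _ (by rw [eval_pow]; exact pow_ne_zero 2 hf)

theorem val_add {c : ℝ} {f g : RatFunc ℝ} (hf : Reg c f) (hg : Reg c g) :
    val (f + g) c = val f c + val g c := RatFunc.eval_add _ _ hf hg

theorem val_mul {c : ℝ} {f g : RatFunc ℝ} (hf : Reg c f) (hg : Reg c g) :
    val (f * g) c = val f c * val g c := RatFunc.eval_mul _ _ hf hg

@[simp] theorem val_C (a c : ℝ) : val (RatFunc.C a) c = a := by simp [val]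

@[simp] theorem val_X (c : ℝ) : val RatFunc.X c = c := by simp [val]

@[simp] theorem val_one (c : ℝ) : val 1 c = 1 := by simp [val]

@[simp] theorem val_zero (c : ℝ) : val 0 c = 0 := by simp [val]

@[simp] theorem val_algebraMap (P : ℝ[X]) (c : ℝ) :
    val (algebraMap ℝ[X] (RatFunc ℝ) P) c = P.eval c := by
  rw [val, RatFunc.eval_algebraMap]; rfl

theorem val_neg {c : ℝ} {f : RatFunc ℝ} (hf : Reg c f) : val (-f) c = -val f c := by
  have := val_mul (reg_C c (-1)) hf
  rw [val_C] at this
  simpa using this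

theorem val_sub {c : ℝ} {f g : RatFunc ℝ} (hf : Reg c f) (hg : Reg c g) :
    val (f - g) c = val f c - val g c := by
  rw [sub_eq_add_neg, val_add hf hg.neg, val_neg hg, sub_eq_add_neg]

theorem val_pow {c : ℝ} {f : RatFunc ℝ} (hf : Reg c f) (n : ℕ) : val (f ^ n) c = val f c ^ n := by
  induction n with
  | zero => simp
  | succ n ih => rw [pow_succ, pow_succ, val_mul (hf.pow n) hf, ih]

theorem val_eq_div (f : RatFunc ℝ) (c : ℝ) : val f c = f.num.eval c / f.denom.eval c := rfl

/-- `f` has neither a zero nor a pole at `c`. -/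
def UnitAt (c : ℝ) (f : RatFunc ℝ) : Prop := Reg c f ∧ val f c ≠ 0

theorem unitAt_iff {c : ℝ} {f : RatFunc ℝ} :
    UnitAt c f ↔ f.denom.eval c ≠ 0 ∧ f.num.eval c ≠ 0 := by
  refine and_congr_right fun h => ?_
  rw [val_eq_div, Ne, div_eq_zero_iff, not_or]
  exact ⟨fun h => h.1, fun h' => ⟨h', h⟩⟩

theorem unitEnds_iff {f : RatFunc ℝ} : UnitEnds f ↔ UnitAt 1 f ∧ UnitAt (-1) f := by
  rw [UnitEnds, RegularEnds, unitAt_iff, unitAt_iff]; tauto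

theorem UnitAt.ne_zero {c : ℝ} {f : RatFunc ℝ} (h : UnitAt c f) : f ≠ 0 := by
  rintro rfl; exact h.2 (by simp)

theorem UnitAt.inv {c : ℝ} {f : RatFunc ℝ} (h : UnitAt c f) : UnitAt c f⁻¹ := by
  have h0 := h.ne_zero
  have hr : Reg c f⁻¹ := fun h' => (unitAt_iff.1 h).2
    (eval_eq_zero_of_dvd_of_eval_eq_zero (RatFunc.denom_inv_dvd h0) h')
  refine ⟨hr, fun h' => ?_⟩
  have := val_mul h.1 hr
  rw [mul_inv_cancel₀ h0, h', mul_zero, val_one] at this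
  exact one_ne_zero this

theorem UnitAt.mul {c : ℝ} {f g : RatFunc ℝ} (hf : UnitAt c f) (hg : UnitAt c g) :
    UnitAt c (f * g) := ⟨hf.1.mul hg.1, by rw [val_mul hf.1 hg.1]; exact mul_ne_zero hf.2 hg.2⟩

theorem val_inv {c : ℝ} {f : RatFunc ℝ} (h : UnitAt c f) : val f⁻¹ c = (val f c)⁻¹ := by
  have := val_mul h.1 h.inv.1
  rw [mul_inv_cancel₀ h.ne_zero, val_one] at this
  exact eq_inv_of_mul_eq_one_right this.symm

theorem val_div {c : ℝ} {f g : RatFunc ℝ} (hf : Reg c f) (hg : UnitAt c g) :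
    val (f / g) c = val f c / val g c := by
  rw [div_eq_mul_inv, val_mul hf hg.inv.1, val_inv hg, div_eq_mul_inv]

theorem Reg.div {c : ℝ} {f g : RatFunc ℝ} (hf : Reg c f) (hg : UnitAt c g) : Reg c (f / g) := by
  rw [div_eq_mul_inv]; exact hf.mul hg.inv.1

theorem UnitAt.div {c : ℝ} {f g : RatFunc ℝ} (hf : UnitAt c f) (hg : UnitAt c g) :
    UnitAt c (f / g) := by
  rw [div_eq_mul_inv]; exact hf.mul hg.inv

theorem UnitAt.ld {c : ℝ} {f : RatFunc ℝ} (h : UnitAt c f) : Reg c (ld f) := h.1.ratDeriv.div h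

theorem UnitAt.zpow {c : ℝ} {f : RatFunc ℝ} (h : UnitAt c f) (n : ℤ) : UnitAt c (f ^ n) := by
  have key : ∀ m : ℕ, UnitAt c (f ^ m) := fun m =>
    ⟨h.1.pow m, by rw [val_pow h.1]; exact pow_ne_zero m h.2⟩
  obtain ⟨m, rfl | rfl⟩ := n.eq_nat_or_neg
  · simpa using key m
  · rw [zpow_neg, zpow_natCast]; exact (key m).inv

theorem unitAt_C {a : ℝ} (c : ℝ) (ha : a ≠ 0) : UnitAt c (RatFunc.C a) := ⟨reg_C c a, by simpa⟩

theorem reg_X_sub (c a : ℝ) : Reg c (RatFunc.X - RatFunc.C a) := (reg_X c).sub (reg_C c a)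

theorem val_X_sub (c a : ℝ) : val (RatFunc.X - RatFunc.C a) c = c - a := by
  rw [val_sub (reg_X c) (reg_C c a)]; simp

theorem unitAt_X_sub {c a : ℝ} (h : c ≠ a) : UnitAt c (RatFunc.X - RatFunc.C a) :=
  ⟨reg_X_sub c a, by rw [val_X_sub]; exact sub_ne_zero.2 h⟩

theorem X_sub_C_eq (a : ℝ) :
    RatFunc.X - RatFunc.C a = algebraMap ℝ[X] (RatFunc ℝ) (X - C a) := by
  rw [map_sub, RatFunc.algebraMap_X, RatFunc.algebraMap_C]

theorem X_sub_ne_zero (a : ℝ) : RatFunc.X - RatFunc.C a ≠ 0 := by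
  rw [X_sub_C_eq]; exact RatFunc.algebraMap_ne_zero (X_sub_C_ne_zero a)

theorem ld_X_sub (a : ℝ) : ld (RatFunc.X - RatFunc.C a) = (RatFunc.X - RatFunc.C a)⁻¹ := by
  rw [ld, ratDeriv_sub, ratDeriv_X, ratDeriv_C, sub_zero, one_div]

theorem exists_local_poly (c : ℝ) {P : ℝ[X]} (hP : P ≠ 0) :
    ∃ (k : ℕ) (Q : ℝ[X]), P = (X - C c) ^ k * Q ∧ Q.eval c ≠ 0 := by
  obtain ⟨Q, h1, h2⟩ := exists_eq_pow_rootMultiplicity_mul_and_not_dvd P hP c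
  exact ⟨_, Q, h1, fun h => h2 (dvd_iff_isRoot.2 h)⟩

theorem exists_local (c : ℝ) {f : RatFunc ℝ} (hf : f ≠ 0) :
    ∃ (k : ℤ) (g : RatFunc ℝ), f = (RatFunc.X - RatFunc.C c) ^ k * g ∧ UnitAt c g := by
  obtain ⟨k, n, hn, hn0⟩ := exists_local_poly c (RatFunc.num_ne_zero hf)
  obtain ⟨l, d, hd, hd0⟩ := exists_local_poly c f.denom_ne_zero
  refine ⟨k - l, algebraMap ℝ[X] (RatFunc ℝ) n / algebraMap ℝ[X] (RatFunc ℝ) d, ?_,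
    UnitAt.div ⟨reg_algebraMap c n, by simpa⟩ ⟨reg_algebraMap c d, by simpa⟩⟩
  conv_lhs => rw [← RatFunc.num_div_denom f, hn, hd]
  rw [zpow_sub₀ (X_sub_ne_zero c), X_sub_C_eq, zpow_natCast, zpow_natCast, map_mul, map_mul,
    map_pow, map_pow, mul_div_mul_comm]

theorem nonneg_of_reg {c : ℝ} {k : ℤ} {g : RatFunc ℝ} (hg : UnitAt c g)
    (h : Reg c ((RatFunc.X - RatFunc.C c) ^ k * g)) : 0 ≤ k := by
  by_contra hk
  push Not at hk
  have h1 := h.mul hg.inv.1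
  rw [mul_assoc, mul_inv_cancel₀ hg.ne_zero, mul_one] at h1
  obtain ⟨m, hm⟩ : ∃ m : ℕ, k = -(m + 1 : ℤ) := ⟨(-k - 1).toNat, by omega⟩
  have h2 := val_mul h1 ((reg_X_sub c c).pow (m + 1))
  have h3 : (RatFunc.X - RatFunc.C c) ^ k * (RatFunc.X - RatFunc.C c) ^ (m + 1) = 1 := by
    rw [hm, ← zpow_natCast, ← zpow_add₀ (X_sub_ne_zero c)]
    push_cast
    simp
  rw [h3, val_pow (reg_X_sub c c), val_X_sub, sub_self] at h2
  simp at h2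

theorem unitAt_of_zpow {c : ℝ} {f : RatFunc ℝ} {g : RatFunc ℝ} {k : ℤ} (hg : UnitAt c g)
    (h : f = (RatFunc.X - RatFunc.C c) ^ k * g) (hk : k = 0) : UnitAt c f := by
  subst hk; simpa [h] using hg

theorem ld_local {c : ℝ} {k : ℤ} {g : RatFunc ℝ} (hg : g ≠ 0) :
    ld ((RatFunc.X - RatFunc.C c) ^ k * g) = k * (RatFunc.X - RatFunc.C c)⁻¹ + ld g := by
  rw [ld_mul (zpow_ne_zero k (X_sub_ne_zero c)) hg, ld_zpow, ld_X_sub]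

/-- A solution of a first-order equation with non-integral exponent at `c` vanishes at `c`. -/
theorem vanish_of_first_order {c A : ℝ} (hA : ¬ IsInt A) {h r F : RatFunc ℝ} (hr : Reg c r)
    (hF : Reg c F)
    (heq : ratDeriv h + (RatFunc.C A * (RatFunc.X - RatFunc.C c)⁻¹ + r) * h = F) :
    ∃ g, Reg c g ∧ h = (RatFunc.X - RatFunc.C c) * g := by
  by_cases h0 : h = 0
  · exact ⟨0, reg_zero c, by simp [h0]⟩
  obtain ⟨k, g, rfl, hg⟩ := exists_local c h0
  have hX := X_sub_ne_zero c
  have hg0 := hg.ne_zero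
  -- With `h = (x-c)^k g` the left side is `(x-c)^(k-1)` times a function with value `(k + A) g(c)`
  -- at `c`. This is non-zero because `A` is not an integer, so regularity of `F` forces `k ≥ 1`.
  have hreg : Reg c ((k : RatFunc ℝ) + RatFunc.C A + (RatFunc.X - RatFunc.C c) * (ld g + r)) :=
    ((reg_intCast c k).add (reg_C c A)).add ((reg_X_sub c c).mul (hg.ld.add hr))
  have hu : UnitAt c (((k : RatFunc ℝ) + RatFunc.C A +
      (RatFunc.X - RatFunc.C c) * (ld g + r)) * g) := by
    refine UnitAt.mul ⟨hreg, ?_⟩ hg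
    rw [val_add ((reg_intCast c k).add (reg_C c A)) ((reg_X_sub c c).mul (hg.ld.add hr)),
      val_mul (reg_X_sub c c) (hg.ld.add hr), val_X_sub, sub_self, zero_mul, add_zero,
      val_add (reg_intCast c k) (reg_C c A), ← map_intCast (RatFunc.C (K := ℝ)) k, val_C, val_C]
    intro h
    exact hA ⟨-k, by push_cast; linarith⟩
  have hE : F = (RatFunc.X - RatFunc.C c) ^ (k - 1) * (((k : RatFunc ℝ) + RatFunc.C A +
      (RatFunc.X - RatFunc.C c) * (ld g + r)) * g) := by
    rw [← heq, ratDeriv_eq_ld_mul h0, ld_local hg0, zpow_sub_one₀ hX]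
    field_simp
    ring
  rw [hE] at hF
  have hk := nonneg_of_reg hu hF
  refine ⟨(RatFunc.X - RatFunc.C c) ^ (k - 1) * g, ?_, ?_⟩
  · obtain ⟨m, hm⟩ := Int.eq_ofNat_of_zero_le hk
    rw [hm, zpow_natCast]
    exact ((reg_X_sub c c).pow m).mul hg.1
  · rw [zpow_sub_one₀ hX]; field_simp

/-- The residue of a logarithmic derivative at a singular end point. -/
theorem residue_sq {c γ K : ℝ} (hc : c ^ 2 = 1) {r R : RatFunc ℝ} (hr : Reg c r) (hR : Reg c R)
    {w : RatFunc ℝ} (hw : w = RatFunc.C K * (RatFunc.X - RatFunc.C c)⁻¹ + r)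
    (heq : pJ * (ratDeriv w + w ^ 2) + 2 * RatFunc.X * w
      - RatFunc.C (c * γ ^ 2 / 2) * (RatFunc.X - RatFunc.C c)⁻¹ + R = 0) : K ^ 2 = (γ / 2) ^ 2 := by
  have hX := X_sub_ne_zero c
  have hp : pJ = (RatFunc.X - RatFunc.C c) * (RatFunc.X + RatFunc.C c) := by
    have : RatFunc.C c ^ 2 = 1 := by rw [← map_pow, hc, map_one]
    rw [pJ]; linear_combination this
  have hdw : ratDeriv w = -RatFunc.C K * (RatFunc.X - RatFunc.C c)⁻¹ ^ 2 + ratDeriv r := by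
    rw [hw, ratDeriv_add, ratDeriv_C_mul, ratDeriv_inv hX, ratDeriv_sub, ratDeriv_X, ratDeriv_C]
    field_simp
    ring
  -- `G` collects the terms that vanish at `c` after the equation is multiplied by `x - c`. The
  -- rest, evaluated at `c`, is the indicial equation `2c (K² - (γ/2)²) = 0`.
  set G := (RatFunc.X - RatFunc.C c) * ((RatFunc.X + RatFunc.C c) * (2 * RatFunc.C K * r +
      (RatFunc.X - RatFunc.C c) * (ratDeriv r + r ^ 2)) + 2 * RatFunc.X * r + R) with hG
  have hXc : Reg c (RatFunc.X + RatFunc.C c) := (reg_X c).add (reg_C c c)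
  have hin : Reg c ((RatFunc.X + RatFunc.C c) * (2 * RatFunc.C K * r +
      (RatFunc.X - RatFunc.C c) * (ratDeriv r + r ^ 2)) + 2 * RatFunc.X * r + R) :=
    ((hXc.mul ((((reg_two c).mul (reg_C c K)).mul hr).add ((reg_X_sub c c).mul
      (hr.ratDeriv.add (hr.pow 2))))).add (((reg_two c).mul (reg_X c)).mul hr)).add hR
  have hGr : Reg c G := (reg_X_sub c c).mul hin
  have h0 : (RatFunc.X + RatFunc.C c) * RatFunc.C (K ^ 2 - K) + RatFunc.X * RatFunc.C (2 * K)
      - RatFunc.C (c * γ ^ 2 / 2) + G = 0 := by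
    have h2 : RatFunc.C (2 * K) = 2 * RatFunc.C K := by rw [map_mul, map_ofNat]
    have := congrArg (fun y => (RatFunc.X - RatFunc.C c) * y) heq
    simp only [mul_zero] at this
    rw [← this, hdw, hp, hw, hG, map_sub, map_pow, h2]
    field_simp
    ring
  have hA : Reg c ((RatFunc.X + RatFunc.C c) * RatFunc.C (K ^ 2 - K)) := hXc.mul (reg_C _ _)
  have hB : Reg c (RatFunc.X * RatFunc.C (2 * K)) := (reg_X c).mul (reg_C _ _)
  have h1 := congrArg (fun y => val y c) h0
  simp only [val_zero] at h1
  rw [val_add ((hA.add hB).sub (reg_C _ _)) hGr, val_sub (hA.add hB) (reg_C _ _), val_add hA hB,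
    val_mul hXc (reg_C _ _), val_add (reg_X c) (reg_C _ _), val_mul (reg_X c) (reg_C _ _), hG,
    val_mul (reg_X_sub c c) hin, val_X_sub] at h1
  simp only [val_C, val_X, sub_self, zero_mul, add_zero] at h1
  have hc0 : c ≠ 0 := by rintro rfl; norm_num at hc
  have h3 : (2 * c) * (K ^ 2 - (γ / 2) ^ 2) = 0 := by linear_combination h1
  rcases mul_eq_zero.1 h3 with h4 | h4
  · exact absurd h4 (by simpa using hc0)
  · linarith

theorem hasDerivAt_val {f : RatFunc ℝ} {c : ℝ} (hf : Reg c f) :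
    HasDerivAt (val f) (val (ratDeriv f) c) c := by
  have h1 := (f.num.hasDerivAt c).div (f.denom.hasDerivAt c) hf
  have hu : UnitAt c (algebraMap ℝ[X] (RatFunc ℝ) (f.denom ^ 2)) :=
    ⟨reg_algebraMap c _, by rw [val_algebraMap, eval_pow]; exact pow_ne_zero 2 hf⟩
  have h2 : val (ratDeriv f) c = (eval c (derivative f.num) * eval c f.denom -
      eval c f.num * eval c (derivative f.denom)) / eval c f.denom ^ 2 := by
    rw [ratDeriv, val_div (reg_algebraMap c _) hu, val_algebraMap, val_algebraMap]
    simp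
  rw [h2]
  exact h1

theorem finite_not_reg (f : RatFunc ℝ) : {x : ℝ | ¬ Reg x f}.Finite := by
  have := (f.denom.rootSet_finite ℝ)
  refine this.subset fun x hx => ?_
  rw [mem_rootSet]
  exact ⟨f.denom_ne_zero, by simpa [Reg] using hx⟩

/-- A rational function without poles outside `±1` and at `±1` is a polynomial, if its poles are
bounded by a power of `x² - 1`. -/
theorem exists_poly_of_reg {f : RatFunc ℝ} {P : ℝ[X]} {i j : ℕ} (h1 : Reg 1 f) (h2 : Reg (-1) f)
    (h : f * (RatFunc.X - 1) ^ i * (RatFunc.X + 1) ^ j = algebraMap ℝ[X] (RatFunc ℝ) P) :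
    ∃ Q : ℝ[X], f = algebraMap ℝ[X] (RatFunc ℝ) Q := by
  have hd : f.denom ∣ (X - C 1) ^ i * (X - C (-1)) ^ j := by
    refine (RatFunc.denom_dvd (mul_ne_zero (pow_ne_zero _ (X_sub_C_ne_zero 1))
      (pow_ne_zero _ (X_sub_C_ne_zero (-1))))).2 ⟨P, ?_⟩
    have e1 := pow_ne_zero i (X_sub_ne_zero 1)
    have e2 := pow_ne_zero j (X_sub_ne_zero (-1))
    rw [← h, map_mul, map_pow, map_pow, ← X_sub_C_eq, ← X_sub_C_eq, eq_div_iff (mul_ne_zero e1 e2)]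
    simp only [map_one, map_neg, sub_neg_eq_add]
    ring
  have c1 : IsCoprime f.denom ((X - C 1) ^ i) :=
    (((prime_X_sub_C (1 : ℝ)).irreducible.coprime_iff_not_dvd.2 fun h => h1 (dvd_iff_isRoot.1 h)).symm).pow_right
  have c2 : IsCoprime f.denom ((X - C (-1)) ^ j) :=
    (((prime_X_sub_C (-1 : ℝ)).irreducible.coprime_iff_not_dvd.2 fun h => h2 (dvd_iff_isRoot.1 h)).symm).pow_right
  have hu : IsUnit f.denom := (c1.mul_right c2).isUnit_of_dvd' dvd_rfl hd
  have h1' : f.denom = 1 := by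
    rwa [← (RatFunc.monic_denom f).isUnit_iff]
  exact ⟨f.num, by conv_lhs => rw [← RatFunc.num_div_denom f, h1', map_one, div_one]⟩

/-! ### The Riccati equation in the symmetric gauge -/

/-- `1/(x-1)` -/
def eP : RatFunc ℝ := (RatFunc.X - 1)⁻¹

/-- `1/(x+1)` -/
def eM : RatFunc ℝ := (RatFunc.X + 1)⁻¹

theorem X_sub_one_ne_zero : (RatFunc.X - 1 : RatFunc ℝ) ≠ 0 := by
  simpa using X_sub_ne_zero 1

theorem X_add_one_ne_zero : (RatFunc.X + 1 : RatFunc ℝ) ≠ 0 := by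
  simpa using X_sub_ne_zero (-1)

theorem eP_eq : eP = (RatFunc.X - RatFunc.C 1)⁻¹ := by simp [eP]

theorem eM_eq : eM = (RatFunc.X - RatFunc.C (-1))⁻¹ := by simp [eM]

theorem pJ_eq : pJ = (RatFunc.X - 1) * (RatFunc.X + 1) := by rw [pJ]; ring

theorem pJ_ne_zero : pJ ≠ 0 := by
  rw [pJ_eq]; exact mul_ne_zero X_sub_one_ne_zero X_add_one_ne_zero

theorem ratDeriv_pJ : ratDeriv pJ = 2 * RatFunc.X := by
  rw [pJ, ratDeriv_sub, ratDeriv_one, pow_two, ratDeriv_mul, ratDeriv_X]; ring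

theorem ratDeriv_eP : ratDeriv eP = -eP ^ 2 := by
  rw [eP, ratDeriv_inv X_sub_one_ne_zero, ratDeriv_sub, ratDeriv_X, ratDeriv_one]
  have := X_sub_one_ne_zero
  field_simp
  ring

theorem ratDeriv_eM : ratDeriv eM = -eM ^ 2 := by
  rw [eM, ratDeriv_inv X_add_one_ne_zero, ratDeriv_add, ratDeriv_X, ratDeriv_one]
  have := X_add_one_ne_zero
  field_simp
  ring

theorem ld_X_sub_one : ld (RatFunc.X - 1) = eP := by simpa [eP] using ld_X_sub 1

theorem ld_X_add_one : ld (RatFunc.X + 1) = eM := by simpa [eM] using ld_X_sub (-1)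

/-- `x/(x²-1)` -/
def hX : RatFunc ℝ := RatFunc.X / pJ

theorem hX_eq : hX = (eP + eM) / 2 := by
  have := X_sub_one_ne_zero
  have := X_add_one_ne_zero
  rw [hX, pJ_eq, eP, eM]
  field_simp
  ring

theorem pJ_mul_hX : pJ * hX = RatFunc.X := by
  rw [hX, mul_div_cancel₀ _ pJ_ne_zero]

theorem ratDeriv_hX : ratDeriv hX = (pJ - 2 * RatFunc.X ^ 2) / pJ ^ 2 := by
  rw [hX, ratDeriv_div pJ_ne_zero, ratDeriv_X, ratDeriv_pJ]; ring

/-- `w` is a rational solution of `(x²-1)(w' + w²) + 2xw + V = E`. -/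
def SRV (V : RatFunc ℝ) (E : ℝ) (w : RatFunc ℝ) : Prop :=
  pJ * (ratDeriv w + w ^ 2) + 2 * RatFunc.X * w + V = RatFunc.C E

/-- The log-derivative of the dual seed function. -/
def dual (w : RatFunc ℝ) : RatFunc ℝ := -w - hX

theorem dual_dual (w : RatFunc ℝ) : dual (dual w) = w := by rw [dual, dual]; ring

/-- The potential of the Darboux transformed operator. -/
def darbouxV (V w : RatFunc ℝ) : RatFunc ℝ := V + 2 * pJ * ratDeriv w + 2 * RatFunc.X * w - 1 / pJ

theorem ratDeriv_dual (w : RatFunc ℝ) : ratDeriv (dual w) = -ratDeriv w - ratDeriv hX := by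
  rw [dual, ratDeriv_sub, ratDeriv_neg]

/-- Since `hX` is half the log-derivative of `p`, the function with log-derivative `dual w` is the
reciprocal of `√p` times the seed, and it is annihilated by the other first-order factor `(D + w) ∘
√p`. -/
theorem SRV.dual {V w : RatFunc ℝ} {E : ℝ} (h : SRV V E w) :
    SRV (darbouxV V w) E (dual w) := by
  rw [SRV] at h ⊢
  have hp := pJ_ne_zero
  have hX2 : RatFunc.X ^ 2 = pJ + 1 := by rw [pJ]; ring
  rw [← h, ratDeriv_dual, ratDeriv_hX, ExcJacobi.dual, darbouxV, hX]
  field_simp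
  linear_combination hX2

/-- The step with the dual seed restores the potential; this involution is what makes the
transformation onto in `SRV.exists_darboux`. -/
theorem darbouxV_dual (V w : RatFunc ℝ) : darbouxV (darbouxV V w) (dual w) = V := by
  have hp := pJ_ne_zero
  have hX2 : RatFunc.X ^ 2 = pJ + 1 := by rw [pJ]; ring
  rw [darbouxV, darbouxV, ratDeriv_dual, ratDeriv_hX, ExcJacobi.dual, hX]
  field_simp
  linear_combination 2 * hX2

theorem SRV.sub_deriv {V w v : RatFunc ℝ} {E E' : ℝ} (h : SRV V E w) (h' : SRV V E' v) :
    pJ * ratDeriv (w - v) = RatFunc.C (E - E') - 2 * RatFunc.X * (w - v)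
      - pJ * ((w - v) * (w + v)) := by
  rw [SRV] at h h'
  rw [ratDeriv_sub, map_sub]
  linear_combination h - h'

theorem SRV.ld_sub {V w v : RatFunc ℝ} {E E' : ℝ} (h : SRV V E w) (h' : SRV V E' v) (hne : w ≠ v) :
    ld (w - v) = RatFunc.C (E - E') / (pJ * (w - v)) - 2 * hX - (w + v) := by
  have hs := sub_ne_zero.2 hne
  have hp := pJ_ne_zero
  have := h.sub_deriv h'
  rw [ld, hX]
  field_simp
  linear_combination this

/-- The log-derivative of the Darboux transform of a function with log-derivative `w`, for the
seed function with log-derivative `w₀`. -/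
def darbouxW (w₀ w : RatFunc ℝ) : RatFunc ℝ := w + ld (w - w₀) + hX

/-- Eliminating derivatives through the two Riccati equations makes the transform a Möbius function
of `w`, whose inverse is visible. -/
theorem SRV.darbouxW_eq {V w w₀ : RatFunc ℝ} {E E₀ : ℝ} (h : SRV V E w) (h₀ : SRV V E₀ w₀)
    (hne : w ≠ w₀) :
    darbouxW w₀ w = ExcJacobi.dual w₀ + RatFunc.C (E - E₀) / (pJ * (w - w₀)) := by
  rw [darbouxW, h.ld_sub h₀ hne, ExcJacobi.dual]; ring

theorem SRV.darboux {V w w₀ : RatFunc ℝ} {E E₀ : ℝ} (h : SRV V E w) (h₀ : SRV V E₀ w₀)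
    (hne : w ≠ w₀) : SRV (darbouxV V w₀) E (darbouxW w₀ w) := by
  have hd := h₀.dual
  have hs := sub_ne_zero.2 hne
  have hp := pJ_ne_zero
  have hds := h.sub_deriv h₀
  rw [h.darbouxW_eq h₀ hne]
  rw [SRV] at hd ⊢
  -- The correction term `κ` solves the Bernoulli equation `κ' = κ (w + w₀ - κ)`; adding it to `dual
  -- w₀` turns a solution at `E₀` into one at `E`.
  have hk : ratDeriv (RatFunc.C (E - E₀) / (pJ * (w - w₀))) =
      RatFunc.C (E - E₀) / (pJ * (w - w₀)) *
        (w + w₀ - RatFunc.C (E - E₀) / (pJ * (w - w₀))) := by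
    rw [ratDeriv_div (mul_ne_zero hp hs), ratDeriv_mul, hds, ratDeriv_pJ, ratDeriv_C]
    field_simp
    ring
  set κ := RatFunc.C (E - E₀) / (pJ * (w - w₀)) with hκ
  have hκs : pJ * (κ * (w - w₀)) = RatFunc.C (E - E₀) := by
    rw [hκ]; field_simp
  rw [ratDeriv_add, hk]
  rw [map_sub] at hκs
  have hdu : ExcJacobi.dual w₀ = -w₀ - hX := rfl
  have hpx := pJ_mul_hX
  linear_combination hd + hκs + 2 * pJ * κ * hdu - 2 * κ * hpx

theorem C_sub_ne_zero {a b : ℝ} (h : a ≠ b) : RatFunc.C (a - b) ≠ 0 :=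
  (map_ne_zero_iff _ RatFunc.C_injective).2 (sub_ne_zero.2 h)

theorem darbouxW_ne_dual {V w w₀ : RatFunc ℝ} {E E₀ : ℝ} (h : SRV V E w) (h₀ : SRV V E₀ w₀)
    (hE : E ≠ E₀) : darbouxW w₀ w ≠ dual w₀ := by
  have hne : w ≠ w₀ := by
    rintro rfl
    rw [SRV] at h h₀
    exact hE (RatFunc.C_injective (h.symm.trans h₀))
  rw [h.darbouxW_eq h₀ hne]
  have : RatFunc.C (E - E₀) / (pJ * (w - w₀)) ≠ 0 :=
    div_ne_zero (C_sub_ne_zero hE) (mul_ne_zero pJ_ne_zero (sub_ne_zero.2 hne))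
  simpa using this

/-- The Darboux transformation of Riccati solutions is onto, away from the seed eigenvalue. -/
theorem SRV.exists_darboux {V v w₀ : RatFunc ℝ} {E E₀ : ℝ} (h₀ : SRV V E₀ w₀)
    (hv : SRV (darbouxV V w₀) E v) (hE : E ≠ E₀) :
    ∃ w, SRV V E w ∧ w ≠ w₀ ∧ v = darbouxW w₀ w := by
  have hd := h₀.dual
  have hne : v ≠ ExcJacobi.dual w₀ := by
    rintro rfl
    exact hE (RatFunc.C_injective (hv.symm.trans hd))
  have h1 := hv.darboux hd hne
  have h2 := darbouxW_ne_dual hv hd hE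
  have h3 := hv.darbouxW_eq hd hne
  rw [darbouxV_dual] at h1
  rw [dual_dual] at h2 h3
  refine ⟨_, h1, h2, ?_⟩
  rw [h1.darbouxW_eq h₀ h2, h3]
  have hs := sub_ne_zero.2 hne
  have hp := pJ_ne_zero
  have hC : RatFunc.C (E - E₀) ≠ 0 := C_sub_ne_zero hE
  rw [add_sub_cancel_left]
  field_simp
  ring

/-- At the seed eigenvalue, a second Riccati solution of the transformed operator amounts to an
antiderivative of the square of the seed function. -/
theorem SRV.exists_primitive {V v w₀ : RatFunc ℝ} {E₀ : ℝ} (h₀ : SRV V E₀ w₀)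
    (hv : SRV (darbouxV V w₀) E₀ v) (hne : v ≠ ExcJacobi.dual w₀) :
    ∃ h, ratDeriv h + 2 * w₀ * h = 1 := by
  have hs := sub_ne_zero.2 hne
  have hp := pJ_ne_zero
  have h1 := hv.sub_deriv h₀.dual
  rw [sub_self, map_zero] at h1
  -- The reciprocal linearises the equation for the difference of two Riccati solutions. If `y₀'/y₀
  -- = w₀`, then `h y₀²` is an antiderivative of `y₀²`.
  refine ⟨(v - ExcJacobi.dual w₀)⁻¹, ?_⟩
  rw [ratDeriv_inv hs]
  have h2 : ratDeriv (v - ExcJacobi.dual w₀) =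
      -(v - ExcJacobi.dual w₀) * ((v - ExcJacobi.dual w₀) - 2 * w₀) := by
    have hpx := pJ_mul_hX
    have hdu : ExcJacobi.dual w₀ = -w₀ - hX := rfl
    apply mul_left_cancel₀ hp
    rw [h1, ← hpx]
    linear_combination (- 2 * pJ * (v - ExcJacobi.dual w₀)) * hdu
  rw [h2]
  field_simp
  ring

/-! ### Types -/

namespace AType

/-- The sign at `x = 1`. -/
def sgnP : AType → ℤ
  | one => 1
  | two => -1
  | three => -1
  | four => 1

/-- The sign at `x = -1`. -/
def sgnM : AType → ℤ
  | one => 1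
  | two => -1
  | three => 1
  | four => -1

/-- The opposite type. -/
def opp : AType → AType
  | one => two
  | two => one
  | three => four
  | four => three

@[simp] theorem opp_opp (t : AType) : t.opp.opp = t := by cases t <;> rfl

theorem opp_ne (t : AType) : t.opp ≠ t := by cases t <;> simp [opp]

theorem sgnP_sq (t : AType) : t.sgnP ^ 2 = 1 := by cases t <;> rfl

theorem sgnM_sq (t : AType) : t.sgnM ^ 2 = 1 := by cases t <;> rfl

theorem sgnP_opp (t : AType) : t.opp.sgnP = -t.sgnP := by cases t <;> rfl

theorem sgnM_opp (t : AType) : t.opp.sgnM = -t.sgnM := by cases t <;> rfl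

theorem sgnP_eq (t : AType) : t.sgnP = 1 ∨ t.sgnP = -1 := by cases t <;> simp [sgnP]

theorem sgnM_eq (t : AType) : t.sgnM = 1 ∨ t.sgnM = -1 := by cases t <;> simp [sgnM]

theorem ext_sgn {s t : AType} (h1 : s.sgnP = t.sgnP) (h2 : s.sgnM = t.sgnM) : s = t := by
  cases s <;> cases t <;> simp_all [sgnP, sgnM]

end AType

/-- The singular part of the log-derivative of a type `t` function in the symmetric gauge. -/
def omg (t : AType) (α β : ℝ) : RatFunc ℝ :=
  RatFunc.C (t.sgnP * α / 2) * eP + RatFunc.C (t.sgnM * β / 2) * eM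

/-- The potential of the operator in the symmetric gauge, `u` being the log-derivative of `τ`. -/
def potV (u : RatFunc ℝ) (α β : ℝ) : RatFunc ℝ :=
  2 * pJ * ratDeriv u + 2 * RatFunc.X * u - RatFunc.C (α ^ 2 / 2) * eP + RatFunc.C (β ^ 2 / 2) * eM

theorem ratDeriv_omg (t : AType) (α β : ℝ) : ratDeriv (omg t α β) =
    -(RatFunc.C (t.sgnP * α / 2) * eP ^ 2 + RatFunc.C (t.sgnM * β / 2) * eM ^ 2) := by
  rw [omg, ratDeriv_add, ratDeriv_C_mul, ratDeriv_C_mul, ratDeriv_eP, ratDeriv_eM]; ring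

/-- The symmetric gauge multiplies functions by the square root of the weight, which adds `omg .one`
to the log-derivative and a constant to the eigenvalue. -/
theorem mem_ric_iff (τ : ℝ[X]) (α β lam : ℝ) (w : RatFunc ℝ) :
    w ∈ ric (Trg τ α β) lam ↔
      SRV (potV (logD τ) α β) (lam + (α + β) / 2 * ((α + β) / 2 + 1)) (w + omg .one α β) := by
  have hp := X_sub_one_ne_zero
  have hm := X_add_one_ne_zero
  rw [ric, mem_ofPred_eq, SRV, ratDeriv_add, ratDeriv_omg]
  simp only [Trg, potV, omg, AType.sgnP, AType.sgnM, eta, pJ_eq, eP, eM, map_add, map_mul,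
    map_div₀, map_pow, map_one, map_ofNat, Int.cast_one]
  rw [← sub_eq_zero, ← sub_eq_zero (b := RatFunc.C lam + _)]
  refine Eq.congr ?_ rfl
  field_simp
  ring

/-- The form `potV` is stable under Darboux steps: a seed with regular part `f` multiplies `τ` by
`f` and shifts `α`, `β` by its signs. Only the fact that the signs square to `1` is used. -/
theorem darbouxV_potV (u f : RatFunc ℝ) (α β : ℝ) (t : AType) :
    darbouxV (potV u α β) (ld f + omg t α β) = potV (u + ld f) (α + t.sgnP) (β + t.sgnM) := by
  have hp := X_sub_one_ne_zero
  have hm := X_add_one_ne_zero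
  rw [darbouxV, potV, potV, ratDeriv_add, ratDeriv_add, ratDeriv_omg, omg]
  have h1 : (t.sgnP : RatFunc ℝ) ^ 2 = 1 := by exact_mod_cast t.sgnP_sq
  have h2 : (t.sgnM : RatFunc ℝ) ^ 2 = 1 := by exact_mod_cast t.sgnM_sq
  simp only [map_add, map_mul, map_div₀, map_pow, map_ofNat, map_intCast, pJ_eq, eP, eM]
  generalize (t.sgnP : RatFunc ℝ) = ε at *
  generalize (t.sgnM : RatFunc ℝ) = δ at *
  field_simp
  linear_combination (RatFunc.X + 1) * h1 - (RatFunc.X - 1) * h2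

/-- `f` is the regular part of a type `t` quasi-rational eigenfunction. -/
def Eig (u : RatFunc ℝ) (α β : ℝ) (t : AType) (E : ℝ) (f : RatFunc ℝ) : Prop :=
  f ≠ 0 ∧ SRV (potV u α β) E (ld f + omg t α β)

theorem omg_sub (s t : AType) (α β : ℝ) : omg s α β - omg t α β =
    RatFunc.C ((s.sgnP - t.sgnP) * α / 2) * eP + RatFunc.C ((s.sgnM - t.sgnM) * β / 2) * eM := by
  simp only [omg, map_div₀, map_mul, map_sub]; ring

theorem reg_eM_one : Reg 1 eM := by
  rw [eM_eq]; exact (unitAt_X_sub (by norm_num)).inv.1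

theorem reg_eP_neg_one : Reg (-1) eP := by
  rw [eP_eq]; exact (unitAt_X_sub (by norm_num)).inv.1

theorem eq_zero_of_reg_pole {c A : ℝ} {r : RatFunc ℝ} (hr : Reg c r)
    (h : RatFunc.C A * (RatFunc.X - RatFunc.C c)⁻¹ = r) : A = 0 := by
  have hX := X_sub_ne_zero c
  have h1 : RatFunc.C A = r * (RatFunc.X - RatFunc.C c) := by rw [← h]; field_simp
  have h2 := congrArg (fun y => val y c) h1
  simpa [val_mul hr (reg_X_sub c c), val_X_sub] using h2

theorem isInt_of_ld_eq {A c : ℝ} {G r : RatFunc ℝ} (hG : G ≠ 0) (hr : Reg c r)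
    (h : RatFunc.C A * (RatFunc.X - RatFunc.C c)⁻¹ + r = ld G) : IsInt A := by
  obtain ⟨k, g, rfl, hg⟩ := exists_local c hG
  rw [ld_local hg.ne_zero] at h
  refine ⟨k, sub_eq_zero.1 (eq_zero_of_reg_pole (c := c) (r := ld g - r) (hg.ld.sub hr) ?_)⟩
  rw [map_sub, map_intCast]
  linear_combination h

theorem isInt_of_omega_eq_ld {A B : ℝ} {G : RatFunc ℝ} (hG : G ≠ 0)
    (h : RatFunc.C A * eP + RatFunc.C B * eM = ld G) : IsInt A ∧ IsInt B := by
  constructor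
  · exact isInt_of_ld_eq (c := 1) hG ((reg_C 1 B).mul reg_eM_one) (by rw [← eP_eq, h])
  · exact isInt_of_ld_eq (c := -1) hG ((reg_C (-1) A).mul reg_eP_neg_one)
      (by rw [← eM_eq, add_comm, h])

theorem isInt_neg {x : ℝ} (h : IsInt x) : IsInt (-x) := by
  obtain ⟨m, rfl⟩ := h; exact ⟨-m, by simp⟩

theorem isInt_neg_iff {x : ℝ} : IsInt (-x) ↔ IsInt x :=
  ⟨fun h => by simpa using isInt_neg h, isInt_neg⟩

/-- Different types would have residues differing by `±α` or `±β` at some end point, up to the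
integral residues of log-derivatives of rational functions. -/
theorem type_eq_of_eq {α β : ℝ} (hα : ¬ IsInt α) (hβ : ¬ IsInt β) {f g : RatFunc ℝ} {s t : AType}
    (hf : f ≠ 0) (hg : g ≠ 0) (h : ld f + omg s α β = ld g + omg t α β) : s = t := by
  have h1 : omg s α β - omg t α β = ld (g * f⁻¹) := by
    rw [ld_mul hg (inv_ne_zero hf), ld_inv hf]; linear_combination h
  rw [omg_sub] at h1
  obtain ⟨hA, hB⟩ := isInt_of_omega_eq_ld (mul_ne_zero hg (inv_ne_zero hf)) h1
  refine AType.ext_sgn ?_ ?_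
  · rcases s.sgnP_eq with h1 | h1 <;> rcases t.sgnP_eq with h2 | h2 <;> rw [h1, h2] at hA ⊢ <;>
      push_cast at hA <;> exfalso <;> apply hα
    · convert hA using 1; ring
    · rw [← isInt_neg_iff]; convert hA using 1; ring
  · rcases s.sgnM_eq with h1 | h1 <;> rcases t.sgnM_eq with h2 | h2 <;> rw [h1, h2] at hB ⊢ <;>
      push_cast at hB <;> exfalso <;> apply hβ
    · convert hB using 1; ring
    · rw [← isInt_neg_iff]; convert hB using 1; ring

/-- Two different Riccati solutions for the same eigenvalue have opposite types. -/
theorem type_eq_opp_of_ne {α β E : ℝ} {u : RatFunc ℝ} (hα : ¬ IsInt α) (hβ : ¬ IsInt β)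
    {f g : RatFunc ℝ} {s t : AType} (hf : Eig u α β s E f) (hg : Eig u α β t E g)
    (h : ld f + omg s α β ≠ ld g + omg t α β) : s = t.opp := by
  have h1 := hf.2.ld_sub hg.2 h
  have hs := sub_ne_zero.2 h
  set w := ld f + omg s α β - (ld g + omg t α β) with hw
  -- The quantity `p y₁ y₂ (w₁ - w₂)` is constant, so the sum of the two singular parts is the
  -- log-derivative of a rational function. Equal signs at an end point would make `α` or `β` an
  -- integer.
  have h2 : RatFunc.C ((s.sgnP + t.sgnP) * α / 2) * eP + RatFunc.C ((s.sgnM + t.sgnM) * β / 2) * eM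
      = ld (w * f * g * (RatFunc.X - 1) * (RatFunc.X + 1))⁻¹ := by
    rw [ld_inv, ld_mul, ld_mul, ld_mul, ld_mul, h1, ld_X_sub_one, ld_X_add_one, hX_eq, omg, omg,
      sub_self, map_zero]
    · simp only [map_div₀, map_mul, map_add]
      ring
    all_goals
      simp only [ne_eq, mul_eq_zero, hs, hf.1, hg.1, X_sub_one_ne_zero, X_add_one_ne_zero, or_self,
        not_false_eq_true]
  obtain ⟨hA, hB⟩ := isInt_of_omega_eq_ld (inv_ne_zero (mul_ne_zero (mul_ne_zero (mul_ne_zero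
    (mul_ne_zero hs hf.1) hg.1) X_sub_one_ne_zero) X_add_one_ne_zero)) h2
  refine AType.ext_sgn ?_ ?_
  · rw [AType.sgnP_opp]
    rcases s.sgnP_eq with h1 | h1 <;> rcases t.sgnP_eq with h2 | h2 <;> rw [h1, h2] at hA ⊢ <;>
      push_cast at hA <;> first | (norm_num; done) | (exfalso; apply hα)
    · convert hA using 1; ring
    · rw [← isInt_neg_iff]; convert hA using 1; ring
  · rw [AType.sgnM_opp]
    rcases s.sgnM_eq with h1 | h1 <;> rcases t.sgnM_eq with h2 | h2 <;> rw [h1, h2] at hB ⊢ <;>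
      push_cast at hB <;> first | (norm_num; done) | (exfalso; apply hβ)
    · convert hB using 1; ring
    · rw [← isInt_neg_iff]; convert hB using 1; ring

/-- Distinct log-derivatives at one eigenvalue would have opposite types. Type and eigenvalue thus
determine an eigenfunction up to a scalar. -/
theorem Eig.ld_eq {α β E : ℝ} {u : RatFunc ℝ} (hα : ¬ IsInt α) (hβ : ¬ IsInt β)
    {f g : RatFunc ℝ} {t : AType} (hf : Eig u α β t E f) (hg : Eig u α β t E g) : ld f = ld g := by
  by_contra h
  exact t.opp_ne (type_eq_opp_of_ne hα hβ hf hg fun h' => h (by linear_combination h')).symm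

/-- The regular part of an eigenfunction has neither zeros nor poles at `±1`. -/
theorem Eig.unitAt {α β E : ℝ} {u : RatFunc ℝ} (hα : ¬ IsInt α) (hβ : ¬ IsInt β)
    {f : RatFunc ℝ} {t : AType} (hf : Eig u α β t E f) (hu1 : Reg 1 u) (hu2 : Reg (-1) u) :
    UnitAt 1 f ∧ UnitAt (-1) f := by
  obtain ⟨h0, h⟩ := hf
  rw [SRV] at h
  constructor
  · obtain ⟨k, g, hfg, hg⟩ := exists_local 1 h0
    have hl : ld f = k * (RatFunc.X - RatFunc.C 1)⁻¹ + ld g := by rw [hfg, ld_local hg.ne_zero]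
    have hsq := residue_sq (c := 1) (γ := α) (K := k + t.sgnP * α / 2)
      (r := ld g + RatFunc.C (t.sgnM * β / 2) * eM)
      (R := 2 * pJ * ratDeriv u + 2 * RatFunc.X * u + RatFunc.C (β ^ 2 / 2) * eM - RatFunc.C E)
      (w := ld f + omg t α β) (by norm_num) (hg.ld.add ((reg_C _ _).mul reg_eM_one)) ?_ ?_ ?_
    · refine unitAt_of_zpow hg hfg ?_
      -- Indicial equation: the residue `k ± α/2` has square `(α/2)²`, and `k = ∓α` is impossible
      -- for an integer `k`.
      have h3 : (k : ℝ) * (k + t.sgnP * α) = 0 := by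
        have : (t.sgnP : ℝ) ^ 2 = 1 := by exact_mod_cast t.sgnP_sq
        linear_combination hsq - α ^ 2 / 4 * this
      rcases mul_eq_zero.1 h3 with h4 | h4
      · exact_mod_cast h4
      · exfalso; apply hα
        rcases t.sgnP_eq with h5 | h5 <;> rw [h5] at h4 <;> push_cast at h4
        · exact ⟨-k, by push_cast; linarith⟩
        · exact ⟨k, by linarith⟩
    · have hp : Reg 1 pJ := ((reg_X 1).pow 2).sub (reg_one 1)
      exact ((((((reg_two 1).mul hp).mul hu1.ratDeriv).add (((reg_two 1).mul (reg_X 1)).mul hu1)).add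
        ((reg_C _ _).mul reg_eM_one))).sub (reg_C _ _)
    · rw [hl, omg, eP_eq, map_add, map_intCast]; ring
    · rw [← eP_eq, one_mul]
      rw [potV] at h
      linear_combination h
  · obtain ⟨k, g, hfg, hg⟩ := exists_local (-1) h0
    have hl : ld f = k * (RatFunc.X - RatFunc.C (-1))⁻¹ + ld g := by rw [hfg, ld_local hg.ne_zero]
    have hsq := residue_sq (c := -1) (γ := β) (K := k + t.sgnM * β / 2)
      (r := ld g + RatFunc.C (t.sgnP * α / 2) * eP)
      (R := 2 * pJ * ratDeriv u + 2 * RatFunc.X * u - RatFunc.C (α ^ 2 / 2) * eP - RatFunc.C E)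
      (w := ld f + omg t α β) (by norm_num) (hg.ld.add ((reg_C _ _).mul reg_eP_neg_one)) ?_ ?_ ?_
    · refine unitAt_of_zpow hg hfg ?_
      have h3 : (k : ℝ) * (k + t.sgnM * β) = 0 := by
        have : (t.sgnM : ℝ) ^ 2 = 1 := by exact_mod_cast t.sgnM_sq
        linear_combination hsq - β ^ 2 / 4 * this
      rcases mul_eq_zero.1 h3 with h4 | h4
      · exact_mod_cast h4
      · exfalso; apply hβ
        rcases t.sgnM_eq with h5 | h5 <;> rw [h5] at h4 <;> push_cast at h4
        · exact ⟨-k, by push_cast; linarith⟩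
        · exact ⟨k, by linarith⟩
    · have hp : Reg (-1) pJ := ((reg_X _).pow 2).sub (reg_one _)
      exact ((((((reg_two _).mul hp).mul hu2.ratDeriv).add (((reg_two _).mul (reg_X _)).mul hu2)).sub
        ((reg_C _ _).mul reg_eP_neg_one))).sub (reg_C _ _)
    · rw [hl, omg, eM_eq, map_add, map_intCast]; ring
    · rw [← eM_eq, show (-1 : ℝ) * β ^ 2 / 2 = -(β ^ 2 / 2) by ring, map_neg]
      rw [potV] at h
      linear_combination h

/-! ### Degrees -/

/-- The degree of a type `t` function in the symmetric gauge, whose regular part has degree `d`. -/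
def zdeg (t : AType) (α β : ℝ) (d : ℝ) : ℝ := d + (t.sgnP * α + t.sgnM * β) / 2

theorem hasLead_eP : HasLead eP (-1) 1 := by
  have := hasLead_ld X_sub_one_ne_zero
  rw [ld_X_sub_one] at this
  have h : (RatFunc.X - 1 : RatFunc ℝ).intDegree = 1 := by
    have := hasLead_X.sub (hasLead_one.of_lt one_pos)
    simpa using this.intDegree_eq (by norm_num)
  rw [h] at this
  simpa using this

theorem hasLead_eM : HasLead eM (-1) 1 := by
  have := hasLead_ld X_add_one_ne_zero
  rw [ld_X_add_one] at this
  have h : (RatFunc.X + 1 : RatFunc ℝ).intDegree = 1 := by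
    have := hasLead_X.add (hasLead_one.of_lt one_pos)
    simpa using this.intDegree_eq (by norm_num)
  rw [h] at this
  simpa using this

theorem hasLead_pJ : HasLead pJ 2 1 := by
  have := (hasLead_X.pow 2).sub ((hasLead_one.of_lt (e := 2) (by norm_num)))
  simpa [pJ] using this

theorem hasLead_omg (t : AType) (α β : ℝ) :
    HasLead (omg t α β) (-1) ((t.sgnP * α + t.sgnM * β) / 2) := by
  have := (hasLead_eP.C_mul (t.sgnP * α / 2)).add (hasLead_eM.C_mul (t.sgnM * β / 2))
  rw [omg, add_div]
  simpa only [mul_one] using this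

theorem hasLead_w {f : RatFunc ℝ} (hf : f ≠ 0) (t : AType) (α β : ℝ) :
    HasLead (ld f + omg t α β) (-1) (zdeg t α β f.intDegree) :=
  (hasLead_ld hf).add (hasLead_omg t α β)

theorem hasLead_two : HasLead 2 0 2 := by
  have := hasLead_C 2
  rwa [map_ofNat] at this

/-- For `u ~ T/x` the constant terms `-2T` of `2p u'` and `2T` of `2x u` cancel, so the potential
does not affect the relation between eigenvalue and degree. -/
theorem hasLead_potV {u : RatFunc ℝ} {T : ℝ} (hu : HasLead u (-1) T) (α β : ℝ) :
    HasLead (potV u α β) 0 0 := by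
  have h1 := (hasLead_two.mul hasLead_pJ).mul hu.ratDeriv
  have h2 := (hasLead_two.mul hasLead_X).mul hu
  have h3 := (hasLead_eP.C_mul (α ^ 2 / 2)).of_lt (e := 0) (by norm_num)
  have h4 := (hasLead_eM.C_mul (β ^ 2 / 2)).of_lt (e := 0) (by norm_num)
  have h5 := ((h1.add h2).sub h3).add h4
  have h6 : (2 * 1 * (((-1 : ℤ) : ℝ) * T) + 2 * 1 * T - 0 + 0) = 0 := by push_cast; ring
  rw [h6] at h5
  exact h5

/-- The eigenvalue is determined by the degree. -/
theorem eigenvalue_of_hasLead {u w : RatFunc ℝ} {T α β E z : ℝ} (hu : HasLead u (-1) T)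
    (hw : HasLead w (-1) z) (h : SRV (potV u α β) E w) : E = z * (z + 1) := by
  rw [SRV] at h
  have h1 := hasLead_pJ.mul (hw.ratDeriv.add (hw.pow 2))
  have h2 := (hasLead_two.mul hasLead_X).mul hw
  have h3 := (h1.add h2).add (hasLead_potV hu α β)
  rw [h] at h3
  rw [(hasLead_C E).unique h3]
  push_cast
  ring

theorem Eig.eigenvalue {u f : RatFunc ℝ} {T α β E : ℝ} {t : AType} (hu : HasLead u (-1) T)
    (h : Eig u α β t E f) : E = zdeg t α β f.intDegree * (zdeg t α β f.intDegree + 1) :=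
  eigenvalue_of_hasLead hu (hasLead_w h.1 t α β) h.2

/-! ### Jacobi polynomials -/

/-- The rising factorial `(x)_n`. -/
def poch (n : ℕ) (x : ℝ) : ℝ := (ascPochhammer ℝ n).eval x

theorem poch_zero (x : ℝ) : poch 0 x = 1 := by simp [poch]

theorem poch_succ (n : ℕ) (x : ℝ) : poch (n + 1) x = poch n x * (x + n) := by
  simp [poch, ascPochhammer_succ_eval]

theorem poch_ne_zero {n : ℕ} {x : ℝ} (h : ∀ k < n, x + k ≠ 0) : poch n x ≠ 0 := by
  induction n with
  | zero => simp [poch_zero]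
  | succ n ih =>
    rw [poch_succ]
    exact mul_ne_zero (ih fun k hk => h k (by omega)) (h n (by omega))

theorem choose_succ_mul (r : ℝ) (k : ℕ) :
    ((k : ℝ) + 1) * Ring.choose r (k + 1) = (r - k) * Ring.choose r k := by
  have h1 : (((k + 1).factorial : ℕ) : ℝ) ≠ 0 := by exact_mod_cast Nat.factorial_ne_zero _
  have h0 : ((k.factorial : ℕ) : ℝ) ≠ 0 := by exact_mod_cast Nat.factorial_ne_zero _
  rw [Ring.choose_eq_smul, Ring.choose_eq_smul, descPochhammer_succ_right, smeval_mul, smeval_sub,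
    smeval_X, smeval_natCast, Nat.factorial_succ]
  simp only [pow_one, pow_zero, smul_eq_mul, nsmul_eq_mul, mul_one]
  push_cast
  have : (k : ℝ) + 1 ≠ 0 := by positivity
  field_simp

theorem choose_eq_poch (r : ℝ) (n : ℕ) : Ring.choose r n = poch n (r - n + 1) / n.factorial := by
  rw [Ring.choose_eq_smul, Polynomial.descPochhammer_smeval_eq_ascPochhammer,
    Polynomial.ascPochhammer_smeval_cast, Polynomial.ascPochhammer_smeval_eq_eval, poch, smul_eq_mul,
    div_eq_inv_mul]

/-- The ratio of neighbouring coefficients in the basis `(x-1)^k (x+1)^(n-k)`; it moves the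
off-diagonal terms of `jacobi_op_monomial` onto the diagonal. -/
theorem jacobi_coeff_up (n : ℕ) (a b : ℝ) {k : ℕ} (hk : k < n) :
    ((k : ℝ) + 1) * (k + 1 + a) * (Ring.choose ((n : ℝ) + a) (n - (k + 1)) *
        Ring.choose ((n : ℝ) + b) (k + 1)) =
      ((n : ℝ) - k) * (n - k + b) * (Ring.choose ((n : ℝ) + a) (n - k) *
        Ring.choose ((n : ℝ) + b) k) := by
  obtain ⟨m, rfl⟩ : ∃ m, n = k + 1 + m := ⟨n - (k + 1), by omega⟩
  have h1 := choose_succ_mul (((k + 1 + m : ℕ) : ℝ) + b) k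
  have h2 := choose_succ_mul (((k + 1 + m : ℕ) : ℝ) + a) m
  rw [show k + 1 + m - (k + 1) = m by omega, show k + 1 + m - k = m + 1 by omega]
  push_cast at *
  linear_combination (k + 1 + a) * (Ring.choose ((k : ℝ) + 1 + m + a) m) * h1 -
    (m + 1 + b) * Ring.choose ((k : ℝ) + 1 + m + b) k * h2

/-- The Jacobi differential operator on `(x-1)^k (x+1)^l`. -/
theorem jacobi_op_monomial (a b : ℝ) (k l : ℕ) :
    (X ^ 2 - 1 : ℝ[X]) * derivative (derivative ((X - 1) ^ k * (X + 1) ^ l)) +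
      (C (a + 1) * (X + 1) + C (b + 1) * (X - 1)) * derivative ((X - 1) ^ k * (X + 1) ^ l) =
    C ((k : ℝ) * (k + a)) * ((X - 1) ^ (k - 1) * (X + 1) ^ (l + 1)) +
    C (2 * k * l + (a + 1) * l + (b + 1) * k) * ((X - 1) ^ k * (X + 1) ^ l) +
    C ((l : ℝ) * (l + b)) * ((X - 1) ^ (k + 1) * (X + 1) ^ (l - 1)) := by
  have d1 : derivative (X - 1 : ℝ[X]) = 1 := by simp
  have d2 : derivative (X + 1 : ℝ[X]) = 1 := by simp
  rcases k with _ | _ | k <;> rcases l with _ | _ | l <;>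
    simp only [pow_zero, mul_one, one_mul, derivative_mul, derivative_pow, d1, d2, zero_add, pow_one,
      derivative_one, mul_zero, zero_mul, add_zero, Nat.add_sub_cancel,
      derivative_natCast, Nat.cast_zero, Nat.cast_one, map_zero, map_one, Nat.cast_add, map_add, map_mul,
      map_natCast, map_ofNat] <;>
    ring

/-- On the basis `(x-1)^k (x+1)^(n-k)` the operator is tridiagonal. After a shift of the index in
the two outer sums every term carries the eigenvalue `n (n + a + b + 1)`. -/
theorem jacobiP_ode (n : ℕ) (a b : ℝ) :
    (X ^ 2 - 1 : ℝ[X]) * derivative (derivative (jacobiP n a b)) +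
      (C (a + 1) * (X + 1) + C (b + 1) * (X - 1)) * derivative (jacobiP n a b) =
    C ((n : ℝ) * (n + a + b + 1)) * jacobiP n a b := by
  set c : ℕ → ℝ := fun k => Ring.choose ((n : ℝ) + a) (n - k) * Ring.choose ((n : ℝ) + b) k with hc
  set S : ℝ[X] := ∑ k ∈ Finset.range (n + 1), C (c k) * ((X - 1) ^ k * (X + 1) ^ (n - k)) with hS
  have hP : jacobiP n a b = C ((2 : ℝ)⁻¹ ^ n) * S := by
    rw [jacobiP, hS]; simp only [hc, mul_assoc]
  suffices h : (X ^ 2 - 1 : ℝ[X]) * derivative (derivative S) +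
      (C (a + 1) * (X + 1) + C (b + 1) * (X - 1)) * derivative S =
      C ((n : ℝ) * (n + a + b + 1)) * S by
    rw [hP, derivative_C_mul, derivative_C_mul]
    linear_combination C ((2 : ℝ)⁻¹ ^ n) * h
  have h1 : (X ^ 2 - 1 : ℝ[X]) * derivative (derivative S) +
      (C (a + 1) * (X + 1) + C (b + 1) * (X - 1)) * derivative S =
      ∑ k ∈ Finset.range (n + 1), C (c k) * (
        C ((k : ℝ) * (k + a)) * ((X - 1) ^ (k - 1) * (X + 1) ^ (n - k + 1)) +
        C (2 * k * ((n - k : ℕ) : ℝ) + (a + 1) * ((n - k : ℕ) : ℝ) + (b + 1) * k) *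
          ((X - 1) ^ k * (X + 1) ^ (n - k)) +
        C (((n - k : ℕ) : ℝ) * (((n - k : ℕ) : ℝ) + b)) *
          ((X - 1) ^ (k + 1) * (X + 1) ^ (n - k - 1))) := by
    rw [hS, derivative_sum, derivative_sum, Finset.mul_sum, Finset.mul_sum, ← Finset.sum_add_distrib]
    refine Finset.sum_congr rfl fun k _ => ?_
    rw [← jacobi_op_monomial, derivative_C_mul, derivative_C_mul]
    ring
  have h2 : ∑ k ∈ Finset.range (n + 1), C (c k) *
        (C ((k : ℝ) * (k + a)) * ((X - 1) ^ (k - 1) * (X + 1) ^ (n - k + 1))) =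
      ∑ k ∈ Finset.range (n + 1), C (((n : ℝ) - k) * (n - k + b) * c k) *
        ((X - 1 : ℝ[X]) ^ k * (X + 1) ^ (n - k)) := by
    rw [Finset.sum_range_succ', Finset.sum_range_succ]
    congr 1
    · refine Finset.sum_congr rfl fun k hk => ?_
      have hk' := Finset.mem_range.1 hk
      have := jacobi_coeff_up n a b hk'
      rw [hc]
      simp only
      rw [← this, show n - (k + 1) + 1 = n - k by omega, Nat.add_sub_cancel, ← mul_assoc, ← C_mul]
      congr 2
      push_cast
      ring
    · simp
  have h3 : ∑ k ∈ Finset.range (n + 1), C (c k) *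
        (C (((n - k : ℕ) : ℝ) * (((n - k : ℕ) : ℝ) + b)) *
          ((X - 1) ^ (k + 1) * (X + 1) ^ (n - k - 1))) =
      ∑ k ∈ Finset.range (n + 1), C ((k : ℝ) * (k + a) * c k) *
        ((X - 1 : ℝ[X]) ^ k * (X + 1) ^ (n - k)) := by
    rw [Finset.sum_range_succ, Finset.sum_range_succ' (fun k => C ((k : ℝ) * (k + a) * c k) *
        ((X - 1 : ℝ[X]) ^ k * (X + 1) ^ (n - k)))]
    congr 1
    · refine Finset.sum_congr rfl fun k hk => ?_
      have hk' := Finset.mem_range.1 hk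
      have := jacobi_coeff_up n a b hk'
      rw [hc]
      simp only
      rw [show (((k + 1 : ℕ) : ℝ)) = k + 1 by push_cast; ring, this,
        show n - k - 1 = n - (k + 1) by omega, ← mul_assoc, ← C_mul, Nat.cast_sub hk'.le]
      congr 2
      ring
    · simp
  rw [h1]
  simp only [mul_add (C (c _)), Finset.sum_add_distrib]
  rw [h2, h3, hS, Finset.mul_sum, ← Finset.sum_add_distrib, ← Finset.sum_add_distrib]
  refine Finset.sum_congr rfl fun k hk => ?_
  rw [← mul_assoc (C (c k)), ← mul_assoc (C (_ * _)) (C (c k)), ← C_mul, ← C_mul, ← add_mul,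
    ← add_mul, ← C_add, ← C_add, Nat.cast_sub (by simpa [Nat.lt_succ_iff] using hk)]
  congr 2
  ring

theorem jacobiP_eval_one (n : ℕ) (a b : ℝ) :
    (jacobiP n a b).eval 1 = poch n (a + 1) / n.factorial := by
  have h : (n : ℝ) + a - n + 1 = a + 1 := by ring
  rw [jacobiP, eval_C_mul, eval_finsetSum, Finset.sum_range_succ', Finset.sum_eq_zero]
  · simp only [eval_mul, eval_C, eval_pow, eval_X, eval_one, eval_add, pow_zero,
      Nat.sub_zero, Ring.choose_zero_right, mul_one, zero_add]
    rw [choose_eq_poch, h, show (1 : ℝ) + 1 = 2 by norm_num, mul_comm, mul_assoc, ← mul_pow]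
    norm_num
  · intro k _
    simp

/-- The coefficient of `x^n` in `P_n(x;a,b)`, where `c = a + b`. -/
def jlead (n : ℕ) (c : ℝ) : ℝ := 2⁻¹ ^ n * poch n (n + c + 1) / n.factorial

theorem jacobiP_natDegree_le (n : ℕ) (a b : ℝ) : (jacobiP n a b).natDegree ≤ n := by
  rw [jacobiP]
  refine (natDegree_C_mul_le _ _).trans (natDegree_sum_le_of_forall_le _ _ fun k hk => ?_)
  have hk' : k ≤ n := by simpa [Nat.lt_succ_iff] using hk
  rw [mul_assoc]
  refine (natDegree_C_mul_le _ _).trans (natDegree_mul_le.trans ?_)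
  have h1 := natDegree_pow_le (p := (X - 1 : ℝ[X])) (n := k)
  have h2 := natDegree_pow_le (p := (X + 1 : ℝ[X])) (n := n - k)
  have e1 : (X - 1 : ℝ[X]).natDegree = 1 := by simpa using natDegree_X_sub_C (1 : ℝ)
  have e2 : (X + 1 : ℝ[X]).natDegree = 1 := by simpa using natDegree_X_add_C (1 : ℝ)
  rw [e1] at h1
  rw [e2] at h2
  omega

/-- Each `(x-1)^k (x+1)^(n-k)` is monic of degree `n`; the resulting sum of products of binomials is
evaluated by Vandermonde's identity. -/
theorem jacobiP_coeff (n : ℕ) (a b : ℝ) : (jacobiP n a b).coeff n = jlead n (a + b) := by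
  have h0 : ∀ k ∈ Finset.range (n + 1), (C (Ring.choose ((n : ℝ) + a) (n - k) *
      Ring.choose ((n : ℝ) + b) k) * (X - 1 : ℝ[X]) ^ k * (X + 1) ^ (n - k)).coeff n =
      Ring.choose ((n : ℝ) + a) (n - k) * Ring.choose ((n : ℝ) + b) k := by
    intro k hk
    have hk' : k ≤ n := by simpa [Nat.lt_succ_iff] using hk
    have m1 : ((X - 1 : ℝ[X]) ^ k).Monic := by
      have : (X - 1 : ℝ[X]).Monic := by simpa using monic_X_sub_C (1 : ℝ)
      exact this.pow k
    have m2 : ((X + 1 : ℝ[X]) ^ (n - k)).Monic := by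
      have : (X + 1 : ℝ[X]).Monic := by simpa using monic_X_add_C (1 : ℝ)
      exact this.pow _
    have hd : ((X - 1 : ℝ[X]) ^ k * (X + 1) ^ (n - k)).natDegree = n := by
      have e1 : (X - 1 : ℝ[X]).natDegree = 1 := by simpa using natDegree_X_sub_C (1 : ℝ)
      have e2 : (X + 1 : ℝ[X]).natDegree = 1 := by simpa using natDegree_X_add_C (1 : ℝ)
      rw [m1.natDegree_mul m2, natDegree_pow, natDegree_pow, e1, e2]; omega
    have := (m1.mul m2).coeff_natDegree
    rw [hd] at this
    rw [mul_assoc, coeff_C_mul, this, mul_one]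
  rw [jacobiP, coeff_C_mul, finsetSum_coeff, Finset.sum_congr rfl h0, jlead,
    Finset.sum_range_reflect (fun k => Ring.choose ((n : ℝ) + a) (n - k) *
      Ring.choose ((n : ℝ) + b) k) (n + 1) |>.symm, mul_div_assoc]
  congr 1
  have h1 := Ring.add_choose_eq (r := (n : ℝ) + a) (s := (n : ℝ) + b) n (Commute.all _ _)
  rw [Finset.Nat.sum_antidiagonal_eq_sum_range_succ_mk] at h1
  rw [choose_eq_poch] at h1
  rw [show (n : ℝ) + (a + b) + 1 = n + a + (n + b) - n + 1 by ring, h1]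
  refine Finset.sum_congr rfl fun k hk => ?_
  have hk' : k ≤ n := by simpa [Nat.lt_succ_iff] using hk
  rw [show n - (n + 1 - 1 - k) = k by omega, show n + 1 - 1 - k = n - k by omega]

theorem hasLead_of_natDegree_le {P : ℝ[X]} {n : ℕ} (h : P.natDegree ≤ n) :
    HasLead (algebraMap ℝ[X] (RatFunc ℝ) P) n (P.coeff n) := by
  rcases h.eq_or_lt with rfl | h
  · exact hasLead_algebraMap P
  · rw [coeff_eq_zero_of_natDegree_lt h]
    exact (hasLead_algebraMap P).of_lt (by exact_mod_cast h)

/-- `P_n(x;a,b)` as a rational function. -/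
def jacobiF (n : ℕ) (a b : ℝ) : RatFunc ℝ := algebraMap ℝ[X] (RatFunc ℝ) (jacobiP n a b)

theorem hasLead_jacobiF (n : ℕ) (a b : ℝ) : HasLead (jacobiF n a b) n (jlead n (a + b)) := by
  rw [← jacobiP_coeff]; exact hasLead_of_natDegree_le (jacobiP_natDegree_le n a b)

theorem poch_ne_zero_of_not_isInt {x : ℝ} (hx : ¬ IsInt x) (n : ℕ) : poch n x ≠ 0 :=
  poch_ne_zero fun k _ h => hx ⟨-k, by push_cast; linarith⟩

theorem isInt_add_one {x : ℝ} : IsInt (x + 1) ↔ IsInt x :=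
  ⟨fun ⟨m, h⟩ => ⟨m - 1, by push_cast; linarith⟩, fun ⟨m, h⟩ => ⟨m + 1, by push_cast; linarith⟩⟩

theorem isInt_add_int {x : ℝ} (k : ℤ) : IsInt (x + k) ↔ IsInt x :=
  ⟨fun ⟨m, h⟩ => ⟨m - k, by push_cast; linarith⟩, fun ⟨m, h⟩ => ⟨m + k, by push_cast; linarith⟩⟩

theorem jacobiP_eval_one_ne_zero {a : ℝ} (ha : ¬ IsInt a) (n : ℕ) (b : ℝ) :
    (jacobiP n a b).eval 1 ≠ 0 := by
  rw [jacobiP_eval_one]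
  exact div_ne_zero (poch_ne_zero_of_not_isInt (isInt_add_one.not.2 ha) n)
    (by exact_mod_cast n.factorial_ne_zero)

theorem jacobiF_ne_zero {a : ℝ} (ha : ¬ IsInt a) (n : ℕ) (b : ℝ) : jacobiF n a b ≠ 0 := by
  refine RatFunc.algebraMap_ne_zero fun h => jacobiP_eval_one_ne_zero ha n b ?_
  rw [h]; simp

/-- The factors `n + c + 1 + k`, `0 ≤ k < n`, are at most `2n + c < 0` for a lower index; for an
upper index they are positive or not integral. So the degree of the Jacobi polynomial is exactly
`n`. -/
theorem jlead_ne_zero {n : ℕ} {c : ℝ} (h : n ∈ lowerIdx c ∪ upperIdx c) : jlead n c ≠ 0 := by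
  have hp : poch n (n + c + 1) ≠ 0 := by
    refine poch_ne_zero fun k hk h0 => ?_
    rcases h with ⟨_, h⟩ | h
    · have : (k : ℝ) + 1 ≤ n := by exact_mod_cast hk
      linarith
    · have hc : IsInt c := ⟨-(n + 1 + k : ℤ), by push_cast; linarith⟩
      have := h hc
      have h2 : (0 : ℝ) ≤ k := by positivity
      linarith
  have hf : (n.factorial : ℝ) ≠ 0 := by exact_mod_cast n.factorial_ne_zero
  rw [jlead]
  positivity

/-- The linear differential equation behind the Riccati equation for `τ = 1`. -/
theorem srv_zero_iff {a b E : ℝ} {t : AType} {w : RatFunc ℝ} :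
    SRV (potV 0 a b) E (w + omg t a b) ↔
      pJ * (ratDeriv w + w ^ 2) + (RatFunc.C (t.sgnP * a + 1) * (RatFunc.X + 1) +
        RatFunc.C (t.sgnM * b + 1) * (RatFunc.X - 1)) * w =
      RatFunc.C (E - (t.sgnP * a + t.sgnM * b) / 2 * ((t.sgnP * a + t.sgnM * b) / 2 + 1)) := by
  have hp := X_sub_one_ne_zero
  have hm := X_add_one_ne_zero
  rw [SRV, ratDeriv_add, ratDeriv_omg, ← sub_eq_zero, ← sub_eq_zero (b := RatFunc.C (_ - _))]
  refine Eq.congr ?_ rfl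
  have h1 : (t.sgnP : RatFunc ℝ) ^ 2 = 1 := by exact_mod_cast t.sgnP_sq
  have h2 : (t.sgnM : RatFunc ℝ) ^ 2 = 1 := by exact_mod_cast t.sgnM_sq
  simp only [potV, omg, pJ_eq, eP, eM, map_add, map_mul, map_sub,
    map_div₀, map_pow, map_one, map_ofNat, map_intCast, ratDeriv_zero]
  generalize (t.sgnP : RatFunc ℝ) = ε at *
  generalize (t.sgnM : RatFunc ℝ) = δ at *
  generalize (RatFunc.C a : RatFunc ℝ) = A at *
  generalize (RatFunc.C b : RatFunc ℝ) = B at *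
  field_simp
  linear_combination 2 * (RatFunc.X + 1) * A ^ 2 * h1 - 2 * (RatFunc.X - 1) * B ^ 2 * h2

theorem ratDeriv_ld_add_sq {f : RatFunc ℝ} (hf : f ≠ 0) :
    ratDeriv (ld f) + ld f ^ 2 = ratDeriv (ratDeriv f) / f := by
  rw [ld, ratDeriv_div hf]; field_simp; ring

theorem eig_jacobiF {a b : ℝ} (ha : ¬ IsInt a) (t : AType) (n : ℕ) :
    Eig 0 a b t (zdeg t a b n * (zdeg t a b n + 1)) (jacobiF n (t.sgnP * a) (t.sgnM * b)) := by
  have ha' : ¬ IsInt (t.sgnP * a) := by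
    rcases t.sgnP_eq with h | h <;> rw [h] <;> push_cast
    · simpa using ha
    · simpa [isInt_neg_iff] using ha
  have h0 := jacobiF_ne_zero ha' n (t.sgnM * b)
  refine ⟨h0, srv_zero_iff.2 ?_⟩
  rw [ratDeriv_ld_add_sq h0, ld]
  have h1 := congrArg (algebraMap ℝ[X] (RatFunc ℝ)) (jacobiP_ode n (t.sgnP * a) (t.sgnM * b))
  simp only [map_add, map_mul, map_sub, map_pow, map_one, RatFunc.algebraMap_X,
    RatFunc.algebraMap_C, ← ratDeriv_algebraMap] at h1
  change pJ * ratDeriv (ratDeriv (jacobiF n (t.sgnP * a) (t.sgnM * b))) + _ = _ *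
    jacobiF n (t.sgnP * a) (t.sgnM * b) at h1
  have h2 : zdeg t a b n * (zdeg t a b n + 1) - (t.sgnP * a + t.sgnM * b) / 2 *
      ((t.sgnP * a + t.sgnM * b) / 2 + 1) = n * (n + t.sgnP * a + t.sgnM * b + 1) := by
    rw [zdeg]; ring
  rw [h2]
  simp only [map_add, map_mul, map_one]
  rw [← jacobiF] at h1
  field_simp
  linear_combination h1

/-! ### Quasi-rational eigenfunctions of the classical operator -/

theorem exists_sub_val {c : ℝ} {g : RatFunc ℝ} (hg : Reg c g) :
    ∃ g₁, Reg c g₁ ∧ g = RatFunc.C (val g c) + (RatFunc.X - RatFunc.C c) * g₁ := by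
  by_cases h0 : g - RatFunc.C (val g c) = 0
  · exact ⟨0, reg_zero c, by linear_combination h0⟩
  obtain ⟨k, h, hk, hh⟩ := exists_local c h0
  have hr : Reg c (g - RatFunc.C (val g c)) := hg.sub (reg_C _ _)
  have hv : val (g - RatFunc.C (val g c)) c = 0 := by rw [val_sub hg (reg_C _ _)]; simp
  have hk0 : 0 ≤ k := nonneg_of_reg hh (hk ▸ hr)
  obtain ⟨m, rfl⟩ := Int.eq_ofNat_of_zero_le hk0
  rcases m with _ | m
  · rw [hk] at hv; simp only [Nat.cast_zero, zpow_zero, one_mul] at hv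
    exact absurd hv hh.2
  · refine ⟨(RatFunc.X - RatFunc.C c) ^ m * h, ((reg_X_sub c c).pow m).mul hh.1, ?_⟩
    rw [zpow_natCast, pow_succ] at hk
    linear_combination hk

/-- Riccati solutions have at most simple poles at the end points. -/
theorem SRV.simple_pole {c E : ℝ} (hc : c ^ 2 = 1) {V w : RatFunc ℝ}
    (hV : Reg c ((RatFunc.X - RatFunc.C c) * V)) (h : SRV V E w) :
    ∃ K r, Reg c r ∧ w = RatFunc.C K * (RatFunc.X - RatFunc.C c)⁻¹ + r := by
  by_cases h0 : w = 0
  · exact ⟨0, 0, reg_zero c, by simp [h0]⟩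
  have hX := X_sub_ne_zero c
  obtain ⟨k, g, hk, hg⟩ := exists_local c h0
  rcases le_or_gt 0 k with hk0 | hk0
  · obtain ⟨m, rfl⟩ := Int.eq_ofNat_of_zero_le hk0
    refine ⟨0, w, ?_, by simp⟩
    rw [hk, zpow_natCast]
    exact ((reg_X_sub c c).pow m).mul hg.1
  obtain ⟨m, rfl⟩ : ∃ m : ℕ, k = -((m + 1 : ℕ) : ℤ) := ⟨(-k - 1).toNat, by omega⟩
  rw [zpow_neg, zpow_natCast] at hk
  rcases m with _ | m
  · obtain ⟨g₁, hg₁, he⟩ := exists_sub_val hg.1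
    refine ⟨val g c, g₁, hg₁, ?_⟩
    rw [hk, zero_add, pow_one]
    conv_lhs => rw [he]
    field_simp
  exfalso
  have hp : pJ = (RatFunc.X - RatFunc.C c) * (RatFunc.X + RatFunc.C c) := by
    have : RatFunc.C c ^ 2 = 1 := by rw [← map_pow, hc, map_one]
    rw [pJ]; linear_combination this
  have hdw : ratDeriv w = ratDeriv g / (RatFunc.X - RatFunc.C c) ^ (m + 2) -
      ((m : RatFunc ℝ) + 2) * g / (RatFunc.X - RatFunc.C c) ^ (m + 3) := by
    rw [ratDeriv_eq_ld_mul h0, hk, ld_mul (inv_ne_zero (pow_ne_zero _ hX)) hg.ne_zero,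
      ld_inv (pow_ne_zero _ hX), ld_pow, ld_X_sub, ld]
    have := hg.ne_zero
    push_cast
    field_simp
    ring
  rw [SRV, hdw, hp] at h
  set s := RatFunc.X - RatFunc.C c with hs
  -- If the pole had order `m + 2`, multiplication of the equation by `(x-c)^(2m+3)` would leave `(x
  -- + c) g²` plus terms vanishing at `c`, so that `2c g(c)² = 0`.
  set G := s * (s ^ m * ((RatFunc.X + RatFunc.C c) * (s * ratDeriv g - ((m : RatFunc ℝ) + 2) * g) +
      2 * RatFunc.X * g) + s ^ (2 * m + 1) * (s * V - s * RatFunc.C E)) with hG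
  have hXc : Reg c (RatFunc.X + RatFunc.C c) := (reg_X c).add (reg_C c c)
  have hsr : Reg c s := reg_X_sub c c
  have hm2 : Reg c ((m : RatFunc ℝ) + 2) := by
    have := reg_intCast c (m + 2); push_cast at this; exact this
  have hin : Reg c (s ^ m * ((RatFunc.X + RatFunc.C c) * (s * ratDeriv g - ((m : RatFunc ℝ) + 2) * g) +
      2 * RatFunc.X * g) + s ^ (2 * m + 1) * (s * V - s * RatFunc.C E)) :=
    ((hsr.pow m).mul ((hXc.mul ((hsr.mul hg.1.ratDeriv).sub (hm2.mul hg.1))).add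
      (((reg_two c).mul (reg_X c)).mul hg.1))).add ((hsr.pow _).mul (hV.sub (hsr.mul (reg_C _ _))))
  have h1 : (RatFunc.X + RatFunc.C c) * g ^ 2 + G = 0 := by
    have h2 := congrArg (fun y => s ^ (2 * m + 3) * y) h
    rw [← sub_eq_zero] at h2
    rw [← h2, hk, hG]
    field_simp
    ring
  have h2 := congrArg (fun y => val y c) h1
  simp only [val_zero] at h2
  rw [val_add (hXc.mul (hg.1.pow 2)) (hsr.mul hin), val_mul hXc (hg.1.pow 2), val_pow hg.1,
    val_mul hsr hin, hs, val_X_sub, sub_self, zero_mul, add_zero, val_add (reg_X c) (reg_C c c),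
    val_X, val_C] at h2
  have hc0 : c ≠ 0 := by rintro rfl; norm_num at hc
  rcases mul_eq_zero.1 h2 with h3 | h3
  · exact hc0 (by linarith)
  · exact hg.2 (pow_eq_zero_iff (by norm_num) |>.1 h3)

/-- A Riccati solution without poles at `±1` for the classical operator is the logarithmic
derivative of a polynomial. -/
theorem eq_ld_of_reg {A B lam : ℝ} {w : RatFunc ℝ} (h1 : Reg 1 w) (h2 : Reg (-1) w)
    (h : pJ * (ratDeriv w + w ^ 2) + (RatFunc.C (A + 1) * (RatFunc.X + 1) +
      RatFunc.C (B + 1) * (RatFunc.X - 1)) * w = RatFunc.C lam) :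
    ∃ P : ℝ[X], P ≠ 0 ∧ w = ld (algebraMap ℝ[X] (RatFunc ℝ) P) := by
  set N := w.num with hN
  set D := w.denom with hD
  have hD0 : D ≠ 0 := w.denom_ne_zero
  have hD' := RatFunc.algebraMap_ne_zero hD0
  have hw : w = algebraMap ℝ[X] (RatFunc ℝ) N / algebraMap ℝ[X] (RatFunc ℝ) D :=
    (RatFunc.num_div_denom w).symm
  have hdw : ratDeriv w = algebraMap ℝ[X] (RatFunc ℝ) (derivative N * D - N * derivative D) /
    algebraMap ℝ[X] (RatFunc ℝ) (D ^ 2) := rfl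
  have hpoly : (X ^ 2 - 1) * (derivative N * D - N * derivative D + N ^ 2) +
      (C (A + 1) * (X + 1) + C (B + 1) * (X - 1)) * (N * D) = C lam * D ^ 2 := by
    apply RatFunc.algebraMap_injective (K := ℝ)
    rw [hdw, hw] at h
    simp only [map_add, map_mul, map_sub, map_pow, map_one, RatFunc.algebraMap_X,
      RatFunc.algebraMap_C, pJ] at h ⊢
    field_simp at h
    linear_combination h
  have hcop : IsCoprime D N := (RatFunc.isCoprime_num_denom w).symm
  have c1 : IsCoprime D (X - C 1) :=
    ((prime_X_sub_C (1 : ℝ)).irreducible.coprime_iff_not_dvd.2 fun h => h1 (dvd_iff_isRoot.1 h)).symm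
  have c2 : IsCoprime D (X - C (-1)) :=
    ((prime_X_sub_C (-1 : ℝ)).irreducible.coprime_iff_not_dvd.2
      fun h => h2 (dvd_iff_isRoot.1 h)).symm
  -- Clearing denominators gives `D ∣ p N (N - D')`. As `D` is coprime to `p` and `N`, it divides `N
  -- - D'`, so `w = D'/D + R` with a polynomial `R`.
  have hdvd : D ∣ ((X - C 1) * (X - C (-1)) * N) * (N - derivative D) := by
    refine ⟨C lam * D - (C (A + 1) * (X + 1) + C (B + 1) * (X - 1)) * N -
      (X ^ 2 - 1) * derivative N, ?_⟩
    rw [map_one, map_neg, map_one]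
    linear_combination hpoly
  obtain ⟨R, hR⟩ := ((c1.mul_right c2).mul_right hcop).dvd_of_dvd_mul_left hdvd
  refine ⟨D, hD0, ?_⟩
  have hwR : w = ld (algebraMap ℝ[X] (RatFunc ℝ) D) + algebraMap ℝ[X] (RatFunc ℝ) R := by
    have : N = derivative D + D * R := by linear_combination hR
    rw [hw, this, ld, ratDeriv_algebraMap, map_add, map_mul]
    field_simp
  by_cases hR0 : R = 0
  · rw [hwR, hR0, map_zero, add_zero]
  exfalso
  have hl : HasLead w R.natDegree R.leadingCoeff := by
    have := ((hasLead_ld hD').of_lt (e := R.natDegree) (by omega)).add (hasLead_algebraMap R)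
    rwa [zero_add, ← hwR] at this
  -- If `R ≠ 0`, the term `p w²` has degree `2 + 2r`, more than every other term of the equation.
  set r : ℤ := (R.natDegree : ℤ) with hr
  have hr0 : 0 ≤ r := by positivity
  have t1 := (hasLead_pJ.mul hl.ratDeriv).of_lt (e := 2 + 2 * r) (by omega)
  have t2 := hasLead_pJ.mul (hl.pow 2)
  have q1 := ((hasLead_X.add (hasLead_one.of_lt one_pos)).C_mul (A + 1)).add
    ((hasLead_X.sub (hasLead_one.of_lt one_pos)).C_mul (B + 1))
  have t3 := (q1.mul hl).of_lt (e := 2 + 2 * r) (by omega)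
  have t4 := (hasLead_C lam).of_lt (e := 2 + 2 * r) (by omega)
  have t5 := (t1.add t2).add t3
  rw [← mul_add, h] at t5
  have := t5.unique t4
  have hlc : R.leadingCoeff ≠ 0 := leadingCoeff_ne_zero.2 hR0
  simp at this
  exact hR0 this

theorem exists_type {K L a b : ℝ} (h1 : K ^ 2 = (a / 2) ^ 2) (h2 : L ^ 2 = (b / 2) ^ 2) :
    ∃ t : AType, K = t.sgnP * a / 2 ∧ L = t.sgnM * b / 2 := by
  rcases sq_eq_sq_iff_eq_or_eq_neg.1 h1 with h1 | h1 <;>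
    rcases sq_eq_sq_iff_eq_or_eq_neg.1 h2 with h2 | h2
  · exact ⟨.one, by simp [AType.sgnP, h1], by simp [AType.sgnM, h2]⟩
  · exact ⟨.four, by simp [AType.sgnP, h1], by simp [AType.sgnM, h2, neg_div]⟩
  · exact ⟨.three, by simp [AType.sgnP, h1, neg_div], by simp [AType.sgnM, h2]⟩
  · exact ⟨.two, by simp [AType.sgnP, h1, neg_div], by simp [AType.sgnM, h2, neg_div]⟩

/-- By the indicial equation the residues at `±1` are `±a/2` and `±b/2`, which singles out a type.
Without its singular part the log-derivative is regular at `±1` and belongs to a polynomial. -/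
theorem exists_eig_of_srv_zero {a b E : ℝ} {w : RatFunc ℝ} (h : SRV (potV 0 a b) E w) :
    ∃ (t : AType) (P : ℝ[X]), Eig 0 a b t E (algebraMap ℝ[X] (RatFunc ℝ) P) ∧
      w = ld (algebraMap ℝ[X] (RatFunc ℝ) P) + omg t a b := by
  have hV : potV 0 a b = - RatFunc.C (a ^ 2 / 2) * eP + RatFunc.C (b ^ 2 / 2) * eM := by
    rw [potV]; simp
  have hp := X_sub_one_ne_zero
  have hm := X_add_one_ne_zero
  obtain ⟨K, r, hr, hw1⟩ := h.simple_pole (c := 1) (by norm_num) (by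
    have : (RatFunc.X - RatFunc.C 1) * potV 0 a b = - RatFunc.C (a ^ 2 / 2) +
        RatFunc.C (b ^ 2 / 2) * (RatFunc.X - RatFunc.C 1) * eM := by
      rw [hV, map_one, eP]; field_simp
    rw [this]
    exact (reg_C _ _).neg.add (((reg_C _ _).mul (reg_X_sub _ _)).mul reg_eM_one))
  obtain ⟨L, r', hr', hw2⟩ := h.simple_pole (c := -1) (by norm_num) (by
    have : (RatFunc.X - RatFunc.C (-1)) * potV 0 a b = RatFunc.C (b ^ 2 / 2) -
        RatFunc.C (a ^ 2 / 2) * (RatFunc.X - RatFunc.C (-1)) * eP := by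
      rw [hV, map_neg, map_one, sub_neg_eq_add, eM]; field_simp; ring
    rw [this]
    exact (reg_C _ _).sub (((reg_C _ _).mul (reg_X_sub _ _)).mul reg_eP_neg_one))
  have h' := h
  rw [SRV, hV] at h'
  have hK := residue_sq (c := 1) (γ := a) (R := RatFunc.C (b ^ 2 / 2) * eM - RatFunc.C E)
    (by norm_num) hr (((reg_C _ _).mul reg_eM_one).sub (reg_C _ _)) hw1 (by
      rw [← eP_eq, one_mul]; linear_combination h')
  have hL := residue_sq (c := -1) (γ := b) (R := - RatFunc.C (a ^ 2 / 2) * eP - RatFunc.C E)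
    (by norm_num) hr' (((reg_C _ _).neg.mul reg_eP_neg_one).sub (reg_C _ _)) hw2 (by
      rw [← eM_eq, show (-1 : ℝ) * b ^ 2 / 2 = -(b ^ 2 / 2) by ring, map_neg]
      linear_combination h')
  obtain ⟨t, ht1, ht2⟩ := exists_type hK hL
  have hv : w = (w - omg t a b) + omg t a b := by ring
  have h1 : Reg 1 (w - omg t a b) := by
    have : w - omg t a b = r - RatFunc.C L * eM := by
      rw [hw1, ht1, ht2, omg, eP_eq]; ring
    rw [this]
    exact hr.sub ((reg_C _ _).mul reg_eM_one)
  have h2 : Reg (-1) (w - omg t a b) := by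
    have : w - omg t a b = r' - RatFunc.C K * eP := by
      rw [hw2, ht1, ht2, omg, eM_eq]; ring
    rw [this]
    exact hr'.sub ((reg_C _ _).mul reg_eP_neg_one)
  rw [hv, srv_zero_iff] at h
  obtain ⟨P, hP, hPw⟩ := eq_ld_of_reg h1 h2 h
  have hv' : w = ld (algebraMap ℝ[X] (RatFunc ℝ) P) + omg t a b := by linear_combination hPw
  refine ⟨t, P, ⟨RatFunc.algebraMap_ne_zero hP, ?_⟩, hv'⟩
  rw [← hPw]
  exact srv_zero_iff.2 h

/-- The parameter `c_ι = ± a ± b`. -/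
def cT (t : AType) (a b : ℝ) : ℝ := t.sgnP * a + t.sgnM * b

theorem zdeg_eq (t : AType) (a b d : ℝ) : zdeg t a b d = d + cT t a b / 2 := rfl

theorem not_isInt_sgnP {a : ℝ} (ha : ¬ IsInt a) (t : AType) : ¬ IsInt (t.sgnP * a) := by
  rcases t.sgnP_eq with h | h <;> rw [h] <;> push_cast
  · simpa using ha
  · simpa [isInt_neg_iff] using ha

theorem not_isInt_sgnM {a : ℝ} (ha : ¬ IsInt a) (t : AType) : ¬ IsInt (t.sgnM * a) := by
  rcases t.sgnM_eq with h | h <;> rw [h] <;> push_cast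
  · simpa using ha
  · simpa [isInt_neg_iff] using ha

theorem intDegree_jacobiF {a b : ℝ} {n : ℕ} (h : n ∈ lowerIdx (a + b) ∪ upperIdx (a + b)) :
    (jacobiF n a b).intDegree = n :=
  (hasLead_jacobiF n a b).intDegree_eq (jlead_ne_zero h)

theorem hasLead_zero_fun : HasLead 0 (-1) 0 := hasLead_zero _

/-- The indices of the classical quasi-rational eigenfunctions. -/
theorem exists_eig_zero_iff {a b : ℝ} (ha : ¬ IsInt a) (hb : ¬ IsInt b) (t : AType) (n : ℤ) :
    (∃ E f, Eig 0 a b t E f ∧ f.intDegree = n) ↔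
      ∃ m : ℕ, n = m ∧ m ∈ lowerIdx (cT t a b) ∪ upperIdx (cT t a b) := by
  constructor
  · rintro ⟨E, f, hf, hn⟩
    obtain ⟨t', P, hP, hw⟩ := exists_eig_of_srv_zero hf.2
    obtain rfl := type_eq_of_eq ha hb hf.1 hP.1 hw
    have hl : ld f = ld (algebraMap ℝ[X] (RatFunc ℝ) P) := by linear_combination hw
    obtain ⟨c, hc, hfc⟩ := eq_C_mul_of_ld_eq hf.1 hP.1 hl
    have hn' : n = P.natDegree := by
      rw [← hn, hfc, RatFunc.intDegree_mul (by simpa using hc) hP.1]; simp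
    refine ⟨P.natDegree, hn', ?_⟩
    by_contra hno
    rw [mem_union, not_or] at hno
    obtain ⟨hlo, hup⟩ := hno
    set m := P.natDegree
    simp only [lowerIdx, upperIdx, mem_ofPred_eq, not_and, not_lt, not_forall, exists_prop,
      not_le] at hlo hup
    obtain ⟨⟨c', hc'⟩, h3⟩ := hup
    have h4 := hlo ⟨c', hc'⟩
    rw [hc'] at h3 h4
    have h3' : (m : ℤ) + c' + 1 < 1 := by exact_mod_cast h3
    have h4' : 0 ≤ 2 * (m : ℤ) + c' := by exact_mod_cast h4
    -- An index in neither part has the same eigenvalue as its mirror image `-m-1-c'`. That is a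
    -- lower index, so the Jacobi polynomial there has exact degree `m'`. Uniqueness gives `m = m'`,
    -- hence `2m + c' = -1`, against `h4'`.
    obtain ⟨m', hm'⟩ : ∃ m' : ℕ, (m' : ℤ) = -m - 1 - c' := ⟨(-m - 1 - c').toNat, by omega⟩
    have hlow : m' ∈ lowerIdx (cT t a b) ∪ upperIdx (cT t a b) := by
      left
      refine ⟨⟨c', hc'⟩, ?_⟩
      rw [hc']
      have : 2 * (m' : ℤ) + c' < 0 := by omega
      exact_mod_cast this
    have hJ := eig_jacobiF (b := b) ha t m'
    have hE : E = zdeg t a b m' * (zdeg t a b m' + 1) := by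
      rw [hf.eigenvalue hasLead_zero_fun, hn, hn', zdeg_eq, zdeg_eq, hc']
      have : (m' : ℝ) = -m - 1 - c' := by exact_mod_cast hm'
      rw [this]; push_cast; ring
    rw [← hE] at hJ
    obtain ⟨c₂, hc₂, h5⟩ := eq_C_mul_of_ld_eq hf.1 hJ.1 (hf.ld_eq ha hb hJ)
    have h6 : n = m' := by
      rw [← hn, h5, RatFunc.intDegree_mul (by simpa using hc₂) hJ.1,
        intDegree_jacobiF (by exact hlow)]; simp
    omega
  · rintro ⟨m, rfl, hm⟩
    exact ⟨_, _, eig_jacobiF ha t m, intDegree_jacobiF (by exact hm)⟩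

/-! ### Exactness of twisted differentials -/

/-- `g (x-1)^A (x+1)^B` has an antiderivative in `(x-1)^A (x+1)^B ℝ(x)`. -/
def Ex (A B : ℝ) (g : RatFunc ℝ) : Prop :=
  ∃ h, ratDeriv h + (RatFunc.C A * eP + RatFunc.C B * eM) * h = g

theorem Ex.add {A B : ℝ} {f g : RatFunc ℝ} (hf : Ex A B f) (hg : Ex A B g) : Ex A B (f + g) := by
  obtain ⟨h, rfl⟩ := hf
  obtain ⟨k, rfl⟩ := hg
  exact ⟨h + k, by rw [ratDeriv_add]; ring⟩

theorem Ex.C_mul {A B : ℝ} {f : RatFunc ℝ} (c : ℝ) (hf : Ex A B f) : Ex A B (RatFunc.C c * f) := by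
  obtain ⟨h, rfl⟩ := hf
  exact ⟨RatFunc.C c * h, by rw [ratDeriv_C_mul]; ring⟩

theorem Ex.neg {A B : ℝ} {f : RatFunc ℝ} (hf : Ex A B f) : Ex A B (-f) := by
  simpa using hf.C_mul (-1)

theorem Ex.sub {A B : ℝ} {f g : RatFunc ℝ} (hf : Ex A B f) (hg : Ex A B g) : Ex A B (f - g) := by
  rw [sub_eq_add_neg]; exact hf.add hg.neg

theorem Ex.zero (A B : ℝ) : Ex A B 0 := ⟨0, by simp⟩

theorem Ex.of_C_mul {A B c : ℝ} (hc : c ≠ 0) {f : RatFunc ℝ} (hf : Ex A B (RatFunc.C c * f)) :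
    Ex A B f := by
  have := hf.C_mul c⁻¹
  rwa [← mul_assoc, ← map_mul, inv_mul_cancel₀ hc, map_one, one_mul] at this

/-- `(x-1)^i (x+1)^j` -/
def mono (i j : ℤ) : RatFunc ℝ := (RatFunc.X - 1) ^ i * (RatFunc.X + 1) ^ j

theorem mono_ne_zero (i j : ℤ) : mono i j ≠ 0 :=
  mul_ne_zero (zpow_ne_zero i X_sub_one_ne_zero) (zpow_ne_zero j X_add_one_ne_zero)

theorem ld_mono (i j : ℤ) : ld (mono i j) = i * eP + j * eM := by
  rw [mono, ld_mul (zpow_ne_zero i X_sub_one_ne_zero) (zpow_ne_zero j X_add_one_ne_zero), ld_zpow,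
    ld_zpow, ld_X_sub_one, ld_X_add_one]

theorem mono_add (i j i' j' : ℤ) : mono (i + i') (j + j') = mono i j * mono i' j' := by
  rw [mono, mono, mono, zpow_add₀ X_sub_one_ne_zero, zpow_add₀ X_add_one_ne_zero]; ring

theorem mono_zero : mono 0 0 = 1 := by simp [mono]

/-- Integral powers of `x ± 1` may be moved between the integrand and the weight. -/
theorem Ex.shift {A B : ℝ} {g : RatFunc ℝ} (i j : ℤ) (h : Ex (A + i) (B + j) g) :
    Ex A B (g * mono i j) := by
  obtain ⟨k, rfl⟩ := h
  refine ⟨k * mono i j, ?_⟩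
  rw [ratDeriv_mul, ratDeriv_eq_ld_mul (mono_ne_zero i j), ld_mono]
  simp only [map_add, map_intCast]
  ring

theorem Ex.unshift {A B : ℝ} {g : RatFunc ℝ} (i j : ℤ) (h : Ex A B (g * mono i j)) :
    Ex (A + i) (B + j) g := by
  have h1 : Ex (A + i + (-i : ℤ)) (B + j + (-j : ℤ)) (g * mono i j) := by
    push_cast; simpa using h
  have h2 := h1.shift
  rwa [mul_assoc, ← mono_add, add_neg_cancel, add_neg_cancel, mono_zero, mul_one] at h2

theorem hasLead_nabla {A B : ℝ} {h : RatFunc ℝ} {d : ℤ} {c : ℝ} (hh : HasLead h d c) :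
    HasLead (ratDeriv h + (RatFunc.C A * eP + RatFunc.C B * eM) * h) (d - 1) ((d + A + B) * c) := by
  have h1 := hh.ratDeriv
  have h2 := ((hasLead_eP.C_mul A).add (hasLead_eM.C_mul B)).mul hh
  rw [show -1 + d = d - 1 by ring] at h2
  have := h1.add h2
  convert this using 1
  ring

/-- The form behaves like `dx/x` at infinity: reaching `1` needs an antiderivative of degree `1`,
for which the factor `1 + A + B` of the leading coefficient is zero. -/
theorem not_ex_one_of_balanced {A B : ℝ} (h : A + B = -1) : ¬ Ex A B 1 := by
  rintro ⟨k, hk⟩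
  have h0 : k ≠ 0 := by rintro rfl; simp at hk
  obtain ⟨c, hc, hl⟩ := exists_hasLead h0
  have h1 := hasLead_nabla (A := A) (B := B) hl
  rw [hk] at h1
  by_cases hd : k.intDegree = 1
  · rw [hd, sub_self] at h1
    have h2 := h1.unique hasLead_one
    have : (((1 : ℤ) : ℝ) + A + B) = 0 := by push_cast; linarith
    rw [this, zero_mul] at h2
    exact zero_ne_one h2
  · have hne : ((k.intDegree : ℝ) + A + B) * c ≠ 0 := by
      refine mul_ne_zero (fun h' => hd ?_) hc
      have : (k.intDegree : ℝ) = 1 := by linarith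
      exact_mod_cast this
    have := h1.intDegree_eq hne
    rw [RatFunc.intDegree_one] at this
    omega

/-- The denominator `D` divides `p N D'` and is coprime to `p N`; hence `D ∣ D'`, which forces `D`
to be constant. -/
theorem eq_poly_of_nabla {A B : ℝ} {h : RatFunc ℝ} (h1 : Reg 1 h) (h2 : Reg (-1) h)
    (hk : ratDeriv h + (RatFunc.C A * eP + RatFunc.C B * eM) * h = 1) :
    ∃ P : ℝ[X], h = algebraMap ℝ[X] (RatFunc ℝ) P := by
  set N := h.num with hN
  set D := h.denom with hD
  have hD0 : D ≠ 0 := h.denom_ne_zero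
  have hD' := RatFunc.algebraMap_ne_zero hD0
  have hw : h = algebraMap ℝ[X] (RatFunc ℝ) N / algebraMap ℝ[X] (RatFunc ℝ) D :=
    (RatFunc.num_div_denom h).symm
  have hdw : ratDeriv h = algebraMap ℝ[X] (RatFunc ℝ) (derivative N * D - N * derivative D) /
    algebraMap ℝ[X] (RatFunc ℝ) (D ^ 2) := rfl
  have hp := X_sub_one_ne_zero
  have hm := X_add_one_ne_zero
  have hpoly : (X ^ 2 - 1) * (derivative N * D - N * derivative D) +
      (C A * (X + 1) + C B * (X - 1)) * (N * D) = (X ^ 2 - 1) * D ^ 2 := by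
    apply RatFunc.algebraMap_injective (K := ℝ)
    rw [hdw, hw, eP, eM] at hk
    simp only [map_add, map_mul, map_sub, map_pow, map_one, RatFunc.algebraMap_X,
      RatFunc.algebraMap_C] at hk ⊢
    field_simp at hk
    linear_combination hk
  have hcop : IsCoprime D N := (RatFunc.isCoprime_num_denom h).symm
  have c1 : IsCoprime D (X - C 1) :=
    ((prime_X_sub_C (1 : ℝ)).irreducible.coprime_iff_not_dvd.2 fun h => h1 (dvd_iff_isRoot.1 h)).symm
  have c2 : IsCoprime D (X - C (-1)) :=
    ((prime_X_sub_C (-1 : ℝ)).irreducible.coprime_iff_not_dvd.2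
      fun h => h2 (dvd_iff_isRoot.1 h)).symm
  have hdvd : D ∣ ((X - C 1) * (X - C (-1)) * N) * derivative D := by
    refine ⟨(C A * (X + 1) + C B * (X - 1)) * N + (X ^ 2 - 1) * derivative N -
      (X ^ 2 - 1) * D, ?_⟩
    rw [map_one, map_neg, map_one]
    linear_combination -hpoly
  have hdd := ((c1.mul_right c2).mul_right hcop).dvd_of_dvd_mul_left hdvd
  have hd0 : derivative D = 0 := by
    by_contra hne
    exact absurd (degree_le_of_dvd hdd hne) (not_le.2 (degree_derivative_lt hD0))
  have hD1 : D = 1 := (RatFunc.monic_denom h).natDegree_eq_zero.1 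
    (derivative_eq_zero.1 hd0)
  exact ⟨N, by rw [hw, hD1, map_one, div_one]⟩

theorem vanish_ends {A B : ℝ} (hA : ¬ IsInt A) (hB : ¬ IsInt B) {h F : RatFunc ℝ} (hF1 : Reg 1 F)
    (hF2 : Reg (-1) F) (hk : ratDeriv h + (RatFunc.C A * eP + RatFunc.C B * eM) * h = F) :
    ∃ g, Reg 1 g ∧ Reg (-1) g ∧ h = pJ * g := by
  obtain ⟨g, hg, e1⟩ := vanish_of_first_order (c := 1) hA ((reg_C 1 B).mul reg_eM_one) hF1
    (by rw [← eP_eq]; exact hk)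
  obtain ⟨k, hk', e2⟩ := vanish_of_first_order (c := -1) hB ((reg_C (-1) A).mul reg_eP_neg_one) hF2
    (by rw [← eM_eq, add_comm (RatFunc.C B * eM)]; exact hk)
  have hp := X_sub_one_ne_zero
  have hm := X_add_one_ne_zero
  rw [map_one] at e1
  rw [map_neg, map_one, sub_neg_eq_add] at e2
  refine ⟨h / pJ, ?_, ?_, by rw [mul_div_cancel₀ _ pJ_ne_zero]⟩
  · have : h / pJ = g * eM := by rw [e1, pJ_eq, eM]; field_simp
    rw [this]; exact hg.mul reg_eM_one
  · have : h / pJ = k * eP := by rw [e2, pJ_eq, eP]; field_simp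
    rw [this]; exact hk'.mul reg_eP_neg_one

/-- A solution is a polynomial vanishing at both `1` and `-1`. Its leading term cannot cancel when
`A + B` is not an integer, so its degree would be `1`. -/
theorem not_ex_one_of_not_isInt {A B : ℝ} (hA : ¬ IsInt A) (hB : ¬ IsInt B) (hAB : ¬ IsInt (A + B)) :
    ¬ Ex A B 1 := by
  rintro ⟨h, hk⟩
  obtain ⟨g, hg1, hg2, rfl⟩ := vanish_ends hA hB (reg_one _) (reg_one _) hk
  have hreg : ∀ c, Reg c pJ := fun c => ((reg_X c).pow 2).sub (reg_one c)
  obtain ⟨P, hP⟩ := eq_poly_of_nabla ((hreg 1).mul hg1) ((hreg (-1)).mul hg2) hk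
  have h0 : pJ * g ≠ 0 := by intro h0; rw [h0] at hk; simp at hk
  have hP0 : P ≠ 0 := by rintro rfl; rw [hP] at h0; simp at h0
  have h1 := hasLead_nabla (A := A) (B := B) (hasLead_algebraMap P)
  rw [← hP, hk] at h1
  have hne : ((P.natDegree : ℤ) + A + B) * P.leadingCoeff ≠ 0 := by
    refine mul_ne_zero (fun h' => hAB ⟨-P.natDegree, ?_⟩) (leadingCoeff_ne_zero.2 hP0)
    push_cast at h' ⊢; linarith
  have hd := h1.intDegree_eq hne
  rw [RatFunc.intDegree_one] at hd
  have hd1 : P.natDegree = 1 := by omega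
  have r1 : P.eval 1 = 0 := by
    rw [← val_algebraMap, ← hP, val_mul (hreg 1) hg1, pJ, val_sub ((reg_X _).pow 2) (reg_one _),
      val_pow (reg_X _)]; simp
  have r2 : P.eval (-1) = 0 := by
    rw [← val_algebraMap, ← hP, val_mul (hreg _) hg2, pJ, val_sub ((reg_X _).pow 2) (reg_one _),
      val_pow (reg_X _)]; simp
  obtain ⟨p, q, hpq⟩ : ∃ p q, P = C p * X + C q := ⟨_, _, eq_X_add_C_of_natDegree_le_one hd1.le⟩
  rw [hpq] at r1 r2
  simp at r1 r2
  apply hP0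
  have hq : q = 0 := by linarith
  have hp : p = 0 := by linarith
  rw [hpq, hq, hp]; simp

/-- Obtained by differentiating `(x-1)^(A+1) (x+1)^(B+1)`. The reductions of exponents below all
come from this relation. -/
theorem ex_basic (A B : ℝ) :
    Ex A B (RatFunc.C (A + 1) * (RatFunc.X + 1) + RatFunc.C (B + 1) * (RatFunc.X - 1)) := by
  refine ⟨pJ, ?_⟩
  have hp := X_sub_one_ne_zero
  have hm := X_add_one_ne_zero
  rw [ratDeriv_pJ, pJ_eq, eP, eM]
  simp only [map_add, map_one]
  field_simp
  ring

theorem ex_X_add_one (A B : ℝ) :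
    Ex A B (RatFunc.C (A + B + 2) * (RatFunc.X + 1) - RatFunc.C (2 * (B + 1))) := by
  convert ex_basic A B using 1
  simp only [map_add, map_one, map_mul, map_ofNat]; ring

/-- Lowering the exponent at `-1` to the balanced position `A + B = -1`. -/
theorem ex_one_sub (A : ℝ) (m : ℕ) :
    Ex A (-1 - A + m) (1 - RatFunc.C (2 ^ m * poch m (-A) / m.factorial) * mono 0 (-m)) := by
  induction m with
  | zero => simpa [poch_zero, mono_zero] using Ex.zero A (-1 - A)
  | succ m ih =>
    have h1 := ex_X_add_one A (-1 - A + m)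
    have h2 := (ih.C_mul (2 * (-A + m) / (m + 1)))
    have hm : (m : ℝ) + 1 ≠ 0 := by positivity
    have hf : (m.factorial : ℝ) ≠ 0 := by exact_mod_cast m.factorial_ne_zero
    have h3 := (h1.C_mul (1 / (m + 1))).add h2
    -- The form `1` at exponent `m + 1` is `x + 1` at exponent `m`, which `ex_X_add_one` replaces by
    -- a constant; then the induction hypothesis applies.
    have h4 : Ex A (-1 - A + m) ((1 - RatFunc.C (2 ^ (m + 1) * poch (m + 1) (-A) / (m + 1).factorial) *
        mono 0 (-(m + 1 : ℕ))) * mono 0 1) := by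
      convert h3 using 1
      have e1 : mono 0 1 = RatFunc.X + 1 := by simp [mono]
      have e2 : mono 0 (-(m + 1 : ℕ)) * mono 0 1 = mono 0 (-m) := by
        rw [← mono_add]; congr 1; push_cast; ring
      have c1 : RatFunc.C (1 / ((m : ℝ) + 1)) * RatFunc.C (A + (-1 - A + m) + 2) = 1 := by
        rw [← map_mul, ← map_one RatFunc.C]; congr 1; field_simp; ring
      have c2 : RatFunc.C (1 / ((m : ℝ) + 1)) * RatFunc.C (2 * (-1 - A + m + 1)) =
          RatFunc.C (2 * (-A + m) / (m + 1)) := by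
        rw [← map_mul]; congr 1; field_simp; ring
      have c3 : RatFunc.C (2 ^ (m + 1) * poch (m + 1) (-A) / (m + 1).factorial) =
          RatFunc.C (2 * (-A + m) / (m + 1)) * RatFunc.C (2 ^ m * poch m (-A) / m.factorial) := by
        rw [← map_mul]; congr 1
        rw [poch_succ, Nat.factorial_succ]; push_cast; field_simp; ring
      rw [sub_mul, one_mul, mul_assoc, e2, e1, c3]
      linear_combination -(RatFunc.X + 1) * c1 + c2
    have h5 := h4.unshift
    convert h5 using 1 <;> push_cast <;> ring

/-- Here `A + B = -2 - m`. For `m = 0` the term in `x + 1` of `ex_X_add_one` drops out; smaller sums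
follow downwards. The constant `2(B + 1)` is non-zero because `A` is not an integer. -/
theorem ex_one_of_neg {A : ℝ} (hA : ¬ IsInt A) (m : ℕ) : Ex A (-2 - A - m) 1 := by
  have hB : ∀ m : ℕ, -2 - A - m + 1 ≠ 0 := fun m h => hA ⟨-1 - m, by push_cast; linarith⟩
  induction m with
  | zero =>
    have h1 := ex_X_add_one A (-2 - A - (0 : ℕ))
    rw [show A + (-2 - A - (0 : ℕ)) + 2 = 0 by push_cast; ring, map_zero, zero_mul, zero_sub] at h1
    have h2 := h1.neg
    rw [neg_neg, ← mul_one (RatFunc.C _)] at h2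
    exact h2.of_C_mul (mul_ne_zero two_ne_zero (hB 0))
  | succ m ih =>
    have h1 := ex_X_add_one A (-2 - A - (m + 1 : ℕ))
    have h3 : Ex (A + (0 : ℤ)) (-2 - A - (m + 1 : ℕ) + (1 : ℤ)) 1 := by
      convert ih using 1 <;> push_cast <;> ring
    have h2 := h3.shift
    rw [one_mul, show mono 0 1 = RatFunc.X + 1 by simp [mono]] at h2
    have h4 := ((h2.C_mul (A + (-2 - A - (m + 1 : ℕ)) + 2)).sub h1)
    rw [sub_sub_cancel, ← mul_one (RatFunc.C _)] at h4
    exact h4.of_C_mul (mul_ne_zero two_ne_zero (hB (m + 1)))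

/-- If the sum of the exponents is an integer `≥ -1`, then `ex_one_sub` reduces `1` to a non-zero
multiple of the balanced weight, which is not exact. -/
theorem not_ex_one {A B : ℝ} (hA : ¬ IsInt A) (hB : ¬ IsInt B)
    (h : ∀ m : ℤ, A + B = m → 0 ≤ m + 1) : ¬ Ex A B 1 := by
  by_cases hAB : IsInt (A + B)
  · obtain ⟨m, hm⟩ := hAB
    obtain ⟨k, hk⟩ := Int.eq_ofNat_of_zero_le (h m hm)
    obtain rfl : B = -1 - A + k := by
      have : (m : ℝ) + 1 = k := by exact_mod_cast hk
      linarith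
    intro h1
    have h2 := h1.sub (ex_one_sub A k)
    rw [sub_sub_cancel] at h2
    have h3 := (h2.of_C_mul (by
      refine div_ne_zero (mul_ne_zero (by positivity) (poch_ne_zero_of_not_isInt ?_ k))
        (by exact_mod_cast k.factorial_ne_zero)
      rwa [isInt_neg_iff]))
    rw [← one_mul (mono _ _)] at h3
    refine not_ex_one_of_balanced ?_ h3.unshift
    push_cast; ring
  · exact not_ex_one_of_not_isInt hA hB hAB

/-- For exponents with sum `-2` the two coefficients in `ex_basic` are opposite, so `(x+1) - (x-1)`
times the weight is exact up to a non-zero factor. This links neighbouring values of `i`. -/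
theorem ex_balanced {A B : ℝ} (hA : ¬ IsInt A) {m : ℤ} (hm : A + B + 1 = m) (i : ℤ) :
    Ex A B (mono i (-m - i) - mono 0 (-m)) := by
  have step : ∀ i : ℤ, Ex A B (mono (i + 1) (-m - (i + 1)) - mono i (-m - i)) := by
    intro i
    have h1 := (ex_basic (A + i) (B + (-m - i - 1 : ℤ))).shift
    have hc : B + (-m - i - 1 : ℤ) + 1 = -(A + i + 1) := by push_cast; rw [← hm]; ring
    rw [hc, map_neg, neg_mul, ← sub_eq_add_neg, ← mul_sub, mul_assoc] at h1
    have h2 := (h1.of_C_mul (fun h => hA ⟨-i - 1, by push_cast; linarith⟩)).neg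
    convert h2 using 1
    have e1 : mono (i + 1) (-m - (i + 1)) = mono i (-m - i - 1) * mono 1 0 := by
      rw [← mono_add]; congr 1; ring
    have e2 : mono i (-m - i) = mono i (-m - i - 1) * mono 0 1 := by
      rw [← mono_add]; congr 1 <;> ring
    have e3 : mono 1 0 = RatFunc.X - 1 := by simp [mono]
    have e4 : mono 0 1 = RatFunc.X + 1 := by simp [mono]
    rw [e1, e2, e3, e4]; ring
  induction i using Int.induction_on with
  | zero => simpa using Ex.zero A B
  | succ i ih => simpa using (step i).add ih
  | pred i ih =>
    have := ih.sub (step (-i - 1))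
    rw [sub_add_cancel] at this
    convert this using 1
    ring

/-! ### Norms of Jacobi polynomials -/

theorem iterate_ode {P : ℝ[X]} {A B lam : ℝ}
    (h : (X ^ 2 - 1 : ℝ[X]) * derivative (derivative P) +
      (C (A + 1) * (X + 1) + C (B + 1) * (X - 1)) * derivative P = C lam * P) (j : ℕ) :
    (X ^ 2 - 1 : ℝ[X]) * derivative (derivative (derivative^[j] P)) +
      (C (A + j + 1) * (X + 1) + C (B + j + 1) * (X - 1)) * derivative (derivative^[j] P) =
      C (lam - j * (j + A + B + 1)) * derivative^[j] P := by
  induction j with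
  | zero => simpa using h
  | succ j ih =>
    have h1 := congrArg derivative ih
    rw [Function.iterate_succ_apply']
    simp only [derivative_mul, derivative_add, derivative_sub, derivative_X_pow, derivative_one,
      derivative_C, derivative_X] at h1
    simp only [map_add, map_sub, map_mul, map_natCast, map_one, map_ofNat, Nat.cast_ofNat,
      Nat.cast_add, Nat.cast_one, Nat.add_one_sub_one, pow_one] at h1 ⊢
    linear_combination h1

/-- Integration by parts: by `iterate_ode` the `j`-th derivative solves the same equation with both
parameters raised by `j`, and the squared norm of its derivative in the next weight is a constant
times its own. -/
theorem ex_iterate {P : ℝ[X]} {A B lam : ℝ}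
    (h : (X ^ 2 - 1 : ℝ[X]) * derivative (derivative P) +
      (C (A + 1) * (X + 1) + C (B + 1) * (X - 1)) * derivative P = C lam * P) (j : ℕ) :
    Ex A B (algebraMap ℝ[X] (RatFunc ℝ) (derivative^[j] P) ^ 2 * mono j j -
      RatFunc.C (∏ i ∈ Finset.range j, -(lam - i * (i + A + B + 1))) *
        algebraMap ℝ[X] (RatFunc ℝ) P ^ 2) := by
  induction j with
  | zero => simpa [mono_zero] using Ex.zero A B
  | succ j ih =>
    have h1 := congrArg (algebraMap ℝ[X] (RatFunc ℝ)) (iterate_ode h j)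
    simp only [map_add, map_mul, map_sub, map_pow, map_one, RatFunc.algebraMap_X,
      RatFunc.algebraMap_C, ← ratDeriv_algebraMap] at h1
    set f := algebraMap ℝ[X] (RatFunc ℝ) (derivative^[j] P) with hf
    have h2 : Ex (A + (j : ℤ)) (B + (j : ℤ)) (pJ * ratDeriv f ^ 2 +
        RatFunc.C (lam - j * (j + A + B + 1)) * f ^ 2) := by
      refine ⟨pJ * f * ratDeriv f, ?_⟩
      have hp := X_sub_one_ne_zero
      have hm := X_add_one_ne_zero
      have e1 : pJ * eP = RatFunc.X + 1 := by rw [pJ_eq, eP]; field_simp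
      have e2 : pJ * eM = RatFunc.X - 1 := by rw [pJ_eq, eM]; field_simp
      rw [ratDeriv_mul, ratDeriv_mul, ratDeriv_pJ]
      simp only [map_sub, map_mul, map_add, map_one, map_natCast, Int.cast_natCast] at *
      have e0 : pJ = RatFunc.X ^ 2 - 1 := rfl
      rw [← e0] at h1
      linear_combination f * h1 + ((RatFunc.C A + j) * f * ratDeriv f) * e1 +
        ((RatFunc.C B + j) * f * ratDeriv f) * e2
    have h3 := h2.shift.add (ih.C_mul (-(lam - j * (j + A + B + 1))))
    convert h3 using 1
    rw [Function.iterate_succ_apply', ← ratDeriv_algebraMap, ← hf, Finset.prod_range_succ, map_mul,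
      show ((j + 1 : ℕ) : ℤ) = 1 + j by push_cast; ring, mono_add,
      show mono 1 1 = pJ by rw [pJ_eq]; simp [mono], map_neg]
    ring

theorem prod_eq_poch (n : ℕ) (c : ℝ) :
    ∏ i ∈ Finset.range n, -((n : ℝ) * (n + c + 1) - i * (i + c + 1)) =
      (-1) ^ n * n.factorial * poch n (n + c + 1) := by
  have h1 : ∀ i ∈ Finset.range n, -((n : ℝ) * (n + c + 1) - i * (i + c + 1)) =
      (-1 * ((n - i : ℕ) : ℝ)) * (n + c + 1 + i) := by
    intro i hi
    rw [Nat.cast_sub (Finset.mem_range.1 hi).le]; ring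
  have h2 : ∀ (k : ℕ) (x : ℝ), ∏ i ∈ Finset.range k, (x + i) = poch k x := by
    intro k x
    induction k with
    | zero => simp [poch_zero]
    | succ k ih => rw [Finset.prod_range_succ, ih, poch_succ]
  have h3 : ∏ i ∈ Finset.range n, ((n - i : ℕ) : ℝ) = n.factorial := by
    rw [← Nat.cast_prod, ← Nat.descFactorial_eq_prod_range, Nat.descFactorial_self]
  rw [Finset.prod_congr rfl h1, Finset.prod_mul_distrib, Finset.prod_mul_distrib, h2, h3]
  simp

/-- The squared norm of `P_n(x;A,B)` reduced to the weight `(1-x²)^n`. -/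
theorem ex_jacobiF_sq (n : ℕ) (A B : ℝ) :
    Ex A B (RatFunc.C ((n.factorial * jlead n (A + B)) ^ 2) * mono n n -
      RatFunc.C ((-1) ^ n * n.factorial * poch n (n + (A + B) + 1)) * jacobiF n A B ^ 2) := by
  have h := ex_iterate (jacobiP_ode n A B) n
  have h1 : derivative^[n] (jacobiP n A B) = C (n.factorial * jlead n (A + B)) := by
    have hd : (derivative^[n] (jacobiP n A B)).natDegree ≤ 0 := by
      have := natDegree_iterate_derivative (jacobiP n A B) n
      have := jacobiP_natDegree_le n A B
      omega
    rw [eq_C_of_natDegree_le_zero hd, coeff_iterate_derivative, zero_add, jacobiP_coeff,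
      Nat.descFactorial_self, nsmul_eq_mul]
  have h2 : ∏ i ∈ Finset.range n, -((n : ℝ) * (n + A + B + 1) - i * (i + A + B + 1)) =
      (-1) ^ n * n.factorial * poch n (n + (A + B) + 1) := by
    rw [← prod_eq_poch]; refine Finset.prod_congr rfl fun i _ => by ring
  rw [h1, h2, RatFunc.algebraMap_C, ← map_pow] at h
  exact h

/-- The square reduces to the weight with exponents `A + n`, `B + n`. For an upper index their sum,
if integral, is at least `n ≥ 0`, so `not_ex_one` applies. -/
theorem not_ex_jacobiF_sq {A B : ℝ} (hA : ¬ IsInt A) (hB : ¬ IsInt B) {n : ℕ}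
    (hn : n ∈ upperIdx (A + B)) : ¬ Ex A B (jacobiF n A B ^ 2) := by
  intro h
  have h1 := (ex_jacobiF_sq n A B).add
    (h.C_mul ((-1) ^ n * n.factorial * poch n (n + (A + B) + 1)))
  rw [sub_add_cancel] at h1
  have hl := jlead_ne_zero (Or.inr hn)
  have h2 := h1.of_C_mul (pow_ne_zero 2 (mul_ne_zero (by exact_mod_cast n.factorial_ne_zero) hl))
  rw [← one_mul (mono _ _)] at h2
  refine not_ex_one ((isInt_add_int _).not.2 hA) ((isInt_add_int _).not.2 hB) ?_ h2.unshift
  intro m hm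
  have hc : IsInt (A + B) := ⟨m - 2 * n, by push_cast at hm ⊢; linarith⟩
  have h3 := hn hc
  have h4 : (0 : ℝ) ≤ m + 1 := by
    rw [← hm]; push_cast
    have : (0 : ℝ) ≤ n := by positivity
    linarith
  exact_mod_cast h4

/-! ### Iterated Darboux transformations -/

/-- The exponent of the gauge factor which restores regularity at an end point. -/
def gap (x y : ℤ) : ℕ := if x = y then 0 else 1

theorem gap_cast {x y : ℤ} (hx : x = 1 ∨ x = -1) (hy : y = 1 ∨ y = -1) :
    2 * (gap x y : ℤ) = 1 - x * y := by
  rcases hx with rfl | rfl <;> rcases hy with rfl | rfl <;> simp [gap]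

theorem gapP_cast (s t : AType) : 2 * (gap s.sgnP t.sgnP : ℤ) = 1 - s.sgnP * t.sgnP :=
  gap_cast s.sgnP_eq t.sgnP_eq

theorem gapM_cast (s t : AType) : 2 * (gap s.sgnM t.sgnM : ℤ) = 1 - s.sgnM * t.sgnM :=
  gap_cast s.sgnM_eq t.sgnM_eq

/-- The gauge factor for the action of a type `s` seed on type `t` functions. -/
def gauge (s t : AType) : RatFunc ℝ :=
  (RatFunc.X - 1) ^ gap s.sgnP t.sgnP * (RatFunc.X + 1) ^ gap s.sgnM t.sgnM

theorem gauge_ne_zero (s t : AType) : gauge s t ≠ 0 :=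
  mul_ne_zero (pow_ne_zero _ X_sub_one_ne_zero) (pow_ne_zero _ X_add_one_ne_zero)

theorem gauge_eq_mono (s t : AType) :
    gauge s t = mono (gap s.sgnP t.sgnP : ℤ) (gap s.sgnM t.sgnM : ℤ) := by
  simp [gauge, mono]

theorem ld_gauge (s t : AType) :
    ld (gauge s t) = (gap s.sgnP t.sgnP : ℕ) * eP + (gap s.sgnM t.sgnM : ℕ) * eM := by
  rw [gauge_eq_mono, ld_mono]; simp

/-- The factor `√p` of a Darboux step adds `1/2` to both exponents while the parameters move by the
signs of the seed; the gauge exponent, `0` or `1`, is the difference of the two effects. -/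
theorem omg_shift (s t : AType) (α β : ℝ) :
    ld (gauge s t) + omg t (α + s.sgnP) (β + s.sgnM) = omg t α β + hX := by
  have h1 : ((gap s.sgnP t.sgnP : ℕ) : RatFunc ℝ) = (1 - s.sgnP * t.sgnP) / 2 := by
    have := gapP_cast s t
    have h : 2 * ((gap s.sgnP t.sgnP : ℕ) : RatFunc ℝ) = 1 - s.sgnP * t.sgnP := by
      exact_mod_cast congrArg (Int.cast (R := RatFunc ℝ)) this
    linear_combination h / 2
  have h2 : ((gap s.sgnM t.sgnM : ℕ) : RatFunc ℝ) = (1 - s.sgnM * t.sgnM) / 2 := by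
    have := gapM_cast s t
    have h : 2 * ((gap s.sgnM t.sgnM : ℕ) : RatFunc ℝ) = 1 - s.sgnM * t.sgnM := by
      exact_mod_cast congrArg (Int.cast (R := RatFunc ℝ)) this
    linear_combination h / 2
  rw [ld_gauge, h1, h2, hX_eq]
  simp only [omg, map_div₀, map_mul, map_add, map_intCast, map_ofNat]
  ring

/-- This is why the dual of a type `s` seed is of type `s.opp` for the shifted parameters, with the
reciprocal as its regular part. -/
theorem omg_opp (s : AType) (α β : ℝ) :
    omg s.opp (α + s.sgnP) (β + s.sgnM) = -omg s α β - hX := by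
  have h1 : (s.sgnP : RatFunc ℝ) ^ 2 = 1 := by exact_mod_cast s.sgnP_sq
  have h2 : (s.sgnM : RatFunc ℝ) ^ 2 = 1 := by exact_mod_cast s.sgnM_sq
  rw [hX_eq]
  simp only [omg, AType.sgnP_opp, AType.sgnM_opp, map_div₀, map_mul, map_add, map_intCast,
    map_ofNat, Int.cast_neg, map_neg]
  linear_combination (- eP / 2) * h1 - (eM / 2) * h2

/-- The Darboux transform of a type `t` eigenfunction `f` for the type `s` seed function `g`. -/
def dstep (α β : ℝ) (s : AType) (g : RatFunc ℝ) (t : AType) (f : RatFunc ℝ) : RatFunc ℝ :=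
  (ratDeriv f + (omg t α β - omg s α β - ld g) * f) * gauge s t

theorem dstep_eq (α β : ℝ) (s : AType) (g : RatFunc ℝ) (t : AType) {f : RatFunc ℝ} (hf : f ≠ 0) :
    dstep α β s g t f = f * (ld f + omg t α β - (ld g + omg s α β)) * gauge s t := by
  rw [dstep, ratDeriv_eq_ld_mul hf]; ring

theorem ld_dstep {α β : ℝ} {s : AType} {g : RatFunc ℝ} {t : AType} {f : RatFunc ℝ} (hf : f ≠ 0)
    (h : ld f + omg t α β ≠ ld g + omg s α β) :
    ld (dstep α β s g t f) + omg t (α + s.sgnP) (β + s.sgnM) =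
      darbouxW (ld g + omg s α β) (ld f + omg t α β) := by
  rw [dstep_eq α β s g t hf, ld_mul (mul_ne_zero hf (sub_ne_zero.2 h)) (gauge_ne_zero s t),
    ld_mul hf (sub_ne_zero.2 h), add_assoc, omg_shift, darbouxW]
  ring

theorem dstep_ne_zero {α β : ℝ} {s : AType} {g : RatFunc ℝ} {t : AType} {f : RatFunc ℝ} (hf : f ≠ 0)
    (h : ld f + omg t α β ≠ ld g + omg s α β) : dstep α β s g t f ≠ 0 := by
  rw [dstep_eq α β s g t hf]
  exact mul_ne_zero (mul_ne_zero hf (sub_ne_zero.2 h)) (gauge_ne_zero s t)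

theorem Eig.darboux {u : RatFunc ℝ} {α β E E₀ : ℝ} {s t : AType} {f g : RatFunc ℝ}
    (hf : Eig u α β t E f) (hg : Eig u α β s E₀ g)
    (h : ld f + omg t α β ≠ ld g + omg s α β) :
    Eig (u + ld g) (α + s.sgnP) (β + s.sgnM) t E (dstep α β s g t f) := by
  refine ⟨dstep_ne_zero hf.1 h, ?_⟩
  rw [ld_dstep hf.1 h, ← darbouxV_potV]
  exact hf.2.darboux hg.2 h

theorem Eig.dual_eq {α β : ℝ} {s : AType} {g : RatFunc ℝ} (hg : g ≠ 0) :
    ld g⁻¹ + omg s.opp (α + s.sgnP) (β + s.sgnM) = dual (ld g + omg s α β) := by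
  rw [ld_inv hg, omg_opp, dual]; ring

theorem Eig.dual {u : RatFunc ℝ} {α β E₀ : ℝ} {s : AType} {g : RatFunc ℝ}
    (hg : Eig u α β s E₀ g) :
    Eig (u + ld g) (α + s.sgnP) (β + s.sgnM) s.opp E₀ g⁻¹ := by
  refine ⟨inv_ne_zero hg.1, ?_⟩
  rw [Eig.dual_eq hg.1, ← darbouxV_potV]
  exact hg.2.dual

theorem SRV.energy_unique {V w : RatFunc ℝ} {E E' : ℝ} (h : SRV V E w) (h' : SRV V E' w) :
    E = E' := RatFunc.C_injective (Eq.trans h.symm h')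

theorem Eig.ne_of_energy {u : RatFunc ℝ} {α β E E₀ : ℝ} {s t : AType} {f g : RatFunc ℝ}
    (hf : Eig u α β t E f) (hg : Eig u α β s E₀ g) (h : E ≠ E₀) :
    ld f + omg t α β ≠ ld g + omg s α β := fun h' => h (by
  have := hf.2
  rw [h'] at this
  exact this.energy_unique hg.2)

/-- Contribution of a type `s` seed to the degree shift of type `t` functions. -/
def sg (s t : AType) : ℤ := 1 - gap s.sgnP t.sgnP - gap s.sgnM t.sgnM

theorem two_sg (s t : AType) : 2 * sg s t = s.sgnP * t.sgnP + s.sgnM * t.sgnM := by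
  rw [sg]; linarith [gapP_cast s t, gapM_cast s t]

theorem sg_opp (s t : AType) : sg s t.opp = -sg s t := by
  have h1 := two_sg s t
  have h2 := two_sg s t.opp
  rw [AType.sgnP_opp, AType.sgnM_opp] at h2
  linarith

theorem sg_self (s : AType) : sg s s = 1 := by simp [sg, gap]

theorem hasLead_gauge (s t : AType) : HasLead (gauge s t) (1 - sg s t) 1 := by
  have h1 : HasLead (RatFunc.X - 1) 1 1 := by
    simpa using hasLead_X.sub (hasLead_one.of_lt one_pos)
  have h2 : HasLead (RatFunc.X + 1) 1 1 := by
    simpa using hasLead_X.add (hasLead_one.of_lt one_pos)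
  have := (h1.pow (gap s.sgnP t.sgnP)).mul (h2.pow (gap s.sgnM t.sgnM))
  rw [gauge]
  convert this using 1
  · rw [sg]; ring
  · simp

/-- The leading coefficient is multiplied by the difference of the degrees in the symmetric gauge.
When this is zero, only a bound on the degree remains. -/
theorem hasLead_dstep {α β c : ℝ} {s t : AType} {f g : RatFunc ℝ} {d : ℤ} (hg : g ≠ 0)
    (hf : HasLead f d c) : HasLead (dstep α β s g t f) (d - sg s t)
      (c * (zdeg t α β d - zdeg s α β g.intDegree)) := by
  have h1 := hf.ratDeriv
  have h2 := (((hasLead_omg t α β).sub (hasLead_omg s α β)).sub (hasLead_ld hg)).mul hf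
  rw [show -1 + d = d - 1 by ring] at h2
  have h3 := (h1.add h2).mul (hasLead_gauge s t)
  rw [show d - 1 + (1 - sg s t) = d - sg s t by ring] at h3
  rw [dstep]
  convert h3 using 1
  rw [zdeg, zdeg]; ring

/-! ### Lists of seeds: parameters, indices and iterated transforms -/

/-- The sum of the signs at `1` of the seeds. -/
def sumP (l : List (AType × ℕ)) : ℤ := (l.map fun s => s.1.sgnP).sum

/-- The sum of the signs at `-1` of the seeds. -/
def sumM (l : List (AType × ℕ)) : ℤ := (l.map fun s => s.1.sgnM).sum

/-- The degree shift of type `t` functions. -/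
def sh (l : List (AType × ℕ)) (t : AType) : ℤ := (l.map fun s => sg s.1 t).sum

theorem sumP_cons (s : AType × ℕ) (l : List (AType × ℕ)) : sumP (s :: l) = s.1.sgnP + sumP l := by
  simp [sumP]

theorem sumM_cons (s : AType × ℕ) (l : List (AType × ℕ)) : sumM (s :: l) = s.1.sgnM + sumM l := by
  simp [sumM]

theorem sh_cons (s : AType × ℕ) (l : List (AType × ℕ)) (t : AType) :
    sh (s :: l) t = sg s.1 t + sh l t := by
  simp [sh]

theorem sh_opp (l : List (AType × ℕ)) (t : AType) : sh l t.opp = -sh l t := by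
  induction l with
  | nil => simp [sh]
  | cons s l ih => rw [sh_cons, sh_cons, ih, sg_opp]; ring

theorem two_sh (l : List (AType × ℕ)) (t : AType) :
    2 * sh l t = t.sgnP * sumP l + t.sgnM * sumM l := by
  induction l with
  | nil => simp [sh, sumP, sumM]
  | cons s l ih => rw [sh_cons, sumP_cons, sumM_cons, mul_add, ih, two_sg]; ring

/-- The first parameter after the transformations. -/
def αL (a : ℝ) (l : List (AType × ℕ)) : ℝ := a + sumP l

/-- The second parameter after the transformations. -/
def βL (b : ℝ) (l : List (AType × ℕ)) : ℝ := b + sumM l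

theorem αL_nil (a : ℝ) : αL a [] = a := by simp [αL, sumP]

theorem βL_nil (b : ℝ) : βL b [] = b := by simp [βL, sumM]

theorem αL_cons (a : ℝ) (s : AType × ℕ) (l : List (AType × ℕ)) :
    αL a (s :: l) = αL a l + s.1.sgnP := by
  rw [αL, αL, sumP_cons]; push_cast; ring

theorem βL_cons (b : ℝ) (s : AType × ℕ) (l : List (AType × ℕ)) :
    βL b (s :: l) = βL b l + s.1.sgnM := by
  rw [βL, βL, sumM_cons]; push_cast; ring

theorem not_isInt_αL {a : ℝ} (ha : ¬ IsInt a) (l : List (AType × ℕ)) : ¬ IsInt (αL a l) := by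
  rwa [αL, isInt_add_int]

theorem not_isInt_βL {b : ℝ} (hb : ¬ IsInt b) (l : List (AType × ℕ)) : ¬ IsInt (βL b l) := by
  rwa [βL, isInt_add_int]

/-- The shift of the degree and the shifts of the parameters cancel, so the degree in the symmetric
gauge, and with it the eigenvalue, depends only on the unshifted index `n`. -/
theorem zdeg_sh (a b : ℝ) (l : List (AType × ℕ)) (t : AType) (n : ℤ) :
    zdeg t (αL a l) (βL b l) (n - sh l t : ℤ) = n + cT t a b / 2 := by
  have h : (2 * sh l t : ℝ) = t.sgnP * sumP l + t.sgnM * sumM l := by exact_mod_cast two_sh l t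
  rw [zdeg, αL, βL, cT]
  push_cast
  linear_combination h / -2

/-- The classical Jacobi polynomial which belongs to a seed. -/
def base (a b : ℝ) (s : AType × ℕ) : RatFunc ℝ := jacobiF s.2 (s.1.sgnP * a) (s.1.sgnM * b)

/-- The iterated Darboux transform of a type `t` function; the last seed is the head of the list. -/
def FL (a b : ℝ) : List (AType × ℕ) → AType → RatFunc ℝ → RatFunc ℝ
  | [], _, f => f
  | s :: l, t, f => dstep (αL a l) (βL b l) s.1 (FL a b l s.1 (base a b s)) t (FL a b l t f)

/-- The transform of a seed function by the preceding seeds. -/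
def SL (a b : ℝ) (l : List (AType × ℕ)) (s : AType × ℕ) : RatFunc ℝ := FL a b l s.1 (base a b s)

theorem FL_cons (a b : ℝ) (s : AType × ℕ) (l : List (AType × ℕ)) (t : AType) (f : RatFunc ℝ) :
    FL a b (s :: l) t f = dstep (αL a l) (βL b l) s.1 (SL a b l s) t (FL a b l t f) := rfl

/-- The product of the transformed seed functions. -/
def tauL (a b : ℝ) : List (AType × ℕ) → RatFunc ℝ
  | [] => 1
  | s :: l => tauL a b l * SL a b l s

/-- The log-derivative of `tauL`. -/
def uL (a b : ℝ) : List (AType × ℕ) → RatFunc ℝ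
  | [] => 0
  | s :: l => uL a b l + ld (SL a b l s)

/-- `n` is the index of a type `t` function in the upper part after the transformations. -/
def NPlus (a b : ℝ) (l : List (AType × ℕ)) (t : AType) (n : ℕ) : Prop :=
  n ∈ upperIdx (cT t a b) ∧ (t, n) ∉ l ∧ ∀ k, (t.opp, k) ∈ l → (n : ℝ) + cT t a b ≠ k

/-- `n` is the index of a type `t` function in the lower part after the transformations. -/
def NMinus (a b : ℝ) (l : List (AType × ℕ)) (t : AType) (n : ℤ) : Prop :=
  (∃ m : ℕ, n = m ∧ m ∈ lowerIdx (cT t a b)) ∨ ∃ k, (t.opp, k) ∈ l ∧ n = -(k : ℤ) - 1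

/-- Lists of seeds in which every seed is an eigenfunction index of the preceding operator. -/
def Good (a b : ℝ) : List (AType × ℕ) → Prop
  | [] => True
  | s :: l => Good a b l ∧ NPlus a b l s.1 s.2

/-- The eigenvalue of a type `t` function of index `n` in the symmetric gauge. -/
def eN (a b : ℝ) (t : AType) (n : ℝ) : ℝ := (n + cT t a b / 2) * (n + cT t a b / 2 + 1)

theorem cT_opp (t : AType) (a b : ℝ) : cT t.opp a b = -cT t a b := by
  rw [cT, cT, AType.sgnP_opp, AType.sgnM_opp]; push_cast; ring

theorem eN_dual (a b : ℝ) (t : AType) (k : ℝ) : eN a b t.opp (-k - 1) = eN a b t k := by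
  rw [eN, eN, cT_opp]; ring

/-- Coincidences of eigenvalues. -/
theorem eN_eq_cases {a b : ℝ} (ha : ¬ IsInt a) (hb : ¬ IsInt b) {s t : AType} {n k : ℤ}
    (h : eN a b t n = eN a b s k) :
    (t = s ∧ (n = k ∨ (n : ℝ) + k + 1 + cT t a b = 0)) ∨
      (t = s.opp ∧ (n + k + 1 = 0 ∨ (n : ℝ) + cT t a b = k)) := by
  have h1 : ((n + cT t a b / 2) - (k + cT s a b / 2)) *
      ((n + cT t a b / 2) + (k + cT s a b / 2) + 1) = 0 := by
    rw [eN, eN] at h; linear_combination h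
  by_cases hs : t = s
  · subst hs
    left
    refine ⟨rfl, ?_⟩
    rcases mul_eq_zero.1 h1 with h2 | h2
    · left; exact_mod_cast (by linarith : (n : ℝ) = k)
    · right; linarith
  by_cases ho : t = s.opp
  · right
    refine ⟨ho, ?_⟩
    have hc : cT s a b = -cT t a b := by rw [ho, cT_opp, neg_neg]
    rw [hc] at h1
    rcases mul_eq_zero.1 h1 with h2 | h2
    · right; linarith
    · left; exact_mod_cast (by linarith : (n : ℝ) + k + 1 = 0)
  exfalso
  -- For types neither equal nor opposite, half the difference and half the sum of the two `cT` are
  -- `±a` and `±b` in some order, so either factor in `h1` would make `a` or `b` an integer.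
  have key : ∀ m : ℤ, a ≠ m ∧ b ≠ m := fun m => ⟨fun h => ha ⟨m, h⟩, fun h => hb ⟨m, h⟩⟩
  have k1 := key (n - k)
  have k2 := key (k - n)
  have k3 := key (n + k + 1)
  have k4 := key (-(n + k + 1))
  push_cast at k1 k2 k3 k4
  cases s <;> cases t <;> first
    | exact hs rfl
    | exact ho rfl
    | (simp only [cT, AType.sgnP, AType.sgnM] at h1
       push_cast at h1
       rcases mul_eq_zero.1 h1 with h2 | h2 <;> first
        | exact k1.1 (by linarith)
        | exact k1.2 (by linarith)
        | exact k2.1 (by linarith)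
        | exact k2.2 (by linarith)
        | exact k3.1 (by linarith)
        | exact k3.2 (by linarith)
        | exact k4.1 (by linarith)
        | exact k4.2 (by linarith))

theorem isInt_of_add_eq {x : ℝ} {n m : ℤ} (h : (n : ℝ) + x = m) : IsInt x :=
  ⟨m - n, by push_cast; linarith⟩

/-- Of the coincidences in `eN_eq_cases`, two are excluded by the definition of `NPlus`, one by `n,
k ≥ 0`, and `n + k + 1 + c = 0` by `n + c ≥ 0`. -/
theorem NPlus.eN_ne {a b : ℝ} (ha : ¬ IsInt a) (hb : ¬ IsInt b) {l : List (AType × ℕ)} {t : AType}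
    {n : ℕ} (h : NPlus a b l t n) {s : AType × ℕ} (hs : s ∈ l) :
    eN a b t n ≠ eN a b s.1 s.2 := by
  intro he
  obtain ⟨s, k⟩ := s
  obtain ⟨hu, hm, ho⟩ := h
  rcases eN_eq_cases (n := n) (k := k) ha hb (by exact_mod_cast he) with
    ⟨rfl, h1 | h1⟩ | ⟨rfl, h1 | h1⟩
  · obtain rfl : n = k := by exact_mod_cast h1
    exact hm hs
  · push_cast at h1
    have := hu (isInt_of_add_eq (n := n + k + 1) (m := 0) (by push_cast; linarith))
    have : (0 : ℝ) ≤ k := Nat.cast_nonneg k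
    linarith
  · omega
  · refine ho k (by simpa using hs) (by exact_mod_cast h1)

theorem eig_base {a : ℝ} (ha : ¬ IsInt a) (b : ℝ) (s : AType × ℕ) :
    Eig 0 a b s.1 (eN a b s.1 s.2) (base a b s) := eig_jacobiF ha s.1 s.2

/-- The second claim applies to the seeds and is needed for the first. The first covers functions at
a seed eigenvalue, where the transform may vanish; the type 1 functions sharing the eigenvalue of a
type 2 seed are of this kind. -/
theorem eig_FL_aux {a b : ℝ} (ha : ¬ IsInt a) (hb : ¬ IsInt b) {l : List (AType × ℕ)}
    (hl : Good a b l) :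
    (∀ t E f, Eig 0 a b t E f → FL a b l t f = 0 ∨ Eig (uL a b l) (αL a l) (βL b l) t E (FL a b l t f)) ∧
    (∀ t E f, Eig 0 a b t E f → (∀ s ∈ l, E ≠ eN a b s.1 s.2) →
      Eig (uL a b l) (αL a l) (βL b l) t E (FL a b l t f)) := by
  induction l with
  | nil =>
    rw [αL_nil, βL_nil]
    exact ⟨fun t E f h => Or.inr h, fun t E f h _ => h⟩
  | cons s l ih =>
    obtain ⟨ih1, ih2⟩ := ih hl.1
    have hg : Eig (uL a b l) (αL a l) (βL b l) s.1 _ (SL a b l s) :=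
      ih2 _ _ _ (eig_base ha b s) fun r hr => hl.2.eN_ne ha hb hr
    constructor
    · intro t E f hf
      by_cases h0 : FL a b (s :: l) t f = 0
      · exact Or.inl h0
      right
      rcases ih1 t E f hf with h | h
      · exact absurd (by rw [FL_cons, h, dstep]; simp) h0
      · rw [αL_cons, βL_cons]
        refine h.darboux hg fun h' => h0 ?_
        rw [FL_cons, dstep_eq _ _ _ _ _ h.1, h', sub_self]; simp
    · intro t E f hf hE
      have h := ih2 t E f hf fun r hr => hE r (List.mem_cons_of_mem s hr)
      rw [αL_cons, βL_cons]
      exact h.darboux hg (h.ne_of_energy hg (hE s List.mem_cons_self))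

theorem eig_FL {a b : ℝ} (ha : ¬ IsInt a) (hb : ¬ IsInt b) {l : List (AType × ℕ)}
    (hl : Good a b l) {t : AType} {E : ℝ} {f : RatFunc ℝ} (hf : Eig 0 a b t E f)
    (h0 : FL a b l t f ≠ 0) : Eig (uL a b l) (αL a l) (βL b l) t E (FL a b l t f) :=
  ((eig_FL_aux ha hb hl).1 t E f hf).resolve_left h0

theorem eig_FL_of_ne {a b : ℝ} (ha : ¬ IsInt a) (hb : ¬ IsInt b) {l : List (AType × ℕ)}
    (hl : Good a b l) {t : AType} {E : ℝ} {f : RatFunc ℝ} (hf : Eig 0 a b t E f)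
    (hE : ∀ s ∈ l, E ≠ eN a b s.1 s.2) : Eig (uL a b l) (αL a l) (βL b l) t E (FL a b l t f) :=
  (eig_FL_aux ha hb hl).2 t E f hf hE

theorem eig_SL {a b : ℝ} (ha : ¬ IsInt a) (hb : ¬ IsInt b) {l : List (AType × ℕ)} {s : AType × ℕ}
    (hl : Good a b (s :: l)) :
    Eig (uL a b l) (αL a l) (βL b l) s.1 (eN a b s.1 s.2) (SL a b l s) :=
  eig_FL_of_ne ha hb hl.1 (eig_base ha b s) fun _ hr => hl.2.eN_ne ha hb hr

theorem tauL_ne_zero {a b : ℝ} (ha : ¬ IsInt a) (hb : ¬ IsInt b) {l : List (AType × ℕ)}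
    (hl : Good a b l) : tauL a b l ≠ 0 := by
  induction l with
  | nil => exact one_ne_zero
  | cons s l ih => exact mul_ne_zero (ih hl.1) (eig_SL ha hb hl).1

theorem uL_eq {a b : ℝ} (ha : ¬ IsInt a) (hb : ¬ IsInt b) {l : List (AType × ℕ)}
    (hl : Good a b l) : uL a b l = ld (tauL a b l) := by
  induction l with
  | nil => simp [uL, tauL]
  | cons s l ih =>
    rw [uL, tauL, ih hl.1, ld_mul (tauL_ne_zero ha hb hl.1) (eig_SL ha hb hl).1]

/-- The indicial argument of `Eig.unitAt` needs a `u` regular at `±1`. By induction this holds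
because the earlier seed functions have neither zeros nor poles there. -/
theorem unitAt_tauL {a b : ℝ} (ha : ¬ IsInt a) (hb : ¬ IsInt b) {l : List (AType × ℕ)}
    (hl : Good a b l) : UnitAt 1 (tauL a b l) ∧ UnitAt (-1) (tauL a b l) := by
  induction l with
  | nil =>
    have : ∀ c, UnitAt c (tauL a b []) := fun c => by simpa [tauL] using unitAt_C c one_ne_zero
    exact ⟨this _, this _⟩
  | cons s l ih =>
    obtain ⟨h1, h2⟩ := ih hl.1
    have h3 := (eig_SL ha hb hl).unitAt (not_isInt_αL ha l) (not_isInt_βL hb l)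
      (by rw [uL_eq ha hb hl.1]; exact h1.ld) (by rw [uL_eq ha hb hl.1]; exact h2.ld)
    exact ⟨h1.mul h3.1, h2.mul h3.2⟩

theorem Eig.unitAt_uL {a b : ℝ} (ha : ¬ IsInt a) (hb : ¬ IsInt b) {l : List (AType × ℕ)}
    (hl : Good a b l) {t : AType} {E : ℝ} {f : RatFunc ℝ}
    (hf : Eig (uL a b l) (αL a l) (βL b l) t E f) : UnitAt 1 f ∧ UnitAt (-1) f := by
  have h := unitAt_tauL ha hb hl
  rw [uL_eq ha hb hl] at hf
  exact hf.unitAt (not_isInt_αL ha l) (not_isInt_βL hb l) h.1.ld h.2.ld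

theorem Eig.eigenvalue_uL {a b : ℝ} (ha : ¬ IsInt a) (hb : ¬ IsInt b) {l : List (AType × ℕ)}
    (hl : Good a b l) {t : AType} {E : ℝ} {f : RatFunc ℝ} {n : ℤ}
    (hf : Eig (uL a b l) (αL a l) (βL b l) t E f) (hn : f.intDegree = n - sh l t) :
    E = eN a b t n := by
  rw [uL_eq ha hb hl] at hf
  have := hf.eigenvalue (hasLead_ld (tauL_ne_zero ha hb hl))
  rw [hn, zdeg_sh] at this
  exact this

/-- The degree in the symmetric gauge of a seed function. -/
def zN (a b : ℝ) (s : AType × ℕ) : ℝ := s.2 + cT s.1 a b / 2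

theorem eN_eq_zN (a b : ℝ) (s : AType × ℕ) : eN a b s.1 s.2 = zN a b s * (zN a b s + 1) := rfl

/-- The formula of `hasLead_FL` for `l` enters as a hypothesis, so that this can be used inside the
induction proving it. -/
theorem intDegree_SL_aux {a b : ℝ} (ha : ¬ IsInt a) (hb : ¬ IsInt b) {l : List (AType × ℕ)}
    {s : AType × ℕ} (hl : Good a b (s :: l))
    (h : ∀ t f (n : ℤ) c, HasLead f n c → HasLead (FL a b l t f) (n - sh l t)
      (c * (l.map fun r => n + cT t a b / 2 - zN a b r).prod)) :
    (SL a b l s).intDegree = s.2 - sh l s.1 := by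
  refine (h s.1 (base a b s) s.2 _ (hasLead_jacobiF _ _ _)).intDegree_eq (mul_ne_zero ?_ ?_)
  · exact jlead_ne_zero (Or.inr hl.2.1)
  · refine List.prod_ne_zero fun h0 => ?_
    obtain ⟨r, hr, h0⟩ := List.mem_map.1 h0
    refine hl.2.eN_ne ha hb hr ?_
    rw [eN_eq_zN a b r, ← sub_eq_zero.1 h0, eN]
    push_cast; ring

theorem hasLead_FL_cons {a b : ℝ} (ha : ¬ IsInt a) (hb : ¬ IsInt b) {l : List (AType × ℕ)}
    {s : AType × ℕ} (hl : Good a b (s :: l)) (hd : (SL a b l s).intDegree = s.2 - sh l s.1)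
    {t : AType} {f : RatFunc ℝ} {n : ℤ} {c : ℝ} (h : HasLead (FL a b l t f) (n - sh l t) c) :
    HasLead (FL a b (s :: l) t f) (n - sh (s :: l) t) (c * (n + cT t a b / 2 - zN a b s)) := by
  have h1 := hasLead_dstep (α := αL a l) (β := βL b l) (s := s.1) (t := t) (eig_SL ha hb hl).1 h
  rw [hd, zdeg_sh, zdeg_sh] at h1
  rw [FL_cons, sh_cons, zN]
  convert h1 using 1
  · ring
  · push_cast; ring

/-- There is one factor per seed, the difference of two symmetric-gauge degrees, and by `zdeg_sh`
these do not change along the steps. -/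
theorem hasLead_FL {a b : ℝ} (ha : ¬ IsInt a) (hb : ¬ IsInt b) {l : List (AType × ℕ)}
    (hl : Good a b l) : ∀ t f (n : ℤ) c, HasLead f n c → HasLead (FL a b l t f) (n - sh l t)
      (c * (l.map fun r => n + cT t a b / 2 - zN a b r).prod) := by
  induction l with
  | nil => intro t f n c h; simpa [sh, FL] using h
  | cons s l ih =>
    intro t f n c h
    have h1 := hasLead_FL_cons ha hb hl (intDegree_SL_aux ha hb hl (ih hl.1)) (ih hl.1 t f n c h)
    rw [List.map_cons, List.prod_cons]
    convert h1 using 1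
    ring

theorem intDegree_SL {a b : ℝ} (ha : ¬ IsInt a) (hb : ¬ IsInt b) {l : List (AType × ℕ)}
    {s : AType × ℕ} (hl : Good a b (s :: l)) : (SL a b l s).intDegree = s.2 - sh l s.1 :=
  intDegree_SL_aux ha hb hl (hasLead_FL ha hb hl.1)

/-! ### Squares of eigenfunctions modulo exact forms -/

/-- The factor by which the transformations multiply the norm of an eigenfunction. -/
def normFac (a b : ℝ) (l : List (AType × ℕ)) (E : ℝ) : ℝ :=
  (l.map fun s => eN a b s.1 s.2 - E).prod

theorem normFac_cons (a b : ℝ) (s : AType × ℕ) (l : List (AType × ℕ)) (E : ℝ) :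
    normFac a b (s :: l) E = (eN a b s.1 s.2 - E) * normFac a b l E := by
  simp [normFac]

theorem normFac_ne_zero {a b : ℝ} {l : List (AType × ℕ)} {E : ℝ}
    (h : ∀ s ∈ l, E ≠ eN a b s.1 s.2) : normFac a b l E ≠ 0 := by
  refine List.prod_ne_zero fun h0 => ?_
  obtain ⟨r, hr, h0⟩ := List.mem_map.1 h0
  exact h r hr (sub_eq_zero.1 h0).symm

/-- The ratio of the weights for the transformed and the original parameters. -/
def wL (l : List (AType × ℕ)) (t : AType) : RatFunc ℝ :=
  mono (t.sgnP * sumP l) (t.sgnM * sumM l)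

theorem wL_nil (t : AType) : wL [] t = 1 := by simp [wL, sumP, sumM, mono]

theorem ratDeriv_wL (l : List (AType × ℕ)) (t : AType) :
    ratDeriv (wL l t) = ld (wL l t) * wL l t := ratDeriv_eq_ld_mul (mono_ne_zero _ _)

theorem gauge_sq_wL (s : AType × ℕ) (l : List (AType × ℕ)) (t : AType) :
    gauge s.1 t ^ 2 * wL (s :: l) t = pJ * wL l t := by
  rw [wL, wL, gauge_eq_mono, pow_two, ← mono_add, ← mono_add, sumP_cons, sumM_cons]
  have h1 := gapP_cast s.1 t
  have h2 := gapM_cast s.1 t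
  have : pJ = mono 1 1 := by rw [pJ_eq]; simp [mono]
  rw [this, ← mono_add]
  congr 1
  · linear_combination h1
  · linear_combination h2

theorem ld_wL (l : List (AType × ℕ)) (t : AType) (a b : ℝ) :
    ld (wL l t) + (RatFunc.C (t.sgnP * a) * eP + RatFunc.C (t.sgnM * b) * eM) =
      2 * omg t (αL a l) (βL b l) := by
  rw [wL, ld_mono, omg, αL, βL]
  simp only [map_div₀, map_mul, map_add, map_intCast, map_ofNat, Int.cast_mul]
  ring

/-- Formal version of `‖A y‖² = (E₀ - E) ‖y‖²` for the first-order Darboux operator `A`; the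
boundary term `p y² (w - w₀)` is the antiderivative. At a seed eigenvalue the factor is zero. -/
theorem ex_FL_sq {a b : ℝ} (ha : ¬ IsInt a) (hb : ¬ IsInt b) {l : List (AType × ℕ)}
    (hl : Good a b l) {t : AType} {E : ℝ} {f : RatFunc ℝ} (hf : Eig 0 a b t E f) :
    Ex (t.sgnP * a) (t.sgnM * b) (FL a b l t f ^ 2 * wL l t - RatFunc.C (normFac a b l E) * f ^ 2) := by
  induction l with
  | nil =>
    have : FL a b [] t f ^ 2 * wL [] t - RatFunc.C (normFac a b [] E) * f ^ 2 = 0 := by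
      rw [wL_nil]; simp [FL, normFac]
    rw [this]; exact Ex.zero _ _
  | cons s l ih =>
    have ih' := ih hl.1
    have hg := eig_SL ha hb hl
    rcases (eig_FL_aux ha hb hl.1).1 t E f hf with h0 | hF
    · rw [h0] at ih'
      rw [FL_cons, h0]
      convert ih'.C_mul (eN a b s.1 s.2 - E) using 1
      rw [dstep, normFac_cons, map_mul]; simp; ring
    · set F := FL a b l t f with hFdef
      set w := ld F + omg t (αL a l) (βL b l) with hw
      set w₀ := ld (SL a b l s) + omg s.1 (αL a l) (βL b l) with hw₀
      have hex : Ex (t.sgnP * a) (t.sgnM * b) (F ^ 2 * wL l t * RatFunc.C (E - eN a b s.1 s.2) +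
          FL a b (s :: l) t f ^ 2 * wL (s :: l) t) := by
        refine ⟨pJ * F ^ 2 * (w - w₀) * wL l t, ?_⟩
        have hd := hF.2.sub_deriv hg.2
        rw [← hw, ← hw₀] at hd
        have hm := ld_wL l t a b
        have hgw := gauge_sq_wL s l t
        rw [FL_cons, dstep_eq _ _ _ _ _ hF.1, ratDeriv_mul, ratDeriv_mul, ratDeriv_mul, pow_two,
          ratDeriv_mul, ratDeriv_eq_ld_mul hF.1, ratDeriv_wL,
          ratDeriv_pJ, ← hw, ← hw₀]
        have hlF : ld F = w - omg t (αL a l) (βL b l) := by rw [hw]; ring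
        rw [hlF]
        linear_combination (F ^ 2 * wL l t) * hd - (F ^ 2 * (w - w₀) ^ 2) * hgw +
          (pJ * F ^ 2 * (w - w₀) * wL l t) * hm
      convert hex.add (ih'.C_mul (eN a b s.1 s.2 - E)) using 1
      rw [normFac_cons]
      simp only [map_mul, map_sub]
      ring

theorem eN_ne_of_good {a b : ℝ} (ha : ¬ IsInt a) (hb : ¬ IsInt b) {l : List (AType × ℕ)}
    {s : AType × ℕ} (hl : Good a b (s :: l)) : ∀ r ∈ l, eN a b s.1 s.2 ≠ eN a b r.1 r.2 :=
  fun _ hr => hl.2.eN_ne ha hb hr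

/-- The square of a transformed seed function has no rational antiderivative. -/
theorem no_primitive_SL {a b : ℝ} (ha : ¬ IsInt a) (hb : ¬ IsInt b) {l : List (AType × ℕ)}
    {s : AType × ℕ} (hl : Good a b (s :: l)) :
    ¬ ∃ h, ratDeriv h + 2 * (ld (SL a b l s) + omg s.1 (αL a l) (βL b l)) * h = 1 := by
  rintro ⟨h, hh⟩
  have h1 : Ex (s.1.sgnP * a) (s.1.sgnM * b) (SL a b l s ^ 2 * wL l s.1) := by
    refine ⟨h * SL a b l s ^ 2 * wL l s.1, ?_⟩
    have hm := ld_wL l s.1 a b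
    rw [ratDeriv_mul, ratDeriv_mul, pow_two, ratDeriv_mul, ratDeriv_eq_ld_mul (eig_SL ha hb hl).1,
      ratDeriv_wL]
    linear_combination (SL a b l s ^ 2 * wL l s.1) * hh + (h * SL a b l s ^ 2 * wL l s.1) * hm
  have h2 := h1.sub (ex_FL_sq ha hb hl.1 (eig_base ha b s))
  rw [← SL, sub_sub_cancel] at h2
  exact not_ex_jacobiF_sq (not_isInt_sgnP ha s.1) (not_isInt_sgnM hb s.1) hl.2.1
    (h2.of_C_mul (normFac_ne_zero (eN_ne_of_good ha hb hl)))

/-! ### All Riccati solutions -/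

/-- A second solution at the seed eigenvalue would integrate the square of the seed function, which
`no_primitive_SL` forbids. -/
theorem SRV.eq_dual {a b : ℝ} (ha : ¬ IsInt a) (hb : ¬ IsInt b) {l : List (AType × ℕ)}
    {s : AType × ℕ} (hl : Good a b (s :: l)) {w : RatFunc ℝ}
    (hw : SRV (potV (uL a b (s :: l)) (αL a (s :: l)) (βL b (s :: l))) (eN a b s.1 s.2) w) :
    w = ld (SL a b l s)⁻¹ + omg s.1.opp (αL a (s :: l)) (βL b (s :: l)) := by
  have hg := eig_SL ha hb hl
  rw [αL_cons, βL_cons, Eig.dual_eq hg.1]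
  by_contra hne
  rw [uL, αL_cons, βL_cons, ← darbouxV_potV] at hw
  exact no_primitive_SL ha hb hl (hg.2.exists_primitive hw hne)

/-- At the eigenvalue of the last seed the solution is the dual seed; elsewhere it is pulled back by
the inverse step, until the classical operator is reached. -/
theorem exists_eig_of_srv {a b : ℝ} (ha : ¬ IsInt a) (hb : ¬ IsInt b) {l : List (AType × ℕ)}
    (hl : Good a b l) {E : ℝ} {w : RatFunc ℝ}
    (hw : SRV (potV (uL a b l) (αL a l) (βL b l)) E w) :
    ∃ t f, Eig (uL a b l) (αL a l) (βL b l) t E f ∧ w = ld f + omg t (αL a l) (βL b l) := by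
  induction l generalizing w with
  | nil =>
    rw [αL_nil, βL_nil, uL] at hw ⊢
    obtain ⟨t, P, h1, h2⟩ := exists_eig_of_srv_zero hw
    exact ⟨t, _, h1, h2⟩
  | cons s l ih =>
    have hg := eig_SL ha hb hl
    by_cases hE : E = eN a b s.1 s.2
    · subst hE
      refine ⟨_, _, ?_, hw.eq_dual ha hb hl⟩
      rw [αL_cons, βL_cons]; exact hg.dual
    · rw [uL, αL_cons, βL_cons] at hw ⊢
      rw [← darbouxV_potV] at hw
      obtain ⟨v, hv, hne, rfl⟩ := hg.2.exists_darboux hw hE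
      obtain ⟨t, f, hf, rfl⟩ := ih hl.1 hv
      exact ⟨t, _, hf.darboux hg hne, (ld_dstep hf.1 hne).symm⟩

theorem intDegree_dstep {α β E E₀ T : ℝ} {s t : AType} {u f g : RatFunc ℝ} (hu : HasLead u (-1) T)
    (hf : Eig u α β t E f) (hg : Eig u α β s E₀ g) (hE : E ≠ E₀) :
    (dstep α β s g t f).intDegree = f.intDegree - sg s t := by
  obtain ⟨c, hc, hl⟩ := exists_hasLead hf.1
  refine (hasLead_dstep hg.1 hl).intDegree_eq (mul_ne_zero hc fun h => hE ?_)
  rw [hf.eigenvalue hu, hg.eigenvalue hu, sub_eq_zero.1 h]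

/-- The (unshifted) indices of the type `t` eigenfunctions. -/
def Ind (a b : ℝ) (l : List (AType × ℕ)) (t : AType) : Set ℤ :=
  {n | ∃ E f, Eig (uL a b l) (αL a l) (βL b l) t E f ∧ f.intDegree = n - sh l t}

theorem hasLead_uL {a b : ℝ} (ha : ¬ IsInt a) (hb : ¬ IsInt b) {l : List (AType × ℕ)}
    (hl : Good a b l) : HasLead (uL a b l) (-1) (tauL a b l).intDegree := by
  rw [uL_eq ha hb hl]; exact hasLead_ld (tauL_ne_zero ha hb hl)

/-- Away from the seed eigenvalue the step is a bijection on solutions and keeps type and unshifted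
index. At that eigenvalue only the dual function remains. -/
theorem mem_Ind_cons {a b : ℝ} (ha : ¬ IsInt a) (hb : ¬ IsInt b) {l : List (AType × ℕ)}
    {s : AType × ℕ} (hl : Good a b (s :: l)) (t : AType) (n : ℤ) :
    n ∈ Ind a b (s :: l) t ↔ (n ∈ Ind a b l t ∧ eN a b t n ≠ eN a b s.1 s.2) ∨
      (t = s.1.opp ∧ n = -(s.2 : ℤ) - 1) := by
  have hg := eig_SL ha hb hl
  have hu := hasLead_uL ha hb hl.1
  have hα := not_isInt_αL ha (s :: l)
  have hβ := not_isInt_βL hb (s :: l)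
  constructor
  · rintro ⟨E, f, hf, hn⟩
    by_cases hE : E = eN a b s.1 s.2
    · right
      subst hE
      have h1 := hf.2.eq_dual ha hb hl
      obtain rfl := type_eq_of_eq hα hβ hf.1 (inv_ne_zero hg.1) h1
      refine ⟨rfl, ?_⟩
      have h2 : ld f = ld (SL a b l s)⁻¹ := add_right_cancel h1
      obtain ⟨c, hc, rfl⟩ := eq_C_mul_of_ld_eq hf.1 (inv_ne_zero hg.1) h2
      rw [RatFunc.intDegree_mul (by simpa using hc) (inv_ne_zero hg.1), RatFunc.intDegree_C,
        RatFunc.intDegree_inv, intDegree_SL ha hb hl, sh_cons, sg_opp, sh_opp, sg_self] at hn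
      linarith
    · left
      have hE' := hf.eigenvalue_uL ha hb hl hn
      refine ⟨?_, hE' ▸ hE⟩
      have hw := hf.2
      rw [uL, αL_cons, βL_cons, ← darbouxV_potV] at hw
      obtain ⟨v, hv, hne, hv'⟩ := hg.2.exists_darboux hw hE
      obtain ⟨t', f', hf', rfl⟩ := exists_eig_of_srv ha hb hl.1 hv
      rw [← ld_dstep hf'.1 hne] at hv'
      rw [αL_cons] at hα
      rw [βL_cons] at hβ
      have h0 := dstep_ne_zero hf'.1 hne
      obtain rfl := type_eq_of_eq hα hβ hf.1 h0 hv'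
      obtain ⟨c, hc, rfl⟩ := eq_C_mul_of_ld_eq hf.1 h0 (add_right_cancel hv')
      rw [RatFunc.intDegree_mul (by simpa using hc) h0, RatFunc.intDegree_C,
        intDegree_dstep hu hf' hg hE, sh_cons] at hn
      exact ⟨E, f', hf', by linarith⟩
  · rintro (⟨⟨E, f, hf, hn⟩, hE⟩ | ⟨rfl, rfl⟩)
    · rw [← hf.eigenvalue_uL ha hb hl.1 hn] at hE
      refine ⟨E, dstep (αL a l) (βL b l) s.1 (SL a b l s) t f, ?_, ?_⟩
      · rw [αL_cons, βL_cons]; exact hf.darboux hg (hf.ne_of_energy hg hE)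
      · rw [intDegree_dstep hu hf hg hE, sh_cons, hn]; ring
    · refine ⟨eN a b s.1 s.2, (SL a b l s)⁻¹, ?_, ?_⟩
      · rw [αL_cons, βL_cons]; exact hg.dual
      · rw [RatFunc.intDegree_inv, intDegree_SL ha hb hl, sh_cons, sg_opp, sh_opp, sg_self]
        ring

/-- This is why steps never delete lower indices: every coincidence in `eN_eq_cases` contradicts the
inequalities defining the two parts or the sign of the indices. -/
theorem eN_ne_of_lower {a b : ℝ} (ha : ¬ IsInt a) (hb : ¬ IsInt b) {s : AType × ℕ}
    (hu : s.2 ∈ upperIdx (cT s.1 a b)) {t : AType} {m : ℕ} (hm : m ∈ lowerIdx (cT t a b)) :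
    eN a b t m ≠ eN a b s.1 s.2 := by
  intro he
  obtain ⟨hi, hm⟩ := hm
  have hm0 : (0 : ℝ) ≤ m := Nat.cast_nonneg m
  have hs0 : (0 : ℝ) ≤ s.2 := Nat.cast_nonneg _
  rcases eN_eq_cases (n := m) (k := s.2) ha hb (by exact_mod_cast he) with
    ⟨rfl, h1 | h1⟩ | ⟨rfl, h1 | h1⟩
  · obtain rfl : m = s.2 := by exact_mod_cast h1
    have := hu hi
    linarith
  · have := hu hi
    push_cast at h1
    linarith
  · omega
  · rw [cT_opp, isInt_neg_iff] at hi
    have := hu hi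
    rw [cT_opp] at h1 hm
    push_cast at h1
    linarith

theorem NMinus.eN_ne {a b : ℝ} (ha : ¬ IsInt a) (hb : ¬ IsInt b) {l : List (AType × ℕ)}
    {s : AType × ℕ} (hl : Good a b (s :: l)) {t : AType} {n : ℤ} (h : NMinus a b l t n) :
    eN a b t n ≠ eN a b s.1 s.2 := by
  rcases h with ⟨m, rfl, hm⟩ | ⟨k, hk, rfl⟩
  · exact_mod_cast eN_ne_of_lower ha hb hl.2.1 hm
  · have h1 : eN a b t ((-(k : ℤ) - 1 : ℤ) : ℝ) = eN a b t.opp k := by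
      rw [← eN_dual a b t.opp k, AType.opp_opp]; push_cast; rfl
    rw [h1]
    exact (eN_ne_of_good ha hb hl _ hk).symm

/-- Unrolls `mem_Ind_cons`. Lower indices survive all steps, and an upper index `n` of type `t` is
deleted exactly by the seed `(t, n)` or by a seed of the opposite type with index `n + c`. -/
theorem mem_Ind_iff {a b : ℝ} (ha : ¬ IsInt a) (hb : ¬ IsInt b) {l : List (AType × ℕ)}
    (hl : Good a b l) (t : AType) (n : ℤ) :
    n ∈ Ind a b l t ↔ NMinus a b l t n ∨ ∃ m : ℕ, n = m ∧ NPlus a b l t m := by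
  induction l with
  | nil =>
    have h0 := exists_eig_zero_iff ha hb t n
    rw [Ind, mem_ofPred_eq, uL, αL_nil, βL_nil, show n - sh [] t = n by simp [sh], h0]
    clear h0
    simp only [NMinus, NPlus, List.not_mem_nil, mem_union]
    constructor
    · rintro ⟨m, rfl, h | h⟩
      · exact Or.inl (Or.inl ⟨m, rfl, h⟩)
      · exact Or.inr ⟨m, rfl, h, by simp⟩
    · rintro ((⟨m, rfl, h⟩ | ⟨k, hk, _⟩) | ⟨m, rfl, h, _⟩)
      · exact ⟨m, rfl, Or.inl h⟩
      · exact hk.elim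
      · exact ⟨m, rfl, Or.inr h⟩
  | cons s l ih =>
    rw [mem_Ind_cons ha hb hl, ih hl.1]
    constructor
    · rintro (⟨h | ⟨m, rfl, h⟩, hE⟩ | ⟨rfl, rfl⟩)
      · left
        rcases h with h | ⟨k, hk, h⟩
        · exact Or.inl h
        · exact Or.inr ⟨k, List.mem_cons_of_mem _ hk, h⟩
      · right
        refine ⟨m, rfl, h.1, ?_, ?_⟩
        · rw [List.mem_cons, not_or]
          exact ⟨by rintro rfl; exact hE rfl, h.2.1⟩
        · intro k hk he
          rcases List.mem_cons.1 hk with rfl | hk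
          · refine hE ?_
            simp only [eN, cT_opp]
            push_cast
            rw [show (m : ℝ) = k - cT t a b by linarith]
            ring
          · exact h.2.2 k hk he
      · exact Or.inl (Or.inr ⟨s.2, by simp, rfl⟩)
    · rintro (h | ⟨m, rfl, h⟩)
      · have : NMinus a b l t n ∨ (t = s.1.opp ∧ n = -(s.2 : ℤ) - 1) := by
          rcases h with h | ⟨k, hk, h⟩
          · exact Or.inl (Or.inl h)
          · rcases List.mem_cons.1 hk with hk | hk
            · right
              rw [← hk]
              exact ⟨by simp, h⟩
            · exact Or.inl (Or.inr ⟨k, hk, h⟩)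
        rcases this with h | h
        · exact Or.inl ⟨Or.inl h, h.eN_ne ha hb hl⟩
        · exact Or.inr h
      · left
        refine ⟨Or.inr ⟨m, rfl, h.1, fun h' => h.2.1 (List.mem_cons_of_mem _ h'),
          fun k hk => h.2.2 k (List.mem_cons_of_mem _ hk)⟩, ?_⟩
        have := h.eN_ne ha hb (List.mem_cons_self (a := s) (l := l))
        exact_mod_cast this

/-! ### The constant Wronskian of a pair of eigenfunctions of types one and two -/

theorem gauge_mul_gauge_opp (s t : AType) : gauge s t * gauge s t.opp = pJ := by
  cases s <;> cases t <;> simp [gauge, gap, AType.sgnP, AType.sgnM, AType.opp, pJ_eq, mul_comm]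

/-- `p (y₁' y₂ - y₁ y₂')` for the symmetric gauge functions `y₁, y₂` of types `t`, `t.opp` with
regular parts `f₁, f₂`. -/
def kap (α β : ℝ) (t : AType) (f₁ f₂ : RatFunc ℝ) : RatFunc ℝ :=
  pJ * (ratDeriv f₁ * f₂ - f₁ * ratDeriv f₂ + (omg t α β - omg t.opp α β) * (f₁ * f₂))

theorem kap_eq {α β : ℝ} {t : AType} {f₁ f₂ : RatFunc ℝ} (h1 : f₁ ≠ 0) (h2 : f₂ ≠ 0) :
    kap α β t f₁ f₂ = pJ * (f₁ * f₂) * (ld f₁ + omg t α β - (ld f₂ + omg t.opp α β)) := by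
  rw [kap, ratDeriv_eq_ld_mul h1, ratDeriv_eq_ld_mul h2]; ring

theorem omg_add_omg_opp (t : AType) (α β : ℝ) : omg t α β + omg t.opp α β = 0 := by
  rw [omg, omg, AType.sgnP_opp, AType.sgnM_opp]
  push_cast
  simp only [neg_mul, neg_div, map_neg]
  ring

/-- Abel's identity for an operator in self-adjoint form; the singular parts of opposite types
cancel, which keeps the Wronskian rational. -/
theorem ratDeriv_kap {α β E : ℝ} {u : RatFunc ℝ} {t : AType} {f₁ f₂ : RatFunc ℝ}
    (h1 : Eig u α β t E f₁) (h2 : Eig u α β t.opp E f₂) : ratDeriv (kap α β t f₁ f₂) = 0 := by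
  have h := h1.2.sub_deriv h2.2
  have ho := omg_add_omg_opp t α β
  rw [sub_self, map_zero] at h
  rw [kap_eq h1.1 h2.1, ratDeriv_mul, ratDeriv_mul, ratDeriv_mul, ratDeriv_eq_ld_mul h1.1,
    ratDeriv_eq_ld_mul h2.1, ratDeriv_pJ]
  linear_combination (f₁ * f₂) * h - pJ * f₁ * f₂ *
    (ld f₁ + omg t α β - (ld f₂ + omg t.opp α β)) * ho

/-- Computed from `SRV.darbouxW_eq`: the summand `dual w₀` is common to both transforms and drops
out of their difference. -/
theorem kap_dstep {α β E E₀ : ℝ} {u : RatFunc ℝ} {s t : AType} {f₁ f₂ g : RatFunc ℝ}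
    (h1 : Eig u α β t E f₁) (h2 : Eig u α β t.opp E f₂) (hg : Eig u α β s E₀ g) (hE : E ≠ E₀) :
    kap (α + s.sgnP) (β + s.sgnM) t (dstep α β s g t f₁) (dstep α β s g t.opp f₂) =
      RatFunc.C (E₀ - E) * kap α β t f₁ f₂ := by
  have n1 := h1.ne_of_energy hg hE
  have n2 := h2.ne_of_energy hg hE
  rw [kap_eq (dstep_ne_zero h1.1 n1) (dstep_ne_zero h2.1 n2), kap_eq h1.1 h2.1, ld_dstep h1.1 n1,
    ld_dstep h2.1 n2, h1.2.darbouxW_eq hg.2 n1, h2.2.darbouxW_eq hg.2 n2,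
    dstep_eq _ _ _ _ _ h1.1, dstep_eq _ _ _ _ _ h2.1, ← neg_sub E E₀, map_neg]
  have hgg := gauge_mul_gauge_opp s t
  have hp := pJ_ne_zero
  have m1 := sub_ne_zero.2 n1
  have m2 := sub_ne_zero.2 n2
  generalize ld f₁ + omg t α β = w₁ at *
  generalize ld f₂ + omg t.opp α β = w₂ at *
  generalize ld g + omg s α β = w₀ at *
  have : ∀ d : RatFunc ℝ, d + RatFunc.C (E - E₀) / (pJ * (w₁ - w₀)) -
      (d + RatFunc.C (E - E₀) / (pJ * (w₂ - w₀))) =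
      RatFunc.C (E - E₀) * (w₂ - w₁) / (pJ * ((w₁ - w₀) * (w₂ - w₀))) := by
    intro d; field_simp; ring
  rw [this]
  field_simp
  linear_combination (f₁ * f₂ * RatFunc.C (E - E₀) * (w₂ - w₁)) * hgg

/-- A constant may be evaluated anywhere. At `x = 1` the factor `p` kills the derivatives, and only
the pole of the singular part contributes, giving `2a` times the values of the two polynomials. -/
theorem kap_base {a b : ℝ} (ha : ¬ IsInt a) {N k : ℕ} (hN : (N : ℝ) = k - (a + b)) :
    kap a b .one (jacobiF N a b) (jacobiF k (-a) (-b)) =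
      RatFunc.C (2 * a * (poch N (a + 1) / N.factorial) * (poch k (-a + 1) / k.factorial)) := by
  have h1 := eig_jacobiF (b := b) ha .one N
  have h2 := eig_jacobiF (b := b) ha .two k
  simp only [AType.sgnP, AType.sgnM, Int.cast_one, one_mul, Int.cast_neg, neg_mul, zdeg] at h1 h2
  have hE : ((k : ℝ) + (-a + -b) / 2) * ((k : ℝ) + (-a + -b) / 2 + 1) =
      ((N : ℝ) + (a + b) / 2) * ((N : ℝ) + (a + b) / 2 + 1) := by rw [hN]; ring
  rw [hE] at h2
  obtain ⟨c, hc⟩ := eq_C_of_ratDeriv_eq_zero (ratDeriv_kap h1 h2)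
  rw [hc]
  congr 1
  have hpoly : kap a b .one (jacobiF N a b) (jacobiF k (-a) (-b)) =
      algebraMap ℝ[X] (RatFunc ℝ) ((X ^ 2 - 1) * (derivative (jacobiP N a b) * jacobiP k (-a) (-b) -
        jacobiP N a b * derivative (jacobiP k (-a) (-b))) + (C a * (X + 1) + C b * (X - 1)) *
        (jacobiP N a b * jacobiP k (-a) (-b))) := by
    have hp := X_sub_one_ne_zero
    have hm := X_add_one_ne_zero
    rw [kap, jacobiF, jacobiF, ratDeriv_algebraMap, ratDeriv_algebraMap, omg, omg, pJ_eq, eP, eM]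
    simp only [AType.sgnP, AType.sgnM, AType.opp, map_add, map_mul, map_sub, map_pow, map_one,
      RatFunc.algebraMap_X, RatFunc.algebraMap_C, map_div₀, map_ofNat, Int.cast_one, Int.cast_neg,
      map_neg]
    field_simp
    ring
  rw [hpoly] at hc
  have h := congrArg (fun y => val y 1) hc
  simp only [val_algebraMap, val_C, eval_add, eval_mul, eval_sub, eval_pow, eval_X, eval_one, eval_C,
    jacobiP_eval_one] at h
  rw [← h]; ring

/-- The initial value of the constant Wronskian. -/
def kapZero (a : ℝ) (N k : ℕ) : ℝ :=
  2 * a * (poch N (a + 1) / N.factorial) * (poch k (-a + 1) / k.factorial)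

theorem eN_two_eq {a b : ℝ} {N k : ℕ} (hN : (N : ℝ) = k - (a + b)) :
    eN a b .two k = eN a b .one N := by
  simp only [eN, cT, AType.sgnP, AType.sgnM, hN]
  push_cast; ring

theorem kap_FL {a b : ℝ} (ha : ¬ IsInt a) (hb : ¬ IsInt b) {l : List (AType × ℕ)}
    (hl : Good a b l) {N k : ℕ} (hN : (N : ℝ) = k - (a + b))
    (hE : ∀ r ∈ l, eN a b .two k ≠ eN a b r.1 r.2) :
    kap (αL a l) (βL b l) .one (FL a b l .one (base a b (.one, N))) (FL a b l .two (base a b (.two, k))) =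
      RatFunc.C (kapZero a N k * normFac a b l (eN a b .two k)) := by
  induction l with
  | nil =>
    rw [αL_nil, βL_nil]
    simp only [FL, base, AType.sgnP, AType.sgnM, Int.cast_one, one_mul, Int.cast_neg, neg_mul]
    rw [kap_base ha hN]
    simp [normFac, kapZero]
  | cons s l ih =>
    have hE' : ∀ r ∈ l, eN a b .two k ≠ eN a b r.1 r.2 := fun r hr => hE r (List.mem_cons_of_mem s hr)
    have h2 := eig_FL_of_ne ha hb hl.1 (eig_base ha b (.two, k)) hE'
    have h1 := eig_FL_of_ne ha hb hl.1 (eig_base ha b (.one, N)) (by rwa [← eN_two_eq hN])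
    rw [← eN_two_eq hN] at h1
    rw [αL_cons, βL_cons, FL_cons, FL_cons]
    have := kap_dstep h1 h2 (eig_SL ha hb hl) (hE s List.mem_cons_self)
    rw [AType.opp] at this
    rw [this, normFac_cons]
    have ih' := ih hl.1 hE'
    rw [show kap (αL a l) (βL b l) .one (FL a b l .one (base a b (.one, N)))
      (FL a b l .two (base a b (.two, k))) = _ from ih', ← map_mul]
    congr 1; ring

/-- If `f` and `g` share an eigenvalue, the numerator is constant, and the transform of `f` is a
multiple of the dual seed `g⁻¹`. -/
theorem dstep_of_seed {α β : ℝ} {t : AType} {f g : RatFunc ℝ} (hf : f ≠ 0) (hg : g ≠ 0) :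
    dstep α β t.opp g t f = kap α β t f g / g := by
  have h := gauge_mul_gauge_opp t.opp t
  have h2 : gauge t.opp t.opp = 1 := by simp [gauge, gap]
  rw [h2, mul_one] at h
  rw [dstep_eq _ _ _ _ _ hf, kap_eq hf hg, h]
  field_simp

theorem normFac_eq (a b : ℝ) (l : List (AType × ℕ)) (z : ℝ) :
    normFac a b l (z * (z + 1)) =
      (l.map fun r => z - zN a b r).prod * (l.map fun r => -1 - z - zN a b r).prod := by
  rw [normFac, ← List.prod_map_mul]
  congr 2
  ext r
  rw [eN_eq_zN]; ring

/-- The leading coefficient of the type one eigenfunction which replaces a type two seed. -/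
theorem hasLead_FL_dual {a b : ℝ} (ha : ¬ IsInt a) (hb : ¬ IsInt b) {l : List (AType × ℕ)}
    (hl : Good a b l) {N k : ℕ} (hN : (N : ℝ) = k - (a + b)) (hk : (AType.two, k) ∈ l) :
    HasLead (FL a b l .one (base a b (.one, N))) ((-(k : ℤ) - 1) - sh l .one)
      (-kapZero a N k / (jlead k (-(a + b)) * (k + N + 1)) *
        (l.map fun r => ((-(k : ℤ) - 1 : ℤ) : ℝ) + cT .one a b / 2 - zN a b r).prod) := by
  induction l with
  | nil => simp at hk
  | cons s l ih =>
    -- When the seed `(.two, k)` acts, the factor in `hasLead_FL` is zero because both functions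
    -- have the same symmetric-gauge degree. The transform is a constant divided by the seed
    -- function, and its leading term is read off there; later seeds act as usual.
    rcases List.mem_cons.1 hk with rfl | hk'
    · have hE' := eN_ne_of_good ha hb hl
      have h2 := eig_FL_of_ne ha hb hl.1 (eig_base ha b (.two, k)) hE'
      have h1 := eig_FL_of_ne ha hb hl.1 (eig_base ha b (.one, N)) (by rwa [← eN_two_eq hN])
      have hkap := kap_FL ha hb hl.1 hN hE'
      have hd : FL a b ((.two, k) :: l) .one (base a b (.one, N)) =
          RatFunc.C (kapZero a N k * normFac a b l (eN a b .two k)) / SL a b l (.two, k) := by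
        rw [← hkap, FL_cons]
        exact dstep_of_seed (t := .one) h1.1 h2.1
      have hcT : cT .two a b = -(a + b) := by simp [cT, AType.sgnP, AType.sgnM]; ring
      have hcT1 : cT .one a b = a + b := by simp [cT, AType.sgnP, AType.sgnM]
      have hlead : HasLead (SL a b l (.two, k)) (k - sh l .two) _ :=
        hasLead_FL ha hb hl.1 .two _ k _ (hasLead_jacobiF k _ _)
      have hcc : ((AType.two.sgnP : ℤ) : ℝ) * a + ((AType.two.sgnM : ℤ) : ℝ) * b = -(a + b) := hcT
      rw [hcc] at hlead
      have hj : jlead k (-(a + b)) ≠ 0 := by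
        rw [← hcT]; exact jlead_ne_zero (Or.inr hl.2.1)
      have hp : (l.map fun r => ((k : ℤ) : ℝ) + cT .two a b / 2 - zN a b r).prod ≠ 0 := by
        refine List.prod_ne_zero fun h0 => ?_
        obtain ⟨r, hr, h0⟩ := List.mem_map.1 h0
        refine hE' r hr ?_
        rw [eN_eq_zN a b r, ← sub_eq_zero.1 h0, eN]
        push_cast; ring
      have := (hasLead_C (kapZero a N k * normFac a b l (eN a b .two k))).div hlead (mul_ne_zero hj hp)
      rw [hd]
      convert this using 1
      · rw [sh_cons, show sg AType.two .one = -1 by rw [show AType.two = AType.one.opp from rfl]; rfl,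
          show AType.two = AType.one.opp from rfl, sh_opp]; ring
      · have hkN : (k : ℝ) + N + 1 ≠ 0 := by positivity
        -- `normFac` splits into two products: the one over `z - z_r` cancels the product in the
        -- leading coefficient of the seed function, the one over `-1 - z - z_r` is the product at
        -- index `-k-1`.
        rw [show eN a b .two k = (((k : ℤ) : ℝ) + cT .two a b / 2) *
          (((k : ℤ) : ℝ) + cT .two a b / 2 + 1) by rw [eN]; push_cast; rfl, normFac_eq,
          List.map_cons, List.prod_cons]
        have e1 : (l.map fun r => ((-(k : ℤ) - 1 : ℤ) : ℝ) + cT .one a b / 2 - zN a b r) =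
            l.map fun r => -1 - (((k : ℤ) : ℝ) + cT .two a b / 2) - zN a b r := by
          refine List.map_congr_left fun r _ => ?_
          rw [hcT, hcT1]; push_cast; ring
        have e2 : ((-(k : ℤ) - 1 : ℤ) : ℝ) + cT .one a b / 2 - zN a b (.two, k) = -(k + N + 1) := by
          rw [zN, hcT, hcT1, hN]; push_cast; ring
        rw [e1, e2]
        generalize (l.map fun r => ((k : ℤ) : ℝ) + cT .two a b / 2 - zN a b r).prod = q at hp ⊢
        generalize (l.map fun r => -1 - (((k : ℤ) : ℝ) + cT .two a b / 2) - zN a b r).prod = q'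
        field_simp
    · have h := hasLead_FL_cons ha hb hl (intDegree_SL ha hb hl) (ih hl.1 hk')
      rw [List.map_cons, List.prod_cons]
      convert h using 1
      ring

/-! ### Wronskians of rational columns -/

/-- The derivative of a type `t` function, written in terms of its regular part. -/
def nab (a b : ℝ) (t : AType) (f : RatFunc ℝ) : RatFunc ℝ :=
  ratDeriv f + (omg t a b - omg .one a b) * f

theorem nab_add (a b : ℝ) (t : AType) (f g : RatFunc ℝ) :
    nab a b t (f + g) = nab a b t f + nab a b t g := by
  rw [nab, nab, nab, ratDeriv_add]; ring

theorem nab_zero (a b : ℝ) (t : AType) : nab a b t 0 = 0 := by simp [nab]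

theorem nab_mul (a b : ℝ) (t : AType) (c f : RatFunc ℝ) :
    nab a b t (c * f) = ratDeriv c * f + c * nab a b t f := by
  rw [nab, nab, ratDeriv_mul]; ring

theorem nab_sum (a b : ℝ) (t : AType) (s : Finset ℕ) (f : ℕ → RatFunc ℝ) :
    nab a b t (∑ i ∈ s, f i) = ∑ i ∈ s, nab a b t (f i) := by
  induction s using Finset.cons_induction with
  | empty => simp [nab_zero]
  | cons i s hi ih => rw [Finset.sum_cons, Finset.sum_cons, nab_add, ih]

/-- The iterated Darboux transform without gauge factors. -/
def AL (a b : ℝ) : List (AType × ℕ) → AType → RatFunc ℝ → RatFunc ℝ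
  | [], _, f => f
  | s :: l, t, f => nab a b t (AL a b l t f) -
      nab a b s.1 (AL a b l s.1 (base a b s)) / AL a b l s.1 (base a b s) * AL a b l t f

/-- The number of seeds with the other sign at `1`. -/
def cntP (l : List (AType × ℕ)) (t : AType) : ℕ := (l.map fun s => gap s.1.sgnP t.sgnP).sum

/-- The number of seeds with the other sign at `-1`. -/
def cntM (l : List (AType × ℕ)) (t : AType) : ℕ := (l.map fun s => gap s.1.sgnM t.sgnM).sum

theorem cntP_cons (s : AType × ℕ) (l : List (AType × ℕ)) (t : AType) :
    cntP (s :: l) t = gap s.1.sgnP t.sgnP + cntP l t := by simp [cntP]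

theorem cntM_cons (s : AType × ℕ) (l : List (AType × ℕ)) (t : AType) :
    cntM (s :: l) t = gap s.1.sgnM t.sgnM + cntM l t := by simp [cntM]

theorem two_cntP (l : List (AType × ℕ)) (t : AType) :
    2 * (cntP l t : ℤ) = l.length - t.sgnP * sumP l := by
  induction l with
  | nil => simp [cntP, sumP]
  | cons s l ih =>
    rw [cntP_cons, sumP_cons, List.length_cons]
    push_cast
    linear_combination ih + gapP_cast s.1 t

theorem two_cntM (l : List (AType × ℕ)) (t : AType) :
    2 * (cntM l t : ℤ) = l.length - t.sgnM * sumM l := by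
  induction l with
  | nil => simp [cntM, sumM]
  | cons s l ih =>
    rw [cntM_cons, sumM_cons, List.length_cons]
    push_cast
    linear_combination ih + gapM_cast s.1 t

theorem omg_cnt (a b : ℝ) (l : List (AType × ℕ)) (s t : AType) :
    ld (mono (cntP l t) (cntM l t)) + omg t (αL a l) (βL b l) -
      (ld (mono (cntP l s) (cntM l s)) + omg s (αL a l) (βL b l)) = omg t a b - omg s a b := by
  have h : ∀ t, (cntP l t : RatFunc ℝ) = (l.length - t.sgnP * sumP l) / 2 := fun t => by
    have : 2 * (cntP l t : RatFunc ℝ) = l.length - t.sgnP * sumP l := by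
      exact_mod_cast congrArg (Int.cast (R := RatFunc ℝ)) (two_cntP l t)
    linear_combination this / 2
  have h' : ∀ t, (cntM l t : RatFunc ℝ) = (l.length - t.sgnM * sumM l) / 2 := fun t => by
    have : 2 * (cntM l t : RatFunc ℝ) = l.length - t.sgnM * sumM l := by
      exact_mod_cast congrArg (Int.cast (R := RatFunc ℝ)) (two_cntM l t)
    linear_combination this / 2
  rw [ld_mono, ld_mono]
  simp only [Int.cast_natCast, h, h', omg, αL, βL, map_div₀, map_mul, map_add, map_intCast,
    map_ofNat]
  ring

/-- Gauge factors enter the steps only through their log-derivatives, which `omg_cnt` trades for the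
shifts of the parameters; they collect in front as a monomial. -/
theorem FL_eq_AL {a b : ℝ} (ha : ¬ IsInt a) (hb : ¬ IsInt b) {l : List (AType × ℕ)}
    (hl : Good a b l) : ∀ t f, FL a b l t f = mono (cntP l t) (cntM l t) * AL a b l t f := by
  induction l with
  | nil => intro t f; simp [FL, AL, cntP, cntM, mono]
  | cons s l ih =>
    intro t f
    have hS := (eig_SL ha hb hl).1
    have hSe : SL a b l s = mono (cntP l s.1) (cntM l s.1) * AL a b l s.1 (base a b s) :=
      ih hl.1 s.1 _
    rw [hSe] at hS
    have hA := right_ne_zero_of_mul hS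
    have hm : ∀ t, ratDeriv (mono (cntP l t) (cntM l t)) =
        ld (mono (cntP l t) (cntM l t)) * mono (cntP l t) (cntM l t) := fun t =>
      ratDeriv_eq_ld_mul (mono_ne_zero _ _)
    have ho := omg_cnt a b l s.1 t
    have hq : nab a b s.1 (AL a b l s.1 (base a b s)) / AL a b l s.1 (base a b s) =
        ld (AL a b l s.1 (base a b s)) + (omg s.1 a b - omg .one a b) := by
      rw [nab, ld, add_div, mul_div_cancel_right₀ _ hA]
    rw [FL_cons, hSe, ih hl.1, dstep, AL, hq, cntP_cons, cntM_cons, gauge_eq_mono, nab, ratDeriv_mul,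
      hm, ld_mul (mono_ne_zero _ _) hA]
    push_cast
    rw [mono_add]
    linear_combination (mono (cntP l t) (cntM l t) * AL a b l t f *
      mono (gap s.1.sgnP t.sgnP) (gap s.1.sgnM t.sgnM)) * ho

/-- Every step composes with a monic first-order operator. The coefficients do not depend on the
type, so that functions of different types fit into one determinant. -/
theorem AL_expand (a b : ℝ) (l : List (AType × ℕ)) : ∃ c : ℕ → RatFunc ℝ, c l.length = 1 ∧
    (∀ i > l.length, c i = 0) ∧
    ∀ t f, AL a b l t f = ∑ i ∈ Finset.range (l.length + 1), c i * (nab a b t)^[i] f := by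
  induction l with
  | nil =>
    refine ⟨fun i => if i = 0 then 1 else 0, rfl, fun i hi => if_neg hi.ne', fun t f => ?_⟩
    simp [AL]
  | cons s l ih =>
    obtain ⟨c, h1, h0, hc⟩ := ih
    set q := nab a b s.1 (AL a b l s.1 (base a b s)) / AL a b l s.1 (base a b s) with hq
    refine ⟨fun i => ratDeriv (c i) - q * c i + if i = 0 then 0 else c (i - 1), ?_, ?_, ?_⟩
    · simp [h0 (l.length + 1) (Nat.lt_succ_self _), h1]
    · intro i hi
      rw [List.length_cons] at hi
      simp [h0 i (by omega), h0 (i - 1) (by omega)]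
    · intro t f
      simp only [add_mul, Finset.sum_add_distrib]
      rw [List.length_cons, Finset.sum_range_succ, Finset.sum_range_succ' (fun i =>
        (if i = 0 then 0 else c (i - 1)) * (nab a b t)^[i] f), h0 (l.length + 1) (Nat.lt_succ_self _)]
      simp only [Nat.add_eq_zero_iff, one_ne_zero, and_false, if_false, Nat.add_sub_cancel, if_true,
        zero_mul, add_zero, ratDeriv_zero, mul_zero, sub_zero]
      rw [AL, ← hq, hc, nab_sum, Finset.mul_sum, ← Finset.sum_sub_distrib, ← Finset.sum_add_distrib]
      refine Finset.sum_congr rfl fun i _ => ?_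
      rw [nab_mul, Function.iterate_succ_apply']
      ring

/-- Replacing the last row by the combination of rows with coefficients `c` keeps the determinant,
since `c n = 1`, and leaves at most one non-zero entry in that row. -/
theorem det_of_monic {n : ℕ} {c : ℕ → RatFunc ℝ} (hc : c n = 1) (g : Fin (n + 1) → ℕ → RatFunc ℝ)
    (h0 : ∀ j : Fin n, ∑ i ∈ Finset.range (n + 1), c i * g j.castSucc i = 0) :
    (Matrix.of fun i j : Fin (n + 1) => g j i).det =
      (Matrix.of fun i j : Fin n => g j.castSucc i).det *
        ∑ i ∈ Finset.range (n + 1), c i * g (Fin.last n) i := by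
  set M : Matrix (Fin (n + 1)) (Fin (n + 1)) (RatFunc ℝ) := Matrix.of fun i j => g j i with hM
  have h1 := Matrix.det_updateRow_sum M (Fin.last n) (fun k => c k)
  rw [Fin.val_last, hc, one_smul] at h1
  rw [← h1, Matrix.det_succ_row _ (Fin.last n), Fin.sum_univ_castSucc]
  have hrow : ∀ j, (∑ k : Fin (n + 1), c k • M k) j = ∑ i ∈ Finset.range (n + 1), c i * g j i := by
    intro j
    rw [Finset.sum_apply, Finset.sum_range]
    rfl
  rw [Finset.sum_eq_zero]
  · rw [Matrix.updateRow_self, hrow, zero_add, Fin.val_last, ← two_mul, pow_mul, neg_one_sq, one_pow,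
      one_mul, mul_comm]
    congr 2
    ext i j
    simp [hM, Matrix.updateRow_apply, (Fin.castSucc_lt_last i).ne]
  · intro j _
    rw [Matrix.updateRow_self, hrow, h0]; simp

/-- The Wronskian determinant of the seed functions, without the non-rational factors. -/
def wrS (a b : ℝ) (S : List (AType × ℕ)) : RatFunc ℝ :=
  (Matrix.of fun i j : Fin S.length => (nab a b (S.get j).1)^[(i : ℕ)] (base a b (S.get j))).det

theorem AL_kill {a b : ℝ} (ha : ¬ IsInt a) (hb : ¬ IsInt b) {l : List (AType × ℕ)}
    (hl : Good a b l) : ∀ r ∈ l, AL a b l r.1 (base a b r) = 0 := by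
  induction l with
  | nil => simp
  | cons s l ih =>
    intro r hr
    have hS := (eig_SL ha hb hl).1
    rw [SL, FL_eq_AL ha hb hl.1] at hS
    have hA := right_ne_zero_of_mul hS
    rcases List.mem_cons.1 hr with rfl | hr
    · rw [AL, div_mul_cancel₀ _ hA, sub_self]
    · rw [AL, ih hl.1 r hr, nab_zero]; simp

/-- Crum's formula: `AL a b l` is a monic operator of order `l.length` annihilating all seeds of
`l`, so `det_of_monic` splits off the last column. -/
theorem wrS_append {a b : ℝ} (ha : ¬ IsInt a) (hb : ¬ IsInt b) {l : List (AType × ℕ)}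
    (hl : Good a b l) (s : AType × ℕ) :
    wrS a b (l.reverse ++ [s]) = wrS a b l.reverse * AL a b l s.1 (base a b s) := by
  obtain ⟨c, h1, -, hc⟩ := AL_expand a b l
  have hlen : l.length = l.reverse.length := by simp
  rw [hlen] at h1 hc
  have hlen2 : l.reverse.length + 1 = (l.reverse ++ [s]).length := by simp
  set g : Fin (l.reverse.length + 1) → ℕ → RatFunc ℝ := fun j i =>
    (nab a b ((l.reverse ++ [s]).get (Fin.cast hlen2 j)).1)^[i]
      (base a b ((l.reverse ++ [s]).get (Fin.cast hlen2 j))) with hg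
  have hcast : ∀ j : Fin l.reverse.length,
      (l.reverse ++ [s]).get (Fin.cast hlen2 j.castSucc) = l.reverse.get j := by
    intro j
    simp only [List.get_eq_getElem, Fin.val_cast, Fin.val_castSucc]
    exact List.getElem_append_left j.2
  have hlast : (l.reverse ++ [s]).get (Fin.cast hlen2 (Fin.last _)) = s := by
    simp only [List.get_eq_getElem, Fin.val_cast, Fin.val_last]
    exact List.getElem_concat_length rfl _
  have h := det_of_monic h1 g fun j => by
    simp only [hg, hcast]
    rw [← hc]
    exact AL_kill ha hb hl _ (List.mem_reverse.1 (List.get_mem _ j))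
  have e1 : (Matrix.of fun i j : Fin (l.reverse.length + 1) => g j i).det =
      wrS a b (l.reverse ++ [s]) := by
    rw [wrS, ← Matrix.det_submatrix_equiv_self (finCongr hlen2)]
    rfl
  rw [← e1, h, wrS]
  simp only [hg, hcast, hlast]
  rw [← hc]

/-- The exponent of `x - 1` in `tauL`. -/
def pairP : List (AType × ℕ) → ℕ
  | [] => 0
  | s :: l => pairP l + cntP l s.1

/-- The exponent of `x + 1` in `tauL`. -/
def pairM : List (AType × ℕ) → ℕ
  | [] => 0
  | s :: l => pairM l + cntM l s.1

theorem tauL_eq_wrS {a b : ℝ} (ha : ¬ IsInt a) (hb : ¬ IsInt b) {l : List (AType × ℕ)}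
    (hl : Good a b l) : tauL a b l = mono (pairP l) (pairM l) * wrS a b l.reverse := by
  induction l with
  | nil =>
    have : IsEmpty (Fin ([] : List (AType × ℕ)).reverse.length) := Fin.isEmpty
    rw [wrS, Matrix.det_isEmpty]
    simp [tauL, pairP, pairM, mono]
  | cons s l ih =>
    rw [tauL, ih hl.1, SL, FL_eq_AL ha hb hl.1, List.reverse_cons, wrS_append ha hb hl.1, pairP,
      pairM]
    push_cast
    rw [mono_add]; ring

/-! ### Functions with poles only at `±1` and their values on `(-1,1)` -/

/-- Rational functions whose only poles are at `±1`. -/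
def polesEnds : Subring (RatFunc ℝ) where
  carrier := {f | ∃ (n : ℕ) (P : ℝ[X]), f * pJ ^ n = algebraMap ℝ[X] (RatFunc ℝ) P}
  mul_mem' := by
    rintro f g ⟨n, P, hP⟩ ⟨m, Q, hQ⟩
    exact ⟨n + m, P * Q, by rw [map_mul, ← hP, ← hQ]; ring⟩
  one_mem' := ⟨0, 1, by simp⟩
  add_mem' := by
    rintro f g ⟨n, P, hP⟩ ⟨m, Q, hQ⟩
    refine ⟨n + m, P * (X ^ 2 - 1) ^ m + Q * (X ^ 2 - 1) ^ n, ?_⟩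
    have hp : algebraMap ℝ[X] (RatFunc ℝ) (X ^ 2 - 1) = pJ := by simp [pJ]
    rw [map_add, map_mul, map_mul, ← hP, ← hQ, map_pow, map_pow, hp]; ring
  zero_mem' := ⟨0, 0, by simp⟩
  neg_mem' := by
    rintro f ⟨n, P, hP⟩
    exact ⟨n, -P, by rw [map_neg, ← hP]; ring⟩

theorem mem_polesEnds {f : RatFunc ℝ} : f ∈ polesEnds ↔
    ∃ (n : ℕ) (P : ℝ[X]), f * pJ ^ n = algebraMap ℝ[X] (RatFunc ℝ) P := Iff.rfl

theorem algebraMap_mem_polesEnds (P : ℝ[X]) : algebraMap ℝ[X] (RatFunc ℝ) P ∈ polesEnds :=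
  ⟨0, P, by simp⟩

theorem C_mem_polesEnds (c : ℝ) : RatFunc.C c ∈ polesEnds := ⟨0, C c, by simp⟩

theorem eP_mem_polesEnds : eP ∈ polesEnds := by
  refine ⟨1, X + 1, ?_⟩
  have := X_sub_one_ne_zero
  rw [eP, pJ_eq]; simp [field]

theorem eM_mem_polesEnds : eM ∈ polesEnds := by
  refine ⟨1, X - 1, ?_⟩
  have := X_add_one_ne_zero
  rw [eM, pJ_eq]; simp [field]

theorem omg_mem_polesEnds (t : AType) (a b : ℝ) : omg t a b ∈ polesEnds :=
  add_mem (mul_mem (C_mem_polesEnds _) eP_mem_polesEnds)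
    (mul_mem (C_mem_polesEnds _) eM_mem_polesEnds)

theorem ratDeriv_mem_polesEnds {f : RatFunc ℝ} (hf : f ∈ polesEnds) : ratDeriv f ∈ polesEnds := by
  obtain ⟨n, P, hP⟩ := hf
  refine ⟨n + 1, derivative P * (X ^ 2 - 1) - (n : ℝ[X]) * (2 * X) * P, ?_⟩
  have h := congrArg ratDeriv hP
  have hp : algebraMap ℝ[X] (RatFunc ℝ) (X ^ 2 - 1) = pJ := by simp [pJ]
  have h2 : ratDeriv (pJ ^ n) * pJ = (n : RatFunc ℝ) * (2 * RatFunc.X) * pJ ^ n := by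
    rw [ratDeriv_eq_ld_mul (pow_ne_zero n pJ_ne_zero), ld_pow, ld, ratDeriv_pJ]
    have := pJ_ne_zero
    field_simp
  rw [ratDeriv_mul, ratDeriv_algebraMap] at h
  rw [map_sub, map_mul, map_mul, map_mul, map_mul, hp, ← h, ← hP, map_natCast, map_ofNat,
    RatFunc.algebraMap_X]
  linear_combination (-f) * h2

theorem nab_mem_polesEnds {a b : ℝ} {t : AType} {f : RatFunc ℝ} (hf : f ∈ polesEnds) :
    nab a b t f ∈ polesEnds :=
  add_mem (ratDeriv_mem_polesEnds hf)
    (mul_mem (sub_mem (omg_mem_polesEnds _ _ _) (omg_mem_polesEnds _ _ _)) hf)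

theorem iterate_nab_mem_polesEnds {a b : ℝ} {t : AType} {f : RatFunc ℝ} (hf : f ∈ polesEnds) (i : ℕ) :
    (nab a b t)^[i] f ∈ polesEnds := by
  induction i with
  | zero => exact hf
  | succ i ih => rw [Function.iterate_succ_apply']; exact nab_mem_polesEnds ih

theorem unitAt_pJ {x : ℝ} (hx : x ∈ Ioo (-1 : ℝ) 1) : UnitAt x pJ := by
  rw [pJ_eq]
  have h1 := (unitAt_X_sub (c := x) (a := 1) hx.2.ne)
  have h2 := (unitAt_X_sub (c := x) (a := -1) hx.1.ne')
  simpa using h1.mul h2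

theorem reg_of_mem_polesEnds {f : RatFunc ℝ} (hf : f ∈ polesEnds) {x : ℝ} (hx : x ∈ Ioo (-1 : ℝ) 1) :
    Reg x f := by
  obtain ⟨n, P, hP⟩ := hf
  have h := (unitAt_pJ hx).zpow n
  rw [zpow_natCast] at h
  rw [eq_div_of_mul_eq h.ne_zero hP]
  exact (reg_algebraMap x P).div h

/-- Evaluation at a point of `(-1,1)`. -/
def valHom (x : ℝ) (hx : x ∈ Ioo (-1 : ℝ) 1) : polesEnds →+* ℝ where
  toFun f := val f x
  map_one' := by simp
  map_mul' f g := val_mul (reg_of_mem_polesEnds f.2 hx) (reg_of_mem_polesEnds g.2 hx)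
  map_zero' := by simp
  map_add' f g := val_add (reg_of_mem_polesEnds f.2 hx) (reg_of_mem_polesEnds g.2 hx)

theorem det_mem_polesEnds {n : ℕ} {M : Matrix (Fin n) (Fin n) (RatFunc ℝ)}
    (h : ∀ i j, M i j ∈ polesEnds) : M.det ∈ polesEnds ∧
    ∀ x ∈ Ioo (-1 : ℝ) 1, val M.det x = (Matrix.of fun i j => val (M i j) x).det := by
  set M' : Matrix (Fin n) (Fin n) polesEnds := Matrix.of fun i j => ⟨M i j, h i j⟩ with hM'
  have h1 : M.det = (M'.det : RatFunc ℝ) := by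
    have := polesEnds.subtype.map_det M'
    rw [Subring.subtype_apply] at this
    rw [this]; rfl
  refine ⟨by rw [h1]; exact M'.det.2, fun x hx => ?_⟩
  have := (valHom x hx).map_det M'
  rw [h1]
  exact this

theorem base_mem_polesEnds (a b : ℝ) (s : AType × ℕ) : base a b s ∈ polesEnds :=
  algebraMap_mem_polesEnds _

theorem wrS_mem_polesEnds (a b : ℝ) (S : List (AType × ℕ)) : wrS a b S ∈ polesEnds :=
  (det_mem_polesEnds fun _ _ => iterate_nab_mem_polesEnds (base_mem_polesEnds a b _) _).1

theorem hasDerivAt_weight (A B : ℝ) {x : ℝ} (hx : x ∈ Ioo (-1 : ℝ) 1) :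
    HasDerivAt (fun y : ℝ => (1 - y) ^ A * (1 + y) ^ B)
      ((1 - x) ^ A * (1 + x) ^ B * (A / (x - 1) + B / (x + 1))) x := by
  have h1 : (0 : ℝ) < 1 - x := by linarith [hx.2]
  have h2 : (0 : ℝ) < 1 + x := by linarith [hx.1]
  have d1 : HasDerivAt (fun y : ℝ => 1 - y) (-1) x := by
    simpa using (hasDerivAt_id x).const_sub 1
  have d2 : HasDerivAt (fun y : ℝ => 1 + y) 1 x := by
    simpa using (hasDerivAt_id x).const_add 1
  have := (d1.rpow_const (p := A) (Or.inl h1.ne')).mul (d2.rpow_const (p := B) (Or.inl h2.ne'))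
  refine this.congr_deriv ?_
  rw [Real.rpow_sub_one h1.ne', Real.rpow_sub_one h2.ne']
  have h3 : x - 1 ≠ 0 := by linarith
  have h4 : x + 1 ≠ 0 := by linarith
  have h5 : 1 - x = -(x - 1) := by ring
  have h6 : 1 + x = x + 1 := by ring
  generalize (1 - x) ^ A = u
  generalize (1 + x) ^ B = v
  rw [h5, h6]
  field_simp

/-- The non-rational factor of type `t` functions. -/
def mu (a b : ℝ) (t : AType) (x : ℝ) : ℝ :=
  (1 - x) ^ ((t.sgnP - 1) / 2 * a) * (1 + x) ^ ((t.sgnM - 1) / 2 * b)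

theorem phi_eq (a b : ℝ) (s : AType × ℕ) (x : ℝ) :
    phi a b s.1 s.2 x = mu a b s.1 x * val (base a b s) x := by
  obtain ⟨t, n⟩ := s
  rw [base, jacobiF, val_algebraMap, mu]
  have e1 : ((-1 - 1) / 2 * a : ℝ) = -a := by ring
  have e2 : ((-1 - 1) / 2 * b : ℝ) = -b := by ring
  cases t <;> simp [phi, AType.sgnP, AType.sgnM, e1, e2]

theorem val_eP {x : ℝ} (hx : x ∈ Ioo (-1 : ℝ) 1) : val eP x = 1 / (x - 1) := by
  rw [eP_eq, val_inv (unitAt_X_sub hx.2.ne), val_X_sub, one_div]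

theorem val_eM {x : ℝ} (hx : x ∈ Ioo (-1 : ℝ) 1) : val eM x = 1 / (x + 1) := by
  rw [eM_eq, val_inv (unitAt_X_sub hx.1.ne'), val_X_sub, one_div, sub_neg_eq_add]

theorem val_CeP_add {x : ℝ} (hx : x ∈ Ioo (-1 : ℝ) 1) (A B : ℝ) :
    val (RatFunc.C A * eP + RatFunc.C B * eM) x = A / (x - 1) + B / (x + 1) := by
  have h1 := reg_of_mem_polesEnds eP_mem_polesEnds hx
  have h2 := reg_of_mem_polesEnds eM_mem_polesEnds hx
  rw [val_add ((reg_C x A).mul h1) ((reg_C x B).mul h2), val_mul (reg_C x A) h1,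
    val_mul (reg_C x B) h2, val_C, val_C, val_eP hx, val_eM hx]
  ring

/-- `omg t - omg .one` is the log-derivative of the factor `mu`, so `nab` is the derivative
conjugated by that factor. -/
theorem iteratedDeriv_mu_mul {a b : ℝ} {t : AType} {f : RatFunc ℝ} (hf : f ∈ polesEnds) (i : ℕ) :
    ∀ x ∈ Ioo (-1 : ℝ) 1, iteratedDeriv i (fun y => mu a b t y * val f y) x =
      mu a b t x * val ((nab a b t)^[i] f) x := by
  induction i with
  | zero => intro x _; simp
  | succ i ih =>
    intro x hx
    have hev : iteratedDeriv i (fun y => mu a b t y * val f y) =ᶠ[𝓝 x]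
        fun y => mu a b t y * val ((nab a b t)^[i] f) y :=
      Filter.eventually_of_mem (isOpen_Ioo.mem_nhds hx) ih
    rw [iteratedDeriv_succ, hev.deriv_eq, Function.iterate_succ_apply']
    have hm := iterate_nab_mem_polesEnds (a := a) (b := b) (t := t) hf i
    have hr := reg_of_mem_polesEnds hm hx
    have hd := (hasDerivAt_weight ((t.sgnP - 1) / 2 * a) ((t.sgnM - 1) / 2 * b) hx).mul
      (hasDerivAt_val hr)
    refine hd.deriv.trans ?_
    have ho : omg t a b - omg .one a b = RatFunc.C ((t.sgnP - 1) / 2 * a) * eP +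
        RatFunc.C ((t.sgnM - 1) / 2 * b) * eM := by
      rw [omg_sub]
      simp only [AType.sgnP, AType.sgnM, Int.cast_one]
      congr 3 <;> ring
    have hor : Reg x (omg t a b - omg .one a b) :=
      reg_of_mem_polesEnds (sub_mem (omg_mem_polesEnds _ _ _) (omg_mem_polesEnds _ _ _)) hx
    rw [nab, val_add hr.ratDeriv (hor.mul hr), val_mul hor hr, ho, val_CeP_add hx, mu]
    ring

/-- The non-rational factors depend only on the column and come out of the determinant. -/
theorem wr_eq (a b : ℝ) (S : List (AType × ℕ)) {x : ℝ} (hx : x ∈ Ioo (-1 : ℝ) 1) :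
    wr (S.map fun s => phi a b s.1 s.2) x =
      (S.map fun s => mu a b s.1 x).prod * val (wrS a b S) x := by
  have hlen : S.length = (S.map fun s => phi a b s.1 s.2).length := by simp
  have hval := (det_mem_polesEnds (M := Matrix.of fun i j : Fin S.length =>
    (nab a b (S.get j).1)^[(i : ℕ)] (base a b (S.get j)))
    fun _ _ => iterate_nab_mem_polesEnds (base_mem_polesEnds a b _) _).2 x hx
  rw [wr, ← Matrix.det_submatrix_equiv_self (finCongr hlen), wrS, hval]
  have hp : (S.map fun s => mu a b s.1 x).prod = ∏ j : Fin S.length, mu a b (S.get j).1 x := by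
    simp only [List.get_eq_getElem]
    rw [← Fin.prod_univ_fun_getElem S (fun s => mu a b s.1 x)]
  rw [hp, ← Matrix.det_mul_row]
  congr 1
  ext i j
  simp only [Matrix.submatrix_apply, Matrix.of_apply, finCongr_apply, List.get_eq_getElem,
    Fin.val_cast, List.getElem_map]
  rw [← iteratedDeriv_mu_mul (base_mem_polesEnds a b _) i x hx]
  congr 1
  ext y
  exact phi_eq a b _ y

/-! ### Symmetric functions of the list of seeds -/

/-- `pairP` counts the pairs of seeds with different signs at `1`: for `r` plus and `s` minus signs,
`4rs = (r+s)² - (r-s)²`. -/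
theorem four_pairP (l : List (AType × ℕ)) : 4 * (pairP l : ℤ) = l.length ^ 2 - sumP l ^ 2 := by
  induction l with
  | nil => simp [pairP, sumP]
  | cons s l ih =>
    rw [pairP, sumP_cons, List.length_cons]
    push_cast
    linear_combination ih + 2 * two_cntP l s.1 + s.1.sgnP_sq

theorem four_pairM (l : List (AType × ℕ)) : 4 * (pairM l : ℤ) = l.length ^ 2 - sumM l ^ 2 := by
  induction l with
  | nil => simp [pairM, sumM]
  | cons s l ih =>
    rw [pairM, sumM_cons, List.length_cons]
    push_cast
    linear_combination ih + 2 * two_cntM l s.1 + s.1.sgnM_sq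

/-- Each seed loses the sum of `sg` over the earlier seeds. Summed over pairs this is quadratic in
the two sign sums, so the order of the seeds does not matter. -/
theorem four_intDegree_tauL {a b : ℝ} (ha : ¬ IsInt a) (hb : ¬ IsInt b) {l : List (AType × ℕ)}
    (hl : Good a b l) : 4 * (tauL a b l).intDegree =
      4 * (l.map fun s => (s.2 : ℤ)).sum - sumP l ^ 2 - sumM l ^ 2 + 2 * l.length := by
  induction l with
  | nil => simp [tauL, sumP, sumM]
  | cons s l ih =>
    rw [tauL, RatFunc.intDegree_mul (tauL_ne_zero ha hb hl.1) (eig_SL ha hb hl).1,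
      intDegree_SL ha hb hl, sumP_cons, sumM_cons, List.length_cons, List.map_cons, List.sum_cons]
    push_cast
    linear_combination ih hl.1 - 2 * two_sh l s.1 + s.1.sgnP_sq + s.1.sgnM_sq

theorem good_of_forall {a b : ℝ} {l : List (AType × ℕ)} (hn : l.Nodup)
    (hu : ∀ s ∈ l, s.2 ∈ upperIdx (cT s.1 a b))
    (ho : ∀ s ∈ l, ∀ k, (s.1.opp, k) ∈ l → (s.2 : ℝ) + cT s.1 a b ≠ k) : Good a b l := by
  induction l with
  | nil => trivial
  | cons s l ih =>
    rw [List.nodup_cons] at hn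
    refine ⟨ih hn.2 (fun r hr => hu r (List.mem_cons_of_mem s hr))
      (fun r hr k hk => ho r (List.mem_cons_of_mem s hr) k (List.mem_cons_of_mem s hk)),
      hu s List.mem_cons_self, hn.1, fun k hk => ho s List.mem_cons_self k (List.mem_cons_of_mem s hk)⟩

theorem Good.upper {a b : ℝ} {l : List (AType × ℕ)} (hl : Good a b l) :
    ∀ s ∈ l, s.2 ∈ upperIdx (cT s.1 a b) := by
  induction l with
  | nil => simp
  | cons s l ih =>
    intro r hr
    rcases List.mem_cons.1 hr with rfl | hr
    · exact hl.2.1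
    · exact ih hl.1 r hr

theorem Good.eN_inj {a b : ℝ} (ha : ¬ IsInt a) (hb : ¬ IsInt b) {l : List (AType × ℕ)}
    (hl : Good a b l) : ∀ r ∈ l, ∀ s ∈ l, eN a b r.1 r.2 = eN a b s.1 s.2 → r = s := by
  induction l with
  | nil => simp
  | cons q l ih =>
    intro r hr s hs h
    rcases List.mem_cons.1 hr with rfl | hr' <;> rcases List.mem_cons.1 hs with rfl | hs'
    · rfl
    · exact absurd h (eN_ne_of_good ha hb hl s hs')
    · exact absurd h.symm (eN_ne_of_good ha hb hl r hr')
    · exact ih hl.1 r hr' s hs' h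

/-! ### The list of seeds of the parameters -/

namespace Params

variable (d : Params)

/-- The four finite sets of indices. -/
def K : AType → Finset ℕ
  | .one => d.K₁
  | .two => d.K₂
  | .three => d.K₃
  | .four => d.K₄

/-- The seeds of type `t`. -/
def block (t : AType) : List (AType × ℕ) := ((d.K t).sort (· ≤ ·)).map fun k => (t, k)

/-- The list of all seeds, in the order of the Wronskian. -/
def S : List (AType × ℕ) := d.block .one ++ d.block .two ++ d.block .three ++ d.block .four

/-- The list of all seeds, the last one first. -/
def l : List (AType × ℕ) := d.S.reverse

theorem mem_block {t : AType} {s : AType × ℕ} : s ∈ d.block t ↔ s.1 = t ∧ s.2 ∈ d.K t := by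
  obtain ⟨t', k⟩ := s
  simp only [block, List.mem_map, Finset.mem_sort, Prod.mk.injEq]
  constructor
  · rintro ⟨k', h, rfl, rfl⟩; exact ⟨rfl, h⟩
  · rintro ⟨rfl, h⟩; exact ⟨k, h, rfl, rfl⟩

theorem mem_S {s : AType × ℕ} : s ∈ d.S ↔ s.2 ∈ d.K s.1 := by
  obtain ⟨t, k⟩ := s
  simp only [S, List.mem_append, mem_block]
  cases t <;> simp

theorem mem_l {s : AType × ℕ} : s ∈ d.l ↔ s.2 ∈ d.K s.1 := by
  rw [l, List.mem_reverse, mem_S]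

theorem nodup_block (t : AType) : (d.block t).Nodup :=
  (Finset.sort_nodup _ _).map fun _ _ h => (Prod.mk.inj h).2

theorem nodup_S : d.S.Nodup := by
  have key : ∀ {A B : List (AType × ℕ)}, A.Nodup → B.Nodup → (∀ s ∈ A, ∀ r ∈ B, s.1 ≠ r.1) →
      (A ++ B).Nodup := fun hA hB h => List.nodup_append.2
    ⟨hA, hB, fun s hs r hr hsr => h s hs r hr (by rw [hsr])⟩
  refine key (key (key (d.nodup_block _) (d.nodup_block _) ?_) (d.nodup_block _) ?_)
    (d.nodup_block _) ?_ <;>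
  · intro s hs r hr
    simp only [List.mem_append, mem_block] at hs hr
    intro h
    simp_all

theorem nodup_l : d.l.Nodup := List.nodup_reverse.2 d.nodup_S

theorem sum_block {M : Type*} [AddCommMonoid M] (f : AType × ℕ → M) (t : AType) :
    ((d.block t).map f).sum = ∑ k ∈ d.K t, f (t, k) := by
  rw [block, List.map_map, ← List.sum_toFinset _ (Finset.sort_nodup _ _), Finset.sort_toFinset]
  rfl

theorem sum_l {M : Type*} [AddCommMonoid M] (f : AType × ℕ → M) :
    (d.l.map f).sum = ∑ k ∈ d.K₁, f (.one, k) + ∑ k ∈ d.K₂, f (.two, k) + ∑ k ∈ d.K₃, f (.three, k) +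
      ∑ k ∈ d.K₄, f (.four, k) := by
  rw [l, List.map_reverse, List.sum_reverse, S, List.map_append, List.map_append, List.map_append,
    List.sum_append, List.sum_append, List.sum_append, sum_block, sum_block, sum_block, sum_block]
  rfl

theorem length_l : d.l.length = d.p₁ + d.p₂ + d.p₃ + d.p₄ := by
  have := d.sum_l fun _ => 1
  simpa [p₁, p₂, p₃, p₄] using this

theorem sumP_l : sumP d.l = d.p₁ - d.p₂ - d.p₃ + d.p₄ := by
  rw [sumP, sum_l]; simp [AType.sgnP, p₁, p₂, p₃, p₄]; ring

theorem sumM_l : sumM d.l = d.p₁ - d.p₂ + d.p₃ - d.p₄ := by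
  rw [sumM, sum_l]; simp [AType.sgnM, p₁, p₂, p₃, p₄]; ring

theorem α_eq : d.α = αL d.a d.l := by rw [αL, sumP_l, α]; push_cast; ring

theorem β_eq : d.β = βL d.b d.l := by rw [βL, sumM_l, β]; push_cast; ring

/-- The degree shift of type `t` functions. -/
def shift : AType → ℤ
  | .one => d.p₁ - d.p₂
  | .two => d.p₂ - d.p₁
  | .three => d.p₃ - d.p₄
  | .four => d.p₄ - d.p₃

theorem sh_l (t : AType) : sh d.l t = d.shift t := by
  have h := two_sh d.l t
  rw [sumP_l, sumM_l] at h
  cases t <;> simp only [AType.sgnP, AType.sgnM] at h <;> rw [shift] <;> linarith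

theorem pairP_l : pairP d.l = (d.p₂ + d.p₃) * (d.p₁ + d.p₄) := by
  have h := four_pairP d.l
  rw [sumP_l, length_l] at h
  zify
  push_cast at h
  linarith

theorem pairM_l : pairM d.l = (d.p₂ + d.p₄) * (d.p₁ + d.p₃) := by
  have h := four_pairM d.l
  rw [sumM_l, length_l] at h
  zify
  push_cast at h
  linarith

theorem cntP_l : cntP d.l .one = d.p₂ + d.p₃ := by
  have h := two_cntP d.l .one
  rw [sumP_l, length_l, AType.sgnP] at h
  zify
  push_cast at h
  linarith

theorem cntM_l : cntM d.l .one = d.p₂ + d.p₄ := by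
  have h := two_cntM d.l .one
  rw [sumM_l, length_l, AType.sgnM] at h
  zify
  push_cast at h
  linarith

theorem cT_one : cT .one d.a d.b = d.a + d.b := by simp [cT, AType.sgnP, AType.sgnM]

theorem cT_two : cT .two d.a d.b = -d.a - d.b := by simp [cT, AType.sgnP, AType.sgnM]; ring

theorem cT_three : cT .three d.a d.b = -d.a + d.b := by simp [cT, AType.sgnP, AType.sgnM]

theorem cT_four : cT .four d.a d.b = d.a - d.b := by simp [cT, AType.sgnP, AType.sgnM]; ring

/-- The degree of the seed function of a seed. -/
def deg (s : AType × ℕ) : ℝ := s.2 + (cT s.1 d.a d.b - (d.a + d.b)) / 2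

theorem zN_eq (s : AType × ℕ) : zN d.a d.b s = d.deg s + (d.a + d.b) / 2 := by rw [zN, deg]; ring

theorem deg_one (k : ℕ) : d.deg (.one, k) = k := by rw [deg, cT_one]; ring

theorem deg_two (k : ℕ) : d.deg (.two, k) = k - d.a - d.b := by rw [deg, cT_two]; ring

theorem deg_three (k : ℕ) : d.deg (.three, k) = k - d.a := by rw [deg, cT_three]; ring

theorem deg_four (k : ℕ) : d.deg (.four, k) = k - d.b := by rw [deg, cT_four]; ring

variable {d}

theorem Admissible.good (hK : d.Admissible) : Good d.a d.b d.l := by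
  obtain ⟨h1, h2, h3, h4, h12, h34⟩ := hK
  have e12 : ∀ k ∈ d.K₁, ∀ k' ∈ d.K₂, (k : ℝ) ≠ k' - d.a - d.b := fun k hk k' hk' h =>
    Finset.disjoint_left.1 h12 (Finset.mem_image_of_mem _ hk) (by
      rw [h]; exact Finset.mem_image_of_mem (fun k : ℕ => (k : ℝ) - d.a - d.b) hk')
  have e34 : ∀ k ∈ d.K₃, ∀ k' ∈ d.K₄, (k : ℝ) - d.a ≠ k' - d.b := fun k hk k' hk' h =>
    Finset.disjoint_left.1 h34 (Finset.mem_image_of_mem (fun k : ℕ => (k : ℝ) - d.a) hk) (by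
      rw [h]; exact Finset.mem_image_of_mem (fun k : ℕ => (k : ℝ) - d.b) hk')
  refine good_of_forall d.nodup_l ?_ ?_
  · rintro ⟨t, k⟩ hs
    rw [mem_l] at hs
    cases t
    · rw [cT_one]; exact h1 k hs
    · rw [cT_two]; exact h2 k hs
    · rw [cT_three]; exact h3 k hs
    · rw [cT_four]; exact h4 k hs
  · rintro ⟨t, n⟩ hs k hk h
    rw [mem_l] at hs hk
    cases t
    · rw [cT_one] at h; exact e12 n hs k hk (by linarith)
    · rw [cT_two] at h; exact e12 k hk n hs (by linarith)
    · rw [cT_three] at h; exact e34 n hs k hk (by linarith)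
    · rw [cT_four] at h; exact e34 k hk n hs (by linarith)

theorem mem_Iplus {t : AType} {i : ℤ} :
    i ∈ d.Iplus t ↔ ∃ n : ℕ, i = n - d.shift t ∧ NPlus d.a d.b d.l t n := by
  have key : ∀ (P : ℕ → Prop), (∀ n, P n ↔ i = n - d.shift t ∧ NPlus d.a d.b d.l t n) →
      ((∃ n, P n) ↔ ∃ n : ℕ, i = n - d.shift t ∧ NPlus d.a d.b d.l t n) := fun P h =>
    exists_congr h
  cases t
  · refine key _ fun n => ?_
    simp only [NPlus, mem_l, cT_one, K, K₁₂, D₁, D₂, Finset.mem_union, Finset.mem_image, not_or,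
      not_exists, not_and, AType.opp, shift, Nat.cast_inj]
    constructor
    · rintro ⟨h1, ⟨h2, h3⟩, rfl⟩
      exact ⟨by ring, h1, fun h => h2 n h rfl, fun k hk h => h3 k hk (by linarith)⟩
    · rintro ⟨rfl, h1, h2, h3⟩
      exact ⟨h1, ⟨fun k hk h => h2 (h ▸ hk), fun k hk h => h3 k hk (by linarith)⟩, by ring⟩
  · refine key _ fun n => ?_
    simp only [NPlus, mem_l, cT_two, K, K₁₂, D₁, D₂, Finset.mem_union, Finset.mem_image, not_or,
      not_exists, not_and, AType.opp, shift]
    constructor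
    · rintro ⟨h1, ⟨h2, h3⟩, rfl⟩
      exact ⟨by ring, h1, fun h => h3 n h rfl, fun k hk h => h2 k hk (by linarith)⟩
    · rintro ⟨rfl, h1, h2, h3⟩
      refine ⟨h1, ⟨fun k hk h => h3 k hk (by linarith), fun k hk h => h2 ?_⟩, by ring⟩
      have : (k : ℝ) = n := by linarith
      exact (Nat.cast_injective this) ▸ hk
  · refine key _ fun n => ?_
    simp only [NPlus, mem_l, cT_three, K, K₃₄, D₃, D₄, Finset.mem_union, Finset.mem_image, not_or,
      not_exists, not_and, AType.opp, shift]
    constructor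
    · rintro ⟨h1, ⟨h2, h3⟩, rfl⟩
      exact ⟨by ring, h1, fun h => h2 n h rfl, fun k hk h => h3 k hk (by linarith)⟩
    · rintro ⟨rfl, h1, h2, h3⟩
      refine ⟨h1, ⟨fun k hk h => h2 ?_, fun k hk h => h3 k hk (by linarith)⟩, by ring⟩
      have : (k : ℝ) = n := by linarith
      exact (Nat.cast_injective this) ▸ hk
  · refine key _ fun n => ?_
    simp only [NPlus, mem_l, cT_four, K, K₃₄, D₃, D₄, Finset.mem_union, Finset.mem_image, not_or,
      not_exists, not_and, AType.opp, shift]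
    constructor
    · rintro ⟨h1, ⟨h2, h3⟩, rfl⟩
      exact ⟨by ring, h1, fun h => h3 n h rfl, fun k hk h => h2 k hk (by linarith)⟩
    · rintro ⟨rfl, h1, h2, h3⟩
      refine ⟨h1, ⟨fun k hk h => h3 k hk (by linarith), fun k hk h => h2 ?_⟩, by ring⟩
      have : (k : ℝ) = n := by linarith
      exact (Nat.cast_injective this) ▸ hk

theorem mem_Iminus {t : AType} {i : ℤ} :
    i ∈ d.Iminus t ↔ NMinus d.a d.b d.l t (i + d.shift t) := by
  cases t <;> simp only [Iminus, NMinus, mem_l, cT_one, cT_two, cT_three, cT_four, K, AType.opp,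
    shift, mem_ofPred_eq] <;>
  · refine or_congr (exists_congr fun n => ?_) (exists_congr fun k => and_congr_right fun _ => ?_)
    · rw [and_comm]
      refine and_congr_left fun _ => ?_
      constructor <;> intro h <;> linarith
    · constructor <;> intro h <;> linarith

theorem mem_I (ha : ¬ IsInt d.a) (hb : ¬ IsInt d.b) (hl : Good d.a d.b d.l) {t : AType} {i : ℤ} :
    i ∈ d.I t ↔ i + d.shift t ∈ Ind d.a d.b d.l t := by
  rw [mem_Ind_iff ha hb hl, I, mem_union, mem_Iminus, mem_Iplus]
  refine or_congr Iff.rfl (exists_congr fun n => and_congr_left fun _ => ?_)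
  constructor <;> intro h <;> linarith

theorem four_degree (h : 4 * (tauL d.a d.b d.l).intDegree =
      4 * (d.l.map fun s => (s.2 : ℤ)).sum - sumP d.l ^ 2 - sumM d.l ^ 2 + 2 * d.l.length) :
    (tauL d.a d.b d.l).intDegree = d.tauDegree := by
  have hc : ∀ n : ℕ, 2 * ((n.choose 2 : ℕ) : ℤ) = n * (n - 1) := by
    intro n
    have h1 := Nat.choose_two_right n
    have h2 : n.choose 2 * 2 = n * (n - 1) := by
      rw [h1]; exact Nat.div_mul_cancel (Nat.even_mul_pred_self n).two_dvd
    rcases n with _ | n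
    · simp
    · zify at h2
      simp only [Nat.add_sub_cancel] at h2
      push_cast at h2 ⊢
      linarith
  have h1 := hc (d.p₁ + d.p₂)
  have h2 := hc (d.p₃ + d.p₄)
  rw [sumP_l, sumM_l, length_l, sum_l] at h
  rw [tauDegree]
  push_cast at h h1 h2
  linarith

/-- Distinct seeds have distinct eigenvalues by `Good.eN_inj`, hence distinct degrees, and nothing
is lost when the list is collapsed to a finite set. -/
theorem prod_Kall (ha : ¬ IsInt d.a) (hb : ¬ IsInt d.b) (hl : Good d.a d.b d.l) (f : ℝ → ℝ) :
    ∏ k ∈ d.Kall, f k = (d.l.map fun s => f (d.deg s)).prod := by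
  have hnd : (d.l.map d.deg).Nodup := by
    refine d.nodup_l.map_on fun r hr s hs h => hl.eN_inj ha hb r hr s hs ?_
    rw [eN_eq_zN, eN_eq_zN, zN_eq, zN_eq, h]
  have hset : d.Kall = (d.l.map d.deg).toFinset := by
    ext x
    simp only [Kall, K₁₂, K₃₄, D₁, D₂, D₃, D₄, Finset.mem_union, Finset.mem_image, List.mem_toFinset,
      List.mem_map, mem_l, Prod.exists]
    constructor
    · rintro ((⟨k, hk, rfl⟩ | ⟨k, hk, rfl⟩) | (⟨k, hk, rfl⟩ | ⟨k, hk, rfl⟩))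
      · exact ⟨.one, k, hk, d.deg_one k⟩
      · exact ⟨.two, k, hk, d.deg_two k⟩
      · exact ⟨.three, k, hk, d.deg_three k⟩
      · exact ⟨.four, k, hk, d.deg_four k⟩
    · rintro ⟨t, k, hk, rfl⟩
      cases t
      · exact Or.inl (Or.inl ⟨k, hk, (d.deg_one k).symm⟩)
      · exact Or.inl (Or.inr ⟨k, hk, (d.deg_two k).symm⟩)
      · exact Or.inr (Or.inl ⟨k, hk, (d.deg_three k).symm⟩)
      · exact Or.inr (Or.inr ⟨k, hk, (d.deg_four k).symm⟩)
  rw [hset, List.prod_toFinset f hnd, List.map_map]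
  rfl

theorem seeds_eq (d : Params) : d.seeds = d.S.map fun s => phi d.a d.b s.1 s.2 := by
  simp only [seeds, S, block, List.map_append, List.map_map]
  rfl

end Params

/-! ### Types and labels -/

theorem exists_hasType (w : RatFunc ℝ) : ∃ t, HasType w t := by
  by_cases h1 : w.denom.eval 1 = 0 <;> by_cases h2 : w.denom.eval (-1) = 0
  · exact ⟨.two, h1, h2⟩
  · exact ⟨.three, h1, h2⟩
  · exact ⟨.four, h1, h2⟩
  · exact ⟨.one, h1, h2⟩

theorem HasType.unique {w : RatFunc ℝ} {s t : AType} (hs : HasType w s) (ht : HasType w t) :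
    s = t := by
  cases s <;> cases t <;> simp only [HasType] at hs ht <;> tauto

/-- The types of the elements of `R`. -/
def typesOf (R : Set (RatFunc ℝ)) : Set AType := {t | ∃ w ∈ R, HasType w t}

/-- Elements of `R` are determined by their types, and different elements have opposite types. -/
def Separated (R : Set (RatFunc ℝ)) : Prop :=
  ∀ w ∈ R, ∀ v ∈ R, ∀ s t, HasType w s → HasType v t → w ≠ v → s = t.opp

theorem Separated.eq {R : Set (RatFunc ℝ)} (h : Separated R) {w v : RatFunc ℝ} (hw : w ∈ R)
    (hv : v ∈ R) {t : AType} (h1 : HasType w t) (h2 : HasType v t) : w = v := by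
  by_contra hne
  exact t.opp_ne (h w hw v hv t t h1 h2 hne).symm

theorem Separated.single_iff {R : Set (RatFunc ℝ)} (h : Separated R) (t : AType) :
    Single R t ↔ typesOf R = {t} := by
  constructor
  · rintro ⟨w, rfl, hw⟩
    ext s
    constructor
    · rintro ⟨v, rfl, hv⟩; exact hv.unique hw
    · rintro rfl; exact ⟨w, rfl, hw⟩
  · intro hR
    obtain ⟨w, hwR, hw⟩ : t ∈ typesOf R := by rw [hR]; rfl
    refine ⟨w, Subset.antisymm (fun v hv => ?_) (by simpa using hwR), hw⟩
    obtain ⟨s, hs⟩ := exists_hasType v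
    have hst : s ∈ typesOf R := ⟨v, hv, hs⟩
    rw [hR] at hst
    obtain rfl : s = t := hst
    exact h.eq hv hwR hs hw

theorem Separated.double_iff {R : Set (RatFunc ℝ)} (h : Separated R) (t : AType) :
    Double R t t.opp ↔ typesOf R = {t, t.opp} := by
  constructor
  · rintro ⟨w, v, -, rfl, hw, hv⟩
    ext s
    constructor
    · rintro ⟨x, rfl | rfl, hx⟩
      · exact Or.inl (hx.unique hw)
      · exact Or.inr (hx.unique hv)
    · rintro (rfl | rfl)
      · exact ⟨w, Or.inl rfl, hw⟩
      · exact ⟨v, Or.inr rfl, hv⟩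
  · intro hR
    obtain ⟨w, hwR, hw⟩ : t ∈ typesOf R := by rw [hR]; exact Or.inl rfl
    obtain ⟨v, hvR, hv⟩ : t.opp ∈ typesOf R := by rw [hR]; exact Or.inr rfl
    refine ⟨w, v, fun hwv => t.opp_ne ?_, Subset.antisymm (fun x hx => ?_) ?_, hw, hv⟩
    · subst hwv; exact hv.unique hw
    · obtain ⟨s, hs⟩ := exists_hasType x
      have hst : s ∈ typesOf R := ⟨x, hx, hs⟩
      rw [hR] at hst
      rcases hst with rfl | rfl
      · exact Or.inl (h.eq hx hwR hs hw)
      · exact Or.inr (h.eq hx hvR hs hv)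
    · rintro x (rfl | rfl) <;> assumption

theorem Separated.not_of_mem {R : Set (RatFunc ℝ)} (h : Separated R) {s t : AType}
    (hs : s ∈ typesOf R) (ht : t ∈ typesOf R) (hne : s ≠ t) : s = t.opp := by
  obtain ⟨w, hw, h1⟩ := hs
  obtain ⟨v, hv, h2⟩ := ht
  exact h w hw v hv s t h1 h2 fun hwv => hne (by subst hwv; exact h1.unique h2)

/-- `asterisk` and `bullet` need types 2 and 3 together, which are not opposite. The remaining
labels are read off the set of types. -/
theorem Separated.hasLabel_iff {R : Set (RatFunc ℝ)} (h : Separated R) (L : Label) :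
    HasLabel R L ↔ match L with
      | .circ => typesOf R = {.one}
      | .times => typesOf R = {.two}
      | .plus => typesOf R = {.three}
      | .minus => typesOf R = {.four}
      | .asterisk => False
      | .div => typesOf R = {.three, .four}
      | .circtimes => typesOf R = {.one, .two}
      | .bullet => False := by
  cases L
  · exact h.single_iff .one
  · exact h.single_iff .two
  · exact h.single_iff .three
  · exact h.single_iff .four
  · simp only [HasLabel, iff_false]
    rintro ⟨w, v, hne, rfl, hw, hv⟩
    have := h w (Or.inl rfl) v (Or.inr rfl) _ _ hw hv hne
    simp [AType.opp] at this
  · exact h.double_iff .three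
  · exact h.double_iff .one
  · simp only [HasLabel, iff_false]
    rintro ⟨-, h2, h3, -⟩
    have := h.not_of_mem h2 h3 (by simp)
    simp [AType.opp] at this

/-! ### The quasi-rational spectrum -/

/-- The eigenvalue in the symmetric gauge. -/
def eShift (α β lam : ℝ) : ℝ := lam + (α + β) / 2 * ((α + β) / 2 + 1)

theorem lamT_shift (a b : ℝ) (l : List (AType × ℕ)) (t : AType) (i : ℤ) :
    eShift (αL a l) (βL b l) (lamT (αL a l) (βL b l) t i) = eN a b t (i + sh l t : ℤ) := by
  have h := zdeg_sh a b l t (i + sh l t)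
  rw [add_sub_cancel_right] at h
  rw [eN, ← h, eShift, zdeg]
  cases t <;> simp only [lamT, AType.sgnP, AType.sgnM] <;> push_cast <;> ring

theorem mem_ric_tau {a b : ℝ} (ha : ¬ IsInt a) (hb : ¬ IsInt b) {l : List (AType × ℕ)}
    (hl : Good a b l) {τ : ℝ[X]} (hτ : logD τ = uL a b l) {lam : ℝ} {w : RatFunc ℝ} :
    w ∈ ric (Trg τ (αL a l) (βL b l)) lam ↔
      ∃ t f, Eig (uL a b l) (αL a l) (βL b l) t (eShift (αL a l) (βL b l) lam) f ∧
        w = ld f + (omg t (αL a l) (βL b l) - omg .one (αL a l) (βL b l)) := by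
  rw [mem_ric_iff, hτ]
  constructor
  · intro h
    obtain ⟨t, f, hf, hw⟩ := exists_eig_of_srv ha hb hl h
    exact ⟨t, f, hf, by linear_combination hw⟩
  · rintro ⟨t, f, hf, rfl⟩
    have := hf.2
    rw [add_assoc, sub_add_cancel]
    exact this

theorem sgn_sub_one_div {x : ℤ} (hx : x = 1 ∨ x = -1) (α : ℝ) :
    (x - (1 : ℤ) : ℝ) * α / 2 = if x = 1 then 0 else -α := by
  rcases hx with rfl | rfl
  · simp
  · norm_num; ring

/-- The regular part contributes no pole at `±1`, and relative to type 1 the singular part has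
residue `0` or the non-zero number `-α`, respectively `-β`. -/
theorem hasType_eig {α β : ℝ} (hα : ¬ IsInt α) (hβ : ¬ IsInt β) {f : RatFunc ℝ}
    (hf : UnitAt 1 f ∧ UnitAt (-1) f) (t : AType) :
    HasType (ld f + (omg t α β - omg .one α β)) t := by
  have h1 : Reg 1 (ld f + (omg t α β - omg .one α β)) ↔ t.sgnP = 1 := by
    have hr : Reg 1 (ld f + RatFunc.C ((t.sgnM - (AType.one.sgnM : ℤ) : ℝ) * β / 2) * eM) :=
      hf.1.ld.add ((reg_C _ _).mul reg_eM_one)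
    rw [omg_sub, show AType.one.sgnP = 1 from rfl, sgn_sub_one_div t.sgnP_eq]
    constructor
    · intro h
      by_contra hP
      rw [if_neg hP, ← add_assoc, add_right_comm] at h
      have h0 := eq_zero_of_reg_pole (c := 1) (A := -α) (h.sub hr) (by rw [← eP_eq]; ring)
      exact hα ⟨0, by push_cast; linarith⟩
    · intro h
      rw [if_pos h, map_zero, zero_mul, zero_add]
      exact hr
  have h2 : Reg (-1) (ld f + (omg t α β - omg .one α β)) ↔ t.sgnM = 1 := by
    have hr : Reg (-1) (ld f + RatFunc.C ((t.sgnP - (AType.one.sgnP : ℤ) : ℝ) * α / 2) * eP) :=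
      hf.2.ld.add ((reg_C _ _).mul reg_eP_neg_one)
    rw [omg_sub, show AType.one.sgnM = 1 from rfl, sgn_sub_one_div t.sgnM_eq]
    constructor
    · intro h
      by_contra hP
      rw [if_neg hP, ← add_assoc] at h
      have h0 := eq_zero_of_reg_pole (c := -1) (A := -β) (h.sub hr) (by rw [← eM_eq]; ring)
      exact hβ ⟨0, by push_cast; linarith⟩
    · intro h
      rw [if_pos h, map_zero, zero_mul, add_zero]
      exact hr
  rw [Reg] at h1 h2
  generalize ld f + (omg t α β - omg .one α β) = w at h1 h2 ⊢
  clear hf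
  cases t <;> simp only [AType.sgnP, AType.sgnM, HasType] at * <;> norm_num at h1 h2 <;> tauto

theorem separated_ric {a b : ℝ} (ha : ¬ IsInt a) (hb : ¬ IsInt b) {l : List (AType × ℕ)}
    (hl : Good a b l) {τ : ℝ[X]} (hτ : logD τ = uL a b l) (lam : ℝ) :
    Separated (ric (Trg τ (αL a l) (βL b l)) lam) := by
  have hα := not_isInt_αL ha l
  have hβ := not_isInt_βL hb l
  intro w hw v hv s t hs ht hne
  obtain ⟨s', f, hf, rfl⟩ := (mem_ric_tau ha hb hl hτ).1 hw
  obtain ⟨t', g, hg, rfl⟩ := (mem_ric_tau ha hb hl hτ).1 hv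
  obtain rfl := (hasType_eig hα hβ (hf.unitAt_uL ha hb hl) s').unique hs
  obtain rfl := (hasType_eig hα hβ (hg.unitAt_uL ha hb hl) t').unique ht
  exact type_eq_opp_of_ne hα hβ hf hg fun h => hne (by linear_combination h)

theorem mem_typesOf_ric {a b : ℝ} (ha : ¬ IsInt a) (hb : ¬ IsInt b) {l : List (AType × ℕ)}
    (hl : Good a b l) {τ : ℝ[X]} (hτ : logD τ = uL a b l) {lam : ℝ} {t : AType} :
    t ∈ typesOf (ric (Trg τ (αL a l) (βL b l)) lam) ↔
      ∃ n ∈ Ind a b l t, eN a b t n = eShift (αL a l) (βL b l) lam := by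
  have hα := not_isInt_αL ha l
  have hβ := not_isInt_βL hb l
  constructor
  · rintro ⟨w, hw, ht⟩
    obtain ⟨s, f, hf, rfl⟩ := (mem_ric_tau ha hb hl hτ).1 hw
    obtain rfl := (hasType_eig hα hβ (hf.unitAt_uL ha hb hl) s).unique ht
    refine ⟨f.intDegree + sh l s, ⟨_, f, hf, by ring⟩, ?_⟩
    exact (hf.eigenvalue_uL ha hb hl (n := f.intDegree + sh l s) (by ring)).symm
  · rintro ⟨n, ⟨E, f, hf, hn⟩, hE⟩
    rw [← hf.eigenvalue_uL ha hb hl hn] at hE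
    subst hE
    exact ⟨_, (mem_ric_tau ha hb hl hτ).2 ⟨t, f, hf, rfl⟩, hasType_eig hα hβ (hf.unitAt_uL ha hb hl) t⟩

theorem qrDegree_eig {α β : ℝ} {f : RatFunc ℝ} (hf : f ≠ 0) (t : AType) :
    qrDegree (ld f + (omg t α β - omg .one α β)) = f.intDegree + degMu α β t := by
  rw [qrDegree_eq_of_hasLead ((hasLead_ld hf).add ((hasLead_omg t α β).sub (hasLead_omg .one α β)))]
  cases t <;> simp only [AType.sgnP, AType.sgnM, degMu] <;> push_cast <;> ring

theorem indexSet_tau {a b : ℝ} (ha : ¬ IsInt a) (hb : ¬ IsInt b) {l : List (AType × ℕ)}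
    (hl : Good a b l) {τ : ℝ[X]} (hτ : logD τ = uL a b l) (t : AType) :
    indexSet (Trg τ (αL a l) (βL b l)) (αL a l) (βL b l) t =
      (fun i : ℤ => (i : ℝ)) '' {i | i + sh l t ∈ Ind a b l t} := by
  have hα := not_isInt_αL ha l
  have hβ := not_isInt_βL hb l
  ext x
  constructor
  · rintro ⟨lam, w, hw, ht, rfl⟩
    obtain ⟨s, f, hf, rfl⟩ := (mem_ric_tau ha hb hl hτ).1 hw
    obtain rfl := (hasType_eig hα hβ (hf.unitAt_uL ha hb hl) s).unique ht
    refine ⟨f.intDegree, ⟨_, f, hf, by ring⟩, ?_⟩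
    rw [qrDegree_eig hf.1]; simp
  · rintro ⟨i, ⟨E, f, hf, hn⟩, rfl⟩
    refine ⟨E - (αL a l + βL b l) / 2 * ((αL a l + βL b l) / 2 + 1), _,
      (mem_ric_tau ha hb hl hτ).2 ⟨t, f, ?_, rfl⟩, hasType_eig hα hβ (hf.unitAt_uL ha hb hl) t, ?_⟩
    · rw [eShift, sub_add_cancel]; exact hf
    · rw [qrDegree_eig hf.1, hn]; push_cast; ring

theorem mem_qrSpectrum {T : Diff2} {lam : ℝ} :
    lam ∈ qrSpectrum T ↔ ∃ t, t ∈ typesOf (ric T lam) := by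
  constructor
  · rintro ⟨w, hw⟩
    obtain ⟨t, ht⟩ := exists_hasType w
    exact ⟨t, w, hw, ht⟩
  · rintro ⟨t, w, hw, -⟩
    exact ⟨w, hw⟩

/-! ### Coincidences of eigenvalues -/

/-- For integral `c` the map `n ↦ n + c` takes upper indices to upper indices of the opposite type
and interchanges the two conditions on the seeds. This produces the labels with two elements. -/
theorem NPlus.opp {a b : ℝ} {l : List (AType × ℕ)} {t : AType} (hc : IsInt (cT t a b)) {n : ℕ}
    (h : NPlus a b l t n) : ∃ m : ℕ, (m : ℝ) = n + cT t a b ∧ NPlus a b l t.opp m := by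
  obtain ⟨h1, h2, h3⟩ := h
  have h4 := h1 hc
  obtain ⟨c, hc'⟩ := hc
  have h5 : (0 : ℤ) ≤ n + c := by
    have : (0 : ℝ) ≤ n + c := by rw [← hc']; linarith
    exact_mod_cast this
  obtain ⟨m, hm⟩ := Int.eq_ofNat_of_zero_le h5
  have hm' : (m : ℝ) = n + cT t a b := by rw [hc']; exact_mod_cast hm.symm
  have hn0 : (0 : ℝ) ≤ n := Nat.cast_nonneg n
  refine ⟨m, hm', fun _ => ?_, fun h => h3 m h hm'.symm, fun k hk hk' => ?_⟩
  · rw [cT_opp, hm']; linarith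
  · rw [cT_opp, hm'] at hk'
    rw [AType.opp_opp] at hk
    have : n = k := by exact_mod_cast (by linarith : (n : ℝ) = k)
    exact h2 (this ▸ hk)

theorem eN_opp_eq {a b : ℝ} {t : AType} {n m : ℝ} (h : m = n + cT t a b) :
    eN a b t.opp m = eN a b t n := by
  rw [eN, eN, cT_opp, h]; ring

theorem eN_seed_dual (a b : ℝ) (t : AType) (k : ℕ) :
    eN a b t ((-(k : ℤ) - 1 : ℤ) : ℝ) = eN a b t.opp k := by
  rw [← eN_dual a b t.opp k, AType.opp_opp]; push_cast; rfl

/-- Behind the labels with a single element. Seed eigenvalues are pairwise different and differ from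
those of lower indices; two lower indices of opposite types would need `2m + c < 0`, `2m' - c < 0`
and `m' = m + c`, so that `m + m' < 0`. -/
theorem NMinus.ne_opp {a b : ℝ} (ha : ¬ IsInt a) (hb : ¬ IsInt b) {l : List (AType × ℕ)}
    (hl : Good a b l) {t : AType} {n n' : ℤ} (h : NMinus a b l t n) (h' : n' ∈ Ind a b l t.opp) :
    eN a b t n ≠ eN a b t.opp n' := by
  have hn0 : ∀ n : ℕ, (0 : ℝ) ≤ n := fun n => Nat.cast_nonneg n
  rcases h with ⟨m, rfl, hm⟩ | ⟨k, hk, rfl⟩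
  · rcases (mem_Ind_iff ha hb hl _ _).1 h' with (⟨m', rfl, hm'⟩ | ⟨k', hk', rfl⟩) | ⟨m', rfl, hm'⟩
    · intro he
      have h1 := hm.2
      have h2 := hm'.2
      rw [cT_opp] at h2
      rcases eN_eq_cases ha hb he with ⟨h3, -⟩ | ⟨-, h3 | h3⟩
      · exact t.opp_ne h3.symm
      · omega
      · push_cast at h3
        have := hn0 m
        have := hn0 m'
        linarith
    · rw [eN_seed_dual]
      exact_mod_cast eN_ne_of_lower ha hb (hl.upper _ hk') hm
    · exact_mod_cast eN_ne_of_lower ha hb (s := (t.opp, m')) hm'.1 hm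
  · rw [eN_seed_dual]
    rcases (mem_Ind_iff ha hb hl _ _).1 h' with (⟨m', rfl, hm'⟩ | ⟨k', hk', rfl⟩) | ⟨m', rfl, hm'⟩
    · intro he
      exact eN_ne_of_lower ha hb (hl.upper _ hk) hm' (by exact_mod_cast he.symm)
    · rw [eN_seed_dual]
      intro he
      have := congrArg Prod.fst (hl.eN_inj ha hb _ hk _ hk' he)
      exact t.opp.opp_ne this.symm
    · exact fun he => hm'.eN_ne ha hb hk (by exact_mod_cast he.symm)

theorem ne_opp_of_not_isInt {a b : ℝ} (ha : ¬ IsInt a) (hb : ¬ IsInt b) {l : List (AType × ℕ)}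
    (hl : Good a b l) {t : AType} (hc : ¬ IsInt (cT t a b)) {n n' : ℤ} (h : n ∈ Ind a b l t)
    (h' : n' ∈ Ind a b l t.opp) : eN a b t n ≠ eN a b t.opp n' := by
  rcases (mem_Ind_iff ha hb hl _ _).1 h with hm | ⟨m, rfl, hm⟩
  · exact hm.ne_opp ha hb hl h'
  rcases (mem_Ind_iff ha hb hl _ _).1 h' with hm' | ⟨m', rfl, hm'⟩
  · have := hm'.ne_opp ha hb hl (n' := (m : ℤ)) (by rwa [AType.opp_opp])
    rw [AType.opp_opp] at this
    exact this.symm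
  · intro he
    rcases eN_eq_cases ha hb he with ⟨h3, -⟩ | ⟨-, h3 | h3⟩
    · exact t.opp_ne h3.symm
    · omega
    · exact hc (isInt_of_add_eq h3)

/-- If `c` is integral, `n` and `-n-1-c` share an eigenvalue, so one may take `2N + 1 + c ≥ 0`. Then
`N` is an upper index, or its mirror image is a lower one, or `N < 0` and `-N-1` is a lower index of
the opposite type. If `c` is not integral, `n` or `-n-1` is an upper index. -/
theorem exists_classical (a b : ℝ) (t : AType) (n : ℤ) : ∃ (s : AType) (m : ℕ),
    m ∈ lowerIdx (cT s a b) ∪ upperIdx (cT s a b) ∧ eN a b s m = eN a b t n := by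
  by_cases hc : IsInt (cT t a b)
  · obtain ⟨c, hc⟩ := hc
    obtain ⟨N, hN, hE⟩ : ∃ N : ℤ, 0 ≤ 2 * N + 1 + c ∧ eN a b t N = eN a b t n := by
      by_cases h : 0 ≤ 2 * n + 1 + c
      · exact ⟨n, h, rfl⟩
      · refine ⟨-n - 1 - c, by omega, ?_⟩
        rw [eN, eN, hc]; push_cast; ring
    rw [← hE]
    rcases le_or_gt 0 N with h0 | h0
    · rcases le_or_gt 0 (N + c) with h1 | h1
      · obtain ⟨m, rfl⟩ := Int.eq_ofNat_of_zero_le h0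
        refine ⟨t, m, Or.inr fun _ => ?_, by simp⟩
        rw [hc]
        have : (0 : ℝ) ≤ (m + c : ℤ) := by exact_mod_cast h1
        push_cast at this
        linarith
      · obtain ⟨m, hm⟩ := Int.eq_ofNat_of_zero_le (show 0 ≤ -N - 1 - c by omega)
        have hm' : (m : ℝ) = -N - 1 - c := by exact_mod_cast hm.symm
        refine ⟨t, m, Or.inl ⟨⟨c, hc⟩, ?_⟩, ?_⟩
        · rw [hc, hm']
          have : (0 : ℝ) ≤ (2 * N + 1 + c : ℤ) := by exact_mod_cast hN
          push_cast at this
          linarith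
        · rw [eN, eN, hc, hm']; ring
    · obtain ⟨m, hm⟩ := Int.eq_ofNat_of_zero_le (show 0 ≤ -N - 1 by omega)
      have hm' : (m : ℝ) = -N - 1 := by exact_mod_cast hm.symm
      refine ⟨t.opp, m, Or.inl ⟨by rw [cT_opp, isInt_neg_iff]; exact ⟨c, hc⟩, ?_⟩, ?_⟩
      · rw [cT_opp, hc, hm']
        have : (0 : ℝ) ≤ (2 * N + 1 + c : ℤ) := by exact_mod_cast hN
        push_cast at this
        linarith
      · rw [eN, eN, cT_opp, hm']; ring
  · rcases le_or_gt 0 n with h0 | h0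
    · obtain ⟨m, rfl⟩ := Int.eq_ofNat_of_zero_le h0
      exact ⟨t, m, Or.inr fun h => absurd h hc, by simp⟩
    · obtain ⟨m, hm⟩ := Int.eq_ofNat_of_zero_le (show 0 ≤ -n - 1 by omega)
      have hm' : (m : ℝ) = -n - 1 := by exact_mod_cast hm.symm
      refine ⟨t.opp, m, Or.inr fun h => absurd (isInt_neg_iff.1 (by rwa [cT_opp] at h)) hc, ?_⟩
      rw [eN, eN, cT_opp, hm']; ring

/-- A seed eigenvalue is taken up by a dual function; any other keeps the classical eigenfunction it
had. -/
theorem exists_mem_Ind {a b : ℝ} (ha : ¬ IsInt a) (hb : ¬ IsInt b) {l : List (AType × ℕ)}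
    (hl : Good a b l) (t : AType) (n : ℤ) : ∃ s, ∃ m ∈ Ind a b l s, eN a b s m = eN a b t n := by
  by_cases h : ∃ s ∈ l, eN a b s.1 s.2 = eN a b t n
  · obtain ⟨s, hs, h⟩ := h
    refine ⟨s.1.opp, -(s.2 : ℤ) - 1, (mem_Ind_iff ha hb hl _ _).2
      (Or.inl (Or.inr ⟨s.2, by simpa using hs, rfl⟩)), ?_⟩
    rw [eN_seed_dual, AType.opp_opp, h]
  · push Not at h
    obtain ⟨s, m, hm, hE⟩ := exists_classical a b t n
    refine ⟨s, m, (mem_Ind_iff ha hb hl _ _).2 ?_, by exact_mod_cast hE⟩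
    rcases hm with hm | hm
    · exact Or.inl (Or.inl ⟨m, rfl, hm⟩)
    · refine Or.inr ⟨m, rfl, hm, fun h' => h _ h' hE, fun k hk hk' => h _ hk ?_⟩
      rw [← hE]
      exact eN_opp_eq hk'.symm

theorem AType.forall_iff {P : AType → Prop} : (∀ t, P t) ↔ P .one ∧ P .two ∧ P .three ∧ P .four :=
  ⟨fun h => ⟨h _, h _, h _, h _⟩, fun h t => by cases t <;> tauto⟩

theorem odd_of_half {a : ℝ} (ha : ¬ IsInt a) {m : ℤ} (hm : 2 * a = m) : ∃ k : ℤ, m = 2 * k + 1 := by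
  rcases Int.even_or_odd m with ⟨k, hk⟩ | h
  · refine absurd ⟨k, ?_⟩ ha
    have : (m : ℝ) = k + k := by exact_mod_cast hk
    linarith
  · exact h

/-- `2a` and `2b` are odd, so both `a + b` and `a - b` are integers, and both pairs of opposite
types are coupled. -/
theorem IsClassCB.isInt_add {a b : ℝ} (h : IsClassCB a b) : IsInt (a + b) ∧ IsInt (a - b) := by
  obtain ⟨ha, hb, ⟨m, hm⟩, ⟨n, hn⟩⟩ := h
  obtain ⟨k, rfl⟩ := odd_of_half ha hm
  obtain ⟨j, rfl⟩ := odd_of_half hb hn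
  push_cast at hm hn
  exact ⟨⟨k + j + 1, by push_cast; linarith⟩, ⟨k - j, by push_cast; linarith⟩⟩

theorem isClassC_shift {a b : ℝ} (h : IsClassC a b) (l : List (AType × ℕ)) :
    IsClassC (αL a l) (βL b l) := by
  obtain ⟨h1, h2, h3, h4⟩ := h
  refine ⟨not_isInt_αL h1 l, not_isInt_βL h2 l, ?_, ?_⟩
  · rw [αL, βL, show a + sumP l - (b + sumM l) = a - b + (sumP l - sumM l : ℤ) by push_cast; ring,
      isInt_add_int]
    exact h3
  · rw [αL, βL, show a + sumP l + (b + sumM l) = a + b + (sumP l + sumM l : ℤ) by push_cast; ring,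
      isInt_add_int]
    exact h4

theorem isClassCB_shift {a b : ℝ} (h : IsClassCB a b) (l : List (AType × ℕ)) :
    IsClassCB (αL a l) (βL b l) := by
  obtain ⟨h1, h2, h3, h4⟩ := h
  refine ⟨not_isInt_αL h1 l, not_isInt_βL h2 l, ?_, ?_⟩
  · rw [αL, show 2 * (a + sumP l) = 2 * a + (2 * sumP l : ℤ) by push_cast; ring, isInt_add_int]
    exact h3
  · rw [βL, show 2 * (b + sumM l) = 2 * b + (2 * sumM l : ℤ) by push_cast; ring, isInt_add_int]
    exact h4

theorem not_isInt_of_class {a b : ℝ} (h : IsClassC a b ∨ IsClassCB a b) :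
    ¬ IsInt a ∧ ¬ IsInt b ∧ IsInt (a + b) := by
  rcases h with h | h
  · exact ⟨h.1, h.2.1, h.2.2.2⟩
  · exact ⟨h.1, h.2.1, h.isInt_add.1⟩

/-! ### Spectrum, spectral diagrams and index sets of the operator -/

namespace Params

variable {d : Params}

theorem eShift_inj {α β x y : ℝ} : eShift α β x = eShift α β y ↔ x = y := by
  rw [eShift, eShift, add_left_inj]

theorem lamT_iff (t : AType) (i : ℤ) (lam : ℝ) :
    lam = lamT d.α d.β t i ↔ eN d.a d.b t (i + d.shift t : ℤ) = eShift d.α d.β lam := by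
  rw [← eShift_inj (α := d.α) (β := d.β), eq_comm (b := eShift d.α d.β lam), α_eq, β_eq, lamT_shift,
    sh_l]

theorem mem_σminus {t : AType} {lam : ℝ} : lam ∈ d.σminus t ↔
    ∃ n : ℤ, NMinus d.a d.b d.l t n ∧ eN d.a d.b t n = eShift d.α d.β lam := by
  constructor
  · rintro ⟨i, hi, h⟩
    exact ⟨_, mem_Iminus.1 hi, (lamT_iff t i lam).1 h⟩
  · rintro ⟨n, hn, h⟩
    refine ⟨n - d.shift t, mem_Iminus.2 (by rwa [sub_add_cancel]), ?_⟩
    rw [lamT_iff, sub_add_cancel, h]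

theorem mem_σplus {t : AType} {lam : ℝ} : lam ∈ d.σplus t ↔
    ∃ n : ℕ, NPlus d.a d.b d.l t n ∧ eN d.a d.b t n = eShift d.α d.β lam := by
  constructor
  · rintro ⟨i, hi, h⟩
    obtain ⟨n, rfl, hn⟩ := mem_Iplus.1 hi
    rw [lamT_iff, sub_add_cancel] at h
    exact ⟨n, hn, by exact_mod_cast h⟩
  · rintro ⟨n, hn, h⟩
    refine ⟨n - d.shift t, mem_Iplus.2 ⟨n, rfl, hn⟩, ?_⟩
    rw [lamT_iff, sub_add_cancel, ← h]
    norm_cast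

theorem σplus_subset {t : AType} (hc : IsInt (cT t d.a d.b)) : d.σplus t ⊆ d.σplus t.opp := by
  intro lam h
  obtain ⟨n, hn, h⟩ := mem_σplus.1 h
  obtain ⟨m, hm, hm'⟩ := hn.opp hc
  exact mem_σplus.2 ⟨m, hm', by rw [eN_opp_eq hm, h]⟩

theorem σplus_opp {t : AType} (hc : IsInt (cT t d.a d.b)) : d.σplus t = d.σplus t.opp := by
  refine Subset.antisymm (σplus_subset hc) ?_
  have := σplus_subset (d := d) (t := t.opp) (by rwa [cT_opp, isInt_neg_iff])
  rwa [AType.opp_opp] at this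

theorem mem_typesOf (ha : ¬ IsInt d.a) (hb : ¬ IsInt d.b) (hl : Good d.a d.b d.l) {τ : ℝ[X]}
    (hτ : logD τ = uL d.a d.b d.l) {lam : ℝ} {t : AType} :
    t ∈ typesOf (ric (Trg τ d.α d.β) lam) ↔ lam ∈ d.σminus t ∨ lam ∈ d.σplus t := by
  rw [α_eq, β_eq, mem_typesOf_ric ha hb hl hτ, mem_σminus, mem_σplus, α_eq, β_eq]
  constructor
  · rintro ⟨n, hn, h⟩
    rcases (mem_Ind_iff ha hb hl _ _).1 hn with hn' | ⟨m, rfl, hn'⟩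
    · exact Or.inl ⟨n, hn', h⟩
    · exact Or.inr ⟨m, hn', by exact_mod_cast h⟩
  · rintro (⟨n, hn, h⟩ | ⟨m, hn, h⟩)
    · exact ⟨n, (mem_Ind_iff ha hb hl _ _).2 (Or.inl hn), h⟩
    · exact ⟨m, (mem_Ind_iff ha hb hl _ _).2 (Or.inr ⟨m, rfl, hn⟩), by exact_mod_cast h⟩

theorem σminus_not_opp (ha : ¬ IsInt d.a) (hb : ¬ IsInt d.b) (hl : Good d.a d.b d.l) {lam : ℝ}
    {t : AType} (h : lam ∈ d.σminus t) : ¬ (lam ∈ d.σminus t.opp ∨ lam ∈ d.σplus t.opp) := by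
  obtain ⟨n, hn, h⟩ := mem_σminus.1 h
  rw [mem_σminus, mem_σplus]
  rintro (⟨n', hn', h'⟩ | ⟨n', hn', h'⟩)
  · exact hn.ne_opp ha hb hl ((mem_Ind_iff ha hb hl _ _).2 (Or.inl hn')) (h.trans h'.symm)
  · exact hn.ne_opp ha hb hl ((mem_Ind_iff ha hb hl _ _).2 (Or.inr ⟨n', rfl, hn'⟩))
      (h.trans (by exact_mod_cast h'.symm))

theorem σ_not_opp (ha : ¬ IsInt d.a) (hb : ¬ IsInt d.b) (hl : Good d.a d.b d.l) {lam : ℝ}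
    {t : AType} (hc : ¬ IsInt (cT t d.a d.b)) (h : lam ∈ d.σminus t ∨ lam ∈ d.σplus t) :
    ¬ (lam ∈ d.σminus t.opp ∨ lam ∈ d.σplus t.opp) := by
  have key : ∀ s, lam ∈ d.σminus s ∨ lam ∈ d.σplus s →
      ∃ n ∈ Ind d.a d.b d.l s, eN d.a d.b s n = eShift d.α d.β lam := by
    intro s hs
    rw [mem_σminus, mem_σplus] at hs
    rcases hs with ⟨n, hn, h⟩ | ⟨m, hn, h⟩
    · exact ⟨n, (mem_Ind_iff ha hb hl _ _).2 (Or.inl hn), h⟩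
    · exact ⟨m, (mem_Ind_iff ha hb hl _ _).2 (Or.inr ⟨m, rfl, hn⟩), by exact_mod_cast h⟩
  intro h'
  obtain ⟨n, hn, h1⟩ := key _ h
  obtain ⟨m, hm, h2⟩ := key _ h'
  exact ne_opp_of_not_isInt ha hb hl hc hn hm (h1.trans h2.symm)

theorem mem_sigmaQ {lam : ℝ} : lam ∈ sigmaQ d.α d.β ↔
    ∃ n : ℤ, eN d.a d.b .one n = eShift d.α d.β lam ∨ eN d.a d.b .three n = eShift d.α d.β lam := by
  have h1 : ∀ k : ℤ, lam = lamT d.α d.β .one k ↔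
      eN d.a d.b .one (k + d.shift .one : ℤ) = eShift d.α d.β lam := fun k => lamT_iff .one k lam
  have h3 : ∀ k : ℤ, lam = lamT d.α d.β .one (k - d.α) ↔
      eN d.a d.b .three (k + d.shift .three : ℤ) = eShift d.α d.β lam := by
    intro k
    rw [← lamT_iff]
    simp only [lamT]
    rw [show ((k : ℝ) - d.α) * (k - d.α + d.α + d.β + 1) = (k - d.α) * (k + d.β + 1) by ring]
  constructor
  · rintro ⟨k, h | h⟩
    · exact ⟨_, Or.inl ((h1 k).1 h)⟩
    · exact ⟨_, Or.inr ((h3 k).1 h)⟩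
  · rintro ⟨n, h | h⟩
    · exact ⟨n - d.shift .one, Or.inl ((h1 _).2 (by rwa [sub_add_cancel]))⟩
    · exact ⟨n - d.shift .three, Or.inr ((h3 _).2 (by rwa [sub_add_cancel]))⟩

/-- Duality `n ↦ -n-1` takes eigenvalues of types 2 and 4 to those of types 1 and 3, so two integer
families suffice; `exists_mem_Ind` shows that every value occurs. -/
theorem qrSpectrum_eq (ha : ¬ IsInt d.a) (hb : ¬ IsInt d.b) (hl : Good d.a d.b d.l) {τ : ℝ[X]}
    (hτ : logD τ = uL d.a d.b d.l) : qrSpectrum (Trg τ d.α d.β) = sigmaQ d.α d.β := by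
  ext lam
  rw [mem_qrSpectrum, mem_sigmaQ, α_eq, β_eq]
  constructor
  · rintro ⟨t, ht⟩
    obtain ⟨n, -, h⟩ := (mem_typesOf_ric ha hb hl hτ).1 ht
    have hd : ∀ s, eN d.a d.b s.opp n = eN d.a d.b s (-n - 1 : ℤ) := by
      intro s
      have := eN_dual d.a d.b s (-n - 1)
      rw [show -(-(n : ℝ) - 1) - 1 = n by ring] at this
      rw [this]; push_cast; rfl
    cases t
    · exact ⟨n, Or.inl h⟩
    · exact ⟨-n - 1, Or.inl (by rw [← hd .one]; exact h)⟩
    · exact ⟨n, Or.inr h⟩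
    · exact ⟨-n - 1, Or.inr (by rw [← hd .three]; exact h)⟩
  · have key : ∀ t (n : ℤ), eN d.a d.b t n = eShift (αL d.a d.l) (βL d.b d.l) lam →
        ∃ t, t ∈ typesOf (ric (Trg τ (αL d.a d.l) (βL d.b d.l)) lam) := by
      intro t n h
      obtain ⟨s, m, hm, hE⟩ := exists_mem_Ind ha hb hl t n
      exact ⟨s, (mem_typesOf_ric ha hb hl hτ).2 ⟨m, hm, hE.trans h⟩⟩
    rintro ⟨n, h | h⟩
    · exact key _ n h
    · exact key _ n h

theorem separated (ha : ¬ IsInt d.a) (hb : ¬ IsInt d.b) (hl : Good d.a d.b d.l) {τ : ℝ[X]}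
    (hτ : logD τ = uL d.a d.b d.l) (lam : ℝ) : Separated (ric (Trg τ d.α d.β) lam) := by
  rw [α_eq, β_eq]; exact separated_ric ha hb hl hτ lam

theorem mem_spectralDiagram (ha : ¬ IsInt d.a) (hb : ¬ IsInt d.b) (hl : Good d.a d.b d.l) {τ : ℝ[X]}
    (hτ : logD τ = uL d.a d.b d.l) (c : ℝ × Label) :
    c ∈ spectralDiagram (Trg τ d.α d.β) ↔ HasLabel (ric (Trg τ d.α d.β) c.1) c.2 := by
  refine ⟨fun h => h.2, fun h => ⟨mem_qrSpectrum.2 ?_, h⟩⟩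
  rw [(separated ha hb hl hτ c.1).hasLabel_iff] at h
  obtain ⟨x, L⟩ := c
  cases L
  · exact ⟨.one, h ▸ rfl⟩
  · exact ⟨.two, h ▸ rfl⟩
  · exact ⟨.three, h ▸ rfl⟩
  · exact ⟨.four, h ▸ rfl⟩
  · exact h.elim
  · exact ⟨.three, h ▸ Or.inl rfl⟩
  · exact ⟨.one, h ▸ Or.inl rfl⟩
  · exact h.elim

theorem mem_ΛC {lam : ℝ} {L : Label} : (lam, L) ∈ d.ΛC ↔ match L with
    | .circ => lam ∈ d.σminus .one
    | .times => lam ∈ d.σminus .two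
    | .plus => lam ∈ d.σminus .three ∨ lam ∈ d.σplus .three
    | .minus => lam ∈ d.σminus .four ∨ lam ∈ d.σplus .four
    | .asterisk => False
    | .div => False
    | .circtimes => lam ∈ d.σplus .one
    | .bullet => False := by
  cases L <;> simp [ΛC]

theorem mem_ΛCB {lam : ℝ} {L : Label} : (lam, L) ∈ d.ΛCB ↔ match L with
    | .circ => lam ∈ d.σminus .one
    | .times => lam ∈ d.σminus .two
    | .plus => lam ∈ d.σminus .three
    | .minus => lam ∈ d.σminus .four
    | .asterisk => False
    | .div => lam ∈ d.σplus .three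
    | .circtimes => lam ∈ d.σplus .one
    | .bullet => False := by
  cases L <;> simp [ΛCB]

theorem isInt_cT_one (h : IsInt (d.a + d.b)) : IsInt (cT .one d.a d.b) := by rwa [cT_one]

/-- By separation a label is decided by which types occur at `lam`, a matter of propositional logic.
Upper parts of types 1 and 2 coincide since `a + b` is an integer; types 3 and 4 never meet since `a
- b` is not. -/
theorem spectralDiagram_C (h : IsClassC d.a d.b) (hl : Good d.a d.b d.l) {τ : ℝ[X]}
    (hτ : logD τ = uL d.a d.b d.l) : spectralDiagram (Trg τ d.α d.β) = d.ΛC := by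
  obtain ⟨ha, hb, h3, h4⟩ := h
  have hc3 : ¬ IsInt (cT .three d.a d.b) := by
    rwa [cT_three, ← isInt_neg_iff, neg_add, neg_neg, ← sub_eq_add_neg]
  ext ⟨lam, L⟩
  rw [mem_spectralDiagram ha hb hl hτ, (separated ha hb hl hτ lam).hasLabel_iff, mem_ΛC]
  have hS := (separated ha hb hl hτ lam)
  have s12 := Set.ext_iff.1 (σplus_opp (d := d) (isInt_cT_one h4)) lam
  have m1 := σminus_not_opp ha hb hl (lam := lam) (t := .one)
  have m2 := σminus_not_opp ha hb hl (lam := lam) (t := .two)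
  have m3 := σ_not_opp ha hb hl (lam := lam) hc3
  have e13 := fun h h' => hS.not_of_mem (s := .one) (t := .three) h h' (by simp)
  have e14 := fun h h' => hS.not_of_mem (s := .one) (t := .four) h h' (by simp)
  have e23 := fun h h' => hS.not_of_mem (s := .two) (t := .three) h h' (by simp)
  have e24 := fun h h' => hS.not_of_mem (s := .two) (t := .four) h h' (by simp)
  simp only [mem_typesOf ha hb hl hτ, AType.opp, reduceCtorEq] at s12 m1 m2 m3 e13 e14 e23 e24
  cases L <;> simp only [Set.ext_iff, mem_insert_iff, mem_singleton_iff, mem_typesOf ha hb hl hτ,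
    AType.forall_iff, reduceCtorEq] <;> clear hS <;> grind

/-- Here `a - b` is an integer as well, so the upper parts of types 3 and 4 coincide too and carry
the label `div`. -/
theorem spectralDiagram_CB (h : IsClassCB d.a d.b) (hl : Good d.a d.b d.l) {τ : ℝ[X]}
    (hτ : logD τ = uL d.a d.b d.l) : spectralDiagram (Trg τ d.α d.β) = d.ΛCB ∧
      d.σplus .three = d.σplus .four := by
  obtain ⟨h3, h4⟩ := h.isInt_add
  obtain ⟨ha, hb, -, -⟩ := h
  have hc3 : IsInt (cT .three d.a d.b) := by
    rwa [cT_three, ← isInt_neg_iff, neg_add, neg_neg, ← sub_eq_add_neg]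
  have hσ := σplus_opp (d := d) hc3
  refine ⟨?_, hσ⟩
  ext ⟨lam, L⟩
  rw [mem_spectralDiagram ha hb hl hτ, (separated ha hb hl hτ lam).hasLabel_iff, mem_ΛCB]
  have hS := (separated ha hb hl hτ lam)
  have s12 := Set.ext_iff.1 (σplus_opp (d := d) (isInt_cT_one h3)) lam
  have s34 := Set.ext_iff.1 hσ lam
  have m1 := σminus_not_opp ha hb hl (lam := lam) (t := .one)
  have m2 := σminus_not_opp ha hb hl (lam := lam) (t := .two)
  have m3 := σminus_not_opp ha hb hl (lam := lam) (t := .three)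
  have m4 := σminus_not_opp ha hb hl (lam := lam) (t := .four)
  have e13 := fun h h' => hS.not_of_mem (s := .one) (t := .three) h h' (by simp)
  have e14 := fun h h' => hS.not_of_mem (s := .one) (t := .four) h h' (by simp)
  have e23 := fun h h' => hS.not_of_mem (s := .two) (t := .three) h h' (by simp)
  have e24 := fun h h' => hS.not_of_mem (s := .two) (t := .four) h h' (by simp)
  simp only [mem_typesOf ha hb hl hτ, AType.opp, reduceCtorEq] at s12 s34 m1 m2 m3 m4 e13 e14 e23 e24
  cases L <;> simp only [Set.ext_iff, mem_insert_iff, mem_singleton_iff, mem_typesOf ha hb hl hτ,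
    AType.forall_iff, reduceCtorEq] <;> clear hS <;> grind

theorem sigmaQ_eq_ΛC (h : IsClassC d.a d.b) (hl : Good d.a d.b d.l) {τ : ℝ[X]}
    (hτ : logD τ = uL d.a d.b d.l) : sigmaQ d.α d.β = Prod.fst '' d.ΛC := by
  rw [← qrSpectrum_eq h.1 h.2.1 hl hτ]
  ext lam
  rw [mem_qrSpectrum]
  have s12 := Set.ext_iff.1 (σplus_opp (d := d) (isInt_cT_one h.2.2.2)) lam
  rw [AType.opp] at s12
  simp only [mem_typesOf h.1 h.2.1 hl hτ, mem_image, Prod.exists, exists_and_right, exists_eq_right]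
  constructor
  · rintro ⟨t, ht⟩
    cases t
    · rcases ht with ht | ht
      · exact ⟨.circ, mem_ΛC.2 ht⟩
      · exact ⟨.circtimes, mem_ΛC.2 ht⟩
    · rcases ht with ht | ht
      · exact ⟨.times, mem_ΛC.2 ht⟩
      · exact ⟨.circtimes, mem_ΛC.2 (s12.2 ht)⟩
    · exact ⟨.plus, mem_ΛC.2 ht⟩
    · exact ⟨.minus, mem_ΛC.2 ht⟩
  · rintro ⟨L, hL⟩
    rw [mem_ΛC] at hL
    cases L
    · exact ⟨.one, Or.inl hL⟩
    · exact ⟨.two, Or.inl hL⟩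
    · exact ⟨.three, hL⟩
    · exact ⟨.four, hL⟩
    · exact hL.elim
    · exact hL.elim
    · exact ⟨.one, Or.inr hL⟩
    · exact hL.elim

theorem sigmaQ_eq_ΛCB (h : IsClassCB d.a d.b) (hl : Good d.a d.b d.l) {τ : ℝ[X]}
    (hτ : logD τ = uL d.a d.b d.l) : sigmaQ d.α d.β = Prod.fst '' d.ΛCB := by
  rw [← qrSpectrum_eq h.1 h.2.1 hl hτ]
  ext lam
  rw [mem_qrSpectrum]
  have s12 := Set.ext_iff.1 (σplus_opp (d := d) (isInt_cT_one h.isInt_add.1)) lam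
  have s34 := Set.ext_iff.1 (spectralDiagram_CB h hl hτ).2 lam
  rw [AType.opp] at s12
  simp only [mem_typesOf h.1 h.2.1 hl hτ, mem_image, Prod.exists, exists_and_right, exists_eq_right]
  constructor
  · rintro ⟨t, ht⟩
    cases t
    · rcases ht with ht | ht
      · exact ⟨.circ, mem_ΛCB.2 ht⟩
      · exact ⟨.circtimes, mem_ΛCB.2 ht⟩
    · rcases ht with ht | ht
      · exact ⟨.times, mem_ΛCB.2 ht⟩
      · exact ⟨.circtimes, mem_ΛCB.2 (s12.2 ht)⟩
    · rcases ht with ht | ht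
      · exact ⟨.plus, mem_ΛCB.2 ht⟩
      · exact ⟨.div, mem_ΛCB.2 ht⟩
    · rcases ht with ht | ht
      · exact ⟨.minus, mem_ΛCB.2 ht⟩
      · exact ⟨.div, mem_ΛCB.2 (s34.2 ht)⟩
  · rintro ⟨L, hL⟩
    rw [mem_ΛCB] at hL
    cases L
    · exact ⟨.one, Or.inl hL⟩
    · exact ⟨.two, Or.inl hL⟩
    · exact ⟨.three, Or.inl hL⟩
    · exact ⟨.four, Or.inl hL⟩
    · exact hL.elim
    · exact ⟨.three, Or.inr hL⟩
    · exact ⟨.one, Or.inr hL⟩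
    · exact hL.elim

theorem indexSet_eq (ha : ¬ IsInt d.a) (hb : ¬ IsInt d.b) (hl : Good d.a d.b d.l) {τ : ℝ[X]}
    (hτ : logD τ = uL d.a d.b d.l) (t : AType) :
    indexSet (Trg τ d.α d.β) d.α d.β t = (fun i : ℤ => (i : ℝ)) '' d.I t := by
  rw [α_eq, β_eq, indexSet_tau ha hb hl hτ]
  congr 1
  ext i
  rw [mem_ofPred_eq, mem_I ha hb hl, sh_l]

end Params

/-! ### The polynomial `τ` -/

/-- As a Wronskian `tauL` can have poles only at `±1`; as a product of regular parts of
eigenfunctions it has none there. -/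
theorem exists_poly_tauL {a b : ℝ} (ha : ¬ IsInt a) (hb : ¬ IsInt b) {l : List (AType × ℕ)}
    (hl : Good a b l) : ∃ τ : ℝ[X], tauL a b l = algebraMap ℝ[X] (RatFunc ℝ) τ := by
  obtain ⟨n, P, hP⟩ := mem_polesEnds.1 (wrS_mem_polesEnds a b l.reverse)
  have hu := unitAt_tauL ha hb hl
  refine exists_poly_of_reg (i := n) (j := n)
    (P := (X - 1) ^ pairP l * (X + 1) ^ pairM l * P) hu.1.1 hu.2.1 ?_
  rw [map_mul, ← hP, tauL_eq_wrS ha hb hl, pJ_eq, mono, mul_pow]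
  simp only [zpow_natCast, map_mul, map_pow, map_sub, map_add, map_one, RatFunc.algebraMap_X]
  ring

theorem gap_one {x : ℤ} (hx : x = 1 ∨ x = -1) : ((x : ℝ) - 1) / 2 = -(gap x 1 : ℝ) := by
  have : 2 * (gap x 1 : ℝ) = 1 - x * 1 := by
    exact_mod_cast congrArg (Int.cast (R := ℝ)) (gap_cast hx (Or.inl rfl))
  linarith

theorem prod_mu (a b : ℝ) (l : List (AType × ℕ)) {x : ℝ} (hx : x ∈ Ioo (-1 : ℝ) 1) :
    (l.map fun s => mu a b s.1 x).prod =
      (1 - x) ^ (-(cntP l .one * a)) * (1 + x) ^ (-(cntM l .one * b)) := by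
  have h1 : 0 < 1 - x := by linarith [hx.2]
  have h2 : 0 < 1 + x := by linarith [hx.1]
  induction l with
  | nil => simp [cntP, cntM]
  | cons s l ih =>
    rw [List.map_cons, List.prod_cons, ih, mu, gap_one s.1.sgnP_eq, gap_one s.1.sgnM_eq, cntP_cons,
      cntM_cons, mul_mul_mul_comm, ← Real.rpow_add h1, ← Real.rpow_add h2,
      show AType.one.sgnP = 1 from rfl, show AType.one.sgnM = 1 from rfl]
    push_cast
    congr 2 <;> ring

theorem val_X_sub_one (x : ℝ) : val (RatFunc.X - 1) x = x - 1 := by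
  simpa using val_X_sub x 1

theorem val_X_add_one (x : ℝ) : val (RatFunc.X + 1) x = x + 1 := by
  simpa using val_X_sub x (-1)

theorem reg_X_sub_one (x : ℝ) : Reg x (RatFunc.X - 1) := (reg_X x).sub (reg_one x)

theorem reg_X_add_one (x : ℝ) : Reg x (RatFunc.X + 1) := (reg_X x).add (reg_one x)

theorem reg_mono_nat (i j : ℕ) (x : ℝ) : Reg x (mono i j) := by
  rw [mono, zpow_natCast, zpow_natCast]
  exact ((reg_X_sub_one x).pow i).mul ((reg_X_add_one x).pow j)

theorem val_mono_nat (i j : ℕ) (x : ℝ) : val (mono i j) x = (x - 1) ^ i * (x + 1) ^ j := by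
  rw [mono, zpow_natCast, zpow_natCast, val_mul ((reg_X_sub_one x).pow i) ((reg_X_add_one x).pow j),
    val_pow (reg_X_sub_one x), val_pow (reg_X_add_one x), val_X_sub_one, val_X_add_one]

/-- The eigenfunction equation and the Riccati equation. -/
theorem act_Trg_iff {τ : ℝ[X]} {α β lam : ℝ} {f : RatFunc ℝ} (hf : f ≠ 0) :
    (Trg τ α β).act f = RatFunc.C lam * f ↔ ld f ∈ ric (Trg τ α β) lam := by
  rw [ric, mem_ofPred_eq, ratDeriv_ld_add_sq hf, Diff2.act, ld]
  constructor
  · intro h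
    field_simp
    linear_combination h
  · intro h
    field_simp at h
    linear_combination h

/-- The natural gauge and the rational gauge are conjugate by `τ`. -/
theorem act_Tng_mul {τ : ℝ[X]} (hτ : τ ≠ 0) (α β : ℝ) (f : RatFunc ℝ) :
    (Tng τ α β).act (algebraMap ℝ[X] (RatFunc ℝ) τ * f) =
      algebraMap ℝ[X] (RatFunc ℝ) τ * (Trg τ α β).act f := by
  have h0 := RatFunc.algebraMap_ne_zero hτ
  have h1 : ratDeriv (logD τ) = algebraMap ℝ[X] (RatFunc ℝ) (derivative (derivative τ)) /
      algebraMap ℝ[X] (RatFunc ℝ) τ - logD τ ^ 2 := by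
    have := ratDeriv_ld_add_sq h0
    rw [← logD_eq, ratDeriv_algebraMap, ratDeriv_algebraMap] at this
    linear_combination this
  have h2 : logD τ * algebraMap ℝ[X] (RatFunc ℝ) τ = algebraMap ℝ[X] (RatFunc ℝ) (derivative τ) := by
    rw [logD]; field_simp
  simp only [Diff2.act, Tng, Trg, ratDeriv_mul, ratDeriv_add, ratDeriv_algebraMap, h1]
  rw [← h2]
  field_simp
  ring

namespace Params

variable {d : Params}

theorem wr_seeds {x : ℝ} (hx : x ∈ Ioo (-1 : ℝ) 1) (L : List (AType × ℕ)) :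
    wr (d.seeds ++ L.map fun s => phi d.a d.b s.1 s.2) x =
      (1 - x) ^ (-(cntP d.l .one * d.a)) * (1 + x) ^ (-(cntM d.l .one * d.b)) *
        (L.map fun s => mu d.a d.b s.1 x).prod * val (wrS d.a d.b (d.l.reverse ++ L)) x := by
  rw [seeds_eq, ← List.map_append, wr_eq _ _ _ hx, List.map_append, List.prod_append, ← prod_mu _ _ _ hx]
  rw [l, List.reverse_reverse, List.map_reverse, List.prod_reverse]

/-- `τ` is, up to sign, the product of the transformed seed functions. -/
def IsTau (d : Params) (τ : ℝ[X]) : Prop :=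
  algebraMap ℝ[X] (RatFunc ℝ) τ = RatFunc.C ((-1) ^ pairP d.l) * tauL d.a d.b d.l

theorem exists_tau (ha : ¬ IsInt d.a) (hb : ¬ IsInt d.b) (hl : Good d.a d.b d.l) :
    ∃ τ : ℝ[X], d.IsTau τ ∧
      ∀ x ∈ Ioo (-1 : ℝ) 1, τ.eval x = d.tauFun x := by
  obtain ⟨P, hP⟩ := exists_poly_tauL ha hb hl
  refine ⟨C ((-1) ^ pairP d.l) * P, by rw [IsTau, hP, map_mul, RatFunc.algebraMap_C], fun x hx => ?_⟩
  have h1 : 0 < 1 - x := by linarith [hx.2]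
  have h2 : 0 < 1 + x := by linarith [hx.1]
  have hr := reg_of_mem_polesEnds (wrS_mem_polesEnds d.a d.b d.l.reverse) hx
  have hv := val_algebraMap P x
  rw [← hP, tauL_eq_wrS ha hb hl, val_mul (reg_mono_nat _ _ x) hr, val_mono_nat] at hv
  have hw := wr_seeds (d := d) hx []
  simp only [List.map_nil, List.append_nil, List.prod_nil, mul_one] at hw
  rw [eval_mul, eval_C, ← hv, tauFun, hw, cntP_l, cntM_l]
  have e1 : ((d.p₂ : ℝ) + d.p₃) * (d.p₁ + d.p₄ + d.a) =
      (pairP d.l : ℕ) + (d.p₂ + d.p₃ : ℕ) * d.a := by rw [pairP_l]; push_cast; ring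
  have e2 : ((d.p₂ : ℝ) + d.p₄) * (d.p₁ + d.p₃ + d.b) =
      (pairM d.l : ℕ) + (d.p₂ + d.p₄ : ℕ) * d.b := by rw [pairM_l]; push_cast; ring
  rw [e1, e2, Real.rpow_add h1, Real.rpow_add h2, Real.rpow_natCast, Real.rpow_natCast,
    Real.rpow_neg h1.le, Real.rpow_neg h2.le]
  have n1 := (Real.rpow_pos_of_pos h1 ((d.p₂ + d.p₃ : ℕ) * d.a)).ne'
  have n2 := (Real.rpow_pos_of_pos h2 ((d.p₂ + d.p₄ : ℕ) * d.b)).ne'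
  -- Passing from powers of `x - 1` to powers of `1 - x` produces the sign in `IsTau`.
  have e3 : (1 - x) ^ pairP d.l = (-1) ^ pairP d.l * (x - 1) ^ pairP d.l := by
    rw [← mul_pow]; ring_nf
  rw [e3, add_comm 1 x] at *
  field_simp

theorem logD_tau {τ : ℝ[X]} (hτ : d.IsTau τ)
    (ha : ¬ IsInt d.a) (hb : ¬ IsInt d.b) (hl : Good d.a d.b d.l) : logD τ = uL d.a d.b d.l := by
  rw [logD_eq, show _ = _ from hτ, ld_C_mul (pow_ne_zero _ (by norm_num)), uL_eq ha hb hl]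

theorem natDegree_tau {τ : ℝ[X]} (hτ : d.IsTau τ)
    (ha : ¬ IsInt d.a) (hb : ¬ IsInt d.b) (hl : Good d.a d.b d.l) : (τ.natDegree : ℤ) = d.tauDegree := by
  rw [← RatFunc.intDegree_polynomial, show _ = _ from hτ, RatFunc.intDegree_mul (by simp) (tauL_ne_zero ha hb hl),
    RatFunc.intDegree_C, zero_add, four_degree (four_intDegree_tauL ha hb hl)]

theorem eval_tau_ne_zero {τ : ℝ[X]} (hτ : d.IsTau τ)
    (ha : ¬ IsInt d.a) (hb : ¬ IsInt d.b) (hl : Good d.a d.b d.l) : τ.eval 1 ≠ 0 ∧ τ.eval (-1) ≠ 0 := by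
  have h := unitAt_tauL ha hb hl
  have h1 : ∀ c, UnitAt c (tauL d.a d.b d.l) → τ.eval c ≠ 0 := fun c hc => by
    have := ((unitAt_C (a := (-1) ^ pairP d.l) c (pow_ne_zero _ (by norm_num))).mul hc).2
    rwa [← show _ = _ from hτ, val_algebraMap] at this
  exact ⟨h1 _ h.1, h1 _ h.2⟩

theorem tau_ne_zero {τ : ℝ[X]} (hτ : d.IsTau τ)
    (ha : ¬ IsInt d.a) (hb : ¬ IsInt d.b) (hl : Good d.a d.b d.l) : τ ≠ 0 := by
  rintro rfl
  exact (eval_tau_ne_zero hτ ha hb hl).1 (by simp)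

theorem act_of_eig {τ : ℝ[X]} (hτ : d.IsTau τ)
    (ha : ¬ IsInt d.a) (hb : ¬ IsInt d.b) (hl : Good d.a d.b d.l) {f : RatFunc ℝ} {lam : ℝ} (hf : f ≠ 0) :
    (Trg τ d.α d.β).act f = RatFunc.C lam * f ↔
      Eig (uL d.a d.b d.l) d.α d.β .one (eShift d.α d.β lam) f := by
  rw [act_Trg_iff hf, mem_ric_iff, logD_tau hτ ha hb hl, Eig, and_iff_right hf, eShift]

theorem exists_nplus_bound (a b : ℝ) (l : List (AType × ℕ)) (t : AType) :
    ∃ B : ℕ, ∀ n ≥ B, NPlus a b l t n := by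
  obtain ⟨m, hm⟩ := exists_nat_ge (-cT t a b)
  obtain ⟨M, hM⟩ := (l.map Prod.snd).toFinset.exists_le
  obtain ⟨q, hq⟩ := exists_nat_ge (M - cT t a b)
  have hM' : ∀ s ∈ l, s.2 ≤ M := fun s hs => hM _ (by simpa using ⟨s.1, hs⟩)
  refine ⟨m + (M + 1) + (q + 1), fun n hn => ⟨fun _ => ?_, fun h => ?_, fun k hk h => ?_⟩⟩
  · have : (m : ℝ) ≤ n := by exact_mod_cast (by omega : m ≤ n)
    linarith
  · have := hM' _ h; simp only at this; omega
  · have h1 := hM' _ hk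
    have h2 : (q + 1 : ℝ) ≤ n := by exact_mod_cast (by omega : q + 1 ≤ n)
    have h3 : (k : ℝ) ≤ M := by exact_mod_cast h1
    linarith

theorem isExceptional_tau {τ : ℝ[X]} (hτ : d.IsTau τ)
    (ha : ¬ IsInt d.a) (hb : ¬ IsInt d.b) (hl : Good d.a d.b d.l) : IsExceptional τ d.α d.β := by
  refine ⟨(eval_tau_ne_zero hτ ha hb hl).1, (eval_tau_ne_zero hτ ha hb hl).2, ?_⟩
  have h0 := tau_ne_zero hτ ha hb hl
  obtain ⟨B, hB⟩ := exists_nplus_bound d.a d.b d.l .one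
  refine (Set.finite_lt_nat (τ.natDegree + (B + (sh d.l .one).natAbs) + (sh d.l .one).natAbs)).subset fun m hm => ?_
  rw [mem_ofPred_eq]
  by_contra hlt
  apply hm
  obtain ⟨n, hn⟩ : ∃ n : ℕ, (n : ℤ) = m - τ.natDegree + sh d.l .one :=
    ⟨(m - τ.natDegree + sh d.l .one).toNat, Int.toNat_of_nonneg (by omega)⟩
  have hN : NPlus d.a d.b d.l .one n := hB n (by omega)
  -- With `(.one, n)` as a further seed, `τ` times the eigenfunction is the next `tauL` up to sign,
  -- and hence a polynomial.
  have hl' : Good d.a d.b ((.one, n) :: d.l) := ⟨hl, hN⟩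
  obtain ⟨P, hP⟩ := exists_poly_tauL ha hb hl'
  have hE := eig_SL ha hb hl'
  have hd := intDegree_SL ha hb hl'
  rw [← α_eq, ← β_eq] at hE
  have hPτ : algebraMap ℝ[X] (RatFunc ℝ) (C ((-1) ^ pairP d.l) * P) =
      algebraMap ℝ[X] (RatFunc ℝ) τ * SL d.a d.b d.l (.one, n) := by
    rw [map_mul, ← hP, show _ = _ from hτ, RatFunc.algebraMap_C, tauL]; ring
  have hP0 : C ((-1) ^ pairP d.l) * P ≠ 0 := by
    intro h
    rw [h, map_zero] at hPτ
    exact mul_ne_zero (RatFunc.algebraMap_ne_zero h0) hE.1 hPτ.symm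
  refine ⟨C ((-1) ^ pairP d.l) * P, eN d.a d.b .one n - (d.α + d.β) / 2 * ((d.α + d.β) / 2 + 1), hP0, ?_, ?_⟩
  · have := RatFunc.intDegree_mul (RatFunc.algebraMap_ne_zero h0) hE.1
    rw [← hPτ, RatFunc.intDegree_polynomial, RatFunc.intDegree_polynomial, hd] at this
    simp only at this
    omega
  · rw [hPτ, act_Tng_mul h0, (act_of_eig hτ ha hb hl hE.1).2]
    · ring
    · rw [eShift, sub_add_cancel]; exact hE

end Params

/-! ### Monic eigenfunctions of type 1 -/

theorem Eig.C_mul {u : RatFunc ℝ} {α β E c : ℝ} {t : AType} {f : RatFunc ℝ} (hf : Eig u α β t E f)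
    (hc : c ≠ 0) : Eig u α β t E (RatFunc.C c * f) := by
  refine ⟨mul_ne_zero (by simpa using hc) hf.1, ?_⟩
  rw [ld_C_mul hc]
  exact hf.2

theorem eN_one_dual (a b : ℝ) (n : ℝ) : eN a b .one (-n - 1 - (a + b)) = eN a b .one n := by
  simp only [eN, cT, AType.sgnP, AType.sgnM, Int.cast_one, one_mul]; ring

/-- `P_N` and `P_n` share type and eigenvalue and are proportional. For `N = -n-1-(a+b)` this is the
drop of degree that occurs when `a + b` is an integer. -/
theorem natDegree_jacobiP_of_eN_eq {a b : ℝ} (ha : ¬ IsInt a) (hb : ¬ IsInt b) {n N : ℕ}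
    (hn : n ∈ lowerIdx (a + b) ∪ upperIdx (a + b)) (h : eN a b .one N = eN a b .one n) :
    (jacobiP N a b).natDegree = n := by
  have h1 := eig_base ha b (.one, N)
  have h2 := eig_base ha b (.one, n)
  simp only [h] at h1
  obtain ⟨c, hc, hcc⟩ := eq_C_mul_of_ld_eq h1.1 h2.1 (h1.ld_eq ha hb h2)
  have h3 : HasLead (base a b (.one, n)) n (jlead n (a + b)) := by
    simpa [base, AType.sgnP, AType.sgnM] using hasLead_jacobiF n a b
  have h4 := (h3.C_mul c).intDegree_eq (mul_ne_zero hc (jlead_ne_zero hn))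
  rw [← hcc, base, jacobiF, RatFunc.intDegree_polynomial] at h4
  simpa [AType.sgnP, AType.sgnM] using h4

theorem base_one (a b : ℝ) (n : ℕ) : base a b (.one, n) = algebraMap ℝ[X] (RatFunc ℝ) (jacobiP n a b) := by
  simp [base, AType.sgnP, AType.sgnM, jacobiF]

theorem poch_cast_add_one (n k : ℕ) : poch n ((k : ℝ) + 1) = (k + n).factorial / k.factorial := by
  rw [eq_div_iff (by positivity)]
  induction n with
  | zero => simp [poch_zero]
  | succ n ih =>
    rw [poch_succ, ← add_assoc, Nat.factorial_succ, mul_right_comm, ih]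
    push_cast; ring

namespace Params

variable {d : Params}

theorem floor_eq {c : ℤ} (hc : d.a + d.b = c) : ⌊d.a + d.b⌋ = c := by rw [hc, Int.floor_intCast]

theorem u_eq {c : ℤ} (hc : d.a + d.b = c) {n : ℤ} {m : ℕ} (h : max n (-n - 1 - c) = m) :
    d.u n = m := by
  rw [u, floor_eq hc, h, Int.toNat_natCast]

theorem prod_Kall_sub (ha : ¬ IsInt d.a) (hb : ¬ IsInt d.b) (hl : Good d.a d.b d.l) (x : ℝ) :
    ∏ k ∈ d.Kall, (x - k) =
      (d.l.map fun r => x + cT .one d.a d.b / 2 - zN d.a d.b r).prod := by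
  rw [prod_Kall ha hb hl]
  congr 1
  refine List.map_congr_left fun s _ => ?_
  rw [zN_eq, cT_one]; ring

theorem exists_deg_eq (ha : ¬ IsInt d.a) (hb : ¬ IsInt d.b) (hl : Good d.a d.b d.l) {x : ℝ}
    (h : ∏ k ∈ d.Kall, (x - k) = 0) : ∃ s ∈ d.l, x = d.deg s ∧
      eN d.a d.b .one x = eN d.a d.b s.1 s.2 := by
  rw [prod_Kall ha hb hl] at h
  by_contra! h'
  refine List.prod_ne_zero (fun h0 => ?_) h
  obtain ⟨s, hs, h0⟩ := List.mem_map.1 h0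
  refine h' s hs (sub_eq_zero.1 h0) ?_
  rw [eN_eq_zN d.a d.b s, zN_eq, ← sub_eq_zero.1 h0, eN, cT_one]

theorem hasLead_FL_of_eN_eq (ha : ¬ IsInt d.a) (hb : ¬ IsInt d.b) (hl : Good d.a d.b d.l) {m : ℕ}
    (hm : m ∈ lowerIdx (d.a + d.b) ∪ upperIdx (d.a + d.b))
    (hE : eN d.a d.b .one (d.u m) = eN d.a d.b .one m) :
    HasLead (FL d.a d.b d.l .one (base d.a d.b (.one, d.u m))) (m - sh d.l .one)
        (d.chi m * ∏ k ∈ d.Kall, ((m : ℝ) - k)) ∧ d.chi m ≠ 0 := by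
  have hnd := natDegree_jacobiP_of_eN_eq ha hb hm hE
  have hchi : d.chi m = (jacobiP (d.u m) d.a d.b).leadingCoeff := by
    rw [chi, if_pos (Int.natCast_nonneg m), mul_one]
  rw [hchi]
  constructor
  · have h1 := hasLead_algebraMap (jacobiP (d.u m) d.a d.b)
    rw [hnd] at h1
    have h2 := hasLead_FL ha hb hl .one _ _ _ h1
    rw [Int.cast_natCast, ← prod_Kall_sub ha hb hl] at h2
    rw [base_one]
    exact h2
  · rw [leadingCoeff_ne_zero]
    intro h0
    have := (eig_base ha d.b (.one, d.u m)).1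
    rw [base_one, h0, map_zero] at this
    exact this rfl

/-- Identifies the constant of `hasLead_FL_dual` with the closed form in `connCoeff`. Both leading
coefficients become quotients of factorials because `k - N = a + b`. -/
theorem chi_dual (ha : ¬ IsInt d.a) (hb : ¬ IsInt d.b) {k N : ℕ} (hN : (N : ℝ) = k - (d.a + d.b))
    (hu : d.u (-(k : ℤ) - 1) = N) : d.chi (-(k : ℤ) - 1) =
      -kapZero d.a N k / (jlead k (-(d.a + d.b)) * (k + N + 1)) := by
  have hNu : N ∈ lowerIdx (d.a + d.b) ∪ upperIdx (d.a + d.b) := Or.inr fun _ => by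
    have : (0 : ℝ) ≤ k := Nat.cast_nonneg k
    linarith
  have hLC : (jacobiP N d.a d.b).leadingCoeff = jlead N (d.a + d.b) := by
    rw [leadingCoeff, natDegree_jacobiP_of_eN_eq ha hb hNu rfl, jacobiP_coeff]
  have hj1 : jlead N (d.a + d.b) = 2⁻¹ ^ N * ((k + N).factorial / k.factorial) / N.factorial := by
    rw [jlead, ← poch_cast_add_one]
    congr 3
    rw [hN]; ring
  have hj2 : jlead k (-(d.a + d.b)) = 2⁻¹ ^ k * ((k + N).factorial / N.factorial) / k.factorial := by
    rw [jlead, add_comm k N, ← poch_cast_add_one]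
    congr 3
    rw [hN]; ring
  have e1 : (-(-(k : ℤ) - 1) - 1).toNat = k := by
    rw [neg_sub, sub_neg_eq_add, add_sub_cancel_left, Int.toNat_natCast]
  have e2 : ¬ (0 : ℤ) ≤ -(k : ℤ) - 1 := by omega
  rw [chi, hu, if_neg e2, hLC, connCoeff, kapZero, hj1, hj2, e1, Nat.factorial_succ (k + N),
    show -d.a + 1 = 1 - d.a by ring, add_comm d.a 1, poch, poch]
  generalize (ascPochhammer ℝ k).eval (1 - d.a) = p
  generalize (ascPochhammer ℝ N).eval (1 + d.a) = q
  have f1 : (k.factorial : ℝ) ≠ 0 := Nat.cast_ne_zero.2 k.factorial_ne_zero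
  have f2 : (N.factorial : ℝ) ≠ 0 := Nat.cast_ne_zero.2 N.factorial_ne_zero
  have f3 : ((k + N).factorial : ℝ) ≠ 0 := Nat.cast_ne_zero.2 (k + N).factorial_ne_zero
  generalize (k.factorial : ℝ) = F1 at *
  generalize (N.factorial : ℝ) = F2 at *
  push_cast
  generalize ((k + N).factorial : ℝ) = F3 at *
  have f4 : (k : ℝ) + N + 1 ≠ 0 := by positivity
  rw [pow_add, pow_add, inv_pow, inv_pow]
  field_simp

/-- The value `u n`, according to the kind of the index `n`. -/
theorem u_cases (ha : ¬ IsInt d.a) (hb : ¬ IsInt d.b) (hc : IsInt (d.a + d.b))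
    (hl : Good d.a d.b d.l) {n : ℤ} (hn : n ∈ Ind d.a d.b d.l .one) :
    (∃ m : ℕ, n = m ∧ m ∈ lowerIdx (d.a + d.b) ∧ (d.u n : ℝ) = -m - 1 - (d.a + d.b)) ∨
    (∃ k : ℕ, n = -k - 1 ∧ (.two, k) ∈ d.l ∧ (d.u n : ℝ) = k - (d.a + d.b)) ∨
    (∃ m : ℕ, n = m ∧ NPlus d.a d.b d.l .one m ∧ d.u n = m) := by
  obtain ⟨c, hc⟩ := hc
  rcases (mem_Ind_iff ha hb hl _ _).1 hn with (⟨m, rfl, hm⟩ | ⟨k, hk, rfl⟩) | ⟨m, rfl, hm⟩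
  · rw [cT_one] at hm
    refine Or.inl ⟨m, rfl, hm, ?_⟩
    have h2 := hm.2
    rw [hc] at h2
    have h2' : 2 * (m : ℤ) + c < 0 := by exact_mod_cast h2
    obtain ⟨N, hN⟩ := Int.eq_ofNat_of_zero_le (a := -m - 1 - c) (by omega)
    rw [u_eq hc (m := N) (by omega), hc]
    exact_mod_cast hN.symm
  · refine Or.inr (Or.inl ⟨k, rfl, hk, ?_⟩)
    have hkc := hl.upper _ hk
    simp only [AType.opp, cT_two] at hkc
    have h2 := hkc ⟨-c, by push_cast; linarith⟩
    have h2' : 0 ≤ (k : ℤ) - c := by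
      have : (0 : ℝ) ≤ (k : ℝ) - c := by linarith
      exact_mod_cast this
    obtain ⟨N, hN⟩ := Int.eq_ofNat_of_zero_le h2'
    rw [u_eq hc (m := N) (by omega), hc]
    exact_mod_cast hN.symm
  · refine Or.inr (Or.inr ⟨m, rfl, hm, u_eq hc ?_⟩)
    have h1 := hm.1
    rw [cT_one] at h1
    have h2 := h1 ⟨c, hc⟩
    have h2' : 0 ≤ (m : ℤ) + c := by
      have : (0 : ℝ) ≤ (m : ℝ) + c := by linarith
      exact_mod_cast this
    omega

theorem eN_u (ha : ¬ IsInt d.a) (hb : ¬ IsInt d.b) (hc : IsInt (d.a + d.b))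
    (hl : Good d.a d.b d.l) {n : ℤ} (hn : n ∈ Ind d.a d.b d.l .one) :
    eN d.a d.b .one (d.u n) = eN d.a d.b .one n := by
  rcases u_cases ha hb hc hl hn with ⟨m, rfl, -, h⟩ | ⟨k, rfl, -, h⟩ | ⟨m, rfl, -, h⟩
  · rw [h, eN_one_dual, Int.cast_natCast]
  · rw [h, ← eN_one_dual d.a d.b ((-(k : ℤ) - 1 : ℤ) : ℝ)]
    congr 1
    push_cast; ring
  · rw [h, Int.cast_natCast]

theorem eN_two_dual (k : ℕ) : eN d.a d.b .two k = eN d.a d.b .one (-(k : ℤ) - 1 : ℤ) := by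
  simp only [eN, cT_one, cT_two]; push_cast; ring

/-- A zero means that some seed has degree `n`, hence the same eigenvalue. This leaves `n = -k-1`
and the seed `(.two, k)`, whose degree is `u n ≥ 0`, a contradiction. -/
theorem prod_Kall_ne_zero (ha : ¬ IsInt d.a) (hb : ¬ IsInt d.b) (hc : IsInt (d.a + d.b))
    (hl : Good d.a d.b d.l) {n : ℤ} (hn : n ∈ Ind d.a d.b d.l .one) :
    (∏ k ∈ d.Kall, ((n : ℝ) - k)) ≠ 0 := by
  intro h0
  obtain ⟨s, hs, hdeg, hE⟩ := exists_deg_eq ha hb hl h0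
  rcases u_cases ha hb hc hl hn with ⟨m, rfl, hm, -⟩ | ⟨k, rfl, hk, hu⟩ | ⟨m, rfl, hm, -⟩
  · exact eN_ne_of_lower (t := .one) ha hb (hl.upper s hs) (by rwa [cT_one]) (by exact_mod_cast hE)
  · have h3 := hl.eN_inj ha hb s hs _ hk (hE.symm.trans (eN_two_dual k).symm)
    rw [h3, deg_two] at hdeg
    have : (0 : ℝ) ≤ k := Nat.cast_nonneg k
    have : (0 : ℝ) ≤ (d.u (-(k : ℤ) - 1) : ℝ) := Nat.cast_nonneg _
    push_cast at hdeg
    linarith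
  · exact hm.eN_ne ha hb hs (by exact_mod_cast hE)

/-- The transform of a Jacobi polynomial which is the eigenfunction of index `n`. -/
theorem hasLead_FL_u (ha : ¬ IsInt d.a) (hb : ¬ IsInt d.b) (hc : IsInt (d.a + d.b))
    (hl : Good d.a d.b d.l) {n : ℤ} (hn : n ∈ Ind d.a d.b d.l .one) :
    HasLead (FL d.a d.b d.l .one (base d.a d.b (.one, d.u n))) (n - sh d.l .one)
        (d.chi n * ∏ k ∈ d.Kall, ((n : ℝ) - k)) ∧ d.chi n ≠ 0 := by
  have hE := eN_u ha hb hc hl hn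
  rcases u_cases ha hb hc hl hn with ⟨m, rfl, hm, -⟩ | ⟨k, rfl, hk, hu⟩ | ⟨m, rfl, hm, -⟩
  · exact hasLead_FL_of_eN_eq ha hb hl (Or.inl hm) (by exact_mod_cast hE)
  · have hchi := chi_dual ha hb hu rfl
    have hlead := hasLead_FL_dual ha hb hl hu hk
    rw [← prod_Kall_sub ha hb hl, ← hchi] at hlead
    refine ⟨hlead, ?_⟩
    have h1 : d.a ≠ 0 := fun h => ha ⟨0, by simpa using h⟩
    have h2 := poch_ne_zero_of_not_isInt (x := d.a + 1) (by rwa [isInt_add_one]) (d.u (-(k : ℤ) - 1))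
    have h3 := poch_ne_zero_of_not_isInt (x := -d.a + 1) (by rwa [isInt_add_one, isInt_neg_iff]) k
    have h4 : jlead k (-(d.a + d.b)) ≠ 0 := jlead_ne_zero (Or.inr fun _ => by
      have : (0 : ℝ) ≤ (d.u (-(k : ℤ) - 1) : ℝ) := Nat.cast_nonneg _
      linarith)
    rw [hchi, kapZero]
    refine div_ne_zero (neg_ne_zero.2 ?_) (mul_ne_zero h4 (by positivity))
    exact mul_ne_zero (mul_ne_zero (mul_ne_zero two_ne_zero h1)
      (div_ne_zero h2 (Nat.cast_ne_zero.2 (Nat.factorial_ne_zero _))))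
      (div_ne_zero h3 (Nat.cast_ne_zero.2 (Nat.factorial_ne_zero _)))
  · have hm1 := hm.1
    rw [cT_one] at hm1
    exact hasLead_FL_of_eN_eq ha hb hl (Or.inr hm1) (by exact_mod_cast hE)

/-- The monic eigenfunction of index `i`. -/
def piR (d : Params) (i : ℤ) : RatFunc ℝ :=
  RatFunc.C (d.chi (i + d.p₁ - d.p₂) * ∏ k ∈ d.Kall, (((i + d.p₁ - d.p₂ : ℤ) : ℝ) - k))⁻¹ *
    FL d.a d.b d.l .one (base d.a d.b (.one, d.u (i + d.p₁ - d.p₂)))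

theorem add_shift (i : ℤ) : i + d.shift .one = i + d.p₁ - d.p₂ := by rw [shift]; ring

theorem mem_I_one (ha : ¬ IsInt d.a) (hb : ¬ IsInt d.b) (hl : Good d.a d.b d.l) {i : ℤ} :
    i ∈ d.I .one ↔ i + d.p₁ - d.p₂ ∈ Ind d.a d.b d.l .one := by
  rw [mem_I ha hb hl, add_shift]

theorem hasLead_piR (ha : ¬ IsInt d.a) (hb : ¬ IsInt d.b) (hc : IsInt (d.a + d.b))
    (hl : Good d.a d.b d.l) {i : ℤ} (hi : i ∈ d.I .one) : HasLead (d.piR i) i 1 := by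
  have hn := (mem_I_one ha hb hl).1 hi
  obtain ⟨h1, h2⟩ := hasLead_FL_u ha hb hc hl hn
  have h3 := prod_Kall_ne_zero ha hb hc hl hn
  have := h1.C_mul (d.chi (i + d.p₁ - d.p₂) * ∏ k ∈ d.Kall, (((i + d.p₁ - d.p₂ : ℤ) : ℝ) - k))⁻¹
  rw [inv_mul_cancel₀ (mul_ne_zero h2 h3), sh_l, shift, show i + (d.p₁ : ℤ) - d.p₂ - (d.p₁ - d.p₂) = i by ring] at this
  exact this

theorem eig_piR (ha : ¬ IsInt d.a) (hb : ¬ IsInt d.b) (hc : IsInt (d.a + d.b))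
    (hl : Good d.a d.b d.l) {i : ℤ} (hi : i ∈ d.I .one) :
    Eig (uL d.a d.b d.l) d.α d.β .one (eShift d.α d.β (lamT d.α d.β .one i)) (d.piR i) := by
  have hn := (mem_I_one ha hb hl).1 hi
  obtain ⟨h1, h2⟩ := hasLead_FL_u ha hb hc hl hn
  have h3 := prod_Kall_ne_zero ha hb hc hl hn
  have h4 := eN_u ha hb hc hl hn
  have h5 := eig_FL ha hb hl (eig_base ha d.b (.one, d.u (i + d.p₁ - d.p₂)))
    (h1.ne_zero (mul_ne_zero h2 h3))
  have h6 := h5.C_mul (inv_ne_zero (mul_ne_zero h2 h3))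
  simp only [h4] at h6
  rw [α_eq, β_eq, lamT_shift, sh_l, add_shift]
  exact h6

/-- Crum's formula expresses the transform through a Wronskian with one more column. The factors
`mu` of the seeds cancel in the quotient, and the powers of `x ± 1` come from `FL_eq_AL`. -/
theorem val_piR (ha : ¬ IsInt d.a) (hb : ¬ IsInt d.b) (hl : Good d.a d.b d.l) (i : ℤ) {x : ℝ}
    (hx : x ∈ Ioo (-1 : ℝ) 1) (h0 : wr d.seeds x ≠ 0) : val (d.piR i) x = d.piFun i x := by
  generalize hs : ((AType.one, d.u (i + d.p₁ - d.p₂)) : AType × ℕ) = s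
  have h1 := wr_seeds (d := d) hx []
  have h2 := wr_seeds (d := d) hx [s]
  have h3 := wrS_append ha hb hl s
  have hr := reg_of_mem_polesEnds (wrS_mem_polesEnds d.a d.b d.l.reverse) hx
  have hr' := reg_of_mem_polesEnds (wrS_mem_polesEnds d.a d.b (d.l.reverse ++ [s])) hx
  have hmu : mu d.a d.b s.1 x = 1 := by rw [← hs]; simp [mu, AType.sgnP, AType.sgnM]
  simp only [List.map_nil, List.append_nil, List.prod_nil, mul_one] at h1
  simp only [List.map_cons, List.map_nil, List.prod_cons, List.prod_nil, mul_one, hmu] at h2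
  rw [h1] at h0
  have hu : UnitAt x (wrS d.a d.b d.l.reverse) := ⟨hr, right_ne_zero_of_mul h0⟩
  have hw := left_ne_zero_of_mul h0
  have hAL : AL d.a d.b d.l s.1 (base d.a d.b s) =
      wrS d.a d.b (d.l.reverse ++ [s]) / wrS d.a d.b d.l.reverse := by
    rw [h3, mul_div_cancel_left₀ _ hu.ne_zero]
  have hFL := FL_eq_AL ha hb hl s.1 (base d.a d.b s)
  rw [← hs] at h2
  rw [piR, piFun, show d.seeds ++ [phi d.a d.b .one (d.u (i + d.p₁ - d.p₂))] = _ from rfl, h2, h1,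
    mul_div_mul_left _ _ hw, hs, show AType.one = s.1 by rw [← hs], hFL, hAL,
    val_mul (reg_C x _) ((reg_mono_nat _ _ x).mul (hr'.div hu)), val_C,
    val_mul (reg_mono_nat _ _ x) (hr'.div hu), val_mono_nat, val_div hr' hu,
    show s.1 = AType.one by rw [← hs], cntP_l, cntM_l]
  ring

/-- A non-zero rational eigenfunction is of type 1, so its degree lies in the index set, and type
and eigenvalue fix it up to a scalar. -/
theorem isQuasiPolyEigen_iff {τ : ℝ[X]} (hτ : d.IsTau τ) (ha : ¬ IsInt d.a) (hb : ¬ IsInt d.b)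
    (hc : IsInt (d.a + d.b)) (hl : Good d.a d.b d.l) (f : RatFunc ℝ) :
    IsQuasiPolyEigen (Trg τ d.α d.β) f ↔
      ∃ i ∈ d.I .one, ∃ c : ℝ, c ≠ 0 ∧ f = RatFunc.C c * d.piR i := by
  constructor
  · rintro ⟨hu, lam, h⟩
    have hf0 := (unitEnds_iff.1 hu).1.ne_zero
    have hf := (act_of_eig hτ ha hb hl hf0).1 h
    have hf' := hf
    rw [α_eq, β_eq] at hf'
    have hi : f.intDegree ∈ d.I .one := by
      rw [mem_I ha hb hl]
      exact ⟨_, f, hf', by rw [sh_l]; ring⟩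
    have hE := hf'.eigenvalue_uL ha hb hl (n := f.intDegree + sh d.l .one) (by ring)
    have hπ := eig_piR ha hb hc hl hi
    rw [← α_eq, ← β_eq] at hE
    have hE' : eShift d.α d.β (lamT d.α d.β .one f.intDegree) =
        eN d.a d.b .one (f.intDegree + sh d.l .one : ℤ) := by rw [α_eq, β_eq, lamT_shift]
    rw [hE', ← hE] at hπ
    have hα : ¬ IsInt d.α := by rw [α_eq]; exact not_isInt_αL ha _
    have hβ : ¬ IsInt d.β := by rw [β_eq]; exact not_isInt_βL hb _
    exact ⟨_, hi, eq_C_mul_of_ld_eq hf0 hπ.1 (hf.ld_eq hα hβ hπ)⟩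
  · rintro ⟨i, hi, c, hc0, rfl⟩
    have h := (eig_piR ha hb hc hl hi).C_mul hc0
    have h' := h
    rw [α_eq, β_eq] at h'
    exact ⟨unitEnds_iff.2 (h'.unitAt_uL ha hb hl), _, (act_of_eig hτ ha hb hl h.1).2 h⟩

end Params

/-! ### Antiderivatives on `(-1,1)` -/

/-- Non-integral exponents force the rational factor of the antiderivative to be divisible by `x² -
1` at the ends, which raises both exponents by one. -/
theorem hasQRPrimitive_of_ex {A B : ℝ} (hA : ¬ IsInt A) (hB : ¬ IsInt B) {F : RatFunc ℝ}
    (h1 : Reg 1 F) (h2 : Reg (-1) F) (h : Ex A B F) {φ : ℝ → ℝ} {S : Set ℝ} (hS : S.Finite)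
    (hφ : ∀ x ∈ Ioo (-1 : ℝ) 1, x ∉ S → φ x = val F x * ((1 - x) ^ A * (1 + x) ^ B)) :
    HasQRPrimitive φ (A + 1) (B + 1) := by
  obtain ⟨k, hk⟩ := h
  obtain ⟨g, hg1, hg2, rfl⟩ := vanish_ends hA hB h1 h2 hk
  -- The sign comes from `x² - 1 = -(1-x)(1+x)`.
  refine ⟨-g, ⟨hg1.neg, hg2.neg⟩, (hS.union (finite_not_reg g)).subset ?_⟩
  rintro x ⟨hx, hnot⟩
  by_contra hxS
  simp only [mem_union, mem_ofPred_eq, not_or, not_not] at hxS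
  obtain ⟨hxS, hg⟩ := hxS
  refine hnot (((hasDerivAt_weight (A + 1) (B + 1) hx).mul (hasDerivAt_val hg.neg)).congr_deriv ?_)
  have p1 : 0 < 1 - x := by linarith [hx.2]
  have p2 : 0 < 1 + x := by linarith [hx.1]
  have hpJ : Reg x pJ := ((reg_X x).pow 2).sub (reg_one x)
  have hvJ : val pJ x = x ^ 2 - 1 := by
    rw [pJ, val_sub ((reg_X x).pow 2) (reg_one x), val_pow (reg_X x), val_X, val_one]
  have hw : Reg x (RatFunc.C A * eP + RatFunc.C B * eM) :=
    ((reg_C x A).mul (reg_of_mem_polesEnds eP_mem_polesEnds hx)).add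
      ((reg_C x B).mul (reg_of_mem_polesEnds eM_mem_polesEnds hx))
  have h2X : Reg x (2 * RatFunc.X) := (reg_two x).mul (reg_X x)
  rw [hφ x hx hxS, ← hk, ratDeriv_mul, ratDeriv_pJ, ratDeriv_neg,
    val_add ((h2X.mul hg).add (hpJ.mul hg.ratDeriv)) (hw.mul (hpJ.mul hg)),
    val_add (h2X.mul hg) (hpJ.mul hg.ratDeriv), val_mul hw (hpJ.mul hg), val_mul hpJ hg,
    val_mul hpJ hg.ratDeriv, val_mul h2X hg, val_CeP_add hx, val_neg hg, val_neg hg.ratDeriv, hvJ,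
    val_mul (reg_two x) (reg_X x), val_X, show val 2 x = 2 by rw [← map_ofNat (RatFunc.C (K := ℝ)) 2, val_C],
    Real.rpow_add_one p1.ne', Real.rpow_add_one p2.ne']
  generalize (1 - x) ^ A = u
  generalize (1 + x) ^ B = v
  have h3 : x - 1 ≠ 0 := by linarith
  have h4 : x + 1 ≠ 0 := by linarith
  field_simp
  ring

/-- Green's formula: up to the difference of the eigenvalues, `p (f' g - f g')` times the weight is
the antiderivative. -/
theorem Eig.ex_mul {u : RatFunc ℝ} {α β E₁ E₂ : ℝ} {f g : RatFunc ℝ} (hf : Eig u α β .one E₁ f)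
    (hg : Eig u α β .one E₂ g) (hE : E₁ ≠ E₂) : Ex α β (f * g) := by
  have h1 := hf.2
  have h2 := hg.2
  have hω : RatFunc.C α * eP + RatFunc.C β * eM = 2 * omg .one α β := by
    simp only [omg, AType.sgnP, AType.sgnM, map_div₀, map_mul, map_ofNat, Int.cast_one, map_one]
    ring
  refine Ex.of_C_mul (c := E₁ - E₂) (sub_ne_zero.2 hE) ⟨pJ * (f * g) * (ld f - ld g), ?_⟩
  rw [hω, ratDeriv_mul, ratDeriv_mul, ratDeriv_mul, ratDeriv_pJ, ratDeriv_sub, map_sub,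
    ratDeriv_eq_ld_mul hf.1, ratDeriv_eq_ld_mul hg.1]
  rw [SRV, ratDeriv_add] at h1 h2
  linear_combination f * g * h1 - f * g * h2

theorem Gamma_add_nat {x : ℝ} (hx : ¬ IsInt x) (m : ℕ) :
    Real.Gamma (x + m) = poch m x * Real.Gamma x := by
  induction m with
  | zero => simp [poch_zero]
  | succ m ih =>
    have h0 : x + m ≠ 0 := fun h => hx ⟨-m, by push_cast; linarith⟩
    rw [poch_succ, Nat.cast_succ, ← add_assoc, Real.Gamma_add_one h0, ih]; ring

theorem Gamma_ne_zero_of_not_isInt {x : ℝ} (hx : ¬ IsInt x) : Real.Gamma x ≠ 0 :=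
  Real.Gamma_ne_zero fun m h => hx ⟨-m, by push_cast; exact h⟩

theorem nuZero_balanced (α : ℝ) : nuZero α (-1 - α) = Real.Gamma (α + 1) * Real.Gamma (-α) := by
  rw [nuZero, show (1 : ℝ) + α + (-1 - α) = 0 by ring, show α + (-1 - α) + 2 = 1 by ring,
    show -1 - α + 1 = -α by ring, Real.rpow_zero, Real.Gamma_one]; ring

theorem nuZero_balanced_ne_zero {α : ℝ} (hα : ¬ IsInt α) : nuZero α (-1 - α) ≠ 0 := by
  rw [nuZero_balanced]
  exact mul_ne_zero (Gamma_ne_zero_of_not_isInt (by rwa [isInt_add_one]))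
    (Gamma_ne_zero_of_not_isInt (by rwa [isInt_neg_iff]))

/-- The ratio of the two normalisations is the constant of `ex_one_sub`; therefore both conditions
of a formal norm hold with the same number. -/
theorem nuZero_eq {α β : ℝ} (hα : ¬ IsInt α) {m : ℕ} (hm : α + β + 1 = m) :
    nuZero α β = nuZero α (-1 - α) * (2 ^ m * poch m (-α) / m.factorial) := by
  rw [nuZero_balanced, nuZero, show 1 + α + β = (m : ℝ) by rw [← hm]; ring,
    show β + 1 = -α + m by rw [← hm]; ring, show α + β + 2 = (m : ℝ) + 1 by rw [← hm]; ring,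
    Gamma_add_nat (by rwa [isInt_neg_iff]), Real.Gamma_nat_eq_factorial, Real.rpow_natCast]
  ring

theorem val_zpow {c : ℝ} {f : RatFunc ℝ} (h : UnitAt c f) (n : ℤ) : val (f ^ n) c = val f c ^ n := by
  obtain ⟨m, rfl | rfl⟩ := n.eq_nat_or_neg
  · rw [zpow_natCast, zpow_natCast, val_pow h.1]
  · rw [zpow_neg, zpow_neg, zpow_natCast, zpow_natCast, val_inv ?_, val_pow h.1]
    have := h.zpow m
    rwa [zpow_natCast] at this

theorem unitAt_X_add_one {c : ℝ} (h : c ≠ -1) : UnitAt c (RatFunc.X + 1) := by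
  have := unitAt_X_sub h
  rwa [map_neg, sub_neg_eq_add, map_one] at this

theorem mono_zero_left (j : ℤ) : mono 0 j = (RatFunc.X + 1) ^ j := by rw [mono, zpow_zero, one_mul]

theorem reg_one_mono_zero (j : ℤ) : Reg 1 (mono 0 j) := by
  rw [mono_zero_left]; exact ((unitAt_X_add_one (by norm_num)).zpow j).1

theorem reg_mono_zero_nat (j : ℕ) (c : ℝ) : Reg c (mono 0 j) := reg_mono_nat 0 j c

theorem val_mono_zero {x : ℝ} (hx : x ∈ Ioo (-1 : ℝ) 1) (j : ℤ) : val (mono 0 j) x = (1 + x) ^ j := by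
  rw [mono_zero_left, val_zpow (unitAt_X_add_one hx.1.ne'), val_X_add_one, add_comm]

theorem reg_mono_zero {x : ℝ} (hx : x ∈ Ioo (-1 : ℝ) 1) (j : ℤ) : Reg x (mono 0 j) := by
  rw [mono_zero_left]; exact ((unitAt_X_add_one hx.1.ne').zpow j).1

theorem ex_sub_const {α β : ℝ} {m : ℕ} (hm : α + β + 1 = m) {f : RatFunc ℝ}
    {N K : ℝ} (hK : K = 2 ^ m * poch m (-α) / m.factorial) (hK0 : K ≠ 0)
    (h : Ex α β (f ^ 2 - RatFunc.C N * mono 0 (-m))) : Ex α β (f ^ 2 - RatFunc.C (N / K)) := by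
  have h1 := ex_one_sub α m
  rw [show -1 - α + m = β by rw [← hm]; ring, ← hK] at h1
  have h2 := h.sub (h1.C_mul (N / K))
  convert h2 using 1
  have : RatFunc.C (N / K) * RatFunc.C K = RatFunc.C N := by rw [← map_mul, div_mul_cancel₀ _ hK0]
  linear_combination -mono 0 (-m) * this

theorem isFormalNorm_of_ex {α β : ℝ} (hα : ¬ IsInt α) (hβ : ¬ IsInt β) {m : ℤ} (hm : α + β + 1 = m)
    {f : RatFunc ℝ} (h1 : Reg 1 f) (h2 : Reg (-1) f) {N : ℝ}
    (h : Ex α β (f ^ 2 - RatFunc.C N * mono 0 (-m))) : IsFormalNorm α β f (N * nuZero α (-1 - α)) := by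
  have hn := nuZero_balanced_ne_zero hα
  have hval : ∀ x ∈ Ioo (-1 : ℝ) 1, Reg x f → val (f ^ 2 - RatFunc.C N * mono 0 (-m)) x =
      val f x ^ 2 - (1 + x) ^ (-m) * N := by
    intro x hx hf
    rw [val_sub (hf.pow 2) ((reg_C x N).mul (reg_mono_zero hx _)), val_pow hf,
      val_mul (reg_C x N) (reg_mono_zero hx _), val_C, val_mono_zero hx, mul_comm N]
  have hF1 : Reg 1 (f ^ 2 - RatFunc.C N * mono 0 (-m)) :=
    (h1.pow 2).sub ((reg_C 1 N).mul (reg_one_mono_zero _))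
  constructor
  · rcases le_or_gt m 0 with hm0 | hm0
    · rw [min_eq_left (by
        have : (m : ℝ) ≤ 0 := by exact_mod_cast hm0
        linarith)]
      obtain ⟨j, hj⟩ := Int.eq_ofNat_of_zero_le (a := -m) (by omega)
      refine hasQRPrimitive_of_ex hα hβ hF1 ((h2.pow 2).sub ((reg_C _ N).mul ?_)) h
        (finite_not_reg f) fun x hx hf => ?_
      · rw [hj]; exact reg_mono_zero_nat j _
      · rw [mem_ofPred_eq, not_not] at hf
        rw [hval x hx hf, mul_div_cancel_right₀ _ hn, hm, ← Int.cast_neg, Real.rpow_intCast]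
    -- For `m > 0` the function `(x+1)^(-m)` is singular at `-1`. Moving `(x+1)^m` from the weight
    -- into the integrand makes it regular and lowers the exponent of the weight to `-1-α`.
    · rw [min_eq_right (by
        have : (0 : ℝ) < m := by exact_mod_cast hm0
        have : (1 : ℝ) ≤ m := by exact_mod_cast hm0
        linarith), show -α = -1 - α + 1 by ring]
      obtain ⟨j, rfl⟩ := Int.eq_ofNat_of_zero_le hm0.le
      have hβ' : ¬ IsInt (-1 - α) := by
        rw [show -1 - α = -(α + 1) by ring, isInt_neg_iff, isInt_add_one]; exact hα
      have h3 : Ex (α + (0 : ℤ)) (-1 - α + (j : ℤ)) (f ^ 2 - RatFunc.C N * mono 0 (-j)) := by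
        rw [← hm]; convert h using 1 <;> push_cast <;> ring
      have h4 := h3.shift
      refine hasQRPrimitive_of_ex hα hβ' (hF1.mul (reg_mono_zero_nat j _)) ?_ h4
        (finite_not_reg f) fun x hx hf => ?_
      · have : (f ^ 2 - RatFunc.C N * mono 0 (-j)) * mono 0 j = f ^ 2 * mono 0 j - RatFunc.C N := by
          rw [sub_mul, mul_assoc, ← mono_add, add_zero, neg_add_cancel, mono_zero, mul_one]
        rw [this]
        exact ((h2.pow 2).mul (reg_mono_zero_nat j _)).sub (reg_C _ _)
      · rw [mem_ofPred_eq, not_not] at hf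
        have hp : 0 < 1 + x := by linarith [hx.1]
        rw [val_mul ((hf.pow 2).sub ((reg_C x N).mul (reg_mono_zero hx _))) (reg_mono_zero hx _),
          hval x hx hf, mul_div_cancel_right₀ _ hn, hm, val_mono_zero hx,
          show β = -1 - α + (j : ℤ) by rw [← hm]; ring, Real.rpow_add hp, ← Int.cast_neg,
          Real.rpow_intCast, Real.rpow_intCast]
        ring
  · intro hm0
    obtain ⟨j, rfl⟩ := Int.eq_ofNat_of_zero_le (a := m) (by rw [hm] at hm0; exact_mod_cast hm0)
    have hm' : α + β + 1 = j := by rw [hm, Int.cast_natCast]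
    have hK := nuZero_eq hα hm'
    have hK0 : (2 : ℝ) ^ j * poch j (-α) / j.factorial ≠ 0 :=
      div_ne_zero (mul_ne_zero (by positivity)
        (poch_ne_zero_of_not_isInt (by rwa [isInt_neg_iff]) j)) (by positivity)
    refine hasQRPrimitive_of_ex hα hβ ((h1.pow 2).sub (reg_C _ _)) ((h2.pow 2).sub (reg_C _ _))
      (ex_sub_const hm' rfl hK0 h) (finite_not_reg f) fun x hx hf => ?_
    rw [mem_ofPred_eq, not_not] at hf
    rw [val_sub (hf.pow 2) (reg_C _ _), val_pow hf, val_C, hK, mul_comm N, mul_div_mul_left _ _ hn]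

/-! ### Formal norms -/

/-- With both exponents raised by `n`, `ex_one_sub` lowers their sum to `-1`; `ex_balanced` then
trades the remaining powers of `x - 1` for powers of `x + 1`. -/
theorem ex_mono_diag {a b : ℝ} (ha : ¬ IsInt a) {n M : ℕ} (hM : 2 * (n : ℝ) + (a + b) + 1 = M) :
    Ex a b (mono n n - RatFunc.C (2 ^ M * poch M (-a - n) / M.factorial) * mono 0 (-(M - 2 * n : ℤ))) := by
  have h1 := ex_one_sub (a + n) M
  rw [show -1 - (a + n) + M = b + (n : ℤ) by rw [← hM]; push_cast; ring, neg_add, ← sub_eq_add_neg,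
    show a + (n : ℝ) = a + (n : ℤ) by norm_cast] at h1
  have h2 := h1.shift
  have h3 := (ex_balanced (A := a) (B := b) (m := M - 2 * n) ha (by push_cast; linarith) n).C_mul
    (2 ^ M * poch M (-a - n) / M.factorial)
  rw [sub_mul, one_mul, mul_assoc, ← mono_add] at h2
  have h4 := h2.add h3
  convert h4 using 1
  rw [show (-(M - 2 * n : ℤ) - n : ℤ) = -M + n by ring, zero_add]
  ring

theorem ex_mono_diag_of_neg {a b : ℝ} (ha : ¬ IsInt a) {n j : ℕ}
    (hM : 2 * (n : ℝ) + (a + b) + 1 = -1 - j) : Ex a b (mono n n) := by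
  have h1 := ex_one_of_neg (A := a + n) (by
    have := isInt_add_int (x := a) n
    rw [Int.cast_natCast] at this
    rwa [this]) j
  rw [show -2 - (a + n) - j = b + (n : ℤ) by push_cast; linarith,
    show a + (n : ℝ) = a + (n : ℤ) by norm_cast] at h1
  simpa using h1.shift

theorem ex_of_sub_ex {A B c e : ℝ} (he : e ≠ 0) {f g : RatFunc ℝ}
    (h1 : Ex A B (RatFunc.C c * f - RatFunc.C e * g)) : Ex A B (g - RatFunc.C (c / e) * f) := by
  have h2 := h1.neg.C_mul e⁻¹
  convert h2 using 1
  rw [neg_sub, mul_sub, ← mul_assoc, ← mul_assoc, ← map_mul, ← map_mul, inv_mul_cancel₀ he, map_one,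
    one_mul, div_eq_inv_mul]

theorem poch_ne_zero_of_mem {n : ℕ} {c : ℝ} (hn : n ∈ lowerIdx c ∪ upperIdx c) :
    poch n (n + c + 1) ≠ 0 := by
  intro h
  apply jlead_ne_zero hn
  rw [jlead, h]; simp

theorem ex_jacobiF_sq_sub {a b : ℝ} (ha : ¬ IsInt a) {n M : ℕ}
    (hn : n ∈ lowerIdx (a + b) ∪ upperIdx (a + b)) (hM : 2 * (n : ℝ) + (a + b) + 1 = M) :
    Ex a b (jacobiF n a b ^ 2 - RatFunc.C (jlead n (a + b) ^ 2 *
      ((-1) ^ n * n.factorial / poch n (n + (a + b) + 1) * (2 ^ M * poch M (-a - n) / M.factorial))) *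
      mono 0 (-(M - 2 * n : ℤ))) := by
  have hP := poch_ne_zero_of_mem hn
  have hf : (n.factorial : ℝ) ≠ 0 := Nat.cast_ne_zero.2 n.factorial_ne_zero
  have h1 : ((-1 : ℝ) ^ n) ≠ 0 := pow_ne_zero _ (by norm_num)
  have h2 := ex_of_sub_ex (mul_ne_zero (mul_ne_zero h1 hf) hP) (ex_jacobiF_sq n a b)
  have h3 := h2.add ((ex_mono_diag ha hM).C_mul ((n.factorial * jlead n (a + b)) ^ 2 /
    ((-1) ^ n * n.factorial * poch n (n + (a + b) + 1))))
  convert h3 using 1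
  rw [mul_sub, sub_add_sub_cancel, ← mul_assoc (RatFunc.C _) (RatFunc.C _), ← map_mul]
  congr 3
  have h4 : ((-1 : ℝ) ^ n) * (-1) ^ n = 1 := by rw [← mul_pow]; norm_num
  generalize 2 ^ M * poch M (-a - n) / (M.factorial : ℝ) = K
  field_simp
  linear_combination jlead n (a + b) ^ 2 * K * h4

theorem ex_jacobiF_sq_of_neg {a b : ℝ} (ha : ¬ IsInt a) {n j : ℕ}
    (hn : n ∈ lowerIdx (a + b) ∪ upperIdx (a + b)) (hM : 2 * (n : ℝ) + (a + b) + 1 = -1 - j) :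
    Ex a b (jacobiF n a b ^ 2) := by
  have hP := poch_ne_zero_of_mem hn
  have hf : (n.factorial : ℝ) ≠ 0 := Nat.cast_ne_zero.2 n.factorial_ne_zero
  have h1 : ((-1 : ℝ) ^ n) ≠ 0 := pow_ne_zero _ (by norm_num)
  have h2 := ex_of_sub_ex (mul_ne_zero (mul_ne_zero h1 hf) hP) (ex_jacobiF_sq n a b)
  have h3 := h2.add ((ex_mono_diag_of_neg ha hM).C_mul ((n.factorial * jlead n (a + b)) ^ 2 /
    ((-1) ^ n * n.factorial * poch n (n + (a + b) + 1))))
  rwa [sub_add_cancel] at h3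

/-- The transformations multiply the norms by `normFac`. -/
theorem ex_FL_sq_sub {a b : ℝ} (ha : ¬ IsInt a) (hb : ¬ IsInt b) {l : List (AType × ℕ)}
    (hl : Good a b l) {E K : ℝ} {f : RatFunc ℝ} (hf : Eig 0 a b .one E f) {m : ℤ} (hm : a + b + 1 = m)
    (h : Ex a b (RatFunc.C (normFac a b l E) * (f ^ 2 - RatFunc.C K * mono 0 (-m)))) :
    Ex (αL a l) (βL b l) (FL a b l .one f ^ 2 -
      RatFunc.C (normFac a b l E * K) * mono 0 (-(m + sumP l + sumM l))) := by
  have h1 := ex_FL_sq ha hb hl hf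
  have h2 := (ex_balanced (A := a) (B := b) ha hm (sumP l)).C_mul (normFac a b l E * K)
  simp only [AType.sgnP, AType.sgnM, Int.cast_one, one_mul, wL] at h1
  refine Ex.unshift (sumP l) (sumM l) ?_
  have h3 := (h1.add h).sub h2
  convert h3 using 1
  rw [sub_mul, mul_assoc (RatFunc.C _), ← mono_add, zero_add,
    show -(m + sumP l + sumM l) + sumM l = -m - sumP l by ring, map_mul]
  ring

theorem neg_one_pow_sumP (l : List (AType × ℕ)) {x : ℤ} (hx : x = sumP l) :
    ((-1 : ℝ) ^ x) = (-1) ^ l.length := by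
  have h := two_cntP l .one
  simp only [AType.sgnP, one_mul] at h
  rw [hx, show sumP l = (l.length : ℤ) + (-(2 * (cntP l .one : ℤ))) by linarith, zpow_add₀ (by norm_num),
    zpow_neg, zpow_mul, zpow_natCast]
  norm_num

theorem Gamma_reflect_nat {x : ℝ} (hx : ¬ IsInt x) (n : ℕ) :
    Real.Gamma (x + n + 1) * Real.Gamma (-(x + n)) =
      (-1) ^ n * (Real.Gamma (x + 1) * Real.Gamma (-x)) := by
  induction n with
  | zero => simp
  | succ n ih =>
    have h0 : x + n + 1 ≠ 0 := fun h => hx ⟨-n - 1, by push_cast; linarith⟩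
    have h1 : -(x + n + 1) ≠ 0 := neg_ne_zero.2 h0
    have h2 := Real.Gamma_add_one h1
    rw [show -(x + n + 1) + 1 = -(x + n) by ring] at h2
    rw [h2] at ih
    push_cast
    rw [← add_assoc, Real.Gamma_add_one h0, pow_succ]
    linear_combination -ih

theorem Gamma_reflect_int {x : ℝ} (hx : ¬ IsInt x) (n : ℤ) :
    Real.Gamma (x + n + 1) * Real.Gamma (-(x + n)) =
      (-1) ^ n * (Real.Gamma (x + 1) * Real.Gamma (-x)) := by
  obtain ⟨m, rfl | rfl⟩ := n.eq_nat_or_neg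
  · simpa using Gamma_reflect_nat hx m
  · have h := Gamma_reflect_nat (x := x + (-m : ℤ)) (by rwa [isInt_add_int]) m
    rw [show x + (-m : ℤ) + (m : ℝ) = x by push_cast; ring] at h
    have h1 : ((-1 : ℝ) ^ m) * (-1) ^ m = 1 := by rw [← mul_pow]; norm_num
    have h2 : ((-1 : ℝ) ^ (-(m : ℤ))) = (-1) ^ m := by
      rw [zpow_neg, zpow_natCast]; exact inv_eq_of_mul_eq_one_left h1
    rw [h, h2, ← mul_assoc, h1, one_mul]

/-- `Γ(x+1) Γ(-x)` changes sign under `x ↦ x + 1`, so the seeds contribute only a sign, which the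
one in `normFac_eN` cancels. -/
theorem nuZero_αL {a : ℝ} (ha : ¬ IsInt a) (l : List (AType × ℕ)) :
    nuZero (αL a l) (-1 - αL a l) = (-1) ^ l.length * (Real.Gamma (a + 1) * Real.Gamma (-a)) := by
  rw [nuZero_balanced, αL, Gamma_reflect_int ha, neg_one_pow_sumP l rfl]

namespace Params

variable {d : Params}

/-- Each factor is `-(x - k)(x - k*)`: the two roots are the degree of the seed and its mirror
image. -/
theorem normFac_eN (ha : ¬ IsInt d.a) (hb : ¬ IsInt d.b) (hl : Good d.a d.b d.l) (x : ℝ) :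
    normFac d.a d.b d.l (eN d.a d.b .one x) = (-1) ^ d.l.length * (∏ k ∈ d.Kall, (x - k)) *
      ∏ k ∈ d.Kall, (x - (-k - d.a - d.b - 1)) := by
  have h1 : ((-1 : ℝ) ^ d.l.length) = (d.l.map fun _ => (-1 : ℝ)).prod := by simp
  rw [prod_Kall ha hb hl, prod_Kall ha hb hl (fun k => x - (-k - d.a - d.b - 1)), h1, normFac,
    ← List.prod_map_mul, ← List.prod_map_mul]
  congr 2
  ext s
  rw [eN_eq_zN d.a d.b s, zN_eq, eN, cT_one]
  ring

theorem kappa_eq (z : ℝ) : d.kappa z = (∏ k ∈ d.Kall, (z - (-k - d.a - d.b - 1))) /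
    ∏ k ∈ d.Kall, (z - k) := by rw [kappa, Finset.prod_div_distrib]

theorem α_add_β : d.α + d.β = d.a + d.b + 2 * (d.p₁ - d.p₂) := by rw [α, β]; ring

theorem not_isInt_α (ha : ¬ IsInt d.a) : ¬ IsInt d.α := by rw [α_eq]; exact not_isInt_αL ha _

theorem not_isInt_β (hb : ¬ IsInt d.b) : ¬ IsInt d.β := by rw [β_eq]; exact not_isInt_βL hb _

/-- Norms of eigenfunctions proportional to the transform of `f`. -/
theorem isFormalNorm_FL (ha : ¬ IsInt d.a) (hb : ¬ IsInt d.b) (hl : Good d.a d.b d.l)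
    {x K r : ℝ} {f : RatFunc ℝ} (hf : Eig 0 d.a d.b .one (eN d.a d.b .one x) f) {m : ℤ}
    (hm : d.a + d.b + 1 = m)
    (h : Ex d.a d.b (RatFunc.C (normFac d.a d.b d.l (eN d.a d.b .one x)) *
      (f ^ 2 - RatFunc.C K * mono 0 (-m)))) {π : RatFunc ℝ} (h1 : Reg 1 π) (h2 : Reg (-1) π)
    (hπ : π = RatFunc.C r * FL d.a d.b d.l .one f) {nu : ℝ}
    (hnu : nu = r ^ 2 * ((∏ k ∈ d.Kall, (x - k)) * ∏ k ∈ d.Kall, (x - (-k - d.a - d.b - 1))) * K *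
      (Real.Gamma (d.a + 1) * Real.Gamma (-d.a))) : IsFormalNorm d.α d.β π nu := by
  have h3 := (ex_FL_sq_sub ha hb hl hf hm h).C_mul (r ^ 2)
  have h4 : RatFunc.C (r ^ 2) * (FL d.a d.b d.l .one f ^ 2 -
      RatFunc.C (normFac d.a d.b d.l (eN d.a d.b .one x) * K) *
        mono 0 (-(m + sumP d.l + sumM d.l))) =
      π ^ 2 - RatFunc.C (r ^ 2 * (normFac d.a d.b d.l (eN d.a d.b .one x) * K)) *
        mono 0 (-(m + sumP d.l + sumM d.l)) := by
    rw [hπ, map_mul _ (r ^ 2), map_pow]; ring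
  rw [h4, ← α_eq, ← β_eq] at h3
  have h5 := isFormalNorm_of_ex (not_isInt_α ha) (not_isInt_β hb) (m := m + sumP d.l + sumM d.l)
    (by rw [α_eq, β_eq, αL, βL]; push_cast; linarith) h1 h2 h3
  convert h5 using 1
  have h6 : ((-1 : ℝ) ^ d.l.length) * (-1) ^ d.l.length = 1 := by rw [← mul_pow]; norm_num
  rw [hnu, α_eq, nuZero_αL ha, normFac_eN ha hb hl]
  linear_combination (-(r ^ 2 * ((∏ k ∈ d.Kall, (x - k)) * ∏ k ∈ d.Kall, (x - (-k - d.a - d.b - 1))) * K *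
      (Real.Gamma (d.a + 1) * Real.Gamma (-d.a)))) * h6

end Params

/-! ### Limits of the classical norm function -/

theorem tendsto_mul_Gamma_sub_nat (j : ℕ) :
    Tendsto (fun x : ℝ => x * Real.Gamma (x - j)) (𝓝[≠] 0) (𝓝 ((-1) ^ j / j.factorial)) := by
  induction j with
  | zero =>
    have h1 : ContinuousAt (fun x : ℝ => Real.Gamma (x + 1)) 0 := by
      have h2 : ContinuousAt Real.Gamma (0 + 1) := (Real.differentiableAt_Gamma fun m => by
        have : (0 : ℝ) ≤ m := Nat.cast_nonneg m
        linarith).continuousAt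
      exact ContinuousAt.comp (f := fun x : ℝ => x + 1) h2 (by fun_prop)
    have h3 := h1.tendsto.mono_left (nhdsWithin_le_nhds (s := {(0 : ℝ)}ᶜ))
    rw [zero_add, Real.Gamma_one] at h3
    simp only [pow_zero, Nat.factorial_zero, Nat.cast_one, div_one, Nat.cast_zero, sub_zero]
    refine h3.congr' ?_
    filter_upwards [self_mem_nhdsWithin] with x hx
    exact Real.Gamma_add_one hx
  | succ j ih =>
    have h1 : Tendsto (fun x : ℝ => x - j - 1) (𝓝[≠] 0) (𝓝 (0 - j - 1)) := by
      have : ContinuousAt (fun x : ℝ => x - j - 1) 0 := by fun_prop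
      exact this.tendsto.mono_left nhdsWithin_le_nhds
    have h0 : (0 : ℝ) - j - 1 ≠ 0 := by
      have : (0 : ℝ) ≤ j := Nat.cast_nonneg j
      intro h; linarith
    have h2 := ih.div h1 h0
    have h3 : (-1 : ℝ) ^ j / j.factorial / (0 - j - 1) = (-1) ^ (j + 1) / (j + 1).factorial := by
      have h4 : (j : ℝ) + 1 ≠ 0 := by positivity
      rw [show (0 : ℝ) - j - 1 = -(j + 1) by ring, Nat.factorial_succ, pow_succ]
      push_cast
      field_simp
    rw [h3] at h2
    refine h2.congr' ?_
    filter_upwards [h1.eventually_ne h0] with x hx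
    have h5 := Real.Gamma_add_one hx
    rw [sub_add_cancel] at h5
    rw [Pi.div_apply, h5]
    push_cast
    rw [← sub_sub]
    field_simp

theorem tendsto_mul_Gamma_pole (n : ℝ) {r : ℝ} (hr : r ≠ 0) (j : ℕ) {f : ℝ → ℝ}
    (hf : ∀ z, f z = r * (z - n) - j) : Tendsto (fun z => (z - n) * Real.Gamma (f z)) (𝓝[≠] n)
      (𝓝 ((-1) ^ j / j.factorial / r)) := by
  have h1 : Tendsto (fun z : ℝ => r * (z - n)) (𝓝[≠] n) (𝓝[≠] 0) := by
    refine tendsto_nhdsWithin_iff.2 ⟨?_, ?_⟩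
    · have : ContinuousAt (fun z : ℝ => r * (z - n)) n := by fun_prop
      have := this.tendsto.mono_left (nhdsWithin_le_nhds (s := {n}ᶜ))
      simpa using this
    · filter_upwards [self_mem_nhdsWithin] with z hz
      exact mul_ne_zero hr (sub_ne_zero.2 hz)
  have h2 := ((tendsto_mul_Gamma_sub_nat j).comp h1).div_const r
  refine h2.congr fun z => ?_
  simp only [Function.comp, hf]
  field_simp

theorem pole_ne_zero {r : ℝ} (hr : r ≠ 0) (j : ℕ) : (-1 : ℝ) ^ j / j.factorial / r ≠ 0 :=
  div_ne_zero (div_ne_zero (pow_ne_zero _ (by norm_num))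
    (Nat.cast_ne_zero.2 (Nat.factorial_ne_zero j))) hr

theorem tendsto_Gamma {f : ℝ → ℝ} {n : ℝ} (hf : ContinuousAt f n) (h : ∀ m : ℕ, f n ≠ -m) :
    Tendsto (fun z => Real.Gamma (f z)) (𝓝[≠] n) (𝓝 (Real.Gamma (f n))) :=
  (ContinuousAt.comp (f := f) (Real.differentiableAt_Gamma h).continuousAt hf).tendsto.mono_left
    nhdsWithin_le_nhds

/-- The regular factor of the classical norm function. -/
def nuReg (a b z : ℝ) : ℝ := 2 ^ (1 + a + b + 2 * z) * (Real.Gamma (a + z + 1) * Real.Gamma (b + z + 1))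

theorem nuJ_eq (z a b : ℝ) : nuJ z a b = nuReg a b z * (Real.Gamma (z + 1) * Real.Gamma (a + b + z + 1)) /
    (Real.Gamma (a + b + 2 * z + 1) * Real.Gamma (a + b + 2 * z + 2)) := by
  rw [nuJ, nuReg]; ring

theorem tendsto_nuReg {a b : ℝ} (ha : ¬ IsInt a) (hb : ¬ IsInt b) (n : ℤ) :
    Tendsto (nuReg a b) (𝓝[≠] (n : ℝ)) (𝓝 (nuReg a b n)) := by
  have h1 : Tendsto (fun z : ℝ => (2 : ℝ) ^ (1 + a + b + 2 * z)) (𝓝[≠] (n : ℝ))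
      (𝓝 (2 ^ (1 + a + b + 2 * (n : ℝ)))) := by
    have : ContinuousAt (fun z : ℝ => (2 : ℝ) ^ (1 + a + b + 2 * z)) n :=
      ContinuousAt.rpow continuousAt_const (by fun_prop) (Or.inl two_ne_zero)
    exact this.tendsto.mono_left nhdsWithin_le_nhds
  refine h1.mul ((tendsto_Gamma (f := fun z => a + z + 1) (by fun_prop) fun m h => ?_).mul
    (tendsto_Gamma (f := fun z => b + z + 1) (by fun_prop) fun m h => ?_))
  · exact ha ⟨-m - n - 1, by push_cast; linarith⟩
  · exact hb ⟨-m - n - 1, by push_cast; linarith⟩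

theorem tendsto_nuJ_of_pos {a b : ℝ} (ha : ¬ IsInt a) (hb : ¬ IsInt b) {n : ℕ}
    (hn : 0 ≤ (n : ℝ) + (a + b)) : Tendsto (fun z => nuJ z a b) (𝓝[≠] (n : ℝ)) (𝓝 (nuJ n a b)) := by
  have h0 : (0 : ℝ) ≤ n := Nat.cast_nonneg n
  have hne : ∀ {x : ℝ}, 0 < x → ∀ m : ℕ, x ≠ -m := fun hx m h => by
    have : (0 : ℝ) ≤ m := Nat.cast_nonneg m
    linarith
  have h1 := tendsto_nuReg ha hb n
  simp only [Int.cast_natCast] at h1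
  have h2 := tendsto_Gamma (f := fun z => z + 1) (n := n) (by fun_prop) (hne (by positivity))
  have h3 := tendsto_Gamma (f := fun z => a + b + z + 1) (n := n) (by fun_prop) (hne (by linarith))
  have h4 := tendsto_Gamma (f := fun z => a + b + 2 * z + 1) (n := n) (by fun_prop) (hne (by linarith))
  have h5 := tendsto_Gamma (f := fun z => a + b + 2 * z + 2) (n := n) (by fun_prop) (hne (by linarith))
  simp only [nuJ_eq]
  exact (h1.mul (h2.mul h3)).div (h4.mul h5) (mul_ne_zero
    (Real.Gamma_pos_of_pos (by linarith)).ne' (Real.Gamma_pos_of_pos (by linarith)).ne')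

/-- One simple pole in the numerator stands against two in the denominator. -/
theorem tendsto_nuJ_of_neg {a b : ℝ} (ha : ¬ IsInt a) (hb : ¬ IsInt b) {n p q : ℕ}
    (hp : (n : ℝ) + (a + b) + 1 = -p) (hq : 2 * (n : ℝ) + (a + b) + 1 = -1 - q) :
    Tendsto (fun z => nuJ z a b) (𝓝[≠] (n : ℝ)) (𝓝 0) := by
  have h0 : (0 : ℝ) ≤ n := Nat.cast_nonneg n
  have h1 := tendsto_nuReg ha hb n
  simp only [Int.cast_natCast] at h1
  have h2 := tendsto_Gamma (f := fun z => z + 1) (n := n) (by fun_prop) fun m h => by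
    have : (0 : ℝ) ≤ m := Nat.cast_nonneg m
    linarith
  have h3 := tendsto_mul_Gamma_pole n one_ne_zero p (f := fun z => a + b + z + 1) fun z => by
    linear_combination hp
  have h4 := tendsto_mul_Gamma_pole n two_ne_zero (q + 1) (f := fun z => a + b + 2 * z + 1) fun z => by
    push_cast; linear_combination hq
  have h5 := tendsto_mul_Gamma_pole n two_ne_zero q (f := fun z => a + b + 2 * z + 2) fun z => by
    linear_combination hq
  have h6 : Tendsto (fun z : ℝ => z - n) (𝓝[≠] (n : ℝ)) (𝓝 0) := by
    have : ContinuousAt (fun z : ℝ => z - n) n := by fun_prop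
    have := this.tendsto.mono_left (nhdsWithin_le_nhds (s := {(n : ℝ)}ᶜ))
    simpa using this
  have h7 := ((h1.mul (h2.mul h3)).div (h4.mul h5) (mul_ne_zero (pole_ne_zero two_ne_zero _)
    (pole_ne_zero two_ne_zero _))).mul h6
  rw [mul_zero] at h7
  refine h7.congr' ?_
  filter_upwards [self_mem_nhdsWithin] with z hz
  have hz' : z - n ≠ 0 := sub_ne_zero.2 hz
  simp only [nuJ_eq, Pi.div_apply]
  generalize Real.Gamma (a + b + 2 * z + 1) = A
  generalize Real.Gamma (a + b + 2 * z + 2) = B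
  field_simp

/-- One simple pole above and one below. The lower gamma function has argument of slope `2`, which
gives the factor `2` behind the exceptional one half. -/
theorem tendsto_nuJ_of_balanced {a b : ℝ} (ha : ¬ IsInt a) (hb : ¬ IsInt b) {n : ℕ}
    (hn : 2 * (n : ℝ) + (a + b) + 1 = 0) : Tendsto (fun z => nuJ z a b) (𝓝[≠] (n : ℝ))
      (𝓝 (2 * (Real.Gamma (a + 1) * Real.Gamma (-a)))) := by
  have h0 : (0 : ℝ) ≤ n := Nat.cast_nonneg n
  have h1 := tendsto_nuReg ha hb n
  simp only [Int.cast_natCast] at h1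
  have h2 := tendsto_Gamma (f := fun z => z + 1) (n := n) (by fun_prop) fun m h => by
    have : (0 : ℝ) ≤ m := Nat.cast_nonneg m
    linarith
  have h3 := tendsto_mul_Gamma_pole n one_ne_zero n (f := fun z => a + b + z + 1) fun z => by
    linear_combination hn
  have h4 := tendsto_mul_Gamma_pole n two_ne_zero 0 (f := fun z => a + b + 2 * z + 1) fun z => by
    push_cast; linear_combination hn
  have h5 := tendsto_Gamma (f := fun z => a + b + 2 * z + 2) (n := n) (by fun_prop) fun m h => by
    have : (0 : ℝ) ≤ m := Nat.cast_nonneg m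
    linarith
  have e1 : a + b + 2 * (n : ℝ) + 2 = 1 := by linear_combination hn
  have h7 := (h1.mul (h2.mul h3)).div (h4.mul h5) (mul_ne_zero (pole_ne_zero two_ne_zero _)
    (by rw [e1, Real.Gamma_one]; exact one_ne_zero))
  have h8 : nuReg a b n * (Real.Gamma ((n : ℝ) + 1) * ((-1) ^ n / n.factorial / 1)) /
      ((-1) ^ 0 / (Nat.factorial 0 : ℝ) / 2 * Real.Gamma (a + b + 2 * (n : ℝ) + 2)) =
      2 * (Real.Gamma (a + 1) * Real.Gamma (-a)) := by
    have hf : (n.factorial : ℝ) ≠ 0 := Nat.cast_ne_zero.2 n.factorial_ne_zero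
    have h9 := Gamma_reflect_nat ha n
    have h10 : ((-1 : ℝ) ^ n) * (-1) ^ n = 1 := by rw [← mul_pow]; norm_num
    rw [nuReg, e1, show 1 + a + b + 2 * (n : ℝ) = 0 by linear_combination hn,
      show b + (n : ℝ) + 1 = -(a + n) by linear_combination hn, h9, Real.Gamma_nat_eq_factorial,
      Real.Gamma_one, Real.rpow_zero, Nat.factorial_zero]
    generalize Real.Gamma (a + 1) * Real.Gamma (-a) = G
    field_simp
    linear_combination G * h10
  rw [h8] at h7
  refine h7.congr' ?_
  filter_upwards [self_mem_nhdsWithin] with z hz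
  have hz' : z - n ≠ 0 := sub_ne_zero.2 hz
  simp only [nuJ_eq, Pi.div_apply]
  generalize Real.Gamma (a + b + 2 * z + 1) = A
  generalize Real.Gamma (a + b + 2 * z + 2) = B
  field_simp

/-- Two simple poles above and two below, so the limit is finite, and the zero of `kappa` at `-k-1`
makes the product tend to zero. -/
theorem exists_tendsto_nuJ_dual {a b : ℝ} (ha : ¬ IsInt a) (hb : ¬ IsInt b) {k N : ℕ}
    (hN : (N : ℝ) = k - (a + b)) :
    ∃ L, Tendsto (fun z => nuJ z a b) (𝓝[≠] ((-(k : ℤ) - 1 : ℤ) : ℝ)) (𝓝 L) := by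
  have h1 := tendsto_nuReg ha hb (-(k : ℤ) - 1)
  generalize hn : ((-(k : ℤ) - 1 : ℤ) : ℝ) = n at *
  push_cast at hn
  have h2 := tendsto_mul_Gamma_pole n one_ne_zero k (f := fun z => z + 1) fun z => by
    linear_combination -hn
  have h3 := tendsto_mul_Gamma_pole n one_ne_zero N (f := fun z => a + b + z + 1) fun z => by
    linear_combination -hn + hN
  have h4 := tendsto_mul_Gamma_pole n two_ne_zero (k + N + 1) (f := fun z => a + b + 2 * z + 1)
    fun z => by push_cast; linear_combination -2 * hn + hN
  have h5 := tendsto_mul_Gamma_pole n two_ne_zero (k + N) (f := fun z => a + b + 2 * z + 2)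
    fun z => by push_cast; linear_combination -2 * hn + hN
  have h7 := ((h1.mul (h2.mul h3)).div (h4.mul h5) (mul_ne_zero (pole_ne_zero two_ne_zero _)
    (pole_ne_zero two_ne_zero _)))
  refine ⟨_, h7.congr' ?_⟩
  filter_upwards [self_mem_nhdsWithin] with z hz
  have hz' : z - n ≠ 0 := sub_ne_zero.2 hz
  simp only [nuJ_eq, Pi.div_apply]
  generalize Real.Gamma (a + b + 2 * z + 1) = A
  generalize Real.Gamma (a + b + 2 * z + 2) = B
  field_simp

/-- Matches the gamma expression with the constant of `ex_jacobiF_sq_sub`. For an upper index all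
gamma values are factorials except `Γ(a+n+1) Γ(b+n+1)`, which reflection reduces to `Γ(a+1) Γ(-a)`.
-/
theorem nuJ_nat {a b : ℝ} (ha : ¬ IsInt a) {n M : ℕ} {q : ℕ} (hq : (n : ℝ) + (a + b) = q)
    (hM : 2 * (n : ℝ) + (a + b) + 1 = M) : nuJ n a b =
      (-1) ^ n * n.factorial / poch n (n + (a + b) + 1) * (2 ^ M * poch M (-a - n) / M.factorial) *
        (Real.Gamma (a + 1) * Real.Gamma (-a)) := by
  obtain rfl : M = n + q + 1 := by
    have : (M : ℝ) = n + q + 1 := by linarith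
    exact_mod_cast this
  have hi : ¬ IsInt (-a - n) := by
    have := isInt_add_int (x := -a) (-n)
    push_cast at this
    rw [sub_eq_add_neg, this, isInt_neg_iff]
    exact ha
  have h1 := Gamma_reflect_nat ha n
  have h2 := Gamma_add_nat hi (n + q + 1)
  rw [nuJ, hq, poch_cast_add_one, show 1 + a + b + 2 * (n : ℝ) = (n + q + 1 : ℕ) by rw [← hM]; ring,
    Real.rpow_natCast, show a + b + (n : ℝ) + 1 = q + 1 by linarith, Real.Gamma_nat_eq_factorial,
    Real.Gamma_nat_eq_factorial, show a + b + 2 * (n : ℝ) + 1 = (n + q : ℕ) + 1 by push_cast at hM ⊢; linarith,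
    show a + b + 2 * (n : ℝ) + 2 = (n + q + 1 : ℕ) + 1 by push_cast at hM ⊢; linarith,
    Real.Gamma_nat_eq_factorial, Real.Gamma_nat_eq_factorial,
    show b + (n : ℝ) + 1 = -a - n + (n + q + 1 : ℕ) by rw [← hM]; ring, h2, add_comm q n]
  rw [neg_add, ← sub_eq_add_neg] at h1
  have f1 : (q.factorial : ℝ) ≠ 0 := Nat.cast_ne_zero.2 q.factorial_ne_zero
  have f2 : ((n + q).factorial : ℝ) ≠ 0 := Nat.cast_ne_zero.2 (n + q).factorial_ne_zero
  have f3 : ((n + q + 1).factorial : ℝ) ≠ 0 := Nat.cast_ne_zero.2 (n + q + 1).factorial_ne_zero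
  generalize poch (n + q + 1) (-a - n) = P
  generalize (q.factorial : ℝ) = F1 at *
  generalize ((n + q).factorial : ℝ) = F2 at *
  generalize ((n + q + 1).factorial : ℝ) = F3 at *
  generalize (n.factorial : ℝ) = F4 at *
  field_simp
  linear_combination P * F4 * h1

namespace Params

variable {d : Params}

theorem kappa_mul_nu (n : ℤ) {lead G : ℝ} (hl : lead ≠ 0) (hP : ∏ k ∈ d.Kall, ((n : ℝ) - k) ≠ 0) :
    d.kappa n * G = ((lead * ∏ k ∈ d.Kall, ((n : ℝ) - k))⁻¹) ^ 2 *
      ((∏ k ∈ d.Kall, ((n : ℝ) - k)) * ∏ k ∈ d.Kall, ((n : ℝ) - (-k - d.a - d.b - 1))) *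
      (lead ^ 2 * G) := by
  rw [kappa_eq]
  field_simp

theorem tendsto_kappa {n : ℝ} (hP : ∏ k ∈ d.Kall, (n - k) ≠ 0) :
    Tendsto d.kappa (𝓝[≠] n) (𝓝 (d.kappa n)) := by
  have h : ContinuousAt (fun z => (∏ k ∈ d.Kall, (z - (-k - d.a - d.b - 1))) /
      ∏ k ∈ d.Kall, (z - k)) n := by
    refine ContinuousAt.div ?_ ?_ hP
    · exact (continuous_finsetProd _ fun k _ => by fun_prop).continuousAt
    · exact (continuous_finsetProd _ fun k _ => by fun_prop).continuousAt
  have h' : ContinuousAt d.kappa n := by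
    convert h using 1
    funext z
    exact kappa_eq z
  exact h'.tendsto.mono_left nhdsWithin_le_nhds

theorem regular_piR (ha : ¬ IsInt d.a) (hb : ¬ IsInt d.b) (hc : IsInt (d.a + d.b))
    (hl : Good d.a d.b d.l) {i : ℤ} (hi : i ∈ d.I .one) :
    UnitAt 1 (d.piR i) ∧ UnitAt (-1) (d.piR i) := by
  have h := eig_piR ha hb hc hl hi
  rw [α_eq, β_eq] at h
  exact h.unitAt_uL ha hb hl

/-- The explicit norm in the cases without poles. -/
theorem isFormalNorm_of_u_eq (ha : ¬ IsInt d.a) (hb : ¬ IsInt d.b) (hc : IsInt (d.a + d.b))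
    (hl : Good d.a d.b d.l) {i : ℤ} (hi : i ∈ d.I .one) {n M : ℕ} (hn : i + d.p₁ - d.p₂ = n)
    (hm : n ∈ lowerIdx (d.a + d.b) ∪ upperIdx (d.a + d.b)) (hu : d.u n = n)
    (hM : 2 * (n : ℝ) + (d.a + d.b) + 1 = M) :
    IsFormalNorm d.α d.β (d.piR i) (d.kappa n *
      ((-1) ^ n * n.factorial / poch n (n + (d.a + d.b) + 1) *
        (2 ^ M * poch M (-d.a - n) / M.factorial) * (Real.Gamma (d.a + 1) * Real.Gamma (-d.a)))) := by
  have hI := (mem_I_one ha hb hl).1 hi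
  have hP := prod_Kall_ne_zero ha hb hc hl hI
  have hr := regular_piR ha hb hc hl hi
  rw [hn] at hP
  have hlead : jlead n (d.a + d.b) ≠ 0 := jlead_ne_zero hm
  have hchi : d.chi n = jlead n (d.a + d.b) := by
    rw [chi, if_pos (Int.natCast_nonneg n), mul_one, hu, leadingCoeff,
      natDegree_jacobiP_of_eN_eq ha hb hm rfl, jacobiP_coeff]
  have hπ : d.piR i = RatFunc.C (jlead n (d.a + d.b) * ∏ k ∈ d.Kall, (((n : ℤ) : ℝ) - k))⁻¹ *
      FL d.a d.b d.l .one (base d.a d.b (.one, n)) := by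
    rw [piR, hn, hchi, hu]
  have hE := eig_base ha d.b (.one, n)
  have hK := ex_jacobiF_sq_sub ha hm hM
  have hf : base d.a d.b (.one, n) = jacobiF n d.a d.b := by rw [base_one]; rfl
  rw [← hf] at hK
  refine isFormalNorm_FL ha hb hl (x := n) hE (m := M - 2 * n) (by push_cast; linarith)
    (hK.C_mul _) hr.1.1 hr.2.1 (by rw [hπ, Int.cast_natCast]) ?_
  rw [← Int.cast_natCast n] at hP
  have := kappa_mul_nu (d := d) n (G := (-1) ^ n * n.factorial / poch n (n + (d.a + d.b) + 1) *
        (2 ^ M * poch M (-d.a - n) / M.factorial)) hlead hP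
  simp only [Int.cast_natCast] at this ⊢
  rw [← mul_assoc, this]

theorem isFormalNorm_zero (ha : ¬ IsInt d.a) (hb : ¬ IsInt d.b) (hc : IsInt (d.a + d.b))
    (hl : Good d.a d.b d.l) {i : ℤ} (hi : i ∈ d.I .one) {r x : ℝ} {f : RatFunc ℝ}
    (hf : Eig 0 d.a d.b .one (eN d.a d.b .one x) f)
    (h : Ex d.a d.b (RatFunc.C (normFac d.a d.b d.l (eN d.a d.b .one x)) * f ^ 2))
    (hπ : d.piR i = RatFunc.C r * FL d.a d.b d.l .one f) : IsFormalNorm d.α d.β (d.piR i) 0 := by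
  obtain ⟨c, hc'⟩ := hc
  have hr := regular_piR ha hb ⟨c, hc'⟩ hl hi
  refine isFormalNorm_FL ha hb hl hf (m := c + 1) (K := 0) (by push_cast; rw [hc']) ?_
    hr.1.1 hr.2.1 hπ (by ring)
  rwa [map_zero, zero_mul, sub_zero]

theorem kappa_ne_zero (ha : ¬ IsInt d.a) (hb : ¬ IsInt d.b) (hl : Good d.a d.b d.l) {x : ℝ}
    (h : ∀ s ∈ d.l, eN d.a d.b .one x ≠ eN d.a d.b s.1 s.2) : d.kappa x ≠ 0 := by
  have h1 := normFac_ne_zero h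
  rw [normFac_eN ha hb hl] at h1
  rw [kappa_eq]
  exact div_ne_zero (right_ne_zero_of_mul h1) (right_ne_zero_of_mul (left_ne_zero_of_mul h1))

/-- The seed `(.two, k)` has degree `k - a - b`, whose mirror image is `-k-1`. -/
theorem kappa_dual_eq_zero (ha : ¬ IsInt d.a) (hb : ¬ IsInt d.b) (hl : Good d.a d.b d.l) {k : ℕ}
    (hk : (.two, k) ∈ d.l) : d.kappa ((-(k : ℤ) - 1 : ℤ) : ℝ) = 0 := by
  rw [kappa_eq, prod_Kall ha hb hl (fun k' => ((-(k : ℤ) - 1 : ℤ) : ℝ) - (-k' - d.a - d.b - 1)),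
    List.prod_eq_zero, zero_div]
  refine List.mem_map.2 ⟨_, hk, ?_⟩
  rw [deg_two]; push_cast; ring

theorem exists_norm (ha : ¬ IsInt d.a) (hb : ¬ IsInt d.b) (hc : IsInt (d.a + d.b))
    (hl : Good d.a d.b d.l) {i : ℤ} (hi : i ∈ d.I .one) : ∃ nu : ℝ,
      IsFormalNorm d.α d.β (d.piR i) nu ∧
      (i ∈ d.Iplus .one → nu = d.kn (i + d.p₁ - d.p₂)) ∧
      (2 * (i : ℝ) + d.α + d.β + 1 ≠ 0 →
        Tendsto d.kn (𝓝[≠] ((i : ℝ) + d.p₁ - d.p₂)) (𝓝 nu)) ∧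
      (2 * (i : ℝ) + d.α + d.β + 1 = 0 →
        Tendsto d.kn (𝓝[≠] ((i : ℝ) + d.p₁ - d.p₂)) (𝓝 (2 * nu))) ∧
      (nu = 0 ↔ i ∈ d.Iminus .one ∧ 2 * (i : ℝ) + d.α + d.β + 1 ≠ 0) := by
  have hI := (mem_I_one ha hb hl).1 hi
  have hP := prod_Kall_ne_zero ha hb hc hl hI
  have hnR : (i : ℝ) + d.p₁ - d.p₂ = ((i + d.p₁ - d.p₂ : ℤ) : ℝ) := by push_cast; rfl
  have hdeg : 2 * (i : ℝ) + d.α + d.β + 1 =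
      2 * ((i + d.p₁ - d.p₂ : ℤ) : ℝ) + (d.a + d.b) + 1 := by
    have := α_add_β (d := d)
    push_cast; linarith
  have hplus : i ∈ d.Iplus .one ↔ ∃ n : ℕ, i + d.p₁ - d.p₂ = n ∧ NPlus d.a d.b d.l .one n := by
    rw [mem_Iplus]
    refine exists_congr fun n => and_congr_left fun _ => ?_
    rw [shift]
    constructor <;> intro h <;> linarith
  have hκ := tendsto_kappa hP
  have hG : Real.Gamma (d.a + 1) * Real.Gamma (-d.a) ≠ 0 :=
    mul_ne_zero (Gamma_ne_zero_of_not_isInt (by rwa [isInt_add_one]))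
      (Gamma_ne_zero_of_not_isInt (by rwa [isInt_neg_iff]))
  rw [hnR, hdeg, hplus, mem_Iminus, add_shift]
  have hnorm := fun n M hn => isFormalNorm_of_u_eq ha hb hc hl hi (n := n) (M := M) hn
  have hzero := fun r x f => isFormalNorm_zero ha hb hc hl hi (r := r) (x := x) (f := f)
  have hπ := eig_piR ha hb hc hl hi
  have hpi : d.piR i = RatFunc.C (d.chi (i + d.p₁ - d.p₂) *
    ∏ k ∈ d.Kall, (((i + d.p₁ - d.p₂ : ℤ) : ℝ) - k))⁻¹ *
      FL d.a d.b d.l .one (base d.a d.b (.one, d.u (i + d.p₁ - d.p₂))) := rfl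
  rw [α_eq, β_eq, lamT_shift, sh_l, add_shift, ← α_eq, ← β_eq] at hπ
  clear hnR hdeg hplus
  generalize i + (d.p₁ : ℤ) - d.p₂ = n at *
  have hex : ∀ m : ℕ, NPlus d.a d.b d.l .one m → ¬ NMinus d.a d.b d.l .one m := by
    rintro m hm (⟨m', h, h'⟩ | ⟨k, -, h⟩)
    · obtain rfl : m = m' := by exact_mod_cast h
      have h1 := hm.1 h'.1
      have h2 := h'.2
      have : (0 : ℝ) ≤ m := Nat.cast_nonneg m
      linarith
    · omega
  have hval : ∀ m M : ℕ, m ∈ lowerIdx (d.a + d.b) ∪ upperIdx (d.a + d.b) →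
      (-1 : ℝ) ^ m * m.factorial / poch m (m + (d.a + d.b) + 1) *
        (2 ^ M * poch M (-d.a - m) / M.factorial) * (Real.Gamma (d.a + 1) * Real.Gamma (-d.a)) ≠ 0 := by
    intro m M hm
    have h1 := poch_ne_zero_of_mem hm
    have h2 : poch M (-d.a - m) ≠ 0 := poch_ne_zero_of_not_isInt (by
      have := isInt_add_int (x := -d.a) (-m)
      push_cast at this
      rw [sub_eq_add_neg, this, isInt_neg_iff]
      exact ha) M
    refine mul_ne_zero (mul_ne_zero (div_ne_zero (mul_ne_zero (pow_ne_zero _ (by norm_num))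
      (by positivity)) h1) (div_ne_zero (mul_ne_zero (by positivity) h2) (by positivity))) hG
  rcases u_cases ha hb hc hl hI with ⟨m, rfl, hm, hu⟩ | ⟨k, rfl, hk, hu⟩ | ⟨m, rfl, hm, hu⟩
  · have hminus : NMinus d.a d.b d.l .one m := Or.inl ⟨m, rfl, by rwa [cT_one]⟩
    have hne : ∀ s ∈ d.l, eN d.a d.b .one m ≠ eN d.a d.b s.1 s.2 := fun s hs =>
      eN_ne_of_lower (t := .one) ha hb (hl.upper s hs) (by rwa [cT_one])
    have hno : ¬ ∃ n : ℕ, (m : ℤ) = n ∧ NPlus d.a d.b d.l .one n := by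
      rintro ⟨n, h, h'⟩
      obtain rfl : m = n := by exact_mod_cast h
      exact hex m h' hminus
    obtain ⟨c, hc'⟩ := hc
    have hlt : 2 * (m : ℤ) + c < 0 := by
      have := hm.2
      rw [hc'] at this
      exact_mod_cast this
    simp only [Int.cast_natCast] at hκ ⊢
    -- In the balanced case `m` is its own mirror image and the square is not exact. Otherwise the
    -- exponents `a + m`, `b + m` have sum at most `-2`, the square is exact and the norm is zero.
    rcases eq_or_ne (2 * (m : ℤ) + c + 1) 0 with h0 | h0
    · have hM : 2 * (m : ℝ) + (d.a + d.b) + 1 = (0 : ℕ) := by rw [hc']; exact_mod_cast h0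
      have hum : d.u m = m := by
        have : (d.u m : ℝ) = m := by rw [hu]; push_cast at hM; linarith
        exact_mod_cast this
      have h1 := hnorm m 0 rfl (Or.inl hm) hum hM
      have h3 := hval m 0 (Or.inl hm)
      have h2 := hκ.mul (tendsto_nuJ_of_balanced ha hb (by simpa using hM))
      have hpo : (-1 : ℝ) ^ m * m.factorial / poch m (m + (d.a + d.b) + 1) *
          (2 ^ 0 * poch 0 (-d.a - m) / (Nat.factorial 0 : ℕ)) = 1 := by
        -- Here `m + (a+b) + 1 = -m`, so the rising factorial is `(-m)_m = (-1)^m m!` and the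
        -- constant becomes `1`.
        have h4 : poch m (m + (d.a + d.b) + 1) = (-1) ^ m * m.factorial := by
          have h5 : ∀ j : ℕ, j ≤ m → poch j (-(m : ℝ)) = (-1) ^ j * (m.descFactorial j : ℝ) := by
            intro j
            induction j with
            | zero => intro _; simp [poch_zero]
            | succ j ih =>
              intro hj
              rw [poch_succ, ih (by omega), Nat.descFactorial_succ, pow_succ]
              push_cast [Nat.cast_sub (by omega : j ≤ m)]
              ring
          have h6 := h5 m le_rfl
          rw [Nat.descFactorial_self] at h6
          rw [← h6]
          congr 1
          push_cast at hM; linarith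
        rw [h4, poch_zero]
        have : (-1 : ℝ) ^ m * m.factorial ≠ 0 := mul_ne_zero (pow_ne_zero _ (by norm_num))
          (Nat.cast_ne_zero.2 m.factorial_ne_zero)
        field_simp
        simp
      rw [hpo, one_mul] at h1 h3
      rw [Nat.cast_zero] at hM
      refine ⟨_, h1, fun h => absurd h hno, fun h => absurd hM h, fun _ => ?_,
        iff_of_false (mul_ne_zero (kappa_ne_zero ha hb hl hne) hG) fun h => h.2 hM⟩
      rw [mul_left_comm]
      exact h2
    · obtain ⟨q, hq⟩ := Int.eq_ofNat_of_zero_le (a := -(2 * (m : ℤ) + c + 1) - 1) (by omega)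
      obtain ⟨p, hp⟩ := Int.eq_ofNat_of_zero_le (a := -((m : ℤ) + c + 1)) (by omega)
      have hq' : 2 * (m : ℝ) + (d.a + d.b) + 1 = -1 - q := by
        rw [hc', ← Int.cast_natCast (R := ℝ) q, ← hq]; push_cast; ring
      have hp' : (m : ℝ) + (d.a + d.b) + 1 = -p := by
        rw [hc', ← Int.cast_natCast (R := ℝ) p, ← hp]; push_cast; ring
      have hM : 2 * (m : ℝ) + (d.a + d.b) + 1 ≠ 0 := by
        have : (0 : ℝ) ≤ q := Nat.cast_nonneg q
        intro h; linarith
      have hE := eig_base ha d.b (.one, m)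
      have hFE := eig_FL_of_ne ha hb hl hE hne
      rw [← α_eq, ← β_eq] at hFE
      -- The eigenfunction is defined through `u m`; by uniqueness it is also a multiple of the
      -- transform of the Jacobi polynomial of index `m`, whose square is known to be exact.
      obtain ⟨r, -, hr⟩ := eq_C_mul_of_ld_eq hπ.1 hFE.1
        (hπ.ld_eq (not_isInt_α ha) (not_isInt_β hb) (by simpa using hFE))
      have hEx := ex_jacobiF_sq_of_neg ha (Or.inl hm) hq'
      have hf : base d.a d.b (.one, m) = jacobiF m d.a d.b := by rw [base_one]; rfl
      rw [← hf] at hEx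
      have h2 := hκ.mul (tendsto_nuJ_of_neg ha hb hp' hq')
      rw [mul_zero] at h2
      exact ⟨0, hzero r m _ hE (hEx.C_mul _) hr, fun h => absurd h hno, fun _ => h2,
        fun h => absurd h hM, iff_of_true rfl ⟨hminus, hM⟩⟩
  · have hminus : NMinus d.a d.b d.l .one (-(k : ℤ) - 1) := Or.inr ⟨k, hk, rfl⟩
    have hno : ¬ ∃ n : ℕ, -(k : ℤ) - 1 = n ∧ NPlus d.a d.b d.l .one n := by
      rintro ⟨n, h, -⟩; omega
    have hM : 2 * ((-(k : ℤ) - 1 : ℤ) : ℝ) + (d.a + d.b) + 1 ≠ 0 := by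
      have h1 : (0 : ℝ) ≤ k := Nat.cast_nonneg k
      have h2 : (0 : ℝ) ≤ d.u (-(k : ℤ) - 1) := Nat.cast_nonneg _
      rw [hu] at h2
      push_cast
      intro h; linarith
    have hE := eig_base ha d.b (.one, d.u (-(k : ℤ) - 1))
    have hEu := eN_u ha hb hc hl hI
    simp only [hEu] at hE
    -- The eigenvalue is that of the seed `(.two, k)`, so one factor is zero, and the square of the
    -- transform is exact.
    have hnf : normFac d.a d.b d.l (eN d.a d.b .one (-(k : ℤ) - 1 : ℤ)) = 0 :=
      List.prod_eq_zero (List.mem_map.2 ⟨_, hk, by rw [← eN_two_dual, sub_self]⟩)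
    obtain ⟨L, hL⟩ := exists_tendsto_nuJ_dual ha hb hu
    have h2 := hκ.mul hL
    rw [kappa_dual_eq_zero ha hb hl hk, zero_mul] at h2
    refine ⟨0, hzero _ _ _ hE ?_ hpi, fun h => absurd h hno, fun _ => h2,
      fun h => absurd h hM, iff_of_true rfl ⟨hminus, hM⟩⟩
    rw [hnf, map_zero, zero_mul]
    exact Ex.zero _ _
  · have hup := hm.1
    rw [cT_one] at hup
    have hge := hup hc
    obtain ⟨c, hc'⟩ := hc
    obtain ⟨q, hq⟩ := Int.eq_ofNat_of_zero_le (a := (m : ℤ) + c) (by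
      have : (0 : ℝ) ≤ (m : ℝ) + c := by linarith
      exact_mod_cast this)
    have hq' : (m : ℝ) + (d.a + d.b) = q := by rw [hc']; exact_mod_cast hq
    have hM : 2 * (m : ℝ) + (d.a + d.b) + 1 = (m + q + 1 : ℕ) := by push_cast; linarith
    have hM0 : 2 * (m : ℝ) + (d.a + d.b) + 1 ≠ 0 := by rw [hM]; positivity
    have h1 := hnorm m _ rfl (Or.inr hup) hu hM
    have h3 := hval m (m + q + 1) (Or.inr hup)
    rw [← nuJ_nat ha hq' hM] at h1 h3
    simp only [Int.cast_natCast] at hκ ⊢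
    refine ⟨_, h1, fun _ => rfl, fun _ => hκ.mul (tendsto_nuJ_of_pos ha hb (by rw [hq']; positivity)),
      fun h => absurd h hM0, iff_of_false (mul_ne_zero (kappa_ne_zero ha hb hl fun s hs =>
        hm.eN_ne ha hb hs) h3) fun h => hex m hm h.1⟩

theorem orthogonal_piR (ha : ¬ IsInt d.a) (hb : ¬ IsInt d.b) (hc : IsInt (d.a + d.b))
    (hl : Good d.a d.b d.l) {i j : ℤ} (hi : i ∈ d.I .one) (hj : j ∈ d.I .one) (hij : i ≠ j) :
    HasQRPrimitive (fun x => val (d.piR i) x * val (d.piR j) x * ((1 - x) ^ d.α * (1 + x) ^ d.β))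
      (d.α + 1) (d.β + 1) := by
  have h1 := eig_piR ha hb hc hl hi
  have h2 := eig_piR ha hb hc hl hj
  have r1 := regular_piR ha hb hc hl hi
  have r2 := regular_piR ha hb hc hl hj
  -- Equal eigenvalues would make the two functions proportional, against their different degrees.
  have hne : eShift d.α d.β (lamT d.α d.β .one i) ≠ eShift d.α d.β (lamT d.α d.β .one j) := by
    intro h
    rw [h] at h1
    obtain ⟨c, hc0, hcc⟩ := eq_C_mul_of_ld_eq h1.1 h2.1
      (h1.ld_eq (not_isInt_α ha) (not_isInt_β hb) h2)
    have l1 := hasLead_piR ha hb hc hl hi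
    have l2 := (hasLead_piR ha hb hc hl hj).C_mul c
    rw [← hcc] at l2
    exact hij ((l1.intDegree_eq one_ne_zero).symm.trans (l2.intDegree_eq (by simpa using hc0)))
  refine hasQRPrimitive_of_ex (not_isInt_α ha) (not_isInt_β hb) (r1.1.1.mul r2.1.1)
    (r1.2.1.mul r2.2.1) (h1.ex_mul h2 hne)
    ((finite_not_reg (d.piR i)).union (finite_not_reg (d.piR j))) fun x _ hxS => ?_
  simp only [mem_union, mem_ofPred_eq, not_or, not_not] at hxS
  rw [val_mul hxS.1 hxS.2]

end Params

end ExcJacobi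

end

theorem mainTheorem11 (d : Params) (hclass : IsClassC d.a d.b ∨ IsClassCB d.a d.b)
    (hK : d.Admissible) :
    ∃ τ : ℝ[X],
      -- the polynomial and its degree
      (∀ x ∈ Ioo (-1 : ℝ) 1, τ.eval x = d.tauFun x) ∧
      (τ.natDegree : ℤ) = d.tauDegree ∧
      -- the exceptional operator, its class and its spectral diagram
      IsExceptional τ d.α d.β ∧
      qrSpectrum (Trg τ d.α d.β) = sigmaQ d.α d.β ∧
      d.σplus .one = d.σplus .two ∧
      (IsClassC d.a d.b →
        IsClassC d.α d.β ∧ spectralDiagram (Trg τ d.α d.β) = d.ΛC ∧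
        sigmaQ d.α d.β = Prod.fst '' d.ΛC) ∧
      (IsClassCB d.a d.b →
        IsClassCB d.α d.β ∧ spectralDiagram (Trg τ d.α d.β) = d.ΛCB ∧
        sigmaQ d.α d.β = Prod.fst '' d.ΛCB ∧ d.σplus .three = d.σplus .four) ∧
      -- the index sets
      (∀ t : AType, indexSet (Trg τ d.α d.β) d.α d.β t = (fun i : ℤ => (i : ℝ)) '' d.I t) ∧
      ∃ (π : ℤ → RatFunc ℝ) (ν : ℤ → ℝ),
        -- the monic quasi-polynomial eigenfunctions
        (∀ i ∈ d.I .one,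
          UnitEnds (π i) ∧ (π i).num.leadingCoeff = 1 ∧ (π i).intDegree = i ∧
          (Trg τ d.α d.β).act (π i) = RatFunc.C (lamT d.α d.β .one i) * π i ∧
          ∀ x ∈ Ioo (-1 : ℝ) 1, wr d.seeds x ≠ 0 → val (π i) x = d.piFun i x) ∧
        (∀ f : RatFunc ℝ, IsQuasiPolyEigen (Trg τ d.α d.β) f ↔
          ∃ i ∈ d.I .one, ∃ c : ℝ, c ≠ 0 ∧ f = RatFunc.C c * π i) ∧
        -- orthogonality and norms
        (∀ i ∈ d.I .one, ∀ j ∈ d.I .one, i ≠ j →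
          HasQRPrimitive (fun x => val (π i) x * val (π j) x * ((1 - x) ^ d.α * (1 + x) ^ d.β))
            (d.α + 1) (d.β + 1)) ∧
        (∀ i ∈ d.I .one, IsFormalNorm d.α d.β (π i) (ν i)) ∧
        (∀ i ∈ d.Iplus .one, ν i = d.kn (i + d.p₁ - d.p₂)) ∧
        (∀ i ∈ d.I .one, 2 * (i : ℝ) + d.α + d.β + 1 ≠ 0 →
          Tendsto d.kn (𝓝[≠] ((i : ℝ) + d.p₁ - d.p₂)) (𝓝 (ν i))) ∧
        (∀ i ∈ d.I .one, 2 * (i : ℝ) + d.α + d.β + 1 = 0 →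
          Tendsto d.kn (𝓝[≠] ((i : ℝ) + d.p₁ - d.p₂)) (𝓝 (2 * ν i))) ∧
        (∀ i ∈ d.I .one, ν i = 0 ↔ i ∈ d.Iminus .one ∧ 2 * (i : ℝ) + d.α + d.β + 1 ≠ 0) := by
  obtain ⟨ha, hb, hc⟩ := not_isInt_of_class hclass
  have hl := hK.good
  obtain ⟨τ, hτ, hτx⟩ := Params.exists_tau ha hb hl
  have hlog := Params.logD_tau hτ ha hb hl
  choose! ν hν using fun (i : ℤ) (hi : i ∈ d.I .one) => Params.exists_norm ha hb hc hl hi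
  refine ⟨τ, hτx, Params.natDegree_tau hτ ha hb hl, Params.isExceptional_tau hτ ha hb hl,
    Params.qrSpectrum_eq ha hb hl hlog, Params.σplus_opp (Params.isInt_cT_one hc), fun h => ?_,
    fun h => ?_, Params.indexSet_eq ha hb hl hlog, d.piR, ν, fun i hi => ?_,
    Params.isQuasiPolyEigen_iff hτ ha hb hc hl,
    fun i hi j hj => Params.orthogonal_piR ha hb hc hl hi hj, fun i hi => (hν i hi).1,
    fun i hi => (hν i (Or.inr hi)).2.1 hi, fun i hi => (hν i hi).2.2.1,
    fun i hi => (hν i hi).2.2.2.1, fun i hi => (hν i hi).2.2.2.2⟩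
  · refine ⟨?_, Params.spectralDiagram_C h hl hlog, Params.sigmaQ_eq_ΛC h hl hlog⟩
    rw [Params.α_eq, Params.β_eq]
    exact isClassC_shift h d.l
  · have hsd := Params.spectralDiagram_CB h hl hlog
    refine ⟨?_, hsd.1, Params.sigmaQ_eq_ΛCB h hl hlog, hsd.2⟩
    rw [Params.α_eq, Params.β_eq]
    exact isClassCB_shift h d.l
  · have hlead := Params.hasLead_piR ha hb hc hl hi
    have he := Params.eig_piR ha hb hc hl hi
    exact ⟨unitEnds_iff.2 (Params.regular_piR ha hb hc hl hi), hlead.num_leadingCoeff one_ne_zero,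
      hlead.intDegree_eq one_ne_zero, (Params.act_of_eig hτ ha hb hl he.1).2 he,
      fun x hx h0 => Params.val_piR ha hb hl i hx h0⟩
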